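/- Let $\sigma\in\{1,-1\}$ and let $u_0\in L^1(\mathbb R)$ be real-valued. Put $\sigma_3=\mathrm{diag}(1,-1)$ and $Q_0(x)=\begin{pmatrix}0&u_0(x)\\-\sigma u_0(-x)&0\end{pmatrix}$. Let $m^\pm=[m_1^\pm,m_2^\pm]$ be the normalized Jost functions of $\psi_x-iz\sigma_3\psi=Q_0\psi$, i.e. the bounded continuous solutions (column by column) of $$m^\pm(x,z)=I+\int_{\pm\infty}^x e^{-iz(y-x)\,\mathrm{ad}\,\sigma_3}\,Q_0(y)\,m^\pm(y,z)\,dy,\qquad e^{\mathrm{ad}\,\sigma_3}A=e^{\sigma_3}Ae^{-\sigma_3},$$ where $m_1^+,m_2^-$ are defined for $\operatorname{Im}z\ge0$ and $m_1^-,m_2^+$ for $\operatorname{Im}z\le0$. Let $a(z)=\det[m_1^+,m_2^-]$ ($\operatorname{Im}z\ge0$), $d(z)=\det[m_1^-,m_2^+]$ ($\operatorname{Im}z\le0$) and $b(z)=\det[m_1^-,m_1^+]e^{2izx}$ ($z\in\mathbb R$), which do not depend on $x$. Assume that there are no eigenvalues or resonances, i.e. $a\ne0$ on $\{\operatorname{Im}z\ge0\}$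 and $d\neq0$ on $\{\operatorname{Im}z\le0\}$, and that the reflection coefficients $$r_1(z)=\frac{b(z)}{a(z)},\qquad r_2(z)=\frac{\overline{b(-z)}}{d(z)}\qquad(z\in\mathbb R)$$ belong to $H^{1,1}(\mathbb R)\cap L^{2,3}(\mathbb R)$, that is, $\langle z\rangle r_j,\ \langle z\rangle r_j',\ \langle z\rangle^3r_j\in L^2(\mathbb R)$ with $\langle z\rangle=(1+z^2)^{1/2}$. For every $(x,t)\in\mathbb R^2$ let $M(x,t;\cdot)$ be a $2\times2$ matrix function, analytic in $\mathbb C\setminus\mathbb R$, with $M(x,t;z)=I+O(z^{-1})$ as $z\to\infty$, $z\in\mathbb C\setminus\mathbb R$, and with boundary values $M_\pm(x,t;s)$ from $\pm\operatorname{Im}z>0$ at every $s\in\mathbb R$ (that is, $M(x,t;z)\to M_\pm(x,t;s)$ as $z\to s$, $\pm\operatorname{Im}z>0$), which satisfy $$M_+(x,t;z)=M_-(x,t;z)V_{x,t}(z),\qquad V_{x,t}=\begin{pmatrix}1+\sigma r_1r_2&\sigma r_2e^{2i\theta}\\ r_1e^{-2i\theta}&1\end{pmatrix},\qquad \theta(x,t;z)=zx+4z^3t,\qquad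 z\in\mathbb R.$$ Then the limit $$u(x,t)=-2i\lim_{z\to\infty}zM_{12}(x,t;z)$$ (over $z\in\mathbb C\setminus\mathbb R$) exists and is real for all $(x,t)\in\mathbb R^2$; $u,u_x,u_{xx}$ exist and are continuous on $\mathbb R^2$; and with $$Q(x,t)=\begin{pmatrix}0&u(x,t)\\-\sigma u(-x,-t)&0\end{pmatrix}$$ the function $M$ satisfies, for all $(x,t)\in\mathbb R^2$ and $z\in\mathbb C\setminus\mathbb R$, both equations of the Lax pair, $$M_x=iz[\sigma_3,M]+QM,$$ $$M_t=4iz^3[\sigma_3,M]+\bigl(4z^2Q+2iz(Q_x+Q^2)\sigma_3+2Q^3-Q_{xx}+[Q_x,Q]\bigr)M .$$ Hence $u$ solves the nonlocal mKdV equation $$u_t(x,t)+u_{xxx}(x,t)+6\sigma\,u(x,t)\,u(-x,-t)\,u_x(x,t)=0$$ on $\mathbb R^2$ in the sense of distributions. -/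

import Mathlib

open Complex MeasureTheory Filter Topology Set
open scoped ContDiff Matrix

/-- `2 × 2` complex matrices. -/
abbrev Mat2 : Type := Matrix (Fin 2) (Fin 2) ℂ

/-- The Pauli matrix `σ₃`. -/
def sigma3 : Mat2 := !![1, 0; 0, -1]

/-- The commutator of two matrices. -/
def comm2 (A B : Mat2) : Mat2 := A * B - B * A

/-- The matrix with upper right entry `p` and lower left entry `-σ q`. -/
noncomputable def offDiag (σ p q : ℝ) : Mat2 := !![0, (p : ℂ); -((σ : ℂ) * (q : ℂ)), 0]

/-! ### Direct scattering for `ψ_x - i z σ₃ ψ = Q ψ`, `Q = offDiag σ (u₀ x) (u₀ (-x))` -/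

/-- The potential matrix of the initial datum. -/
noncomputable def initialQ (σ : ℝ) (u₀ : ℝ → ℝ) (x : ℝ) : Mat2 := offDiag σ (u₀ x) (u₀ (-x))

/-- Action of `exp (-i z w ad σ₃)` on a first column: `diag (1, exp (2 i z w))`. -/
noncomputable def phase1 (z : ℂ) (w : ℝ) : Mat2 := !![1, 0; 0, exp (2 * I * z * (w : ℂ))]

/-- Action of `exp (-i z w ad σ₃)` on a second column: `diag (exp (-2 i z w), 1)`. -/
noncomputable def phase2 (z : ℂ) (w : ℝ) : Mat2 := !![exp (-(2 * I * z * (w : ℂ))), 0; 0, 1]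

/-- `m` is the bounded continuous solution of the Volterra equation
`m x = e + ∫_{+∞}^x E (y - x) Q y m y dy`. -/
structure IsJostRight (Q E : ℝ → Mat2) (e : Fin 2 → ℂ) (m : ℝ → Fin 2 → ℂ) : Prop where
  continuous : Continuous m
  bounded : ∃ C : ℝ, ∀ x, ‖m x‖ ≤ C
  volterra : ∀ x, m x = e - ∫ y in Ioi x, E (y - x) *ᵥ (Q y *ᵥ m y)

/-- `m` is the bounded continuous solution of the Volterra equation
`m x = e + ∫_{-∞}^x E (y - x) Q y m y dy`. -/
structure IsJostLeft (Q E : ℝ → Mat2) (e : Fin 2 → ℂ) (m : ℝ → Fin 2 → ℂ) : Prop where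
  continuous : Continuous m
  bounded : ∃ C : ℝ, ∀ x, ‖m x‖ ≤ C
  volterra : ∀ x, m x = e + ∫ y in Iic x, E (y - x) *ᵥ (Q y *ᵥ m y)

/-- The determinant of the matrix with columns `v`, `w`. -/
def det2 (v w : Fin 2 → ℂ) : ℂ := v 0 * w 1 - w 0 * v 1

/-- `a` (on the closed upper half-plane), `d` (on the closed lower half-plane) and `b` (on the real
line) are the scattering coefficients of `u₀`: with the normalized Jost functions
`m^± = [m₁^±, m₂^±]`, `a = det [m₁⁺, m₂⁻]`, `d = det [m₁⁻, m₂⁺]`,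
`b = det [m₁⁻, m₁⁺] exp (2 i z x)`; equivalently `a`, `b`, `d` are the (1,1), (2,1), (2,2) entries
of `S` in `m⁺ = m⁻ exp (i z x σ₃) S exp (-i z x σ₃)`. -/
def IsScatteringCoefficients (σ : ℝ) (u₀ : ℝ → ℝ) (a d : ℂ → ℂ) (b : ℝ → ℂ) : Prop :=
  ∃ m₁p m₁m m₂p m₂m : ℂ → ℝ → Fin 2 → ℂ,
    (∀ z : ℂ, 0 ≤ z.im →
      IsJostRight (initialQ σ u₀) (phase1 z) ![1, 0] (m₁p z) ∧
      IsJostLeft (initialQ σ u₀) (phase2 z) ![0, 1] (m₂m z)) ∧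
    (∀ z : ℂ, z.im ≤ 0 →
      IsJostLeft (initialQ σ u₀) (phase1 z) ![1, 0] (m₁m z) ∧
      IsJostRight (initialQ σ u₀) (phase2 z) ![0, 1] (m₂p z)) ∧
    (∀ z : ℂ, 0 ≤ z.im → ∀ x, a z = det2 (m₁p z x) (m₂m z x)) ∧
    (∀ z : ℂ, z.im ≤ 0 → ∀ x, d z = det2 (m₁m z x) (m₂p z x)) ∧
    (∀ s x : ℝ, b s = det2 (m₁m s x) (m₁p s x) * exp (2 * I * (s : ℂ) * (x : ℂ)))

/-- No eigenvalues and no resonances: `a` and `d` have no zeros in the closed upper, respectively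
lower, half-plane. -/
def NoEigenvaluesOrResonances (a d : ℂ → ℂ) : Prop :=
  (∀ z : ℂ, 0 ≤ z.im → a z ≠ 0) ∧ (∀ z : ℂ, z.im ≤ 0 → d z ≠ 0)

/-- The reflection coefficient `r₁ = b / a`. -/
noncomputable def reflection1 (a : ℂ → ℂ) (b : ℝ → ℂ) (s : ℝ) : ℂ := b s / a (s : ℂ)

/-- The reflection coefficient `r₂ (s) = conj (b (-s)) / d (s)`. -/
noncomputable def reflection2 (d : ℂ → ℂ) (b : ℝ → ℂ) (s : ℝ) : ℂ :=
  (starRingEnd ℂ) (b (-s)) / d (s : ℂ)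

/-! ### Weighted spaces on the line -/

/-- The Japanese bracket. -/
noncomputable def bracket (s : ℝ) : ℝ := Real.sqrt (1 + s ^ 2)

/-- `f ∈ L^{2,k}`: `⟨s⟩^k f ∈ L²`. -/
def MemL2k (k : ℕ) (f : ℝ → ℂ) : Prop :=
  MemLp (fun s => ((bracket s ^ k : ℝ) : ℂ) * f s) 2 volume

/-- `g` is the weak derivative of `f`. -/
def IsWeakDeriv (f g : ℝ → ℂ) : Prop :=
  ∀ φ : ℝ → ℝ, ContDiff ℝ ∞ φ → HasCompactSupport φ →
    ∫ s, f s * ((deriv φ s : ℝ) : ℂ) = -∫ s, g s * ((φ s : ℝ) : ℂ)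

/-- `f ∈ H^{1,1}`: `⟨s⟩ f` and `⟨s⟩ f'` are in `L²`, with the weak derivative `f'`. -/
def MemH11 (f : ℝ → ℂ) : Prop :=
  MemL2k 1 f ∧ ∃ g : ℝ → ℂ, IsWeakDeriv f g ∧ MemL2k 1 g

/-! ### The time-dependent Riemann-Hilbert problem -/

/-- `θ (x, t; z) = z x + 4 z³ t`. -/
def theta (x t s : ℝ) : ℝ := s * x + 4 * s ^ 3 * t

/-- The jump matrix `V_{x,t}`. -/
noncomputable def jumpMatrix (σ : ℝ) (r₁ r₂ : ℝ → ℂ) (x t s : ℝ) : Mat2 :=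
  !![1 + (σ : ℂ) * r₁ s * r₂ s, (σ : ℂ) * r₂ s * exp (2 * I * (theta x t s : ℂ));
     r₁ s * exp (-(2 * I * (theta x t s : ℂ))), 1]

/-- The filter of `z → ∞` in `ℂ \ ℝ`. -/
noncomputable def atInftyOffReal : Filter ℂ := Bornology.cobounded ℂ ⊓ 𝓟 {z : ℂ | z.im ≠ 0}

/-- `M` solves the Riemann-Hilbert problem with jump `V` on the real line: it is analytic in
`ℂ \ ℝ`, is `I + O(1/z)` at infinity, and has boundary values on the real line from above and from
below with `M₊ = M₋ V`. -/
structure IsRHSolution (V : ℝ → Mat2) (M : ℂ → Mat2) : Prop where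
  analytic : ∀ i j, DifferentiableOn ℂ (fun z => M z i j) {z : ℂ | z.im ≠ 0}
  normalized : ∀ i j, (fun z => M z i j - (1 : Mat2) i j) =O[atInftyOffReal] fun z => z⁻¹
  jump : ∃ Mp Mm : ℝ → Mat2,
    (∀ s : ℝ, Tendsto M (𝓝[{z : ℂ | 0 < z.im}] (s : ℂ)) (𝓝 (Mp s))) ∧
    (∀ s : ℝ, Tendsto M (𝓝[{z : ℂ | z.im < 0}] (s : ℂ)) (𝓝 (Mm s))) ∧
    ∀ s : ℝ, Mp s = Mm s * V s

/-! ### The Lax pair and the nonlocal mKdV equation -/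

/-- `Q (x, t)`, with entries `u (x, t)` and `-σ u (-x, -t)`. -/
noncomputable def laxQ (σ : ℝ) (u : ℝ → ℝ → ℝ) (x t : ℝ) : Mat2 := offDiag σ (u x t) (u (-x) (-t))

/-- `Q_x`. -/
noncomputable def laxQx (σ : ℝ) (u : ℝ → ℝ → ℝ) (x t : ℝ) : Mat2 :=
  Matrix.of fun i j => deriv (fun y => laxQ σ u y t i j) x

/-- `Q_{xx}`. -/
noncomputable def laxQxx (σ : ℝ) (u : ℝ → ℝ → ℝ) (x t : ℝ) : Mat2 :=
  Matrix.of fun i j => iteratedDeriv 2 (fun y => laxQ σ u y t i j) x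

/-- The coefficient
`4 z² Q + 2 i z (Q_x + Q²) σ₃ + 2 Q³ - Q_{xx} + [Q_x, Q]` of the `t`-equation. -/
noncomputable def laxB (σ : ℝ) (u : ℝ → ℝ → ℝ) (x t : ℝ) (z : ℂ) : Mat2 :=
  (4 * z ^ 2) • laxQ σ u x t
    + (2 * I * z) • ((laxQx σ u x t + laxQ σ u x t ^ 2) * sigma3)
    + (2 : ℂ) • laxQ σ u x t ^ 3 - laxQxx σ u x t
    + comm2 (laxQx σ u x t) (laxQ σ u x t)

/-- `M_x = i z [σ₃, M] + Q M` at all `(x, t)` and all `z ∈ ℂ \ ℝ`. -/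
def SatisfiesLaxX (σ : ℝ) (u : ℝ → ℝ → ℝ) (M : ℝ → ℝ → ℂ → Mat2) : Prop :=
  ∀ (x t : ℝ) (z : ℂ), z.im ≠ 0 → ∀ i j,
    HasDerivAt (fun y => M y t z i j)
      (((I * z) • comm2 sigma3 (M x t z) + laxQ σ u x t * M x t z) i j) x

/-- `M_t = 4 i z³ [σ₃, M] + B M` at all `(x, t)` and all `z ∈ ℂ \ ℝ`. -/
def SatisfiesLaxT (σ : ℝ) (u : ℝ → ℝ → ℝ) (M : ℝ → ℝ → ℂ → Mat2) : Prop :=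
  ∀ (x t : ℝ) (z : ℂ), z.im ≠ 0 → ∀ i j,
    HasDerivAt (fun τ => M x τ z i j)
      (((4 * I * z ^ 3) • comm2 sigma3 (M x t z) + laxB σ u x t z * M x t z) i j) t

/-- `u`, `u_x`, `u_{xx}` exist and are continuous on `ℝ²`. -/
structure ContinuousC2InX (u : ℝ → ℝ → ℝ) : Prop where
  contDiff : ∀ t, ContDiff ℝ 2 fun x => u x t
  cont : Continuous fun p : ℝ × ℝ => u p.1 p.2
  cont_x : Continuous fun p : ℝ × ℝ => deriv (fun y => u y p.2) p.1
  cont_xx : Continuous fun p : ℝ × ℝ => iteratedDeriv 2 (fun y => u y p.2) p.1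

/-- `u_t + u_{xxx} + 6 σ u(x,t) u(-x,-t) u_x = 0` on `ℝ²` in the sense of distributions. -/
def SolvesNonlocalMKdV (σ : ℝ) (u : ℝ → ℝ → ℝ) : Prop :=
  ∀ φ : ℝ × ℝ → ℝ, ContDiff ℝ ∞ φ → HasCompactSupport φ →
    ∫ p : ℝ × ℝ, (-(u p.1 p.2 * deriv (fun τ => φ (p.1, τ)) p.2)
      - u p.1 p.2 * iteratedDeriv 3 (fun y => φ (y, p.2)) p.1
      + 6 * σ * u p.1 p.2 * u (-p.1) (-p.2) * deriv (fun y => u y p.2) p.1 * φ p) = 0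

/-! The solution `M` is given separately at every point `(x, t)`, so its regularity in `(x, t)` has
to be produced. The tool is the quotient `E = M(p) M(q)⁻¹` of the solutions at two points. All jumps
have determinant one, so `E` is analytic off the line, tends to `1`, and satisfies `E₊ - E₋ = E₋ W`,
where `W` (`relJump`) is small uniformly and in `L²` when `p` is near `q`. By Cauchy's theorem the
boundary values of a decaying function are orthogonal in `L²` (`HasCut.integral_sq_le`), hence `E₋ -
1` is controlled by its jump and, for small `W`, by `W` itself (`RHData.small_norm`). This a priori
bound replaces the inversion of a singular integral operator.

Next, `E = 1 + C(W) + C((E₋ - 1) W)` with the Cauchy integral `C`, and the last term is quadratic in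
the displacement. So `M` is differentiable in `x` and in `t`. The derivative of `W` is `-i s` in `x`
and `-4 i s³` in `t`, times the jump of `M σ₃ M⁻¹` (`RHFlow.hasDerivAt_path`). Trading powers of `s`
for powers of `z` turns the two Cauchy integrals into polynomials in `z` whose coefficients are
moments `B₀, B₁, B₂` of that jump (`coefS`). The `L^{2,3}` bound is used in full: moments up to
order two converge absolutely, and the third power is handled under a Cauchy kernel. The
`x`-equation expanded at infinity gives `x`-derivatives of the coefficients, and the relation `(M σ₃
M⁻¹)² = 1` gives anticommutators with `σ₃`. Together they identify `B₀, B₁, B₂` through `Q, Q_x,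
Q_xx` (`RHFlow.coefS_eq`, `RHFlow.coefS_anticomm`, `lax_coefficient_identity`).

No classical `u_t` or `u_xxx` is at hand. The `t`-equation is therefore tested against a smooth
function at fixed `z` and expanded along the imaginary axis, locally uniformly in `(x, t)`
(`RHFlow.integral_coef_eq_zero`). The pointwise identity `mkdv_identity` turns the leading
coefficient into the nonlocal equation.

That the same `u` fills both entries of `Q` follows from two symmetries and uniqueness. Real data
give `conj M(-conj z) = M(z)`, so `u` is real. The nonlocal symmetry compares `M(x, t)` with `M(-x,
-t)`, corrected by the functions `a` and `d` (`RHFlow.reflect_eq`). It needs `a` and `d` to be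
analytic, free of zeros and equal to `1` at infinity, and `a d + σ b² = 1` on the line. These facts
come from the Volterra equations of the Jost functions (`IsScatteringCoefficients.relations`).

Finally, the limit defining `u` is taken uniformly up to the real line. The `H^{1,1}` bound makes `z
M'(z)` of size `1 + |Im z|^(-1/2)`, which is integrable in `Im z`, so the behaviour near the line is
governed by that at a small fixed height (`RHFlow.tendsto_atInftyOffReal`). -/

/-! ### Functions holomorphic off the real line -/

/-- Cauchy's theorem on the upper half-plane for `k = o(1/z)`. -/
theorem tendsto_integral_of_upper {k : ℂ → ℂ} (hc : ContinuousOn k {z | 0 ≤ z.im})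
    (hd : DifferentiableOn ℂ k {z | 0 < z.im})
    (h0 : ∀ ε > 0, ∃ R₀ : ℝ, ∀ z : ℂ, 0 ≤ z.im → R₀ ≤ ‖z‖ → ‖k z‖ * ‖z‖ ≤ ε) :
    Tendsto (fun R : ℝ => ∫ s in (-R)..R, k s) atTop (𝓝 0) := by
  rw [Metric.tendsto_atTop]
  intro ε hε
  obtain ⟨R₀, hR₀⟩ := h0 (ε / 8) (by positivity)
  refine ⟨max R₀ 1, fun R hR => ?_⟩
  have hR0 : R₀ ≤ R := le_trans (le_max_left _ _) hR
  have hR1 : 1 ≤ R := le_trans (le_max_right _ _) hR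
  have hRpos : 0 < R := by linarith
  -- On the other three sides of `[-R, R] × [0, R]` one has `‖z‖ ≥ R`, hence `‖k‖ ≤ ε / (8 R)`.
  -- Their total length is `4 R`, so they contribute at most `ε / 2`.
  have key := Complex.integral_boundary_rect_eq_zero_of_continuousOn_of_differentiableOn k
    (⟨-R, 0⟩ : ℂ) (⟨R, R⟩ : ℂ)
    (hc.mono (by
      intro z hz
      rw [mem_reProdIm] at hz
      have := hz.2
      simp only [uIcc_of_le hRpos.le] at this
      exact this.1))
    (hd.mono (by
      intro z hz
      rw [mem_reProdIm] at hz
      have := hz.2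
      simp only [min_eq_left hRpos.le] at this
      exact this.1))
  simp only [ofReal_zero, zero_mul, add_zero] at key
  have bd : ∀ z : ℂ, 0 ≤ z.im → R ≤ ‖z‖ → ‖k z‖ ≤ ε / 8 / R := by
    intro z hz hzR
    rw [le_div_iff₀ hRpos]
    exact (mul_le_mul_of_nonneg_left hzR (norm_nonneg _)).trans (hR₀ z hz (hR0.trans hzR))
  have b1 : ‖∫ x : ℝ in (-R)..R, k (x + R * I)‖ ≤ ε / 8 / R * |R - (-R)| := by
    refine intervalIntegral.norm_integral_le_of_norm_le_const fun x _ => bd _ (by simp [hRpos.le]) ?_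
    refine le_trans ?_ (abs_im_le_norm _)
    simp [le_abs_self]
  have b2 : ‖∫ y : ℝ in (0:ℝ)..R, k (R + y * I)‖ ≤ ε / 8 / R * |R - 0| := by
    refine intervalIntegral.norm_integral_le_of_norm_le_const fun y hy => bd _ ?_ ?_
    · rw [uIoc_of_le hRpos.le] at hy; simp [hy.1.le]
    refine le_trans ?_ (abs_re_le_norm _)
    simp [le_abs_self]
  have b3 : ‖∫ y : ℝ in (0:ℝ)..R, k ((-R : ℝ) + y * I)‖ ≤ ε / 8 / R * |R - 0| := by
    refine intervalIntegral.norm_integral_le_of_norm_le_const fun y hy => bd _ ?_ ?_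
    · rw [uIoc_of_le hRpos.le] at hy; simp [hy.1.le]
    refine le_trans ?_ (abs_re_le_norm _)
    simp [le_abs_self]
  have e : (∫ s : ℝ in (-R)..R, k s) = (∫ x : ℝ in (-R)..R, k (x + R * I))
      - I • (∫ y : ℝ in (0:ℝ)..R, k (R + y * I)) + I • (∫ y : ℝ in (0:ℝ)..R, k ((-R : ℝ) + y * I)) := by
    linear_combination key
  rw [dist_zero_right, e]
  have h1 : |R - (-R)| = 2 * R := by rw [abs_of_pos] <;> linarith
  have h2 : |R - 0| = R := by rw [sub_zero, abs_of_pos hRpos]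
  rw [h1] at b1; rw [h2] at b2 b3
  have c1 : ε / 8 / R * (2 * R) = ε / 4 := by field_simp; ring
  have c2 : ε / 8 / R * R = ε / 8 := by field_simp
  rw [c1] at b1; rw [c2] at b2 b3
  refine lt_of_le_of_lt (norm_add_le _ _) ?_
  have := norm_sub_le (∫ x : ℝ in (-R)..R, k (x + R * I)) (I • (∫ y : ℝ in (0:ℝ)..R, k (R + y * I)))
  rw [norm_smul, norm_I, one_mul] at this
  rw [norm_smul, norm_I, one_mul]
  linarith

/-- `f` is holomorphic off the real line with boundary values `fp` from above and `fm` from below. -/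
structure HasCut (f : ℂ → ℂ) (fp fm : ℝ → ℂ) : Prop where
  diff : DifferentiableOn ℂ f {z : ℂ | z.im ≠ 0}
  up : ∀ s : ℝ, Tendsto f (𝓝[{z : ℂ | 0 < z.im}] (s : ℂ)) (𝓝 (fp s))
  lo : ∀ s : ℝ, Tendsto f (𝓝[{z : ℂ | z.im < 0}] (s : ℂ)) (𝓝 (fm s))

theorem closure_upper_halfplane : closure {z : ℂ | 0 < z.im} = {z : ℂ | 0 ≤ z.im} :=
  Complex.closure_setOfPred_lt_im 0

instance neBot_nhdsWithin_upper (s : ℝ) : (𝓝[{z : ℂ | 0 < z.im}] (s : ℂ)).NeBot := by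
  rw [← mem_closure_iff_nhdsWithin_neBot, closure_upper_halfplane]; simp

instance neBot_nhdsWithin_lower (s : ℝ) : (𝓝[{z : ℂ | z.im < 0}] (s : ℂ)).NeBot := by
  rw [← mem_closure_iff_nhdsWithin_neBot, Complex.closure_setOfPred_im_lt]; simp

theorem isOpen_off_real : IsOpen {z : ℂ | z.im ≠ 0} :=
  isOpen_ne_fun Complex.continuous_im continuous_const

namespace HasCut

variable {f g : ℂ → ℂ} {fp fm gp gm : ℝ → ℂ}

theorem const (c : ℂ) : HasCut (fun _ => c) (fun _ => c) (fun _ => c) :=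
  ⟨differentiableOn_const c, fun _ => tendsto_const_nhds, fun _ => tendsto_const_nhds⟩

theorem add (hf : HasCut f fp fm) (hg : HasCut g gp gm) :
    HasCut (fun z => f z + g z) (fun s => fp s + gp s) (fun s => fm s + gm s) :=
  ⟨hf.diff.add hg.diff, fun s => (hf.up s).add (hg.up s), fun s => (hf.lo s).add (hg.lo s)⟩

theorem sub (hf : HasCut f fp fm) (hg : HasCut g gp gm) :
    HasCut (fun z => f z - g z) (fun s => fp s - gp s) (fun s => fm s - gm s) :=
  ⟨hf.diff.sub hg.diff, fun s => (hf.up s).sub (hg.up s), fun s => (hf.lo s).sub (hg.lo s)⟩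

theorem mul (hf : HasCut f fp fm) (hg : HasCut g gp gm) :
    HasCut (fun z => f z * g z) (fun s => fp s * gp s) (fun s => fm s * gm s) :=
  ⟨hf.diff.mul hg.diff, fun s => (hf.up s).mul (hg.up s), fun s => (hf.lo s).mul (hg.lo s)⟩

theorem neg (hf : HasCut f fp fm) : HasCut (fun z => - f z) (fun s => - fp s) (fun s => - fm s) :=
  ⟨hf.diff.neg, fun s => (hf.up s).neg, fun s => (hf.lo s).neg⟩

/-- The map `z ↦ -z` exchanges the half-planes, so whatever is proved above the line can be used
below it. -/
theorem comp_neg (hf : HasCut f fp fm) :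
    HasCut (fun z => f (-z)) (fun s => fm (-s)) (fun s => fp (-s)) := by
  refine ⟨hf.diff.comp (differentiableOn_neg _) (fun z hz => by simpa using hz), fun s => ?_, fun s => ?_⟩
  · refine (hf.lo (-s)).comp ?_
    refine tendsto_nhdsWithin_iff.2 ⟨?_, ?_⟩
    · push_cast; exact (continuous_neg.tendsto _).mono_left nhdsWithin_le_nhds
    · filter_upwards [self_mem_nhdsWithin] with z hz; simpa using hz
  · refine (hf.up (-s)).comp ?_
    refine tendsto_nhdsWithin_iff.2 ⟨?_, ?_⟩
    · push_cast; exact (continuous_neg.tendsto _).mono_left nhdsWithin_le_nhds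
    · filter_upwards [self_mem_nhdsWithin] with z hz; simpa using hz

theorem comp_add (hf : HasCut f fp fm) (h : ℝ) :
    HasCut (fun z => f (z + h)) (fun s => fp (s + h)) (fun s => fm (s + h)) := by
  refine ⟨hf.diff.comp (by fun_prop) (fun z hz => by simpa using hz), fun s => ?_, fun s => ?_⟩
  · refine (hf.up (s + h)).comp (tendsto_nhdsWithin_iff.2 ⟨?_, ?_⟩)
    · push_cast
      exact ((continuous_id.add continuous_const).tendsto _).mono_left nhdsWithin_le_nhds
    · filter_upwards [self_mem_nhdsWithin] with z hz; simpa using hz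
  · refine (hf.lo (s + h)).comp (tendsto_nhdsWithin_iff.2 ⟨?_, ?_⟩)
    · push_cast
      exact ((continuous_id.add continuous_const).tendsto _).mono_left nhdsWithin_le_nhds
    · filter_upwards [self_mem_nhdsWithin] with z hz; simpa using hz

/-- Schwarz reflection places the conjugate of the lower boundary value on the upper side. This is
what makes the product of `f₊` with the conjugate of `f₋` a boundary value of one holomorphic
function. -/
theorem conj_conj (hf : HasCut f fp fm) :
    HasCut (fun z => (starRingEnd ℂ) (f ((starRingEnd ℂ) z)))
      (fun s => (starRingEnd ℂ) (fm s)) (fun s => (starRingEnd ℂ) (fp s)) := by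
  refine ⟨fun z hz => ?_, fun s => ?_, fun s => ?_⟩
  · have hz' : ((starRingEnd ℂ) z).im ≠ 0 := by simpa using hz
    have h := (hf.diff.differentiableAt (isOpen_off_real.mem_nhds hz')).conj_conj
    rw [Complex.conj_conj] at h
    exact h.differentiableWithinAt
  · refine (Complex.continuous_conj.tendsto _).comp ((hf.lo s).comp (tendsto_nhdsWithin_iff.2 ⟨?_, ?_⟩))
    · have := Complex.continuous_conj.tendsto (s : ℂ)
      rw [conj_ofReal] at this
      exact this.mono_left nhdsWithin_le_nhds
    · filter_upwards [self_mem_nhdsWithin] with z hz; simpa using hz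
  · refine (Complex.continuous_conj.tendsto _).comp ((hf.up s).comp (tendsto_nhdsWithin_iff.2 ⟨?_, ?_⟩))
    · have := Complex.continuous_conj.tendsto (s : ℂ)
      rw [conj_ofReal] at this
      exact this.mono_left nhdsWithin_le_nhds
    · filter_upwards [self_mem_nhdsWithin] with z hz; simpa using hz

theorem congr (hf : HasCut f fp fm) (h : ∀ z, z.im ≠ 0 → g z = f z) (hp : ∀ s, gp s = fp s)
    (hm : ∀ s, gm s = fm s) : HasCut g gp gm := by
  refine ⟨hf.diff.congr h, fun s => ?_, fun s => ?_⟩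
  · rw [hp s]
    refine (hf.up s).congr' ?_
    filter_upwards [self_mem_nhdsWithin] with z hz
    exact (h z (ne_of_gt hz)).symm
  · rw [hm s]
    refine (hf.lo s).congr' ?_
    filter_upwards [self_mem_nhdsWithin] with z hz
    exact (h z (ne_of_lt hz)).symm

/-- The continuous extension to the closed upper half-plane. -/
theorem exists_upper (hf : HasCut f fp fm) : ∃ k : ℂ → ℂ, ContinuousOn k {z | 0 ≤ z.im} ∧
    DifferentiableOn ℂ k {z | 0 < z.im} ∧ (∀ z, 0 < z.im → k z = f z) ∧ ∀ s : ℝ, k s = fp s := by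
  have hopen : IsOpen {z : ℂ | 0 < z.im} := isOpen_lt continuous_const Complex.continuous_im
  have hin : ∀ z : ℂ, 0 < z.im → Tendsto f (𝓝[{z : ℂ | 0 < z.im}] z) (𝓝 (f z)) := fun z hz =>
    ((hf.diff.differentiableAt (isOpen_off_real.mem_nhds hz.ne')).continuousAt.tendsto).mono_left
      nhdsWithin_le_nhds
  have heq : ∀ z, 0 < z.im → extendFrom {z : ℂ | 0 < z.im} f z = f z := fun z hz =>
    extendFrom_eq (subset_closure hz) (hin z hz)
  refine ⟨extendFrom {z : ℂ | 0 < z.im} f, ?_, ?_, heq, ?_⟩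
  · refine continuousOn_extendFrom closure_upper_halfplane.ge fun z hz => ?_
    rcases (show 0 ≤ z.im from hz).lt_or_eq with h | h
    · exact ⟨_, hin z h⟩
    · have : z = (z.re : ℂ) := Complex.ext (by simp) (by simp [← h])
      rw [this]; exact ⟨_, hf.up _⟩
  · exact (hf.diff.mono fun z hz => ne_of_gt hz).congr heq
  · intro s
    exact extendFrom_eq (by rw [closure_upper_halfplane]; simp) (hf.up s)

theorem continuous_up (hf : HasCut f fp fm) : Continuous fp := by
  obtain ⟨k, hk, -, -, hs⟩ := hf.exists_upper
  have : fp = fun s : ℝ => k s := funext fun s => (hs s).symm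
  rw [this]
  exact hk.comp_continuous Complex.continuous_ofReal fun s => by simp

theorem continuous_lo (hf : HasCut f fp fm) : Continuous fm := by
  have := hf.comp_neg.continuous_up.comp continuous_neg
  simpa [Function.comp_def] using this

end HasCut

/-! ### The Cauchy formula -/

/-- Decay of order `1/z`, uniformly up to the real line. -/
def Decays (f : ℂ → ℂ) : Prop := ∃ C : ℝ, ∀ z : ℂ, z.im ≠ 0 → ‖f z‖ * (1 + ‖z‖) ≤ C

/-- Convergence to zero at infinity, uniformly up to the real line. -/
def Vanishes (f : ℂ → ℂ) : Prop :=
  ∀ ε > 0, ∃ R : ℝ, ∀ z : ℂ, z.im ≠ 0 → R ≤ ‖z‖ → ‖f z‖ ≤ ε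

theorem Decays.vanishes {f : ℂ → ℂ} (h : Decays f) : Vanishes f := by
  obtain ⟨C, hC⟩ := h
  intro ε hε
  refine ⟨C / ε, fun z hz hR => ?_⟩
  rw [div_le_iff₀ hε] at hR
  have h1 := hC z hz
  by_contra! hlt
  have : ε * (1 + ‖z‖) ≤ ‖f z‖ * (1 + ‖z‖) := by gcongr
  nlinarith

namespace HasCut

variable {f g : ℂ → ℂ} {fp fm gp gm : ℝ → ℂ}

theorem up_vanishes (hf : HasCut f fp fm) (hv : Vanishes f) {ε : ℝ} (hε : 0 < ε) :
    ∃ R : ℝ, ∀ s : ℝ, R ≤ |s| → ‖fp s‖ ≤ ε := by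
  obtain ⟨R, hR⟩ := hv ε hε
  refine ⟨R + 1, fun s hs => le_of_tendsto (hf.up s).norm ?_⟩
  have h1 : ∀ᶠ z : ℂ in 𝓝 (s : ℂ), R < ‖z‖ :=
    continuous_norm.continuousAt.eventually_const_lt (by simp only [norm_real, Real.norm_eq_abs]; linarith)
  filter_upwards [self_mem_nhdsWithin, nhdsWithin_le_nhds h1] with z hz hz2
  exact hR z (ne_of_gt hz) hz2.le

theorem up_bound (hf : HasCut f fp fm) {C : ℝ} {w : ℂ → ℝ} (hw : Continuous w)
    (hC : ∀ z : ℂ, z.im ≠ 0 → ‖f z‖ * w z ≤ C) (s : ℝ) : ‖fp s‖ * w s ≤ C := by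
  refine le_of_tendsto ((hf.up s).norm.mul ((hw.tendsto (s : ℂ)).mono_left nhdsWithin_le_nhds)) ?_
  filter_upwards [self_mem_nhdsWithin] with z hz
  exact hC z (ne_of_gt hz)

theorem lo_bound (hf : HasCut f fp fm) {C : ℝ} {w : ℂ → ℝ} (hw : Continuous w)
    (hC : ∀ z : ℂ, z.im ≠ 0 → ‖f z‖ * w z ≤ C) (s : ℝ) : ‖fm s‖ * w s ≤ C := by
  refine le_of_tendsto ((hf.lo s).norm.mul ((hw.tendsto (s : ℂ)).mono_left nhdsWithin_le_nhds)) ?_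
  filter_upwards [self_mem_nhdsWithin] with z hz
  exact hC z (ne_of_lt hz)

theorem bounded_upper (hf : HasCut f fp fm) (R : ℝ) :
    ∃ C : ℝ, ∀ z : ℂ, 0 < z.im → ‖z‖ ≤ R → ‖f z‖ ≤ C := by
  obtain ⟨k, hk, -, hkf, -⟩ := hf.exists_upper
  have hcl : IsClosed {z : ℂ | 0 ≤ z.im} := isClosed_le continuous_const Complex.continuous_im
  have hK : IsCompact ({z : ℂ | 0 ≤ z.im} ∩ Metric.closedBall 0 R) :=
    (isCompact_closedBall (0 : ℂ) R).inter_left hcl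
  obtain ⟨C, hC⟩ := hK.exists_bound_of_continuousOn (hk.mono inter_subset_left)
  refine ⟨C, fun z hz hR => ?_⟩
  rw [← hkf z hz]
  exact hC z ⟨le_of_lt (show 0 < z.im from hz), by simpa using hR⟩

theorem bounded_ball (hf : HasCut f fp fm) (R : ℝ) :
    ∃ C : ℝ, ∀ z : ℂ, z.im ≠ 0 → ‖z‖ ≤ R → ‖f z‖ ≤ C := by
  obtain ⟨C, hC⟩ := hf.bounded_upper R
  obtain ⟨C', hC'⟩ := hf.comp_neg.bounded_upper R
  refine ⟨max C C', fun z hz hR => ?_⟩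
  rcases lt_or_gt_of_ne hz with h | h
  · have := hC' (-z) (by simpa using h) (by simpa using hR)
    rw [neg_neg] at this
    exact this.trans (le_max_right _ _)
  · exact (hC z h hR).trans (le_max_left _ _)

/-- The boundary values make `f` bounded on bounded sets, up to the line, so the normalization at
infinity becomes an estimate on all of `ℂ \ ℝ`. -/
theorem decays (hf : HasCut f fp fm) (h : f =O[atInftyOffReal] fun z => z⁻¹) : Decays f := by
  obtain ⟨c, hc⟩ := h.bound
  rw [atInftyOffReal, eventually_inf_principal] at hc
  obtain ⟨R, -, hR⟩ := (Filter.hasBasis_cobounded_norm (E := ℂ)).eventually_iff.1 hc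
  obtain ⟨C, hC⟩ := hf.bounded_ball (max R 1)
  refine ⟨max (C * (1 + max R 1)) (2 * |c|), fun z hz => ?_⟩
  by_cases h : ‖z‖ ≤ max R 1
  · refine le_trans ?_ (le_max_left _ _)
    have h1 := hC z hz h
    have : 0 ≤ C := (norm_nonneg _).trans h1
    gcongr
  · push Not at h
    have h1 : 1 ≤ ‖z‖ := (le_max_right _ _).trans h.le
    have h2 := hR (show z ∈ {x : ℂ | R ≤ ‖x‖} from (le_max_left _ _).trans h.le) hz
    refine le_trans ?_ (le_max_right _ _)
    rw [norm_inv] at h2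
    have hz0 : 0 < ‖z‖ := by linarith
    have h3 : c * ‖z‖⁻¹ ≤ |c| * ‖z‖⁻¹ := by gcongr; exact le_abs_self c
    calc ‖f z‖ * (1 + ‖z‖) ≤ |c| * ‖z‖⁻¹ * (2 * ‖z‖) := by
          gcongr
          · exact h2.trans h3
          · linarith
      _ = 2 * |c| := by field_simp

theorem _root_.Decays.bounded_of_sub {c : ℂ} (h : Decays fun z => f z - c) :
    ∃ C : ℝ, ∀ z : ℂ, z.im ≠ 0 → ‖f z‖ ≤ C := by
  obtain ⟨C, hC⟩ := h
  refine ⟨C + ‖c‖, fun z hz => ?_⟩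
  have h1 := hC z hz
  have h2 : ‖f z - c‖ ≤ C := by
    nlinarith [norm_nonneg (f z - c), norm_nonneg z, mul_nonneg (norm_nonneg (f z - c)) (norm_nonneg z)]
  calc ‖f z‖ = ‖(f z - c) + c‖ := by rw [sub_add_cancel]
    _ ≤ _ := (norm_add_le _ _).trans (by linarith)

end HasCut

theorem norm_sub_ge_of_norm {z w : ℂ} (h : 2 * ‖w‖ ≤ ‖z‖) : ‖z‖ / 2 ≤ ‖z - w‖ := by
  have := norm_sub_norm_le z w
  linarith

/-- Integral of the Poisson kernel. -/
theorem integral_poisson {y : ℝ} (hy : 0 < y) (x : ℝ) :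
    Integrable (fun s : ℝ => ((s - x) ^ 2 + y ^ 2)⁻¹) ∧
      ∫ s : ℝ, ((s - x) ^ 2 + y ^ 2)⁻¹ = Real.pi / y := by
  have e : (fun s : ℝ => ((s - x) ^ 2 + y ^ 2)⁻¹)
      = fun s : ℝ => (fun r : ℝ => (y ^ 2)⁻¹ * (1 + (r / y) ^ 2)⁻¹) (s - x) := by
    ext s
    have : 0 < (s - x) ^ 2 + y ^ 2 := by positivity
    simp only []
    rw [← mul_inv]
    congr 1
    field_simp
    ring
  constructor
  · rw [e]
    have h : Integrable fun r : ℝ => (y ^ 2)⁻¹ * (1 + (r / y) ^ 2)⁻¹ :=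
      (integrable_inv_one_add_sq.comp_div hy.ne').const_mul _
    exact h.comp_sub_right x
  · have e2 := integral_sub_right_eq_self (μ := (volume : Measure ℝ))
        (fun r : ℝ => (y ^ 2)⁻¹ * (1 + (r / y) ^ 2)⁻¹) x
    rw [e, e2, integral_const_mul, Measure.integral_comp_div (fun r : ℝ => (1 + r ^ 2)⁻¹) y,
      integral_univ_inv_one_add_sq, abs_of_pos hy, smul_eq_mul]
    field_simp

theorem norm_ofReal_sub_sq (s : ℝ) (z : ℂ) : ‖(s : ℂ) - z‖ ^ 2 = (s - z.re) ^ 2 + z.im ^ 2 := by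
  rw [← Complex.normSq_eq_norm_sq, Complex.normSq_apply]
  simp; ring

theorem abs_im_le_norm_ofReal_sub (s : ℝ) (z : ℂ) : |z.im| ≤ ‖(s : ℂ) - z‖ := by
  have := abs_im_le_norm ((s : ℂ) - z)
  simpa using this

theorem ofReal_sub_ne_zero {z : ℂ} (hz : z.im ≠ 0) (s : ℝ) : (s : ℂ) - z ≠ 0 := by
  intro h
  have := congrArg Complex.im h
  simp at this
  exact hz this

/-- The Cauchy integral `(2 π i)⁻¹ ∫ f s / (s - z) ds`. -/
noncomputable def cauchyInt (f : ℝ → ℂ) (z : ℂ) : ℂ :=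
  (2 * Real.pi * I)⁻¹ * ∫ s : ℝ, f s / ((s : ℂ) - z)

theorem HasCut.upper_vanishes {f : ℂ → ℂ} {fp fm : ℝ → ℂ} (hf : HasCut f fp fm)
    (hv : Vanishes f) {k : ℂ → ℂ} (hkf : ∀ z, 0 < z.im → k z = f z) (hks : ∀ s : ℝ, k s = fp s)
    {ε : ℝ} (hε : 0 < ε) : ∃ R : ℝ, ∀ z : ℂ, 0 ≤ z.im → R ≤ ‖z‖ → ‖k z‖ ≤ ε := by
  obtain ⟨R, hR⟩ := hv ε hε
  obtain ⟨R', hR'⟩ := hf.up_vanishes hv hε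
  refine ⟨max R R', fun z hz h => ?_⟩
  rcases hz.lt_or_eq with h0 | h0
  · rw [hkf z h0]; exact hR z h0.ne' ((le_max_left _ _).trans h)
  · have : z = (z.re : ℂ) := Complex.ext (by simp) (by simp [← h0])
    rw [this, hks]
    refine hR' _ ?_
    rw [this, norm_real] at h
    exact (le_max_right _ _).trans h

theorem Vanishes.comp_neg {f : ℂ → ℂ} (hv : Vanishes f) : Vanishes fun z => f (-z) := by
  intro ε hε
  obtain ⟨R, hR⟩ := hv ε hε
  exact ⟨R, fun z hz h => hR (-z) (by simpa using hz) (by simpa using h)⟩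

/-- The Poisson kernel as a product of Cauchy kernels. -/
theorem integral_cauchy_mul {z : ℂ} (hz : 0 < z.im) :
    Integrable (fun s : ℝ => (z - (starRingEnd ℂ) z) / ((s : ℂ) - (starRingEnd ℂ) z) / ((s : ℂ) - z)) ∧
    ∫ s : ℝ, (z - (starRingEnd ℂ) z) / ((s : ℂ) - (starRingEnd ℂ) z) / ((s : ℂ) - z)
      = 2 * Real.pi * I := by
  have e : (fun s : ℝ => (z - (starRingEnd ℂ) z) / ((s : ℂ) - (starRingEnd ℂ) z) / ((s : ℂ) - z))
      = fun s : ℝ => (2 * z.im * I) * ((((s - z.re) ^ 2 + z.im ^ 2)⁻¹ : ℝ) : ℂ) := by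
    ext s
    rw [div_div]
    have h1 : ((s : ℂ) - (starRingEnd ℂ) z) * ((s : ℂ) - z)
        = (((s - z.re) ^ 2 + z.im ^ 2 : ℝ) : ℂ) := by
      have : (starRingEnd ℂ) ((s : ℂ) - z) = (s : ℂ) - (starRingEnd ℂ) z := by simp
      rw [← this, mul_comm, Complex.mul_conj, Complex.normSq_eq_norm_sq, norm_ofReal_sub_sq]
    rw [h1, Complex.sub_conj, div_eq_mul_inv]
    push_cast; ring
  obtain ⟨h1, h2⟩ := integral_poisson hz z.re
  rw [e]
  refine ⟨h1.ofReal.const_mul _, ?_⟩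
  rw [integral_const_mul, integral_complex_ofReal, h2]
  have : (z.im : ℂ) ≠ 0 := by exact_mod_cast hz.ne'
  push_cast
  field_simp

/-- The pole at `z` is removed by hand: with `c ζ = (z - conj z) / (ζ - conj z)`, holomorphic above
the line and equal to `1` at `z`, the function `(f - f z * c) / (ζ - z)` has no pole and is
`o(1/ζ)`, so its integral over the line vanishes. The subtracted term integrates to `2 π i f z` by
the Poisson kernel. -/
theorem HasCut.cauchy_upper {f : ℂ → ℂ} {fp fm : ℝ → ℂ} (hf : HasCut f fp fm) (hv : Vanishes f)
    {z : ℂ} (hz : 0 < z.im) (hi : Integrable fun s : ℝ => (fp s - fm s) / ((s : ℂ) - z)) :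
    f z = cauchyInt (fun s => fp s - fm s) z := by
  obtain ⟨k, hkc, hkd, hkf, hks⟩ := hf.exists_upper
  obtain ⟨l, hlc, hld, hlf, hls⟩ := hf.comp_neg.exists_upper
  have hzne : z ≠ (starRingEnd ℂ) z := by
    intro h; have := congrArg Complex.im h; simp at this; linarith
  have hcden : ∀ ζ : ℂ, 0 ≤ ζ.im → ζ - (starRingEnd ℂ) z ≠ 0 := by
    intro ζ hζ h; have := congrArg Complex.im h; simp at this; linarith
  have hlden : ∀ ζ : ℂ, 0 ≤ ζ.im → ζ + z ≠ 0 := by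
    intro ζ hζ h; have := congrArg Complex.im h; simp at this; linarith
  set c : ℂ → ℂ := fun ζ => (z - (starRingEnd ℂ) z) / (ζ - (starRingEnd ℂ) z) with hc
  set h : ℂ → ℂ := fun ζ => k ζ - f z * c ζ with hh
  have hcz : c z = 1 := div_self (sub_ne_zero.2 hzne)
  have hhz : h z = 0 := by simp [hh, hcz, hkf z hz]
  have hcd : DifferentiableOn ℂ c {ζ | 0 ≤ ζ.im} := by
    intro ζ hζ
    have hd : DifferentiableAt ℂ (fun ζ : ℂ => ζ - (starRingEnd ℂ) z) ζ := by fun_prop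
    exact ((differentiableAt_const (z - (starRingEnd ℂ) z)).div hd (hcden ζ hζ)).differentiableWithinAt
  have hhc : ContinuousOn h {ζ | 0 ≤ ζ.im} := hkc.sub (continuousOn_const.mul hcd.continuousOn)
  have hhd : DifferentiableOn ℂ h {ζ | 0 < ζ.im} :=
    hkd.sub ((hcd.mono fun ζ hζ => le_of_lt (show 0 < ζ.im from hζ)).const_mul _)
  have hopen : IsOpen {z : ℂ | 0 < z.im} := isOpen_lt continuous_const Complex.continuous_im
  have hmem : {ζ : ℂ | 0 < ζ.im} ∈ 𝓝 z := hopen.mem_nhds hz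
  have hmem' : {ζ : ℂ | 0 ≤ ζ.im} ∈ 𝓝 z :=
    mem_of_superset hmem fun ζ hζ => le_of_lt (show 0 < ζ.im from hζ)
  have hds : ∀ ζ, ζ ≠ z → dslope h z ζ = h ζ / (ζ - z) := by
    intro ζ hζ
    rw [dslope_of_ne _ hζ, slope_def_field, hhz, sub_zero]
  have t1 := tendsto_integral_of_upper (k := dslope h z)
    ((continuousOn_dslope hmem').2 ⟨hhc, hhd.differentiableAt hmem⟩)
    ((Complex.differentiableOn_dslope hmem).2 hhd) (by
      intro ε hε
      obtain ⟨R, hR⟩ := hf.upper_vanishes hv hkf hks (show 0 < ε / 4 by positivity)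
      set A := ‖f z‖ * ‖z - (starRingEnd ℂ) z‖ with hA
      refine ⟨max (max R (2 * ‖z‖ + 1)) (8 * A / ε), fun ζ hζ hζR => ?_⟩
      have hR1 : R ≤ ‖ζ‖ := (le_max_left _ _).trans ((le_max_left _ _).trans hζR)
      have hR2 : 2 * ‖z‖ + 1 ≤ ‖ζ‖ := (le_max_right _ _).trans ((le_max_left _ _).trans hζR)
      have hR3 : 8 * A / ε ≤ ‖ζ‖ := (le_max_right _ _).trans hζR
      have hζ0 : 0 < ‖ζ‖ := by linarith [norm_nonneg z]
      have hne : ζ ≠ z := by rintro rfl; linarith [norm_nonneg ζ]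
      have d1 : ‖ζ‖ / 2 ≤ ‖ζ - z‖ := norm_sub_ge_of_norm (by linarith)
      have d2 : ‖ζ‖ / 2 ≤ ‖ζ - (starRingEnd ℂ) z‖ :=
        norm_sub_ge_of_norm (by rw [RCLike.norm_conj]; linarith)
      have hcb : ‖f z * c ζ‖ ≤ ε / 4 := by
        rw [norm_mul, hc, norm_div, ← mul_div_assoc, ← hA]
        have hpos : 0 < ‖ζ - (starRingEnd ℂ) z‖ := by linarith
        rw [div_le_iff₀ hpos]
        rw [div_le_iff₀ hε] at hR3
        nlinarith
      have hhb : ‖h ζ‖ ≤ ε / 2 := by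
        have := norm_sub_le (k ζ) (f z * c ζ)
        have := hR ζ hζ hR1
        simp only [hh]; linarith
      rw [hds ζ hne, norm_div, div_mul_eq_mul_div, div_le_iff₀ (by linarith)]
      nlinarith [norm_nonneg (h ζ)])
  -- The lower half of `f` is moved above the line by `ζ ↦ -ζ`. The pole then lies at `-z`, below
  -- the line, and nothing has to be subtracted.
  have t2 := tendsto_integral_of_upper (k := fun ζ => l ζ / (ζ + z))
    (hlc.div (by fun_prop) hlden)
    (hld.div (by fun_prop) (fun ζ hζ => hlden ζ (le_of_lt hζ))) (by
      intro ε hε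
      obtain ⟨R, hR⟩ := hf.comp_neg.upper_vanishes hv.comp_neg hlf hls (show 0 < ε / 2 by positivity)
      refine ⟨max R (2 * ‖z‖ + 1), fun ζ hζ hζR => ?_⟩
      have hR1 : R ≤ ‖ζ‖ := (le_max_left _ _).trans hζR
      have hR2 : 2 * ‖z‖ + 1 ≤ ‖ζ‖ := (le_max_right _ _).trans hζR
      have d1 : ‖ζ‖ / 2 ≤ ‖ζ - (-z)‖ := norm_sub_ge_of_norm (by rw [norm_neg]; linarith)
      rw [sub_neg_eq_add] at d1
      have := hR ζ hζ hR1
      rw [norm_div, div_mul_eq_mul_div, div_le_iff₀ (by linarith [norm_nonneg z])]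
      nlinarith [norm_nonneg (l ζ), norm_nonneg ζ, norm_nonneg (ζ + z)])
  obtain ⟨p1, p2⟩ := integral_cauchy_mul hz
  have t3 := intervalIntegral_tendsto_integral p1 tendsto_neg_atTop_atBot tendsto_id
  have t4 := intervalIntegral_tendsto_integral hi tendsto_neg_atTop_atBot tendsto_id
  have hsz := ofReal_sub_ne_zero hz.ne'
  have cont_p : Continuous fun s : ℝ => fp s / ((s : ℂ) - z) :=
    hf.continuous_up.div (by fun_prop) hsz
  have cont_m : Continuous fun s : ℝ => fm s / ((s : ℂ) - z) :=
    hf.continuous_lo.div (by fun_prop) hsz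
  have cont_c : Continuous fun s : ℝ => c s / ((s : ℂ) - z) :=
    (hcd.continuousOn.comp_continuous Complex.continuous_ofReal fun s => by simp).div
      (by fun_prop) hsz
  have eq : ∀ R : ℝ, (∫ s in (-R)..R, (fp s - fm s) / ((s : ℂ) - z))
      = (∫ s : ℝ in (-R)..R, dslope h z s) + (f z * ∫ s : ℝ in (-R)..R, c s / ((s : ℂ) - z))
        + ∫ s : ℝ in (-R)..R, l s / (s + z) := by
    intro R
    have e1 : (∫ s : ℝ in (-R)..R, l s / (s + z)) = - ∫ s : ℝ in (-R)..R, fm s / (s - z) := by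
      rw [← intervalIntegral.integral_neg]
      have := intervalIntegral.integral_comp_neg (fun s : ℝ => l s / (s + z)) (a := -R) (b := R)
      rw [neg_neg] at this
      rw [← this]
      refine intervalIntegral.integral_congr fun s _ => ?_
      simp only [hls, neg_neg]
      have h1 := hsz s
      have h2 : ((-s : ℝ) : ℂ) + z ≠ 0 := by
        have : ((-s : ℝ) : ℂ) + z = -((s : ℂ) - z) := by push_cast; ring
        rw [this]; exact neg_ne_zero.2 h1
      rw [← neg_div, div_eq_div_iff h2 h1]
      push_cast; ring
    have e2 : (∫ s : ℝ in (-R)..R, dslope h z s)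
        = (∫ s : ℝ in (-R)..R, fp s / ((s : ℂ) - z)) - f z * ∫ s : ℝ in (-R)..R, c s / ((s : ℂ) - z) := by
      rw [← intervalIntegral.integral_const_mul, ← intervalIntegral.integral_sub
        (cont_p.intervalIntegrable _ _) ((cont_c.intervalIntegrable _ _).const_mul _)]
      refine intervalIntegral.integral_congr fun s _ => ?_
      rw [hds s (sub_ne_zero.1 (hsz s))]
      simp only [hh, hks]
      ring
    rw [e1, e2]
    simp_rw [sub_div]
    rw [intervalIntegral.integral_sub (cont_p.intervalIntegrable _ _) (cont_m.intervalIntegrable _ _)]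
    ring
  have t5 := (t1.add (t3.const_mul (f z))).add t2
  have t6 := tendsto_nhds_unique (t4.congr eq) t5
  rw [p2] at t6
  have hpi : (2 * Real.pi * I : ℂ) ≠ 0 := by simp [Real.pi_ne_zero]
  rw [cauchyInt, t6]
  field_simp
  ring

/-- **Cauchy formula** for functions with a jump on the real line. -/
theorem HasCut.cauchy {f : ℂ → ℂ} {fp fm : ℝ → ℂ} (hf : HasCut f fp fm) (hv : Vanishes f)
    {z : ℂ} (hz : z.im ≠ 0) (hi : Integrable fun s : ℝ => (fp s - fm s) / ((s : ℂ) - z)) :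
    f z = cauchyInt (fun s => fp s - fm s) z := by
  rcases lt_or_gt_of_ne hz with h | h
  · have e : (fun s : ℝ => (fm (-s) - fp (-s)) / ((s : ℂ) - -z))
        = fun s : ℝ => (fun r : ℝ => (fp r - fm r) / ((r : ℂ) - z)) (-s) := by
      ext s
      have h1 := ofReal_sub_ne_zero hz (-s)
      have h2 : (s : ℂ) - -z ≠ 0 := by
        have : (s : ℂ) - -z = -(((-s : ℝ) : ℂ) - z) := by push_cast; ring
        rw [this]; exact neg_ne_zero.2 h1
      simp only []
      rw [div_eq_div_iff h2 h1]
      push_cast; ring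
    have := hf.comp_neg.cauchy_upper hv.comp_neg (z := -z) (by simpa using h)
      (by rw [e]; exact hi.comp_neg)
    rw [neg_neg] at this
    rw [this, cauchyInt, cauchyInt, e, integral_neg_eq_self (fun r : ℝ => (fp r - fm r) / ((r : ℂ) - z))]
  · exact hf.cauchy_upper hv h hi

/-- A function without jump which vanishes at infinity is zero. -/
theorem HasCut.eq_zero {f : ℂ → ℂ} {fp : ℝ → ℂ} (hf : HasCut f fp fp) (hv : Vanishes f)
    {z : ℂ} (hz : z.im ≠ 0) : f z = 0 := by
  rw [hf.cauchy hv hz (by simp)]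
  simp [cauchyInt]

theorem integrable_of_decay {f : ℝ → ℂ} (hf : Continuous f) {C : ℝ}
    (h : ∀ s, ‖f s‖ * (1 + |s|) ≤ C) : Integrable fun s => ‖f s‖ ^ 2 := by
  refine (integrable_inv_one_add_sq.const_mul (C ^ 2)).mono' (by fun_prop) (ae_of_all _ fun s => ?_)
  have h1 := h s
  have hpos : 0 < 1 + s ^ 2 := by positivity
  rw [Real.norm_of_nonneg (by positivity), ← div_eq_mul_inv, le_div_iff₀ hpos]
  have h2 : (‖f s‖ * (1 + |s|)) ^ 2 ≤ C ^ 2 := by gcongr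
  refine le_trans ?_ h2
  rw [mul_pow]
  gcongr
  nlinarith [sq_abs s, abs_nonneg s]

/-- Orthogonality of the two boundary values. -/
theorem HasCut.integral_sq_le {f : ℂ → ℂ} {fp fm : ℝ → ℂ} (hf : HasCut f fp fm) (hd : Decays f) :
    Integrable (fun s => ‖fm s‖ ^ 2) ∧ Integrable (fun s => ‖fp s - fm s‖ ^ 2) ∧
    ∫ s, ‖fm s‖ ^ 2 ≤ ∫ s, ‖fp s - fm s‖ ^ 2 := by
  obtain ⟨C, hC⟩ := hd
  have hw : Continuous fun z : ℂ => 1 + ‖z‖ := by fun_prop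
  have bp : ∀ s : ℝ, ‖fp s‖ * (1 + |s|) ≤ C := fun s => by simpa using hf.up_bound hw hC s
  have bm : ∀ s : ℝ, ‖fm s‖ * (1 + |s|) ≤ C := fun s => by simpa using hf.lo_bound hw hC s
  have cp := hf.continuous_up
  have cm := hf.continuous_lo
  have ip := integrable_of_decay cp bp
  have im := integrable_of_decay cm bm
  have ipm : Integrable fun s => ‖fp s - fm s‖ ^ 2 := integrable_of_decay (C := 2 * C) (by fun_prop)
    fun s => by
      have := norm_sub_le (fp s) (fm s)
      nlinarith [bp s, bm s, abs_nonneg s, norm_nonneg (fp s)]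
  -- The product `f(z) conj f(conj z)` is `O(z⁻²)` and has upper boundary value `f₊ conj f₋`. By
  -- Cauchy's theorem `f₊` and `f₋` are orthogonal, so `‖f₊ - f₋‖² = ‖f₊‖² + ‖f₋‖²` in `L²`.
  have hg := hf.mul hf.conj_conj
  have hgb : ∀ z : ℂ, z.im ≠ 0 →
      ‖f z * (starRingEnd ℂ) (f ((starRingEnd ℂ) z))‖ * (1 + ‖z‖) ^ 2 ≤ C ^ 2 := by
    intro z hz
    have h1 := hC z hz
    have h2 := hC ((starRingEnd ℂ) z) (by simpa using hz)
    rw [RCLike.norm_conj] at h2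
    rw [norm_mul, RCLike.norm_conj]
    calc _ = (‖f z‖ * (1 + ‖z‖)) * (‖f ((starRingEnd ℂ) z)‖ * (1 + ‖z‖)) := by ring
      _ ≤ C * C := mul_le_mul h1 h2 (by positivity) ((by positivity : (0:ℝ) ≤ _).trans h1)
      _ = C ^ 2 := by ring
  obtain ⟨k, hkc, hkd, hkf, hks⟩ := hg.exists_upper
  have hkb : ∀ z : ℂ, 0 ≤ z.im → ‖k z‖ * (1 + ‖z‖) ^ 2 ≤ C ^ 2 := by
    intro z hz
    rcases hz.lt_or_eq with h0 | h0
    · rw [hkf z h0]; exact hgb z h0.ne'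
    · have : z = (z.re : ℂ) := Complex.ext (by simp) (by simp [← h0])
      rw [this, hks]
      exact hg.up_bound (w := fun z : ℂ => (1 + ‖z‖) ^ 2) (by fun_prop) hgb z.re
  have t1 := tendsto_integral_of_upper hkc hkd (by
    intro ε hε
    refine ⟨max 1 (C ^ 2 / ε), fun z hz hR => ?_⟩
    have h1 : 1 ≤ ‖z‖ := (le_max_left _ _).trans hR
    have h2 : C ^ 2 / ε ≤ ‖z‖ := (le_max_right _ _).trans hR
    rw [div_le_iff₀ hε] at h2
    have h3 := hkb z hz
    by_contra! hlt
    nlinarith [norm_nonneg (k z), mul_nonneg (norm_nonneg (k z)) (norm_nonneg z)])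
  have ic : Integrable fun s : ℝ => fp s * (starRingEnd ℂ) (fm s) := by
    refine (ip.add im).mono' (by fun_prop) (ae_of_all _ fun s => ?_)
    rw [norm_mul, RCLike.norm_conj]
    simp only [Pi.add_apply]
    nlinarith [sq_nonneg (‖fp s‖ - ‖fm s‖), sq_nonneg (‖fp s‖ + ‖fm s‖)]
  have t2 := intervalIntegral_tendsto_integral ic tendsto_neg_atTop_atBot tendsto_id
  have t3 : ∫ s : ℝ, fp s * (starRingEnd ℂ) (fm s) = 0 := by
    refine tendsto_nhds_unique t2 (t1.congr fun R => ?_)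
    exact intervalIntegral.integral_congr fun s _ => hks s
  refine ⟨im, ipm, ?_⟩
  have e : ∀ s, ‖fp s - fm s‖ ^ 2
      = ‖fp s‖ ^ 2 + ‖fm s‖ ^ 2 - 2 * (fp s * (starRingEnd ℂ) (fm s)).re := by
    intro s
    simp only [← Complex.normSq_eq_norm_sq]
    rw [Complex.normSq_sub]
  have hre : ∫ s, (fp s * (starRingEnd ℂ) (fm s)).re = 0 := by
    have := integral_re ic
    simp only [RCLike.re_to_complex] at this
    rw [this, t3]; simp
  have hreI : Integrable fun s => (fp s * (starRingEnd ℂ) (fm s)).re := ic.re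
  simp_rw [e]
  have isum : Integrable fun s => ‖fp s‖ ^ 2 + ‖fm s‖ ^ 2 := ip.add im
  rw [integral_sub isum (hreI.const_mul 2), integral_add ip im, integral_const_mul, hre]
  have : 0 ≤ ∫ s, ‖fp s‖ ^ 2 := integral_nonneg fun s => by positivity
  linarith

theorem one_add_abs_le {z : ℂ} (hz : z.im ≠ 0) (s : ℝ) :
    1 + |s| ≤ (1 + (1 + ‖z‖) / |z.im|) * ‖(s : ℂ) - z‖ := by
  have h1 := abs_im_le_norm_ofReal_sub s z
  have h2 : |s| ≤ ‖(s : ℂ) - z‖ + ‖z‖ := by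
    have := norm_add_le ((s : ℂ) - z) z
    rwa [sub_add_cancel, norm_real, Real.norm_eq_abs] at this
  have h3 : 0 < |z.im| := abs_pos.2 hz
  have h4 : 1 + ‖z‖ ≤ (1 + ‖z‖) / |z.im| * ‖(s : ℂ) - z‖ := by
    rw [div_mul_eq_mul_div, le_div_iff₀ h3]
    gcongr
  linarith

theorem norm_inv_ofReal_sub_le {z : ℂ} (hz : z.im ≠ 0) (s : ℝ) :
    ‖((s : ℂ) - z)‖⁻¹ ≤ (1 + (1 + ‖z‖) / |z.im|) * (1 + |s|)⁻¹ := by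
  have h0 : 0 < ‖(s : ℂ) - z‖ := norm_pos_iff.2 (ofReal_sub_ne_zero hz s)
  have h1 : 0 < 1 + |s| := by positivity
  rw [← div_eq_mul_inv, le_div_iff₀ h1, inv_mul_le_iff₀ h0, mul_comm]
  exact one_add_abs_le hz s

theorem integrable_inv_one_add_abs_sq : Integrable fun s : ℝ => ((1 + |s|) ^ 2)⁻¹ := by
  have hc : Continuous fun s : ℝ => ((1 + |s|) ^ 2)⁻¹ :=
    Continuous.inv₀ (by fun_prop) fun s => by positivity
  refine integrable_inv_one_add_sq.mono' hc.aestronglyMeasurable (ae_of_all _ fun s => ?_)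
  rw [Real.norm_of_nonneg (by positivity)]
  gcongr
  nlinarith [sq_abs s, abs_nonneg s]

theorem Decays.add {f g : ℂ → ℂ} (hf : Decays f) (hg : Decays g) : Decays fun z => f z + g z := by
  obtain ⟨C, hC⟩ := hf
  obtain ⟨D, hD⟩ := hg
  refine ⟨C + D, fun z hz => ?_⟩
  have h1 := hC z hz
  have h2 := hD z hz
  have h3 := norm_add_le (f z) (g z)
  have h4 : 0 ≤ 1 + ‖z‖ := by positivity
  nlinarith

theorem Decays.neg {f : ℂ → ℂ} (hf : Decays f) : Decays fun z => - f z := by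
  obtain ⟨C, hC⟩ := hf
  exact ⟨C, fun z hz => by simpa using hC z hz⟩

theorem Decays.sub {f g : ℂ → ℂ} (hf : Decays f) (hg : Decays g) : Decays fun z => f z - g z := by
  simpa [sub_eq_add_neg] using hf.add hg.neg

theorem Decays.mul_bounded {f g : ℂ → ℂ} (hf : Decays f) {B : ℝ}
    (hg : ∀ z : ℂ, z.im ≠ 0 → ‖g z‖ ≤ B) : Decays fun z => f z * g z := by
  obtain ⟨C, hC⟩ := hf
  refine ⟨C * B, fun z hz => ?_⟩
  have h1 := hC z hz
  rw [norm_mul, mul_right_comm]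
  exact mul_le_mul h1 (hg z hz) (norm_nonneg _) ((by positivity : (0:ℝ) ≤ _).trans h1)

theorem Decays.congr {f g : ℂ → ℂ} (hf : Decays f) (h : ∀ z, z.im ≠ 0 → g z = f z) : Decays g := by
  obtain ⟨C, hC⟩ := hf
  exact ⟨C, fun z hz => by rw [h z hz]; exact hC z hz⟩

theorem HasCut.jump_bound {f : ℂ → ℂ} {fp fm : ℝ → ℂ} (hf : HasCut f fp fm) (hd : Decays f) :
    ∃ C : ℝ, ∀ s : ℝ, ‖fp s - fm s‖ * (1 + |s|) ≤ C := by
  obtain ⟨C, hC⟩ := hd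
  have hw : Continuous fun z : ℂ => 1 + ‖z‖ := by fun_prop
  refine ⟨2 * C, fun s => ?_⟩
  have bp : ‖fp s‖ * (1 + |s|) ≤ C := by simpa using hf.up_bound hw hC s
  have bm : ‖fm s‖ * (1 + |s|) ≤ C := by simpa using hf.lo_bound hw hC s
  have := norm_sub_le (fp s) (fm s)
  nlinarith [abs_nonneg s]

theorem integrable_div_of_decay {f : ℝ → ℂ} (hf : Continuous f) {C : ℝ}
    (h : ∀ s, ‖f s‖ * (1 + |s|) ≤ C) {z : ℂ} (hz : z.im ≠ 0) :
    Integrable fun s : ℝ => f s / ((s : ℂ) - z) := by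
  have hc : Continuous fun s : ℝ => f s / ((s : ℂ) - z) :=
    hf.div (by fun_prop) (ofReal_sub_ne_zero hz)
  refine (integrable_inv_one_add_abs_sq.const_mul (C * (1 + (1 + ‖z‖) / |z.im|))).mono'
    hc.aestronglyMeasurable (ae_of_all _ fun s => ?_)
  have h1 : ‖f s‖ ≤ C * (1 + |s|)⁻¹ := by
    rw [← div_eq_mul_inv, le_div_iff₀ (by positivity)]; exact h s
  rw [norm_div, div_eq_mul_inv]
  calc _ ≤ (C * (1 + |s|)⁻¹) * ((1 + (1 + ‖z‖) / |z.im|) * (1 + |s|)⁻¹) :=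
        mul_le_mul h1 (norm_inv_ofReal_sub_le hz s) (by positivity) ((norm_nonneg _).trans h1)
    _ = _ := by rw [sq, mul_inv]; ring

theorem HasCut.cauchy_of_decays {f : ℂ → ℂ} {fp fm : ℝ → ℂ} (hf : HasCut f fp fm) (hd : Decays f)
    {z : ℂ} (hz : z.im ≠ 0) : f z = cauchyInt (fun s => fp s - fm s) z := by
  obtain ⟨C, hC⟩ := hf.jump_bound hd
  exact hf.cauchy hd.vanishes hz
    (integrable_div_of_decay (hf.continuous_up.sub hf.continuous_lo) hC hz)

theorem norm_two_pi_I_inv_le : ‖(2 * Real.pi * I : ℂ)⁻¹‖ ≤ 1 := by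
  rw [norm_inv]
  apply inv_le_one_of_one_le₀
  simp only [norm_mul, Complex.norm_ofNat, norm_real, norm_I, mul_one, Real.norm_eq_abs,
    abs_of_pos Real.pi_pos]
  linarith [Real.pi_gt_three]

theorem norm_cauchyInt_le {f : ℝ → ℂ} (hf : Integrable f) {z : ℂ} (hz : z.im ≠ 0) :
    ‖cauchyInt f z‖ ≤ (∫ s, ‖f s‖) / |z.im| := by
  have h3 : 0 < |z.im| := abs_pos.2 hz
  rw [cauchyInt, norm_mul]
  have : ‖∫ s : ℝ, f s / ((s : ℂ) - z)‖ ≤ (∫ s, ‖f s‖) / |z.im| := by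
    rw [← integral_div]
    refine norm_integral_le_of_norm_le (hf.norm.div_const _) (ae_of_all _ fun s => ?_)
    rw [norm_div]
    gcongr
    exact abs_im_le_norm_ofReal_sub s z
  calc _ ≤ 1 * ‖∫ s : ℝ, f s / ((s : ℂ) - z)‖ := by gcongr; exact norm_two_pi_I_inv_le
    _ ≤ _ := by rwa [one_mul]

/-! ### `2 × 2` matrices -/

/-- The sum of the absolute values of the entries. -/
noncomputable def nrm (A : Mat2) : ℝ := ‖A 0 0‖ + ‖A 0 1‖ + ‖A 1 0‖ + ‖A 1 1‖

theorem nrm_nonneg (A : Mat2) : 0 ≤ nrm A := by unfold nrm; positivity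

theorem norm_entry_le (A : Mat2) (i j : Fin 2) : ‖A i j‖ ≤ nrm A := by
  unfold nrm
  have := norm_nonneg (A 0 0); have := norm_nonneg (A 0 1)
  have := norm_nonneg (A 1 0); have := norm_nonneg (A 1 1)
  fin_cases i <;> fin_cases j <;> simp <;> linarith

theorem nrm_add_le (A B : Mat2) : nrm (A + B) ≤ nrm A + nrm B := by
  unfold nrm
  simp only [Matrix.add_apply]
  linarith [norm_add_le (A 0 0) (B 0 0), norm_add_le (A 0 1) (B 0 1), norm_add_le (A 1 0) (B 1 0),
    norm_add_le (A 1 1) (B 1 1)]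

theorem mul_apply2 (A B : Mat2) (i j : Fin 2) : (A * B) i j = A i 0 * B 0 j + A i 1 * B 1 j := by
  rw [Matrix.mul_apply, Fin.sum_univ_two]

theorem nrm_mul_le (A B : Mat2) : nrm (A * B) ≤ nrm A * nrm B := by
  unfold nrm
  simp only [mul_apply2]
  have h : ∀ i j, ‖A i 0 * B 0 j + A i 1 * B 1 j‖ ≤ ‖A i 0‖ * ‖B 0 j‖ + ‖A i 1‖ * ‖B 1 j‖ :=
    fun i j => (norm_add_le _ _).trans (by rw [norm_mul, norm_mul])
  have h00 := h 0 0; have h01 := h 0 1; have h10 := h 1 0; have h11 := h 1 1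
  have p : ∀ i j k l, 0 ≤ ‖A i j‖ * ‖B k l‖ := fun i j k l => by positivity
  nlinarith [p 0 0 1 0, p 0 0 1 1, p 0 1 0 0, p 0 1 0 1, p 1 0 1 0, p 1 0 1 1, p 1 1 0 0, p 1 1 0 1]

theorem nrm_adjugate (A : Mat2) : nrm A.adjugate = nrm A := by
  rw [Matrix.adjugate_fin_two]
  simp [nrm]; ring

theorem nrm_one : nrm 1 = 2 := by simp [nrm]; norm_num

theorem mul_adj {A : Mat2} (h : A.det = 1) : A * A.adjugate = 1 := by
  rw [Matrix.mul_adjugate, h, one_smul]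

theorem adj_mul {A : Mat2} (h : A.det = 1) : A.adjugate * A = 1 := by
  rw [Matrix.adjugate_mul, h, one_smul]

theorem nrm_sq_le (A : Mat2) :
    nrm A ^ 2 ≤ 4 * (‖A 0 0‖ ^ 2 + ‖A 0 1‖ ^ 2 + ‖A 1 0‖ ^ 2 + ‖A 1 1‖ ^ 2) := by
  unfold nrm
  generalize ‖A 0 0‖ = a; generalize ‖A 0 1‖ = b; generalize ‖A 1 0‖ = c; generalize ‖A 1 1‖ = d
  nlinarith [sq_nonneg (a - b), sq_nonneg (a - c), sq_nonneg (a - d), sq_nonneg (b - c),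
    sq_nonneg (b - d), sq_nonneg (c - d)]

theorem sum_sq_le (A : Mat2) :
    ‖A 0 0‖ ^ 2 + ‖A 0 1‖ ^ 2 + ‖A 1 0‖ ^ 2 + ‖A 1 1‖ ^ 2 ≤ nrm A ^ 2 := by
  unfold nrm
  have := norm_nonneg (A 0 0); have := norm_nonneg (A 0 1)
  have := norm_nonneg (A 1 0); have := norm_nonneg (A 1 1)
  generalize ‖A 0 0‖ = a at *; generalize ‖A 0 1‖ = b at *
  generalize ‖A 1 0‖ = c at *; generalize ‖A 1 1‖ = d at *
  have h1 : 0 ≤ a * b := by positivity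
  have h2 : 0 ≤ a * c := by positivity
  have h3 : 0 ≤ a * d := by positivity
  have h4 : 0 ≤ b * c := by positivity
  have h5 : 0 ≤ b * d := by positivity
  have h6 : 0 ≤ c * d := by positivity
  nlinarith

/-- Entrywise `HasCut`. -/
def MatCut (M : ℂ → Mat2) (Mp Mm : ℝ → Mat2) : Prop :=
  ∀ i j, HasCut (fun z => M z i j) (fun s => Mp s i j) (fun s => Mm s i j)

/-- Entrywise `Decays`. -/
def MatDecays (M : ℂ → Mat2) : Prop := ∀ i j, Decays fun z => M z i j

namespace MatCut

variable {M N : ℂ → Mat2} {Mp Mm Np Nm : ℝ → Mat2}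

theorem mul (hM : MatCut M Mp Mm) (hN : MatCut N Np Nm) :
    MatCut (fun z => M z * N z) (fun s => Mp s * Np s) (fun s => Mm s * Nm s) := by
  intro i j
  simp only [mul_apply2]
  exact ((hM i 0).mul (hN 0 j)).add ((hM i 1).mul (hN 1 j))

theorem sub (hM : MatCut M Mp Mm) (hN : MatCut N Np Nm) :
    MatCut (fun z => M z - N z) (fun s => Mp s - Np s) (fun s => Mm s - Nm s) :=
  fun i j => (hM i j).sub (hN i j)

theorem const (A : Mat2) : MatCut (fun _ => A) (fun _ => A) (fun _ => A) :=
  fun i j => HasCut.const (A i j)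

theorem adjugate (hM : MatCut M Mp Mm) :
    MatCut (fun z => (M z).adjugate) (fun s => (Mp s).adjugate) (fun s => (Mm s).adjugate) := by
  intro i j
  simp only [Matrix.adjugate_fin_two]
  fin_cases i <;> fin_cases j <;> simp
  · exact hM 1 1
  · exact (hM 0 1).neg
  · exact (hM 1 0).neg
  · exact hM 0 0

theorem congr (hM : MatCut M Mp Mm) (h : ∀ z, z.im ≠ 0 → N z = M z) (hp : ∀ s, Np s = Mp s)
    (hm : ∀ s, Nm s = Mm s) : MatCut N Np Nm := fun i j =>
  (hM i j).congr (fun z hz => by rw [h z hz]) (fun s => by rw [hp s]) (fun s => by rw [hm s])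

theorem continuous_up (hM : MatCut M Mp Mm) : Continuous Mp :=
  continuous_matrix fun i j => (hM i j).continuous_up

theorem continuous_lo (hM : MatCut M Mp Mm) : Continuous Mm :=
  continuous_matrix fun i j => (hM i j).continuous_lo

theorem cauchy (hM : MatCut M Mp Mm) (hd : MatDecays M) {z : ℂ} (hz : z.im ≠ 0) (i j : Fin 2) :
    M z i j = cauchyInt (fun s => (Mp s - Mm s) i j) z :=
  (hM i j).cauchy_of_decays (hd i j) hz

end MatCut

theorem Continuous.nrm {X : Type*} [TopologicalSpace X] {F : X → Mat2} (hF : Continuous F) :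
    Continuous fun s => nrm (F s) := by
  unfold _root_.nrm
  have := fun i j => hF.matrix_elem i j
  exact ((((this 0 0).norm).add (this 0 1).norm).add (this 1 0).norm).add (this 1 1).norm

theorem MatDecays.mul_bounded {M N : ℂ → Mat2} (hM : MatDecays M) {B : ℝ}
    (hN : ∀ z : ℂ, z.im ≠ 0 → nrm (N z) ≤ B) : MatDecays fun z => M z * N z := by
  intro i j
  simp only [mul_apply2]
  exact ((hM i 0).mul_bounded fun z hz => (norm_entry_le _ _ _).trans (hN z hz)).add
    ((hM i 1).mul_bounded fun z hz => (norm_entry_le _ _ _).trans (hN z hz))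

theorem MatDecays.add {M N : ℂ → Mat2} (hM : MatDecays M) (hN : MatDecays N) :
    MatDecays fun z => M z + N z := fun i j => (hM i j).add (hN i j)

theorem MatDecays.adjugate {M : ℂ → Mat2} (hM : MatDecays M) :
    MatDecays fun z => (M z).adjugate := by
  intro i j
  simp only [Matrix.adjugate_fin_two]
  fin_cases i <;> fin_cases j <;> simp
  · exact hM 1 1
  · exact (hM 0 1).neg
  · exact (hM 1 0).neg
  · exact hM 0 0

theorem MatDecays.congr {M N : ℂ → Mat2} (hM : MatDecays M) (h : ∀ z, z.im ≠ 0 → N z = M z) :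
    MatDecays N := fun i j => (hM i j).congr fun z hz => by rw [h z hz]

theorem adjugate_sub_one (A : Mat2) : A.adjugate - 1 = (A - 1).adjugate := by
  rw [Matrix.adjugate_fin_two, Matrix.adjugate_fin_two]
  ext i j; fin_cases i <;> fin_cases j <;> simp

/-! ### Solutions of a Riemann-Hilbert problem and quotients of two of them -/

/-- A solution of the Riemann-Hilbert problem with its boundary values. -/
structure RHData (V Mp Mm : ℝ → Mat2) (M : ℂ → Mat2) : Prop where
  cut : MatCut M Mp Mm
  decays : MatDecays fun z => M z - 1
  jump : ∀ s, Mp s = Mm s * V s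
  detV : ∀ s, (V s).det = 1

theorem IsRHSolution.exists_data {V : ℝ → Mat2} {M : ℂ → Mat2} (h : IsRHSolution V M)
    (hV : ∀ s, (V s).det = 1) : ∃ Mp Mm : ℝ → Mat2, RHData V Mp Mm M := by
  obtain ⟨Mp, Mm, hp, hm, hj⟩ := h.jump
  have cut : MatCut M Mp Mm := fun i j => ⟨h.analytic i j,
    fun s => ((continuous_apply_apply i j).tendsto (Mp s)).comp (hp s),
    fun s => ((continuous_apply_apply i j).tendsto (Mm s)).comp (hm s)⟩
  exact ⟨Mp, Mm, cut, fun i j => ((cut.sub (MatCut.const 1)) i j).decays (h.normalized i j), hj, hV⟩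

namespace RHData

variable {V V₀ Mp Mm Np Nm : ℝ → Mat2} {M N : ℂ → Mat2}

theorem bounded (h : RHData V Mp Mm M) : ∃ m : ℝ, 1 ≤ m ∧ (∀ z : ℂ, z.im ≠ 0 → nrm (M z) ≤ m) ∧
    (∀ s, nrm (Mp s) ≤ m) ∧ ∀ s, nrm (Mm s) ≤ m := by
  have hb : ∀ i j, ∃ C : ℝ, ∀ z : ℂ, z.im ≠ 0 → ‖M z i j‖ ≤ C := fun i j =>
    Decays.bounded_of_sub (c := (1 : Mat2) i j) (h.decays i j)
  choose C hC using hb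
  have hw : Continuous fun _ : ℂ => (1 : ℝ) := continuous_const
  have hp : ∀ s i j, ‖Mp s i j‖ ≤ C i j := fun s i j => by
    simpa using (h.cut i j).up_bound hw (fun z hz => by simpa using hC i j z hz) s
  have hm : ∀ s i j, ‖Mm s i j‖ ≤ C i j := fun s i j => by
    simpa using (h.cut i j).lo_bound hw (fun z hz => by simpa using hC i j z hz) s
  refine ⟨max 1 (C 0 0 + C 0 1 + C 1 0 + C 1 1), le_max_left _ _, fun z hz => ?_, fun s => ?_,
    fun s => ?_⟩ <;> refine le_trans ?_ (le_max_right _ _) <;> unfold nrm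
  · linarith [hC 0 0 z hz, hC 0 1 z hz, hC 1 0 z hz, hC 1 1 z hz]
  · linarith [hp s 0 0, hp s 0 1, hp s 1 0, hp s 1 1]
  · linarith [hm s 0 0, hm s 0 1, hm s 1 0, hm s 1 1]

theorem sub_one_adjugate (h : RHData V Mp Mm M) : MatDecays fun z => (M z).adjugate - 1 :=
  h.decays.adjugate.congr fun z _ => adjugate_sub_one (M z)

/-- The quotient of two solutions is normalized. -/
theorem quotient_decays (h : RHData V Mp Mm M) (h₀ : RHData V₀ Np Nm N) :
    MatDecays fun z => M z * (N z).adjugate - 1 := by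
  obtain ⟨m, -, hm, -, -⟩ := h₀.bounded
  refine ((h.decays.mul_bounded (N := fun z => (N z).adjugate) (B := m)
    fun z hz => by rw [nrm_adjugate]; exact hm z hz).add h₀.sub_one_adjugate).congr fun z _ => ?_
  rw [sub_mul, one_mul]; abel

theorem quotient_cut (h : RHData V Mp Mm M) (h₀ : RHData V₀ Np Nm N) :
    MatCut (fun z => M z * (N z).adjugate) (fun s => Mp s * (Np s).adjugate)
      (fun s => Mm s * (Nm s).adjugate) := h.cut.mul h₀.cut.adjugate

/-- A jump of determinant one leaves `det M` without a jump, and `det M - 1` vanishes at infinity.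
Consequently the adjugate serves as the inverse of `M` throughout. -/
theorem det_eq_one (h : RHData V Mp Mm M) {z : ℂ} (hz : z.im ≠ 0) : (M z).det = 1 := by
  have hc : HasCut (fun z => (M z).det - 1) (fun s => (Mp s).det - 1) (fun s => (Mm s).det - 1) := by
    simp only [Matrix.det_fin_two]
    exact (((h.cut 0 0).mul (h.cut 1 1)).sub ((h.cut 0 1).mul (h.cut 1 0))).sub (HasCut.const 1)
  have hc' : HasCut (fun z => (M z).det - 1) (fun s => (Mm s).det - 1) (fun s => (Mm s).det - 1) :=
    hc.congr (fun _ _ => rfl) (fun s => by rw [h.jump, Matrix.det_mul, h.detV, mul_one])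
      (fun _ => rfl)
  obtain ⟨m, -, hm, -, -⟩ := h.bounded
  have hd : Decays fun z => (M z).det - 1 := by
    have h1 : Decays fun z => (M z 0 0 - 1) * M z 1 1 :=
      Decays.mul_bounded (by simpa using h.decays 0 0)
        fun z hz => (norm_entry_le _ 1 1).trans (hm z hz)
    have h2 : Decays fun z => M z 0 1 * M z 1 0 :=
      Decays.mul_bounded (by simpa using h.decays 0 1)
        fun z hz => (norm_entry_le _ 1 0).trans (hm z hz)
    have h3 : Decays fun z => M z 1 1 - 1 := by simpa using h.decays 1 1
    refine ((h1.add h3).sub h2).congr fun z _ => ?_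
    rw [Matrix.det_fin_two]; ring
  have := hc'.eq_zero hd.vanishes hz
  exact sub_eq_zero.1 this

theorem det_lo (h : RHData V Mp Mm M) (s : ℝ) : (Mm s).det = 1 := by
  have hc : HasCut (fun z => (M z).det) (fun s => (Mp s).det) (fun s => (Mm s).det) := by
    simp only [Matrix.det_fin_two]
    exact ((h.cut 0 0).mul (h.cut 1 1)).sub ((h.cut 0 1).mul (h.cut 1 0))
  refine tendsto_nhds_unique (hc.lo s) (tendsto_const_nhds.congr' ?_)
  filter_upwards [self_mem_nhdsWithin] with z hz
  exact (h.det_eq_one (ne_of_lt hz)).symm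

theorem V_eq (h : RHData V Mp Mm M) (s : ℝ) : V s = (Mm s).adjugate * Mp s := by
  rw [h.jump, ← mul_assoc, adj_mul (h.det_lo s), one_mul]

/-- The jump is a quotient of continuous boundary values. This is the source of the continuity of
the reflection coefficients. -/
theorem continuous_V (h : RHData V Mp Mm M) : Continuous V := by
  have : V = fun s => (Mm s).adjugate * Mp s := funext h.V_eq
  rw [this]
  exact h.cut.adjugate.continuous_lo.mul h.cut.continuous_up

/-- Since `V - 1 = M₋⁻¹ (M₊ - M₋)`, the normalization of `M` yields pointwise decay of the
reflection coefficients in addition to the `L²` bounds. -/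
theorem V_sub_one_bound (h : RHData V Mp Mm M) :
    ∃ C : ℝ, ∀ s, nrm (V s - 1) * (1 + |s|) ≤ C := by
  obtain ⟨m, hm1, -, -, hm⟩ := h.bounded
  have hcut := h.cut.sub (MatCut.const 1)
  choose C hC using fun i j => (hcut i j).jump_bound (h.decays i j)
  refine ⟨m * (C 0 0 + C 0 1 + C 1 0 + C 1 1), fun s => ?_⟩
  have e : V s - 1 = (Mm s).adjugate * (Mp s - Mm s) := by
    rw [h.jump s, ← mul_sub_one, ← mul_assoc, adj_mul (h.det_lo s), one_mul]
  have hb : nrm (Mp s - Mm s) * (1 + |s|) ≤ C 0 0 + C 0 1 + C 1 0 + C 1 1 := by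
    have := fun i j => hC i j s
    simp only [Matrix.sub_apply, sub_sub_sub_cancel_right] at this
    unfold nrm
    simp only [Matrix.sub_apply]
    linarith [this 0 0, this 0 1, this 1 0, this 1 1]
  calc _ ≤ (nrm (Mm s) * nrm (Mp s - Mm s)) * (1 + |s|) := by
        rw [e]; gcongr; rw [← nrm_adjugate (Mm s)]; exact nrm_mul_le _ _
    _ = nrm (Mm s) * (nrm (Mp s - Mm s) * (1 + |s|)) := by ring
    _ ≤ _ := mul_le_mul (hm s) hb (mul_nonneg (nrm_nonneg _) (by positivity)) (by linarith)

end RHData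

/-- The relative jump `N₋ (V - V₀) V₀⁻¹ N₋⁻¹`. -/
noncomputable def relJump (V V₀ Nm : ℝ → Mat2) (s : ℝ) : Mat2 :=
  Nm s * (V s - V₀ s) * ((V₀ s).adjugate * (Nm s).adjugate)

namespace RHData

variable {V V₀ Mp Mm Np Nm : ℝ → Mat2} {M N : ℂ → Mat2}

/-- For `E = M N⁻¹` this reads `E₊ - E₋ = E₋ W`. The matrix `W` depends on the reference solution
`N` and on the two jumps only, and it vanishes where the jumps agree. -/
theorem quotient_jump (h : RHData V Mp Mm M) (h₀ : RHData V₀ Np Nm N) (s : ℝ) :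
    Mp s * (Np s).adjugate - Mm s * (Nm s).adjugate
      = Mm s * (Nm s).adjugate * relJump V V₀ Nm s := by
  have e1 : (Nm s).adjugate * Nm s = 1 := adj_mul (h₀.det_lo s)
  have e2 : V₀ s * (V₀ s).adjugate = 1 := mul_adj (h₀.detV s)
  calc _ = Mm s * V s * ((V₀ s).adjugate * (Nm s).adjugate) - Mm s * (Nm s).adjugate := by
        rw [h.jump, h₀.jump, Matrix.adjugate_mul_distrib]
    _ = Mm s * V s * ((V₀ s).adjugate * (Nm s).adjugate)
        - Mm s * (V₀ s * (V₀ s).adjugate) * (Nm s).adjugate := by rw [e2, mul_one]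
    _ = Mm s * 1 * (V s - V₀ s) * ((V₀ s).adjugate * (Nm s).adjugate) := by noncomm_ring
    _ = _ := by rw [relJump, ← e1]; noncomm_ring

theorem continuous_relJump (h : RHData V Mp Mm M) (h₀ : RHData V₀ Np Nm N) :
    Continuous (relJump V V₀ Nm) :=
  (h₀.cut.continuous_lo.mul (h.continuous_V.sub h₀.continuous_V)).mul
    (h₀.continuous_V.matrix_adjugate.mul h₀.cut.continuous_lo.matrix_adjugate)

/-- The a priori `L²` estimate for a small relative jump. -/
theorem small_norm (h : RHData V Mp Mm M) (h₀ : RHData V₀ Np Nm N)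
    (hsmall : ∀ s, nrm (relJump V V₀ Nm s) ≤ 1 / 4)
    (hW : Integrable fun s => nrm (relJump V V₀ Nm s) ^ 2) :
    Integrable (fun s => nrm (Mm s * (Nm s).adjugate - 1) ^ 2) ∧
    ∫ s, nrm (Mm s * (Nm s).adjugate - 1) ^ 2 ≤ 16 * ∫ s, nrm (relJump V V₀ Nm s) ^ 2 := by
  set W := relJump V V₀ Nm with hWdef
  set D : ℝ → Mat2 := fun s => Mm s * (Nm s).adjugate - 1 with hD
  have hcut := (h.quotient_cut h₀).sub (MatCut.const 1)
  have hdec := h.quotient_decays h₀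
  have key := fun i j => (hcut i j).integral_sq_le (hdec i j)
  have hDc : Continuous D := hcut.continuous_lo
  have ej : ∀ s i j, (Mp s * (Np s).adjugate - 1) i j - (Mm s * (Nm s).adjugate - 1) i j
      = ((1 + D s) * W s) i j := by
    intro s i j
    have := congrFun (congrFun (h.quotient_jump h₀ s) i) j
    rw [hD]
    simp only [Matrix.sub_apply, sub_sub_sub_cancel_right] at this ⊢
    rw [this, add_sub_cancel]
  simp only [ej] at key
  have iD : Integrable fun s => nrm (D s) ^ 2 := by
    refine ((((((key 0 0).1.add (key 0 1).1).add (key 1 0).1).add (key 1 1).1)).const_mul 4).mono'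
      ((hDc.nrm.pow 2).aestronglyMeasurable) (ae_of_all _ fun s => ?_)
    rw [Real.norm_of_nonneg (by positivity)]
    exact nrm_sq_le (D s)
  refine ⟨iD, ?_⟩
  -- Orthogonality is applied to each entry of `E - 1`, whose jump is `(1 + D) W`. The factor `4`
  -- compares the squared sum of four moduli with the sum of their squares.
  have s1 : ∫ s, nrm (D s) ^ 2 ≤ 4 * ∫ s, nrm ((1 + D s) * W s) ^ 2 := by
    have i1 : Integrable fun s => 4 * (‖D s 0 0‖ ^ 2 + ‖D s 0 1‖ ^ 2 + ‖D s 1 0‖ ^ 2 + ‖D s 1 1‖ ^ 2) :=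
      (((((key 0 0).1.add (key 0 1).1).add (key 1 0).1).add (key 1 1).1)).const_mul 4
    have i2 : Integrable fun s => ‖((1 + D s) * W s) 0 0‖ ^ 2 + ‖((1 + D s) * W s) 0 1‖ ^ 2
        + ‖((1 + D s) * W s) 1 0‖ ^ 2 + ‖((1 + D s) * W s) 1 1‖ ^ 2 :=
      ((((key 0 0).2.1.add (key 0 1).2.1).add (key 1 0).2.1).add (key 1 1).2.1)
    have i3 : Integrable fun s => nrm ((1 + D s) * W s) ^ 2 := by
      refine (i2.const_mul 4).mono' ?_ (ae_of_all _ fun s => ?_)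
      · exact (((continuous_const.add hDc).mul (h.continuous_relJump h₀)).nrm.pow 2).aestronglyMeasurable
      · rw [Real.norm_of_nonneg (by positivity)]
        exact nrm_sq_le _
    calc ∫ s, nrm (D s) ^ 2
        ≤ ∫ s, 4 * (‖D s 0 0‖ ^ 2 + ‖D s 0 1‖ ^ 2 + ‖D s 1 0‖ ^ 2 + ‖D s 1 1‖ ^ 2) :=
          integral_mono iD i1 fun s => nrm_sq_le (D s)
      _ = 4 * ((∫ s, ‖D s 0 0‖ ^ 2) + (∫ s, ‖D s 0 1‖ ^ 2) + (∫ s, ‖D s 1 0‖ ^ 2)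
            + ∫ s, ‖D s 1 1‖ ^ 2) := by
          rw [integral_const_mul]
          congr 1
          have a1 := (key 0 0).1; have a2 := (key 0 1).1; have a3 := (key 1 0).1
          have a12 : Integrable fun s => ‖D s 0 0‖ ^ 2 + ‖D s 0 1‖ ^ 2 := a1.add a2
          have a123 : Integrable fun s => ‖D s 0 0‖ ^ 2 + ‖D s 0 1‖ ^ 2 + ‖D s 1 0‖ ^ 2 := a12.add a3
          rw [integral_add a123 (key 1 1).1, integral_add a12 a3, integral_add a1 a2]
      _ ≤ 4 * ((∫ s, ‖((1 + D s) * W s) 0 0‖ ^ 2) + (∫ s, ‖((1 + D s) * W s) 0 1‖ ^ 2)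
            + (∫ s, ‖((1 + D s) * W s) 1 0‖ ^ 2) + ∫ s, ‖((1 + D s) * W s) 1 1‖ ^ 2) := by
          have b1 := (key 0 0).2.2; have b2 := (key 0 1).2.2
          have b3 := (key 1 0).2.2; have b4 := (key 1 1).2.2
          simp only [hD] at *
          linarith
      _ = 4 * ∫ s, (‖((1 + D s) * W s) 0 0‖ ^ 2 + ‖((1 + D s) * W s) 0 1‖ ^ 2
            + ‖((1 + D s) * W s) 1 0‖ ^ 2 + ‖((1 + D s) * W s) 1 1‖ ^ 2) := by
          congr 1
          have a1 := (key 0 0).2.1; have a2 := (key 0 1).2.1; have a3 := (key 1 0).2.1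
          have a12 : Integrable fun s => ‖((1 + D s) * W s) 0 0‖ ^ 2 + ‖((1 + D s) * W s) 0 1‖ ^ 2 :=
            a1.add a2
          have a123 : Integrable fun s => ‖((1 + D s) * W s) 0 0‖ ^ 2
            + ‖((1 + D s) * W s) 0 1‖ ^ 2 + ‖((1 + D s) * W s) 1 0‖ ^ 2 := a12.add a3
          rw [integral_add a123 (key 1 1).2.1, integral_add a12 a3, integral_add a1 a2]
      _ ≤ _ := by
          have := integral_mono i2 i3 fun s => sum_sq_le ((1 + D s) * W s)
          linarith
  -- From `(w + d/4)² ≤ 2 w² + d²/8`: after multiplication by `4`, half of `∫ ‖D‖²` is absorbed on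
  -- the left, which leaves the constant `16`.
  have s2 : ∫ s, nrm ((1 + D s) * W s) ^ 2
      ≤ ∫ s, (2 * nrm (W s) ^ 2 + 1 / 8 * nrm (D s) ^ 2) := by
    refine integral_mono_of_nonneg (ae_of_all _ fun s => by positivity)
      ((hW.const_mul 2).add (iD.const_mul (1 / 8))) (ae_of_all _ fun s => ?_)
    have h1 : nrm ((1 + D s) * W s) ≤ nrm (W s) + nrm (D s) * (1 / 4) := by
      rw [add_mul, one_mul]
      refine (nrm_add_le _ _).trans ?_
      have := nrm_mul_le (D s) (W s)
      have := mul_le_mul_of_nonneg_left (hsmall s) (nrm_nonneg (D s))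
      linarith
    have h2 : nrm ((1 + D s) * W s) ^ 2 ≤ (nrm (W s) + nrm (D s) * (1 / 4)) ^ 2 :=
      pow_le_pow_left₀ (nrm_nonneg _) h1 2
    simp only []
    nlinarith [sq_nonneg (nrm (W s) - nrm (D s) * (1 / 4))]
  rw [integral_add (hW.const_mul 2) (iD.const_mul (1 / 8)), integral_const_mul, integral_const_mul] at s2
  linarith

end RHData

/-! ### The phase and the jump matrix -/

/-- The oscillating factor `exp (2 i θ)`. -/
noncomputable def phase (p : ℝ × ℝ) (s : ℝ) : ℂ := exp (2 * I * (theta p.1 p.2 s : ℂ))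

theorem norm_phase (p : ℝ × ℝ) (s : ℝ) : ‖phase p s‖ = 1 := by
  have : 2 * I * (theta p.1 p.2 s : ℂ) = ((2 * theta p.1 p.2 s : ℝ) : ℂ) * I := by push_cast; ring
  rw [phase, this, Complex.norm_exp_ofReal_mul_I]

theorem exp_neg_phase (p : ℝ × ℝ) (s : ℝ) :
    exp (-(2 * I * (theta p.1 p.2 s : ℂ))) = (starRingEnd ℂ) (phase p s) := by
  rw [phase, ← Complex.exp_conj]
  congr 1
  simp only [map_mul, conj_I, conj_ofReal, map_ofNat]
  ring

theorem norm_phase_sub_le (p q : ℝ × ℝ) (s : ℝ) :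
    ‖phase p s - phase q s‖ ≤ 2 * |theta p.1 p.2 s - theta q.1 q.2 s| := by
  have e : phase p s - phase q s
      = phase q s * (exp (I * ((2 * (theta p.1 p.2 s - theta q.1 q.2 s) : ℝ) : ℂ)) - 1) := by
    rw [mul_sub, mul_one, phase, phase, ← Complex.exp_add]
    congr 2
    push_cast; ring
  rw [e, norm_mul, norm_phase, one_mul]
  refine (Real.norm_exp_I_mul_ofReal_sub_one_le).trans ?_
  rw [Real.norm_eq_abs, abs_mul, abs_of_pos (by norm_num : (0:ℝ) < 2)]

theorem norm_phase_sub_le_two (p q : ℝ × ℝ) (s : ℝ) : ‖phase p s - phase q s‖ ≤ 2 := by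
  refine (norm_sub_le _ _).trans ?_
  rw [norm_phase, norm_phase]; norm_num

theorem continuous_phase (s : ℝ) : Continuous fun p : ℝ × ℝ => phase p s := by
  unfold phase theta
  fun_prop

theorem continuous_phase' (p : ℝ × ℝ) : Continuous fun s : ℝ => phase p s := by
  unfold phase theta
  fun_prop

/-- The jump matrix at the point `p`. -/
noncomputable def jumpAt (σ : ℝ) (r₁ r₂ : ℝ → ℂ) (p : ℝ × ℝ) (s : ℝ) : Mat2 :=
  jumpMatrix σ r₁ r₂ p.1 p.2 s

theorem jumpAt_eq (σ : ℝ) (r₁ r₂ : ℝ → ℂ) (p : ℝ × ℝ) (s : ℝ) : jumpAt σ r₁ r₂ p s =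
    !![1 + (σ : ℂ) * r₁ s * r₂ s, (σ : ℂ) * r₂ s * phase p s;
      r₁ s * (starRingEnd ℂ) (phase p s), 1] := by
  rw [jumpAt, jumpMatrix, exp_neg_phase, phase]

theorem phase_mul_conj (p : ℝ × ℝ) (s : ℝ) : phase p s * (starRingEnd ℂ) (phase p s) = 1 := by
  rw [Complex.mul_conj, Complex.normSq_eq_norm_sq, norm_phase]; simp

theorem det_jumpAt (σ : ℝ) (r₁ r₂ : ℝ → ℂ) (p : ℝ × ℝ) (s : ℝ) : (jumpAt σ r₁ r₂ p s).det = 1 := by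
  rw [jumpAt_eq, Matrix.det_fin_two_of]
  linear_combination (-(σ : ℂ) * r₁ s * r₂ s) * phase_mul_conj p s

/-! ### Stability of the solution under a change of the point `(x, t)` -/

/-- A family of solutions of the Riemann-Hilbert problem together with the `L^{2,3}` bound. -/
structure RHFlow (σ : ℝ) (r₁ r₂ : ℝ → ℂ) (M : ℝ × ℝ → ℂ → Mat2) (Mp Mm : ℝ × ℝ → ℝ → Mat2) :
    Prop where
  data : ∀ p, RHData (jumpAt σ r₁ r₂ p) (Mp p) (Mm p) (M p)
  sq : σ ^ 2 = 1
  l2 : Integrable fun s => ((1 + |s|) ^ 3 * (‖r₁ s‖ + ‖r₂ s‖)) ^ 2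

namespace RHFlow

variable {σ : ℝ} {r₁ r₂ : ℝ → ℂ} {M : ℝ × ℝ → ℂ → Mat2} {Mp Mm : ℝ × ℝ → ℝ → Mat2}

theorem abs_sigma (h : RHFlow σ r₁ r₂ M Mp Mm) : |σ| = 1 := by
  have := h.sq
  rw [← sq_abs] at this
  nlinarith [abs_nonneg σ]

theorem norm_sigma (h : RHFlow σ r₁ r₂ M Mp Mm) : ‖(σ : ℂ)‖ = 1 := by
  rw [norm_real, Real.norm_eq_abs, h.abs_sigma]

theorem phase_zero (s : ℝ) : phase 0 s = 1 := by simp [phase, theta]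

theorem continuous_r₁ (h : RHFlow σ r₁ r₂ M Mp Mm) : Continuous r₁ := by
  have := (h.data 0).continuous_V.matrix_elem 1 0
  simpa [jumpAt_eq, phase_zero] using this

theorem continuous_r₂ (h : RHFlow σ r₁ r₂ M Mp Mm) : Continuous r₂ := by
  have : Continuous fun s => (σ : ℂ) * (jumpAt σ r₁ r₂ 0 s 0 1) :=
    continuous_const.mul ((h.data 0).continuous_V.matrix_elem 0 1)
  have e : ∀ s, (σ : ℂ) * (jumpAt σ r₁ r₂ 0 s 0 1) = r₂ s := by
    intro s
    have h2 : (σ : ℂ) * σ = 1 := by have := h.sq; rw [pow_two] at this; exact_mod_cast this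
    simp only [jumpAt_eq, phase_zero, Matrix.of_apply, Matrix.cons_val_zero, Matrix.cons_val_one,
      Matrix.cons_val', Matrix.cons_val_fin_one, mul_one]
    rw [← mul_assoc, h2, one_mul]
  simpa only [e] using this

theorem continuous_rho (h : RHFlow σ r₁ r₂ M Mp Mm) : Continuous fun s => ‖r₁ s‖ + ‖r₂ s‖ :=
  h.continuous_r₁.norm.add h.continuous_r₂.norm

theorem rho_bound (h : RHFlow σ r₁ r₂ M Mp Mm) :
    ∃ C : ℝ, 0 ≤ C ∧ ∀ s, (‖r₁ s‖ + ‖r₂ s‖) * (1 + |s|) ≤ C := by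
  obtain ⟨C, hC⟩ := (h.data 0).V_sub_one_bound
  have hn : ∀ s, (‖r₁ s‖ + ‖r₂ s‖) * (1 + |s|) ≤ C := fun s => by
    refine le_trans ?_ (hC s)
    gcongr
    rw [jumpAt_eq, phase_zero]
    simp [nrm, h.abs_sigma]
    linarith [mul_nonneg (norm_nonneg (r₁ s)) (norm_nonneg (r₂ s))]
  exact ⟨C, le_trans (by positivity) (hn 0), hn⟩

theorem nrm_jump_sub (h : RHFlow σ r₁ r₂ M Mp Mm) (p q : ℝ × ℝ) (s : ℝ) :
    nrm (jumpAt σ r₁ r₂ p s - jumpAt σ r₁ r₂ q s) = (‖r₁ s‖ + ‖r₂ s‖) * ‖phase p s - phase q s‖ := by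
  have e : ‖(starRingEnd ℂ) (phase p s) - (starRingEnd ℂ) (phase q s)‖ = ‖phase p s - phase q s‖ := by
    rw [← map_sub, RCLike.norm_conj]
  simp [jumpAt_eq, nrm, ← mul_sub, h.abs_sigma, e]
  ring

/-- A constant bounding the reflection coefficients and the jump matrices. -/
theorem exists_jump_bound (h : RHFlow σ r₁ r₂ M Mp Mm) : ∃ v : ℝ, 1 ≤ v ∧
    (∀ s, (‖r₁ s‖ + ‖r₂ s‖) * (1 + |s|) ≤ v) ∧ (∀ p s, nrm (jumpAt σ r₁ r₂ p s) ≤ v) ∧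
    ∀ p s, nrm (jumpAt σ r₁ r₂ p s - 1) ≤ v * (‖r₁ s‖ + ‖r₂ s‖) := by
  obtain ⟨C, hC0, hC⟩ := h.rho_bound
  have h1 : ∀ s, ‖r₁ s‖ + ‖r₂ s‖ ≤ C := fun s => by
    have := hC s
    nlinarith [mul_nonneg (add_nonneg (norm_nonneg (r₁ s)) (norm_nonneg (r₂ s))) (abs_nonneg s)]
  have h2 : ∀ p s, nrm (jumpAt σ r₁ r₂ p s - 1) ≤ (1 + C) * (‖r₁ s‖ + ‖r₂ s‖) := by
    intro p s
    simp [jumpAt_eq, nrm, h.abs_sigma, norm_phase]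
    nlinarith [h1 s, norm_nonneg (r₁ s), norm_nonneg (r₂ s)]
  refine ⟨2 + (1 + C) * C, by nlinarith, fun s => (hC s).trans (by nlinarith), fun p s => ?_,
    fun p s => (h2 p s).trans ?_⟩
  · have := nrm_add_le (jumpAt σ r₁ r₂ p s - 1) 1
    rw [sub_add_cancel, nrm_one] at this
    have := h2 p s
    nlinarith [h1 s]
  · have : 0 ≤ ‖r₁ s‖ + ‖r₂ s‖ := by positivity
    nlinarith [mul_nonneg hC0 hC0]

/-- The weight `(1 + |s|)³` in `L²` against `(1 + |s|)⁻¹`: one power is spent on integrability, so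
that moments up to order two converge absolutely. -/
theorem integrable_weight (h : RHFlow σ r₁ r₂ M Mp Mm) :
    Integrable fun s => (1 + |s|) ^ 2 * (‖r₁ s‖ + ‖r₂ s‖) := by
  have hc := h.continuous_rho
  refine (h.l2.add integrable_inv_one_add_abs_sq).mono'
    (Continuous.aestronglyMeasurable (by fun_prop)) (ae_of_all _ fun s => ?_)
  have h0 : 0 < 1 + |s| := by positivity
  rw [Real.norm_of_nonneg (by positivity)]
  simp only [Pi.add_apply]
  set a := (1 + |s|) ^ 3 * (‖r₁ s‖ + ‖r₂ s‖) with ha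
  have e : (1 + |s|) ^ 2 * (‖r₁ s‖ + ‖r₂ s‖) = a * (1 + |s|)⁻¹ := by rw [ha]; field_simp
  rw [e, ← inv_pow]
  nlinarith [sq_nonneg (a - (1 + |s|)⁻¹), sq_nonneg (a + (1 + |s|)⁻¹)]

theorem integrable_rho_sq (h : RHFlow σ r₁ r₂ M Mp Mm) :
    Integrable fun s => (‖r₁ s‖ + ‖r₂ s‖) ^ 2 := by
  have hc := h.continuous_rho
  refine h.l2.mono' (Continuous.aestronglyMeasurable (by fun_prop)) (ae_of_all _ fun s => ?_)
  rw [Real.norm_of_nonneg (by positivity), mul_pow]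
  have : 1 ≤ ((1 + |s|) ^ 3) ^ 2 := one_le_pow₀ (one_le_pow₀ (by linarith [abs_nonneg s]))
  nlinarith [sq_nonneg (‖r₁ s‖ + ‖r₂ s‖)]

/-- The `L²` distance of two jump matrices. -/
noncomputable def jumpDist (r₁ r₂ : ℝ → ℂ) (p q : ℝ × ℝ) : ℝ :=
  ∫ s, ((‖r₁ s‖ + ‖r₂ s‖) * ‖phase p s - phase q s‖) ^ 2

theorem integrable_jumpDist (h : RHFlow σ r₁ r₂ M Mp Mm) (p q : ℝ × ℝ) :
    Integrable fun s => ((‖r₁ s‖ + ‖r₂ s‖) * ‖phase p s - phase q s‖) ^ 2 := by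
  have hc := h.continuous_rho
  have h1 := continuous_phase' p
  have h2 := continuous_phase' q
  refine (h.integrable_rho_sq.const_mul 4).mono' (Continuous.aestronglyMeasurable (by fun_prop))
    (ae_of_all _ fun s => ?_)
  rw [Real.norm_of_nonneg (by positivity), mul_pow, mul_comm]
  gcongr
  have := norm_phase_sub_le_two p q s
  nlinarith [norm_nonneg (phase p s - phase q s)]

theorem jumpDist_nonneg (r₁ r₂ : ℝ → ℂ) (p q : ℝ × ℝ) : 0 ≤ jumpDist r₁ r₂ p q :=
  integral_nonneg fun s => by positivity

theorem tendsto_jumpDist (h : RHFlow σ r₁ r₂ M Mp Mm) (q : ℝ × ℝ) :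
    Tendsto (fun p => jumpDist r₁ r₂ p q) (𝓝 q) (𝓝 0) := by
  have hc := h.continuous_rho
  have e : (0 : ℝ) = ∫ s : ℝ, (0 : ℝ) := by simp
  rw [e]
  refine tendsto_integral_filter_of_dominated_convergence
    (fun s => 4 * (‖r₁ s‖ + ‖r₂ s‖) ^ 2) (Eventually.of_forall fun p =>
      (h.integrable_jumpDist p q).aestronglyMeasurable)
    (Eventually.of_forall fun p => ae_of_all _ fun s => ?_) (h.integrable_rho_sq.const_mul 4)
    (ae_of_all _ fun s => ?_)
  · rw [Real.norm_of_nonneg (by positivity), mul_pow, mul_comm]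
    gcongr
    have := norm_phase_sub_le_two p q s
    nlinarith [norm_nonneg (phase p s - phase q s)]
  · have h1 : Continuous fun p => ((‖r₁ s‖ + ‖r₂ s‖) * ‖phase p s - phase q s‖) ^ 2 := by
      have := continuous_phase s
      fun_prop
    simpa using h1.tendsto q

/-- The phases at nearby points are not uniformly close for large `|s|`. Beyond `R = 2 v / ε` the
decay of the reflection coefficients suffices, as the phases differ by at most `2`; below `R` the
difference of the phases is bounded by that of `θ`, which is small. -/
theorem eventually_small (h : RHFlow σ r₁ r₂ M Mp Mm) (q : ℝ × ℝ) {ε : ℝ} (hε : 0 < ε) :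
    ∀ᶠ p in 𝓝 q, ∀ s, (‖r₁ s‖ + ‖r₂ s‖) * ‖phase p s - phase q s‖ ≤ ε := by
  obtain ⟨v, hv1, hv, -, -⟩ := h.exists_jump_bound
  set R := 2 * v / ε with hR
  have hRpos : 0 < R := by positivity
  have ht : Tendsto (fun p : ℝ × ℝ => v * (2 * (R * |p.1 - q.1| + 4 * R ^ 3 * |p.2 - q.2|))) (𝓝 q)
      (𝓝 0) := by
    have : Continuous fun p : ℝ × ℝ => v * (2 * (R * |p.1 - q.1| + 4 * R ^ 3 * |p.2 - q.2|)) := by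
      fun_prop
    simpa using this.tendsto q
  filter_upwards [ht.eventually_le_const hε] with p hp s
  have hρ : 0 ≤ ‖r₁ s‖ + ‖r₂ s‖ := by positivity
  rcases le_or_gt R |s| with hs | hs
  · have h1 := hv s
    have h2 := norm_phase_sub_le_two p q s
    have h3 : (‖r₁ s‖ + ‖r₂ s‖) * R ≤ v := by nlinarith
    have h4 : (‖r₁ s‖ + ‖r₂ s‖) * (2 * v) ≤ v * ε := by
      rw [hR, ← mul_div_assoc, div_le_iff₀ hε] at h3; exact h3
    have h5 : (‖r₁ s‖ + ‖r₂ s‖) * 2 ≤ ε := by nlinarith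
    exact (mul_le_mul_of_nonneg_left h2 hρ).trans h5
  · have h1 : ‖r₁ s‖ + ‖r₂ s‖ ≤ v := by nlinarith [hv s, abs_nonneg s]
    refine le_trans (mul_le_mul h1 ((norm_phase_sub_le p q s).trans ?_) (norm_nonneg _)
      (by linarith)) hp
    have e : theta p.1 p.2 s - theta q.1 q.2 s = s * (p.1 - q.1) + 4 * s ^ 3 * (p.2 - q.2) := by
      simp only [theta]; ring
    rw [e]
    have h2 : |s| ^ 3 ≤ R ^ 3 := by gcongr
    have h3 := abs_add_le (s * (p.1 - q.1)) (4 * s ^ 3 * (p.2 - q.2))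
    rw [abs_mul, abs_mul, abs_mul, abs_pow, abs_of_pos (by norm_num : (0:ℝ) < 4)] at h3
    have h4 : |s| * |p.1 - q.1| ≤ R * |p.1 - q.1| := by gcongr
    have h5 : 4 * |s| ^ 3 * |p.2 - q.2| ≤ 4 * R ^ 3 * |p.2 - q.2| := by gcongr
    linarith

/-- The boundary value of the quotient of two solutions, minus the identity. -/
noncomputable def relDiff (Mm : ℝ × ℝ → ℝ → Mat2) (p q : ℝ × ℝ) (s : ℝ) : Mat2 :=
  Mm p s * (Mm q s).adjugate - 1

theorem lo_eq (h : RHFlow σ r₁ r₂ M Mp Mm) (p q : ℝ × ℝ) (s : ℝ) :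
    Mm p s = (1 + relDiff Mm p q s) * Mm q s := by
  rw [relDiff, add_sub_cancel, mul_assoc, adj_mul ((h.data q).det_lo s), mul_one]

theorem continuous_relDiff (h : RHFlow σ r₁ r₂ M Mp Mm) (p q : ℝ × ℝ) :
    Continuous (relDiff Mm p q) :=
  (((h.data p).cut.continuous_lo).mul (h.data q).cut.continuous_lo.matrix_adjugate).sub
    continuous_const

theorem nrm_relJump_le (h : RHFlow σ r₁ r₂ M Mp Mm) (q : ℝ × ℝ) : ∃ K : ℝ, 1 ≤ K ∧ ∀ p s,
    nrm (relJump (jumpAt σ r₁ r₂ p) (jumpAt σ r₁ r₂ q) (Mm q) s)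
      ≤ K * ((‖r₁ s‖ + ‖r₂ s‖) * ‖phase p s - phase q s‖) := by
  obtain ⟨v, hv1, -, hv, -⟩ := h.exists_jump_bound
  obtain ⟨m, hm1, -, -, hm⟩ := (h.data q).bounded
  refine ⟨m * (v * m), by nlinarith [mul_nonneg (sub_nonneg.2 hv1) (sub_nonneg.2 hm1)], fun p s => ?_⟩
  rw [relJump]
  have h1 := nrm_mul_le (Mm q s * (jumpAt σ r₁ r₂ p s - jumpAt σ r₁ r₂ q s))
    ((jumpAt σ r₁ r₂ q s).adjugate * (Mm q s).adjugate)
  have h2 := nrm_mul_le (Mm q s) (jumpAt σ r₁ r₂ p s - jumpAt σ r₁ r₂ q s)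
  have h3 := nrm_mul_le (jumpAt σ r₁ r₂ q s).adjugate (Mm q s).adjugate
  rw [nrm_adjugate, nrm_adjugate] at h3
  rw [h.nrm_jump_sub] at h2
  have hd : 0 ≤ (‖r₁ s‖ + ‖r₂ s‖) * ‖phase p s - phase q s‖ := by positivity
  calc _ ≤ _ := h1
    _ ≤ (nrm (Mm q s) * ((‖r₁ s‖ + ‖r₂ s‖) * ‖phase p s - phase q s‖))
        * (nrm (jumpAt σ r₁ r₂ q s) * nrm (Mm q s)) :=
        mul_le_mul h2 h3 (nrm_nonneg _) (mul_nonneg (nrm_nonneg _) hd)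
    _ ≤ (m * ((‖r₁ s‖ + ‖r₂ s‖) * ‖phase p s - phase q s‖)) * (v * m) := by
        have := nrm_nonneg (Mm q s)
        have := nrm_nonneg (jumpAt σ r₁ r₂ q s)
        gcongr
        · exact hm s
        · exact hv q s
        · exact hm s
    _ = _ := by ring

theorem integrable_relJump_sq (h : RHFlow σ r₁ r₂ M Mp Mm) (p q : ℝ × ℝ) :
    Integrable fun s => nrm (relJump (jumpAt σ r₁ r₂ p) (jumpAt σ r₁ r₂ q) (Mm q) s) ^ 2 := by
  obtain ⟨K, -, hK⟩ := h.nrm_relJump_le q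
  refine ((h.integrable_jumpDist p q).const_mul (K ^ 2)).mono'
    ((((h.data p).continuous_relJump (h.data q)).nrm.pow 2).aestronglyMeasurable)
    (ae_of_all _ fun s => ?_)
  rw [Real.norm_of_nonneg (by positivity), ← mul_pow]
  exact pow_le_pow_left₀ (nrm_nonneg _) (hK p s) 2

/-- Local `L²` stability of the boundary values. -/
theorem eventually_relDiff (h : RHFlow σ r₁ r₂ M Mp Mm) (q : ℝ × ℝ) : ∃ K : ℝ, 0 ≤ K ∧ ∀ᶠ p in 𝓝 q,
    Integrable (fun s => nrm (relDiff Mm p q s) ^ 2) ∧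
    ∫ s, nrm (relDiff Mm p q s) ^ 2 ≤ K * jumpDist r₁ r₂ p q ∧
    ∫ s, nrm (relJump (jumpAt σ r₁ r₂ p) (jumpAt σ r₁ r₂ q) (Mm q) s) ^ 2
      ≤ K * jumpDist r₁ r₂ p q := by
  obtain ⟨K, hK1, hK⟩ := h.nrm_relJump_le q
  have hK0 : 0 < K := by linarith
  -- The `16` is the constant of `RHData.small_norm`. The threshold `1 / (4 K)` below brings the
  -- relative jump under `1 / 4`.
  refine ⟨16 * K ^ 2, by positivity, ?_⟩
  filter_upwards [h.eventually_small q (show 0 < 1 / (4 * K) by positivity)] with p hp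
  have hi := h.integrable_relJump_sq p q
  have h2 : ∫ s, nrm (relJump (jumpAt σ r₁ r₂ p) (jumpAt σ r₁ r₂ q) (Mm q) s) ^ 2
      ≤ K ^ 2 * jumpDist r₁ r₂ p q := by
    rw [jumpDist, ← integral_const_mul]
    refine integral_mono hi ((h.integrable_jumpDist p q).const_mul _) fun s => ?_
    simp only []
    rw [← mul_pow]
    exact pow_le_pow_left₀ (nrm_nonneg _) (hK p s) 2
  have h3 := (h.data p).small_norm (h.data q) (fun s => (hK p s).trans (by
    have := mul_le_mul_of_nonneg_left (hp s) hK0.le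
    refine this.trans (le_of_eq ?_)
    field_simp)) hi
  have h0 := jumpDist_nonneg r₁ r₂ p q
  refine ⟨h3.1, h3.2.trans (by linarith), h2.trans ?_⟩
  nlinarith [mul_nonneg (sq_nonneg K) h0]

end RHFlow

/-! ### Cauchy integrals and moments of matrix densities -/

/-- The Cauchy integral of `s ^ k F`. -/
noncomputable def matC (k : ℕ) (F : ℝ → Mat2) (z : ℂ) : Mat2 :=
  Matrix.of fun i j => cauchyInt (fun s => (s : ℂ) ^ k * F s i j) z

/-- The moment `(2 π i)⁻¹ ∫ s ^ k F`. -/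
noncomputable def mom (k : ℕ) (F : ℝ → Mat2) : Mat2 :=
  Matrix.of fun i j => (2 * Real.pi * I)⁻¹ * ∫ s : ℝ, (s : ℂ) ^ k * F s i j

theorem integrable_div_ofReal_sub {f : ℝ → ℂ} (hf : Integrable f) {z : ℂ} (hz : z.im ≠ 0) :
    Integrable fun s : ℝ => f s / ((s : ℂ) - z) := by
  have h3 : 0 < |z.im| := abs_pos.2 hz
  have hc : Continuous fun s : ℝ => ((s : ℂ) - z)⁻¹ :=
    Continuous.inv₀ (by fun_prop) (ofReal_sub_ne_zero hz)
  simp_rw [div_eq_mul_inv]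
  refine hf.mul_bdd (c := |z.im|⁻¹) hc.aestronglyMeasurable (ae_of_all _ fun s => ?_)
  rw [norm_inv]
  gcongr
  exact abs_im_le_norm_ofReal_sub s z

/-- From `s / (s - z) = 1 + z / (s - z)`. Each multiplication by `z` splits off one moment, and
iteration produces the expansion at infinity with an explicit remainder. -/
theorem cauchyInt_mul {f : ℝ → ℂ} (hf : Integrable f) {z : ℂ} (hz : z.im ≠ 0) :
    z * cauchyInt f z = cauchyInt (fun s => (s : ℂ) * f s) z - (2 * Real.pi * I)⁻¹ * ∫ s, f s := by
  have hi := integrable_div_ofReal_sub hf hz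
  have e : (fun s : ℝ => (s : ℂ) * f s / ((s : ℂ) - z))
      = fun s : ℝ => f s + z * (f s / ((s : ℂ) - z)) := by
    ext s
    have := ofReal_sub_ne_zero hz s
    field_simp
    ring
  rw [cauchyInt, cauchyInt, e, integral_add hf (hi.const_mul z), integral_const_mul]
  ring

/-- Along the imaginary axis. -/
theorem norm_ofReal_sub_I_mul_ge {y : ℝ} (hy : 1 ≤ y) (s : ℝ) :
    (1 + |s|) / 2 ≤ ‖(s : ℂ) - I * y‖ := by
  have h1 : |s| ≤ ‖(s : ℂ) - I * y‖ := by
    have := abs_re_le_norm ((s : ℂ) - I * y)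
    simpa using this
  have h2 : |y| ≤ ‖(s : ℂ) - I * y‖ := by
    have := abs_im_le_norm ((s : ℂ) - I * y)
    simpa using this
  have := le_abs_self y
  linarith

/-- Integrability of `g` is not required: for `y ≥ 1` the distance `|s - i y|` dominates `(1 + |s|)
/ 2`. The case of interest is the reflection coefficients with weight `(1 + |s|)³`, one power more
than is absolutely integrable. -/
theorem tendsto_weighted_integral {g : ℝ → ℝ} (hg : Integrable fun s => g s / (1 + |s|))
    (hm : AEStronglyMeasurable g) :
    Tendsto (fun y : ℝ => ∫ s : ℝ, |g s| / ‖(s : ℂ) - I * y‖) atTop (𝓝 0) := by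
  have e : (0 : ℝ) = ∫ s : ℝ, (0 : ℝ) := by simp
  rw [e]
  refine tendsto_integral_filter_of_dominated_convergence (fun s => 2 * ‖g s / (1 + |s|)‖) ?_ ?_
    (hg.norm.const_mul 2) ?_
  · refine Eventually.of_forall fun y => ?_
    simp_rw [div_eq_mul_inv]
    refine AEStronglyMeasurable.mul hm.norm ?_
    have : Continuous fun s : ℝ => ‖(s : ℂ) - I * y‖ := by fun_prop
    exact (this.measurable.inv).aestronglyMeasurable
  · filter_upwards [eventually_ge_atTop 1] with y hy
    refine ae_of_all _ fun s => ?_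
    have h1 := norm_ofReal_sub_I_mul_ge hy s
    have h2 : 0 < 1 + |s| := by positivity
    rw [norm_div, Real.norm_of_nonneg (abs_nonneg _), norm_norm, norm_div, Real.norm_eq_abs,
      Real.norm_of_nonneg h2.le, ← mul_div_assoc, div_le_div_iff₀ (by linarith) h2]
    nlinarith [abs_nonneg (g s)]
  · refine ae_of_all _ fun s => ?_
    have h1 : Tendsto (fun y : ℝ => |g s| / y) atTop (𝓝 0) := tendsto_const_nhds.div_atTop tendsto_id
    refine squeeze_zero' (Eventually.of_forall fun y => by positivity) ?_ h1
    filter_upwards [eventually_ge_atTop 1] with y hy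
    have h2 : |y| ≤ ‖(s : ℂ) - I * y‖ := by
      have := abs_im_le_norm ((s : ℂ) - I * y)
      simpa using this
    have := (le_abs_self y).trans h2
    gcongr

theorem norm_cauchyInt_le_integral {f : ℝ → ℂ} {g : ℝ → ℝ} {z : ℂ} (hfg : ∀ s, ‖f s‖ ≤ |g s|)
    (hi : Integrable fun s : ℝ => |g s| / ‖(s : ℂ) - z‖) :
    ‖cauchyInt f z‖ ≤ ∫ s : ℝ, |g s| / ‖(s : ℂ) - z‖ := by
  rw [cauchyInt, norm_mul]
  have : ‖∫ s : ℝ, f s / ((s : ℂ) - z)‖ ≤ ∫ s : ℝ, |g s| / ‖(s : ℂ) - z‖ := by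
    refine norm_integral_le_of_norm_le hi (ae_of_all _ fun s => ?_)
    rw [norm_div]
    gcongr
    exact hfg s
  calc _ ≤ 1 * ‖∫ s : ℝ, f s / ((s : ℂ) - z)‖ := by gcongr; exact norm_two_pi_I_inv_le
    _ ≤ _ := by rwa [one_mul]

theorem integrable_weighted_div {g : ℝ → ℝ} (hg : Integrable fun s => g s / (1 + |s|))
    (hm : AEStronglyMeasurable g) {z : ℂ} (hz : z.im ≠ 0) :
    Integrable fun s : ℝ => |g s| / ‖(s : ℂ) - z‖ := by
  refine (hg.norm.const_mul (1 + (1 + ‖z‖) / |z.im|)).mono' ?_ (ae_of_all _ fun s => ?_)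
  · simp_rw [div_eq_mul_inv]
    refine AEStronglyMeasurable.mul hm.norm ?_
    have : Continuous fun s : ℝ => ‖(s : ℂ) - z‖ := by fun_prop
    exact (this.measurable.inv).aestronglyMeasurable
  · have h2 : 0 < 1 + |s| := by positivity
    have := norm_inv_ofReal_sub_le hz s
    rw [norm_div, Real.norm_of_nonneg (abs_nonneg _), norm_norm, norm_div, Real.norm_eq_abs,
      Real.norm_of_nonneg h2.le, div_eq_mul_inv, div_eq_mul_inv]
    calc _ ≤ |g s| * ((1 + (1 + ‖z‖) / |z.im|) * (1 + |s|)⁻¹) := by gcongr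
      _ = _ := by ring

theorem one_add_abs_pow_ge {k l : ℕ} (hkl : k ≤ l) (s : ℝ) : |s| ^ k ≤ (1 + |s|) ^ l :=
  (pow_le_pow_left₀ (abs_nonneg s) (by linarith) k).trans
    (pow_le_pow_right₀ (by linarith [abs_nonneg s]) hkl)

/-- Densities bounded by the reflection coefficients. -/
structure RhoBdd (r₁ r₂ : ℝ → ℂ) (c : ℝ) (F : ℝ → Mat2) : Prop where
  cont : Continuous F
  bound : ∀ s, nrm (F s) ≤ c * (‖r₁ s‖ + ‖r₂ s‖)

namespace RHFlow

variable {σ : ℝ} {r₁ r₂ : ℝ → ℂ} {M : ℝ × ℝ → ℂ → Mat2} {Mp Mm : ℝ × ℝ → ℝ → Mat2}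

theorem integrable_weight_div (h : RHFlow σ r₁ r₂ M Mp Mm) (c : ℝ) :
    Integrable fun s => c * ((1 + |s|) ^ 3 * (‖r₁ s‖ + ‖r₂ s‖)) / (1 + |s|) := by
  refine (h.integrable_weight.const_mul c).congr (ae_of_all _ fun s => ?_)
  have : 0 < 1 + |s| := by positivity
  simp only []
  field_simp

theorem continuous_weight (h : RHFlow σ r₁ r₂ M Mp Mm) (c : ℝ) :
    Continuous fun s => c * ((1 + |s|) ^ 3 * (‖r₁ s‖ + ‖r₂ s‖)) := by
  have := h.continuous_rho
  fun_prop

theorem integrable_of_rhoBdd (h : RHFlow σ r₁ r₂ M Mp Mm) {c : ℝ} {F : ℝ → Mat2}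
    (hF : RhoBdd r₁ r₂ c F) {κ : ℝ → ℂ} (hκ : Continuous κ) {b : ℝ}
    (hb : ∀ s, ‖κ s‖ ≤ b * (1 + |s|) ^ 2) (i j : Fin 2) : Integrable fun s => κ s * F s i j := by
  refine (h.integrable_weight.const_mul (b * c)).mono'
    (hκ.mul (hF.cont.matrix_elem i j)).aestronglyMeasurable (ae_of_all _ fun s => ?_)
  rw [norm_mul]
  calc _ ≤ (b * (1 + |s|) ^ 2) * (c * (‖r₁ s‖ + ‖r₂ s‖)) :=
        mul_le_mul (hb s) ((norm_entry_le _ _ _).trans (hF.bound s)) (norm_nonneg _)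
          ((norm_nonneg _).trans (hb s))
    _ = _ := by ring

theorem integrable_pow_mul (h : RHFlow σ r₁ r₂ M Mp Mm) {c : ℝ} {F : ℝ → Mat2}
    (hF : RhoBdd r₁ r₂ c F) {k : ℕ} (hk : k ≤ 2) (i j : Fin 2) :
    Integrable fun s : ℝ => (s : ℂ) ^ k * F s i j := by
  refine h.integrable_of_rhoBdd hF (by fun_prop) (b := 1) (fun s => ?_) i j
  rw [norm_pow, norm_real, Real.norm_eq_abs, one_mul]
  exact one_add_abs_pow_ge hk s

theorem matC_succ (h : RHFlow σ r₁ r₂ M Mp Mm) {c : ℝ} {F : ℝ → Mat2}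
    (hF : RhoBdd r₁ r₂ c F) {k : ℕ} (hk : k ≤ 2) {z : ℂ} (hz : z.im ≠ 0) :
    z • matC k F z = matC (k + 1) F z - mom k F := by
  ext i j
  simp only [matC, mom, Matrix.smul_apply, Matrix.sub_apply, Matrix.of_apply, smul_eq_mul]
  rw [cauchyInt_mul (h.integrable_pow_mul hF hk i j) hz]
  simp_rw [pow_succ', mul_assoc]

theorem norm_pow_mul_le {c : ℝ} {F : ℝ → Mat2}
    (hF : RhoBdd r₁ r₂ c F) {k : ℕ} (hk : k ≤ 3) (i j : Fin 2) (s : ℝ) :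
    ‖(s : ℂ) ^ k * F s i j‖ ≤ |c * ((1 + |s|) ^ 3 * (‖r₁ s‖ + ‖r₂ s‖))| := by
  rw [norm_mul, norm_pow, norm_real, Real.norm_eq_abs]
  refine le_trans ?_ (le_abs_self _)
  calc _ ≤ (1 + |s|) ^ 3 * (c * (‖r₁ s‖ + ‖r₂ s‖)) := by
        gcongr
        · exact one_add_abs_pow_ge hk s
        · exact (norm_entry_le _ _ _).trans (hF.bound s)
    _ = _ := by ring

theorem norm_matC_le (h : RHFlow σ r₁ r₂ M Mp Mm) {c : ℝ} {F : ℝ → Mat2}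
    (hF : RhoBdd r₁ r₂ c F) {k : ℕ} (hk : k ≤ 3) (i j : Fin 2) {z : ℂ} (hz : z.im ≠ 0) :
    ‖matC k F z i j‖ ≤ ∫ s : ℝ, |c * ((1 + |s|) ^ 3 * (‖r₁ s‖ + ‖r₂ s‖))| / ‖(s : ℂ) - z‖ :=
  norm_cauchyInt_le_integral (norm_pow_mul_le hF hk i j)
    (integrable_weighted_div (h.integrable_weight_div c)
      (h.continuous_weight c).aestronglyMeasurable hz)

theorem tendsto_matC (h : RHFlow σ r₁ r₂ M Mp Mm) {c : ℝ} {F : ℝ → Mat2}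
    (hF : RhoBdd r₁ r₂ c F) {k : ℕ} (hk : k ≤ 3) :
    Tendsto (fun y : ℝ => matC k F (I * y)) atTop (𝓝 0) := by
  refine tendsto_pi_nhds.2 fun i => tendsto_pi_nhds.2 fun j => ?_
  refine squeeze_zero_norm' ?_ (tendsto_weighted_integral (h.integrable_weight_div c)
    (h.continuous_weight c).aestronglyMeasurable)
  filter_upwards [eventually_gt_atTop 0] with y hy
  exact h.norm_matC_le hF hk i j (by simpa using hy.ne')

/-- The density `M₊ - M₋`. -/
noncomputable def dens (Mp Mm : ℝ × ℝ → ℝ → Mat2) (p : ℝ × ℝ) (s : ℝ) : Mat2 := Mp p s - Mm p s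

theorem dens_eq (h : RHFlow σ r₁ r₂ M Mp Mm) (p : ℝ × ℝ) (s : ℝ) :
    dens Mp Mm p s = Mm p s * (jumpAt σ r₁ r₂ p s - 1) := by
  rw [dens, (h.data p).jump, mul_sub, mul_one]

theorem rhoBdd_lo_mul (h : RHFlow σ r₁ r₂ M Mp Mm) (q : ℝ × ℝ) : ∃ c : ℝ, 0 ≤ c ∧ ∀ p,
    RhoBdd r₁ r₂ c fun s => Mm q s * (jumpAt σ r₁ r₂ p s - 1) := by
  obtain ⟨v, hv1, -, -, hv⟩ := h.exists_jump_bound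
  obtain ⟨m, hm1, -, -, hm⟩ := (h.data q).bounded
  refine ⟨m * v, by nlinarith, fun p => ⟨(h.data q).cut.continuous_lo.mul
    ((h.data p).continuous_V.sub continuous_const), fun s => (nrm_mul_le _ _).trans ?_⟩⟩
  rw [mul_assoc]
  exact mul_le_mul (hm s) (hv p s) (nrm_nonneg _) (by linarith)

theorem rhoBdd_dens (h : RHFlow σ r₁ r₂ M Mp Mm) (p : ℝ × ℝ) : ∃ c : ℝ, 0 ≤ c ∧
    RhoBdd r₁ r₂ c (dens Mp Mm p) := by
  obtain ⟨c, hc0, hc⟩ := h.rhoBdd_lo_mul p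
  have e : dens Mp Mm p = fun s => Mm p s * (jumpAt σ r₁ r₂ p s - 1) := funext (h.dens_eq p)
  exact ⟨c, hc0, e ▸ hc p⟩

theorem eq_one_add_matC (h : RHFlow σ r₁ r₂ M Mp Mm) (p : ℝ × ℝ) {z : ℂ} (hz : z.im ≠ 0) :
    M p z = 1 + matC 0 (dens Mp Mm p) z := by
  rw [← sub_eq_iff_eq_add']
  ext i j
  have := ((h.data p).cut.sub (MatCut.const 1)).cauchy (h.data p).decays hz i j
  rw [this]
  simp [matC, dens]

/-- In the first term the solution is frozen at `q` and `p` enters only through the explicit jump,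
so dominated convergence applies. The second term has a factor which is small in `L²`. -/
theorem dens_split (h : RHFlow σ r₁ r₂ M Mp Mm) (p q : ℝ × ℝ) (s : ℝ) :
    dens Mp Mm p s = Mm q s * (jumpAt σ r₁ r₂ p s - 1)
      + relDiff Mm p q s * (Mm q s * (jumpAt σ r₁ r₂ p s - 1)) := by
  rw [h.dens_eq, h.lo_eq p q s]; noncomm_ring

/-- Bound of a weighted integral of the `L²`-small part of the density. -/
theorem integral_relDiff_le (h : RHFlow σ r₁ r₂ M Mp Mm) {p q : ℝ × ℝ} {c η : ℝ} (hη : 0 < η)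
    {F : ℝ → Mat2} (hF : RhoBdd r₁ r₂ c F)
    (hi : Integrable (fun s => nrm (relDiff Mm p q s) ^ 2)) {w : ℝ → ℝ} (hw : Continuous w)
    (hw0 : ∀ s, 0 ≤ w s) (hw3 : ∀ s, w s ≤ (1 + |s|) ^ 3) :
    Integrable (fun s => w s * nrm (relDiff Mm p q s * F s)) ∧
    ∫ s, w s * nrm (relDiff Mm p q s * F s) ≤ η * (∫ s, ((1 + |s|) ^ 3 * (‖r₁ s‖ + ‖r₂ s‖)) ^ 2)
      + c ^ 2 / η * ∫ s, nrm (relDiff Mm p q s) ^ 2 := by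
  have hb : ∀ s, w s * nrm (relDiff Mm p q s * F s)
      ≤ η * ((1 + |s|) ^ 3 * (‖r₁ s‖ + ‖r₂ s‖)) ^ 2 + c ^ 2 / η * nrm (relDiff Mm p q s) ^ 2 := by
    intro s
    set a := (1 + |s|) ^ 3 * (‖r₁ s‖ + ‖r₂ s‖)
    set b := nrm (relDiff Mm p q s)
    have h1 : nrm (relDiff Mm p q s * F s) ≤ b * (c * (‖r₁ s‖ + ‖r₂ s‖)) :=
      (nrm_mul_le _ _).trans (mul_le_mul_of_nonneg_left (hF.bound s) (nrm_nonneg _))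
    have h2 : w s * nrm (relDiff Mm p q s * F s) ≤ (1 + |s|) ^ 3 * (b * (c * (‖r₁ s‖ + ‖r₂ s‖))) :=
      mul_le_mul (hw3 s) h1 (nrm_nonneg _) (by positivity)
    have h3 : (1 + |s|) ^ 3 * (b * (c * (‖r₁ s‖ + ‖r₂ s‖))) = a * (c * b) := by ring
    have h4 : a * (c * b) ≤ η * a ^ 2 + c ^ 2 / η * b ^ 2 := by
      have e : η * a ^ 2 + c ^ 2 / η * b ^ 2 - a * (c * b)
          = ((η * a - c * b / 2) ^ 2 + 3 / 4 * (c * b) ^ 2) / η := by field_simp; ring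
      have : 0 ≤ ((η * a - c * b / 2) ^ 2 + 3 / 4 * (c * b) ^ 2) / η := by positivity
      linarith
    linarith
  have hib : Integrable fun s => η * ((1 + |s|) ^ 3 * (‖r₁ s‖ + ‖r₂ s‖)) ^ 2
      + c ^ 2 / η * nrm (relDiff Mm p q s) ^ 2 := (h.l2.const_mul η).add (hi.const_mul _)
  have hI : Integrable (fun s => w s * nrm (relDiff Mm p q s * F s)) := by
    refine hib.mono' (hw.mul ((h.continuous_relDiff p q).mul hF.cont).nrm).aestronglyMeasurable
      (ae_of_all _ fun s => ?_)
    rw [Real.norm_of_nonneg (mul_nonneg (hw0 s) (nrm_nonneg _))]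
    exact hb s
  refine ⟨hI, (integral_mono hI hib hb).trans (le_of_eq ?_)⟩
  rw [integral_add (h.l2.const_mul η) (hi.const_mul _), integral_const_mul, integral_const_mul]

/-- Weighted integrals of the density depend continuously on the parameters. -/
theorem continuous_integral_dens (h : RHFlow σ r₁ r₂ M Mp Mm) {κ : ℝ → ℂ} (hκ : Continuous κ)
    {b : ℝ} (hb : ∀ s, ‖κ s‖ ≤ b * (1 + |s|) ^ 2) (i j : Fin 2) :
    Continuous fun p => ∫ s, κ s * dens Mp Mm p s i j := by
  rw [continuous_iff_continuousAt]
  intro q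
  obtain ⟨c, hc0, hc⟩ := h.rhoBdd_lo_mul q
  obtain ⟨K, hK0, hK⟩ := h.eventually_relDiff q
  have hb0 : 0 ≤ b := by
    have := (norm_nonneg _).trans (hb 0); simpa using this
  set A : ℝ × ℝ → ℝ → Mat2 := fun p s => Mm q s * (jumpAt σ r₁ r₂ p s - 1) with hA
  have t1 : Tendsto (fun p => ∫ s, κ s * A p s i j) (𝓝 q) (𝓝 (∫ s, κ s * A q s i j)) := by
    refine tendsto_integral_filter_of_dominated_convergence
      (fun s => b * c * ((1 + |s|) ^ 2 * (‖r₁ s‖ + ‖r₂ s‖)))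
      (Eventually.of_forall fun p => (h.integrable_of_rhoBdd (hc p) hκ hb i j).aestronglyMeasurable)
      (Eventually.of_forall fun p => ae_of_all _ fun s => ?_) (h.integrable_weight.const_mul _)
      (ae_of_all _ fun s => ?_)
    · rw [norm_mul]
      calc _ ≤ (b * (1 + |s|) ^ 2) * (c * (‖r₁ s‖ + ‖r₂ s‖)) :=
            mul_le_mul (hb s) ((norm_entry_le _ _ _).trans ((hc p).bound s)) (norm_nonneg _)
              ((norm_nonneg _).trans (hb s))
        _ = _ := by ring
    · have hcont : Continuous fun p => jumpAt σ r₁ r₂ p s := by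
        have hp := continuous_phase s
        have hp' := Complex.continuous_conj.comp hp
        refine continuous_matrix fun k l => ?_
        simp only [jumpAt_eq]
        fin_cases k <;> fin_cases l <;> simp
        · exact continuous_const
        · exact continuous_const.mul hp
        · exact continuous_const.mul hp'
        · exact continuous_const
      have hAc : Continuous fun p => A p s := continuous_const.mul (hcont.sub continuous_const)
      exact ((continuous_const.mul (hAc.matrix_elem i j)).tendsto q)
  have t2 : Tendsto (fun p => ∫ s, κ s * (relDiff Mm p q s * A p s) i j) (𝓝 q) (𝓝 0) := by
    rw [Metric.tendsto_nhds]
    intro ε hε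
    set L := ∫ s, ((1 + |s|) ^ 3 * (‖r₁ s‖ + ‖r₂ s‖)) ^ 2 with hL
    have hL0 : 0 ≤ L := integral_nonneg fun s => by positivity
    -- This choice gives `b η L < ε`. The companion term carries `1 / η`, but it is multiplied by
    -- `jumpDist`, which tends to zero while `η` stays fixed.
    set η := ε / (2 * (b * L + 1)) with hη
    have hη0 : 0 < η := by positivity
    have hbη : b * (η * L) < ε := by
      have : b * (η * L) = ε * (b * L) / (2 * (b * L + 1)) := by rw [hη]; ring
      rw [this, div_lt_iff₀ (by positivity)]
      nlinarith [mul_nonneg hb0 hL0]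
    have hlim : Tendsto (fun p => b * (η * L + c ^ 2 / η * (K * jumpDist r₁ r₂ p q))) (𝓝 q)
        (𝓝 (b * (η * L + c ^ 2 / η * (K * 0)))) :=
      (((h.tendsto_jumpDist q).const_mul K).const_mul _).const_add _ |>.const_mul b
    rw [mul_zero, mul_zero, add_zero] at hlim
    filter_upwards [hK, hlim.eventually_lt_const hbη] with p hp hp2
    have hw : Continuous fun s : ℝ => (1 + |s|) ^ 2 := by fun_prop
    obtain ⟨i1, i2⟩ := h.integral_relDiff_le hη0 (hc p) hp.1 hw (fun s => by positivity)
      (fun s => pow_le_pow_right₀ (by linarith [abs_nonneg s]) (by norm_num))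
    rw [dist_zero_right]
    refine lt_of_le_of_lt ?_ hp2
    have hle : ‖∫ s, κ s * (relDiff Mm p q s * A p s) i j‖
        ≤ ∫ s, b * ((1 + |s|) ^ 2 * nrm (relDiff Mm p q s * A p s)) := by
      refine norm_integral_le_of_norm_le (i1.const_mul b) (ae_of_all _ fun s => ?_)
      rw [norm_mul]
      calc _ ≤ (b * (1 + |s|) ^ 2) * nrm (relDiff Mm p q s * A p s) :=
            mul_le_mul (hb s) (norm_entry_le _ _ _) (norm_nonneg _) ((norm_nonneg _).trans (hb s))
        _ = _ := by ring
    refine hle.trans ?_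
    rw [integral_const_mul]
    gcongr
    refine i2.trans ?_
    gcongr
    exact hp.2.1
  have t3 := t1.add t2
  rw [add_zero] at t3
  have eq : ∀ᶠ p in 𝓝 q, (∫ s, κ s * A p s i j) + (∫ s, κ s * (relDiff Mm p q s * A p s) i j)
      = ∫ s, κ s * dens Mp Mm p s i j := by
    filter_upwards [hK] with p hp
    have hw : Continuous fun s : ℝ => (1 + |s|) ^ 2 := by fun_prop
    obtain ⟨i1, -⟩ := h.integral_relDiff_le one_pos (hc p) hp.1 hw (fun s => by positivity)
      (fun s => pow_le_pow_right₀ (by linarith [abs_nonneg s]) (by norm_num))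
    rw [← integral_add (h.integrable_of_rhoBdd (hc p) hκ hb i j)]
    · refine integral_congr_ae (ae_of_all _ fun s => ?_)
      simp only []
      rw [h.dens_split p q s, Matrix.add_apply, mul_add]
    · refine (i1.const_mul b).mono' (hκ.mul
        (((h.continuous_relDiff p q).mul (hc p).cont).matrix_elem i j)).aestronglyMeasurable
        (ae_of_all _ fun s => ?_)
      rw [norm_mul]
      calc _ ≤ (b * (1 + |s|) ^ 2) * nrm (relDiff Mm p q s * A p s) :=
            mul_le_mul (hb s) (norm_entry_le _ _ _) (norm_nonneg _) ((norm_nonneg _).trans (hb s))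
        _ = _ := by ring
  have t4 := t3.congr' eq
  have e0 : (∫ s, κ s * A q s i j) = ∫ s, κ s * dens Mp Mm q s i j := by
    refine integral_congr_ae (ae_of_all _ fun s => ?_)
    simp only [hA]
    rw [h.dens_eq q s]
  rw [e0] at t4
  exact t4

theorem continuous_mom (h : RHFlow σ r₁ r₂ M Mp Mm) {k : ℕ} (hk : k ≤ 2) :
    Continuous fun p => mom k (dens Mp Mm p) := by
  refine continuous_matrix fun i j => ?_
  simp only [mom, Matrix.of_apply]
  refine continuous_const.mul (h.continuous_integral_dens (by fun_prop) (b := 1) (fun s => ?_) i j)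
  rw [norm_pow, norm_real, Real.norm_eq_abs, one_mul]
  exact one_add_abs_pow_ge hk s

theorem continuous_M (h : RHFlow σ r₁ r₂ M Mp Mm) {z : ℂ} (hz : z.im ≠ 0) :
    Continuous fun p => M p z := by
  have e : (fun p => M p z) = fun p => 1 + matC 0 (dens Mp Mm p) z :=
    funext fun p => h.eq_one_add_matC p hz
  rw [e]
  refine continuous_const.add (continuous_matrix fun i j => ?_)
  simp only [matC, Matrix.of_apply, cauchyInt, pow_zero, one_mul]
  have h3 : 0 < |z.im| := abs_pos.2 hz
  have hc : Continuous fun s : ℝ => ((s : ℂ) - z)⁻¹ :=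
    Continuous.inv₀ (by fun_prop) (ofReal_sub_ne_zero hz)
  have := h.continuous_integral_dens hc (b := |z.im|⁻¹) (fun s => by
    rw [norm_inv]
    have h1 : ‖(s : ℂ) - z‖⁻¹ ≤ |z.im|⁻¹ := by
      gcongr
      exact abs_im_le_norm_ofReal_sub s z
    have h2 : 1 ≤ (1 + |s|) ^ 2 := one_le_pow₀ (by linarith [abs_nonneg s])
    have h4 : 0 < |z.im|⁻¹ := by positivity
    nlinarith) i j
  refine continuous_const.mul ?_
  simpa only [div_eq_mul_inv, mul_comm] using this

/-- Locally uniform decay of the remainder along the imaginary axis. -/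
theorem tendstoUniformly_matC (h : RHFlow σ r₁ r₂ M Mp Mm) {k : ℕ} (hk : k ≤ 3) (q : ℝ × ℝ)
    (i j : Fin 2) : TendstoUniformlyOnFilter
      (fun (y : ℝ) p => matC k (dens Mp Mm p) (I * y) i j) (fun _ => 0) atTop (𝓝 q) := by
  obtain ⟨c, hc0, hc⟩ := h.rhoBdd_lo_mul q
  obtain ⟨K, hK0, hK⟩ := h.eventually_relDiff q
  set A : ℝ × ℝ → ℝ → Mat2 := fun p s => Mm q s * (jumpAt σ r₁ r₂ p s - 1) with hA
  set L := ∫ s, ((1 + |s|) ^ 3 * (‖r₁ s‖ + ‖r₂ s‖)) ^ 2 with hL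
  rw [Metric.tendstoUniformlyOnFilter_iff]
  intro ε hε
  have t1 := tendsto_weighted_integral (h.integrable_weight_div c)
    (h.continuous_weight c).aestronglyMeasurable
  have t2 : Tendsto (fun y : ℝ => (1 * L + c ^ 2 / 1 * (K * 1)) / y) atTop (𝓝 0) :=
    tendsto_const_nhds.div_atTop tendsto_id
  have t3 := t1.add t2
  rw [add_zero] at t3
  have hy := (t3.eventually_lt_const hε).and (eventually_gt_atTop 0)
  have hp := hK.and ((h.tendsto_jumpDist q).eventually_le_const one_pos)
  filter_upwards [hy.prod_mk hp] with n hn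
  obtain ⟨⟨h1, h2⟩, ⟨h3, h4, -⟩, h5⟩ := hn
  set y := n.1
  set p := n.2
  have hz : (I * (y : ℂ)).im ≠ 0 := by simpa using h2.ne'
  have hw : Continuous fun s : ℝ => |s| ^ k := by fun_prop
  obtain ⟨i1, i2⟩ := h.integral_relDiff_le one_pos (hc p) h3 hw (fun s => by positivity)
    (fun s => one_add_abs_pow_ge hk s)
  have b1 := h.norm_matC_le (hc p) hk i j hz
  have iB : Integrable fun s : ℝ => (s : ℂ) ^ k * (relDiff Mm p q s * A p s) i j := by
    refine i1.mono' (Continuous.aestronglyMeasurable ?_) (ae_of_all _ fun s => ?_)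
    · have := ((h.continuous_relDiff p q).mul (hc p).cont).matrix_elem i j
      exact (by fun_prop : Continuous fun s : ℝ => (s : ℂ) ^ k).mul this
    · rw [norm_mul, norm_pow, norm_real, Real.norm_eq_abs]
      gcongr
      exact norm_entry_le _ _ _
  -- As a product of two `L²` functions the second part of the density stays integrable even with
  -- the weight `s³`, so its Cauchy integral is `O(1/y)` with a constant uniform in `p` near `q`.
  have b2 : ‖cauchyInt (fun s : ℝ => (s : ℂ) ^ k * (relDiff Mm p q s * A p s) i j) (I * y)‖
      ≤ (1 * L + c ^ 2 / 1 * (K * 1)) / y := by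
    refine (norm_cauchyInt_le iB hz).trans ?_
    have e : |(I * (y : ℂ)).im| = y := by simp [abs_of_pos h2]
    rw [e]
    gcongr
    calc _ ≤ ∫ s, |s| ^ k * nrm (relDiff Mm p q s * A p s) := by
          refine integral_mono iB.norm i1 fun s => ?_
          simp only []
          rw [norm_mul, norm_pow, norm_real, Real.norm_eq_abs]
          gcongr
          exact norm_entry_le _ _ _
      _ ≤ _ := by
          refine i2.trans ?_
          gcongr
          refine h4.trans ?_
          gcongr
  have esum : matC k (dens Mp Mm p) (I * y) i j = matC k (A p) (I * y) i j
      + cauchyInt (fun s : ℝ => (s : ℂ) ^ k * (relDiff Mm p q s * A p s) i j) (I * y) := by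
    simp only [matC, Matrix.of_apply, cauchyInt]
    rw [← mul_add, ← integral_add]
    · congr 1
      refine integral_congr_ae (ae_of_all _ fun s => ?_)
      simp only []
      rw [h.dens_split p q s, Matrix.add_apply]
      ring
    · have := integrable_weighted_div (h.integrable_weight_div c)
        (h.continuous_weight c).aestronglyMeasurable hz
      refine this.mono' (Continuous.aestronglyMeasurable ?_) (ae_of_all _ fun s => ?_)
      · have h6 : Continuous fun s : ℝ => (s : ℂ) ^ k * A p s i j :=
          (by fun_prop : Continuous fun s : ℝ => (s : ℂ) ^ k).mul ((hc p).cont.matrix_elem i j)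
        exact h6.div (by fun_prop) (ofReal_sub_ne_zero hz)
      · rw [norm_div]
        gcongr
        exact norm_pow_mul_le (hc p) hk i j s
    · exact integrable_div_ofReal_sub iB hz
  rw [dist_zero_left, esum]
  refine lt_of_le_of_lt (norm_add_le _ _) (lt_of_le_of_lt (add_le_add b1 b2) h1)

end RHFlow

/-! ### Differentiability in `x` and `t` at a fixed spectral parameter -/

theorem nrm_sigma3 : nrm sigma3 = 2 := by simp [nrm, sigma3]; norm_num

theorem adjugate_sub2 (A B : Mat2) : A.adjugate - B.adjugate = (A - B).adjugate := by
  rw [Matrix.adjugate_fin_two, Matrix.adjugate_fin_two, Matrix.adjugate_fin_two]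
  ext i j; fin_cases i <;> fin_cases j <;> simp <;> ring

theorem hasDerivAt_mul_mul {X : ℝ → Mat2} {X' A B : Mat2} {h : ℝ}
    (hX : ∀ i j, HasDerivAt (fun t => X t i j) (X' i j) h) (i j : Fin 2) :
    HasDerivAt (fun t => (A * X t * B) i j) ((A * X' * B) i j) h := by
  simp only [mul_apply2]
  exact ((((hX 0 0).const_mul _).add ((hX 1 0).const_mul _)).mul_const _).add
    ((((hX 0 1).const_mul _).add ((hX 1 1).const_mul _)).mul_const _)

namespace RHFlow

variable {σ : ℝ} {r₁ r₂ : ℝ → ℂ} {M : ℝ × ℝ → ℂ → Mat2} {Mp Mm : ℝ × ℝ → ℝ → Mat2}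

/-- The jump of `M σ₃ M⁻¹`. -/
noncomputable def sdens (Mp Mm : ℝ × ℝ → ℝ → Mat2) (p : ℝ × ℝ) (s : ℝ) : Mat2 :=
  Mp p s * sigma3 * (Mp p s).adjugate - Mm p s * sigma3 * (Mm p s).adjugate

theorem rhoBdd_sdens (h : RHFlow σ r₁ r₂ M Mp Mm) (p : ℝ × ℝ) : ∃ c : ℝ, 0 ≤ c ∧
    RhoBdd r₁ r₂ c (sdens Mp Mm p) := by
  obtain ⟨c, hc0, hc⟩ := h.rhoBdd_dens p
  obtain ⟨m, hm1, -, hmp, hmm⟩ := (h.data p).bounded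
  have c1 := (h.data p).cut.continuous_up
  have c2 := (h.data p).cut.continuous_lo
  refine ⟨4 * m * c, by positivity, ⟨((c1.mul continuous_const).mul c1.matrix_adjugate).sub
    ((c2.mul continuous_const).mul c2.matrix_adjugate), fun s => ?_⟩⟩
  have e : sdens Mp Mm p s = dens Mp Mm p s * (sigma3 * (Mp p s).adjugate)
      + Mm p s * (sigma3 * (dens Mp Mm p s).adjugate) := by
    rw [sdens, dens, ← adjugate_sub2]; noncomm_ring
  have b := hc.bound s
  have n1 := nrm_mul_le (dens Mp Mm p s) (sigma3 * (Mp p s).adjugate)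
  have n2 := nrm_mul_le sigma3 (Mp p s).adjugate
  have n3 := nrm_mul_le (Mm p s) (sigma3 * (dens Mp Mm p s).adjugate)
  have n4 := nrm_mul_le sigma3 (dens Mp Mm p s).adjugate
  rw [nrm_sigma3, nrm_adjugate] at n2 n4
  have hd0 := nrm_nonneg (dens Mp Mm p s)
  set d := nrm (dens Mp Mm p s)
  have f1 : nrm (dens Mp Mm p s * (sigma3 * (Mp p s).adjugate)) ≤ d * (2 * m) :=
    n1.trans (mul_le_mul_of_nonneg_left (n2.trans (by linarith [hmp s])) hd0)
  have f3 : nrm (Mm p s * (sigma3 * (dens Mp Mm p s).adjugate)) ≤ m * (2 * d) :=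
    n3.trans (mul_le_mul (hmm s) n4 (nrm_nonneg _) (by linarith))
  rw [e]
  refine (nrm_add_le _ _).trans ?_
  have : d * (4 * m) ≤ c * (‖r₁ s‖ + ‖r₂ s‖) * (4 * m) := by gcongr
  linarith

/-- Cauchy's formula for `M σ₃ M⁻¹`, which tends to `σ₃`. Both matrices of the Lax pair will appear
as polynomial parts of a power of `z` times this function. -/
theorem sandwich_eq (h : RHFlow σ r₁ r₂ M Mp Mm) (p : ℝ × ℝ) {z : ℂ} (hz : z.im ≠ 0) :
    M p z * sigma3 * (M p z).adjugate - sigma3 = matC 0 (sdens Mp Mm p) z := by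
  have hd := h.data p
  obtain ⟨m, -, hm, -, -⟩ := hd.bounded
  have hcut := ((hd.cut.mul (MatCut.const sigma3)).mul hd.cut.adjugate).sub (MatCut.const sigma3)
  have hB : MatDecays fun z => M p z * sigma3 * (M p z).adjugate - sigma3 := by
    have h1 := hd.decays.mul_bounded (N := fun z => sigma3 * (M p z).adjugate) (B := 2 * m)
      fun z hz => (nrm_mul_le _ _).trans (by rw [nrm_sigma3, nrm_adjugate]; linarith [hm z hz])
    have h2 : MatDecays fun z => sigma3 * ((M p z).adjugate - 1) := by
      intro i j
      simp only [mul_apply2]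
      have hs : ∀ k l, Decays fun z => sigma3 k l * ((M p z).adjugate - 1) l j := fun k l =>
        ((hd.sub_one_adjugate l j).mul_bounded (g := fun _ => sigma3 k l) (B := ‖sigma3 k l‖)
          fun _ _ => le_rfl).congr fun z _ => mul_comm _ _
      exact (hs i 0).add (hs i 1)
    refine (h1.add h2).congr fun z _ => ?_
    noncomm_ring
  ext i j
  have := hcut.cauchy hB hz i j
  rw [this]
  simp [matC, sdens]

/-- The `t`-derivative of the jump matrix along a path with phase speed `c s ^ k`. -/
noncomputable def jumpDeriv (σ : ℝ) (r₁ r₂ : ℝ → ℂ) (c : ℝ) (k : ℕ) (p : ℝ × ℝ) (s : ℝ) : Mat2 :=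
  !![0, (σ : ℂ) * r₂ s * (phase p s * (2 * I * c * (s : ℂ) ^ k));
    r₁ s * ((starRingEnd ℂ) (phase p s) * -(2 * I * c * (s : ℂ) ^ k)), 0]

/-- The phases enter the jump as conjugation by `exp (i θ σ₃)`, and differentiating a conjugation
gives a commutator. -/
theorem jumpDeriv_eq (σ : ℝ) (r₁ r₂ : ℝ → ℂ) (c : ℝ) (k : ℕ) (p : ℝ × ℝ) (s : ℝ) :
    jumpDeriv σ r₁ r₂ c k p s = (I * c * (s : ℂ) ^ k) •
      (sigma3 * jumpAt σ r₁ r₂ p s - jumpAt σ r₁ r₂ p s * sigma3) := by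
  rw [jumpAt_eq, jumpDeriv, sigma3]
  ext i j
  fin_cases i <;> fin_cases j <;> simp <;> ring

theorem nrm_jumpDeriv_le (h : RHFlow σ r₁ r₂ M Mp Mm) (c : ℝ) (k : ℕ) (p : ℝ × ℝ) (s : ℝ) :
    nrm (jumpDeriv σ r₁ r₂ c k p s) ≤ 2 * |c| * (|s| ^ k * (‖r₁ s‖ + ‖r₂ s‖)) := by
  simp [nrm, jumpDeriv, norm_phase, h.abs_sigma]
  apply le_of_eq; ring

/-- With `V' = i c s^k [σ₃, V]` and `M₊ = M₋ V`, the infinitesimal relative jump `M₋ V' V⁻¹ M₋⁻¹`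
becomes `i c s^k (M₋ σ₃ M₋⁻¹ - M₊ σ₃ M₊⁻¹)`. -/
theorem jumpDeriv_conj (h : RHFlow σ r₁ r₂ M Mp Mm) (c : ℝ) (k : ℕ) (p : ℝ × ℝ) (s : ℝ) :
    Mm p s * jumpDeriv σ r₁ r₂ c k p s * ((jumpAt σ r₁ r₂ p s).adjugate * (Mm p s).adjugate)
      = (-(I * c * (s : ℂ) ^ k)) • sdens Mp Mm p s := by
  have hd := h.data p
  have e2 : jumpAt σ r₁ r₂ p s * (jumpAt σ r₁ r₂ p s).adjugate = 1 := mul_adj (hd.detV s)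
  rw [jumpDeriv_eq, sdens, hd.jump, Matrix.adjugate_mul_distrib]
  set V := jumpAt σ r₁ r₂ p s
  rw [Matrix.mul_smul, Matrix.smul_mul, neg_smul, ← smul_neg]
  congr 1
  calc _ = Mm p s * sigma3 * (V * V.adjugate) * (Mm p s).adjugate
        - Mm p s * V * sigma3 * (V.adjugate * (Mm p s).adjugate) := by noncomm_ring
    _ = _ := by rw [e2]; noncomm_ring

/-- Paths along which `θ` moves at speed `c s^k` treat both variables at once: `c = 1`, `k = 1` for
`x` and `c = 4`, `k = 3` for `t`. -/
theorem phase_path {c : ℝ} {k : ℕ} {γ : ℝ → ℝ × ℝ} {p : ℝ × ℝ}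
    (hγ : ∀ t s, theta (γ t).1 (γ t).2 s = theta p.1 p.2 s + t * (c * s ^ k)) (t s : ℝ) :
    HasDerivAt (fun t => phase (γ t) s) (phase (γ t) s * (2 * I * c * (s : ℂ) ^ k)) t := by
  have e : ∀ t, phase (γ t) s = exp (2 * I * (theta p.1 p.2 s + t * (c * (s : ℂ) ^ k))) := by
    intro t; rw [phase, hγ]; push_cast; rfl
  simp only [e]
  have h1 : HasDerivAt (fun t : ℝ => (t : ℂ)) 1 t := by
    simpa using (hasDerivAt_id (t : ℂ)).comp_ofReal
  have h2 := ((((h1.mul_const (c * (s : ℂ) ^ k)).const_add (theta p.1 p.2 s : ℂ)).const_mul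
    (2 * I))).cexp
  convert h2 using 1
  ring

theorem hasDerivAt_jump_path {c : ℝ} {k : ℕ} {γ : ℝ → ℝ × ℝ} {p : ℝ × ℝ} (B : Mat2)
    (hγ : ∀ t s, theta (γ t).1 (γ t).2 s = theta p.1 p.2 s + t * (c * s ^ k)) (t s : ℝ)
    (i j : Fin 2) :
    HasDerivAt (fun t => (jumpAt σ r₁ r₂ (γ t) s - B) i j)
      (jumpDeriv σ r₁ r₂ c k (γ t) s i j) t := by
  have h1 := phase_path hγ t s
  have h2 : HasDerivAt (fun t => (starRingEnd ℂ) (phase (γ t) s))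
      ((starRingEnd ℂ) (phase (γ t) s) * -(2 * I * c * (s : ℂ) ^ k)) t := by
    refine HasDerivAt.congr_deriv h1.star ?_
    simp
  simp only [Matrix.sub_apply, jumpAt_eq, jumpDeriv]
  refine HasDerivAt.sub_const _ ?_
  fin_cases i <;> fin_cases j <;> simp
  · exact hasDerivAt_const _ _
  · simpa using h1.const_mul ((σ : ℂ) * r₂ s)
  · simpa using h2.const_mul (r₁ s)
  · exact hasDerivAt_const _ _

/-- The phase changes by at most `2 |t| |c| |s|^k`, and for `k ≤ 3` the `L^{2,3}` bound absorbs the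
growth in `s`. The quadratic order in `t` makes the second-order remainder negligible. -/
theorem jumpDist_path_le (h : RHFlow σ r₁ r₂ M Mp Mm) {c : ℝ} {k : ℕ} (hk : k ≤ 3)
    {γ : ℝ → ℝ × ℝ} {p : ℝ × ℝ}
    (hγ : ∀ t s, theta (γ t).1 (γ t).2 s = theta p.1 p.2 s + t * (c * s ^ k)) (t : ℝ) :
    jumpDist r₁ r₂ (γ t) p
      ≤ (4 * c ^ 2 * ∫ s, ((1 + |s|) ^ 3 * (‖r₁ s‖ + ‖r₂ s‖)) ^ 2) * t ^ 2 := by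
  have e : (4 * c ^ 2 * ∫ s, ((1 + |s|) ^ 3 * (‖r₁ s‖ + ‖r₂ s‖)) ^ 2) * t ^ 2
      = ∫ s, (4 * c ^ 2 * t ^ 2) * ((1 + |s|) ^ 3 * (‖r₁ s‖ + ‖r₂ s‖)) ^ 2 := by
    rw [integral_const_mul]; ring
  rw [e, jumpDist]
  refine integral_mono (h.integrable_jumpDist _ _) (h.l2.const_mul _) fun s => ?_
  simp only []
  have h1 : ‖phase (γ t) s - phase p s‖ ≤ 2 * (|t| * |c|) * (1 + |s|) ^ 3 := by
    refine (norm_phase_sub_le _ _ _).trans ?_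
    rw [hγ, add_sub_cancel_left, abs_mul, abs_mul, abs_pow]
    have := one_add_abs_pow_ge hk s
    have h2 : |t| * |c| * |s| ^ k ≤ |t| * |c| * (1 + |s|) ^ 3 := by gcongr
    nlinarith
  calc _ ≤ ((‖r₁ s‖ + ‖r₂ s‖) * (2 * (|t| * |c|) * (1 + |s|) ^ 3)) ^ 2 := by gcongr
    _ = (4 * |c| ^ 2 * |t| ^ 2) * ((1 + |s|) ^ 3 * (‖r₁ s‖ + ‖r₂ s‖)) ^ 2 := by ring
    _ = _ := by rw [sq_abs, sq_abs]

/-- Differentiability of the solution along a path with phase speed `c s ^ k`. -/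
theorem hasDerivAt_path (h : RHFlow σ r₁ r₂ M Mp Mm) {c : ℝ} {k : ℕ} (hk : k ≤ 3)
    {γ : ℝ → ℝ × ℝ} {p : ℝ × ℝ} (hγ0 : γ 0 = p) (hγc : ContinuousAt γ 0)
    (hγ : ∀ t s, theta (γ t).1 (γ t).2 s = theta p.1 p.2 s + t * (c * s ^ k)) {z : ℂ}
    (hz : z.im ≠ 0) (i j : Fin 2) :
    HasDerivAt (fun t => M (γ t) z i j)
      (((-(I * c)) • (matC k (sdens Mp Mm p) z * M p z)) i j) 0 := by
  obtain ⟨K, hK0, hK⟩ := h.eventually_relDiff p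
  obtain ⟨v, hv1, -, hv, -⟩ := h.exists_jump_bound
  obtain ⟨m, hm1, -, -, hm⟩ := (h.data p).bounded
  have hy : 0 < |z.im| := abs_pos.2 hz
  set W : ℝ → ℝ → Mat2 := fun t s => relJump (jumpAt σ r₁ r₂ (γ t)) (jumpAt σ r₁ r₂ p) (Mm p) s
    with hW
  have hWc : ∀ t, Continuous (W t) := fun t => (h.data (γ t)).continuous_relJump (h.data p)
  -- the leading part
  have d1 : ∀ i j, HasDerivAt (fun t => cauchyInt (fun s => W t s i j) z)
      (-(I * c) * matC k (sdens Mp Mm p) z i j) 0 := by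
    intro i j
    set W' : ℝ → ℝ → Mat2 := fun t s => Mm p s * jumpDeriv σ r₁ r₂ c k (γ t) s *
      ((jumpAt σ r₁ r₂ p s).adjugate * (Mm p s).adjugate) with hW'
    have bdW' : ∀ t s, ‖W' t s i j‖ ≤ |m * m * v * (2 * |c|) * ((1 + |s|) ^ 3 * (‖r₁ s‖ + ‖r₂ s‖))| := by
      intro t s
      refine (norm_entry_le _ _ _).trans (le_trans ?_ (le_abs_self _))
      have n1 := nrm_mul_le (Mm p s * jumpDeriv σ r₁ r₂ c k (γ t) s)
        ((jumpAt σ r₁ r₂ p s).adjugate * (Mm p s).adjugate)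
      have n2 := nrm_mul_le (Mm p s) (jumpDeriv σ r₁ r₂ c k (γ t) s)
      have n3 := nrm_mul_le (jumpAt σ r₁ r₂ p s).adjugate (Mm p s).adjugate
      rw [nrm_adjugate, nrm_adjugate] at n3
      have n4 := h.nrm_jumpDeriv_le c k (γ t) s
      have n5 : |s| ^ k * (‖r₁ s‖ + ‖r₂ s‖) ≤ (1 + |s|) ^ 3 * (‖r₁ s‖ + ‖r₂ s‖) := by
        gcongr; exact one_add_abs_pow_ge hk s
      have n6 : nrm (jumpDeriv σ r₁ r₂ c k (γ t) s)
          ≤ 2 * |c| * ((1 + |s|) ^ 3 * (‖r₁ s‖ + ‖r₂ s‖)) := n4.trans (by gcongr)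
      calc _ ≤ (m * (2 * |c| * ((1 + |s|) ^ 3 * (‖r₁ s‖ + ‖r₂ s‖)))) * (v * m) := by
            refine n1.trans (mul_le_mul (n2.trans ?_) (n3.trans ?_) (nrm_nonneg _) (by positivity))
            · exact mul_le_mul (hm s) n6 (nrm_nonneg _) (by linarith)
            · exact mul_le_mul (hv p s) (hm s) (nrm_nonneg _) (by linarith)
        _ = _ := by ring
    have hWd : ∀ t s, HasDerivAt (fun t => W t s i j) (W' t s i j) t := fun t s =>
      hasDerivAt_mul_mul (fun i j => hasDerivAt_jump_path _ hγ t s i j) i j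
    have hci : Continuous fun s : ℝ => ((s : ℂ) - z)⁻¹ :=
      Continuous.inv₀ (by fun_prop) (ofReal_sub_ne_zero hz)
    have hW'c : Continuous fun s => W' 0 s i j := by
      have : (fun s => W' 0 s i j) = fun s : ℝ => ((-(I * c * (s : ℂ) ^ k)) • sdens Mp Mm p s) i j := by
        funext s; simp only [hW', hγ0]; rw [h.jumpDeriv_conj]
      rw [this]
      obtain ⟨c', -, hc'⟩ := h.rhoBdd_sdens p
      simp only [Matrix.smul_apply, smul_eq_mul]
      exact (by fun_prop : Continuous fun s : ℝ => -(I * c * (s : ℂ) ^ k)).mul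
        (hc'.cont.matrix_elem i j)
    have key := hasDerivAt_integral_of_dominated_loc_of_deriv_le (𝕜 := ℝ) (μ := volume)
      (F := fun t s => W t s i j / ((s : ℂ) - z)) (F' := fun t s => W' t s i j / ((s : ℂ) - z))
      (x₀ := (0 : ℝ)) (s := univ)
      (bound := fun s => |m * m * v * (2 * |c|) * ((1 + |s|) ^ 3 * (‖r₁ s‖ + ‖r₂ s‖))| / ‖(s : ℂ) - z‖)
      univ_mem
      (Eventually.of_forall fun t => by
        simp_rw [div_eq_mul_inv]
        exact (((hWc t).matrix_elem i j).mul hci).aestronglyMeasurable)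
      (by
        have : ∀ s, W 0 s i j = 0 := by
          intro s; simp only [hW, hγ0, relJump, sub_self, mul_zero, zero_mul, Matrix.zero_apply]
        simp [this])
      (by
        simp_rw [div_eq_mul_inv]
        exact (hW'c.mul hci).aestronglyMeasurable)
      (ae_of_all _ fun s t _ => by rw [norm_div]; gcongr; exact bdW' t s)
      (integrable_weighted_div (h.integrable_weight_div _)
        (h.continuous_weight _).aestronglyMeasurable hz)
      (ae_of_all _ fun s t _ => (hWd t s).div_const _)
    have key2 := key.2.const_mul ((2 * Real.pi * I : ℂ)⁻¹)
    refine key2.congr_deriv ?_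
    simp only [matC, Matrix.of_apply, cauchyInt]
    have : ∀ s, W' 0 s i j / ((s : ℂ) - z)
        = -(I * c) * ((s : ℂ) ^ k * sdens Mp Mm p s i j / ((s : ℂ) - z)) := by
      intro s
      simp only [hW', hγ0]
      rw [h.jumpDeriv_conj, Matrix.smul_apply, smul_eq_mul]; ring
    simp only [this]
    rw [integral_const_mul]; ring
  -- the quadratic remainder
  have hev := hγc.eventually (by rw [hγ0]; exact hK)
  have hDi : ∀ t i j, Integrable (fun s => nrm (relDiff Mm (γ t) p s) ^ 2) →
      Integrable (fun s => (relDiff Mm (γ t) p s * W t s) i j) ∧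
      ∫ s, ‖(relDiff Mm (γ t) p s * W t s) i j‖
        ≤ (∫ s, nrm (relDiff Mm (γ t) p s) ^ 2) + ∫ s, nrm (W t s) ^ 2 := by
    intro t i j hi
    have hi2 := h.integrable_relJump_sq (γ t) p
    have hb : ∀ s, ‖(relDiff Mm (γ t) p s * W t s) i j‖
        ≤ nrm (relDiff Mm (γ t) p s) ^ 2 + nrm (W t s) ^ 2 := by
      intro s
      refine (norm_entry_le _ _ _).trans ((nrm_mul_le _ _).trans ?_)
      nlinarith [sq_nonneg (nrm (relDiff Mm (γ t) p s) - nrm (W t s)),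
        sq_nonneg (nrm (relDiff Mm (γ t) p s) + nrm (W t s))]
    have hI : Integrable (fun s => (relDiff Mm (γ t) p s * W t s) i j) :=
      (hi.add hi2).mono' (((h.continuous_relDiff (γ t) p).mul
        (hWc t)).matrix_elem i j).aestronglyMeasurable (ae_of_all _ hb)
    refine ⟨hI, ?_⟩
    rw [← integral_add hi hi2]
    exact integral_mono hI.norm (hi.add hi2) hb
  have d2 : ∀ i j, HasDerivAt (fun t => cauchyInt (fun s => (relDiff Mm (γ t) p s * W t s) i j) z)
      0 0 := by
    intro i j
    set L := ∫ s, ((1 + |s|) ^ 3 * (‖r₁ s‖ + ‖r₂ s‖)) ^ 2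
    have hO : (fun t => cauchyInt (fun s => (relDiff Mm (γ t) p s * W t s) i j) z)
        =O[𝓝 0] fun t : ℝ => ‖t - 0‖ ^ 2 := by
      -- Each of the two squared `L²` norms is at most `K` times `jumpDist`, hence `2 K`, and
      -- `jumpDist` is at most `4 c² L t²`. A function of order `t²` has derivative zero.
      refine Asymptotics.IsBigO.of_bound (2 * K * (4 * c ^ 2 * L) / |z.im|) ?_
      filter_upwards [hev] with t ht
      obtain ⟨h1, h2, h3⟩ := ht
      obtain ⟨i1, i2⟩ := hDi t i j h1
      refine (norm_cauchyInt_le i1 hz).trans ?_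
      have h4 := mul_le_mul_of_nonneg_left (h.jumpDist_path_le hk hγ t) hK0
      rw [sub_zero, Real.norm_of_nonneg (by positivity), Real.norm_eq_abs, sq_abs,
        div_mul_eq_mul_div]
      gcongr
      linarith
    have := hO.hasFDerivAt (𝕜 := ℝ) (by norm_num : 1 < 2)
    rw [hasDerivAt_iff_hasFDerivAt]
    simpa using this
  -- assembling
  have hE : ∀ i j, HasDerivAt (fun t => (M (γ t) z * (M p z).adjugate) i j)
      (-(I * c) * matC k (sdens Mp Mm p) z i j) 0 := by
    intro i j
    have hs := ((d1 i j).add (d2 i j)).const_add ((1 : Mat2) i j)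
    rw [add_zero] at hs
    refine hs.congr_of_eventuallyEq ?_
    filter_upwards [hev] with t ht
    have hq := (h.data (γ t)).quotient_cut (h.data p)
    have hc := (hq.sub (MatCut.const 1)).cauchy ((h.data (γ t)).quotient_decays (h.data p)) hz i j
    rw [Matrix.sub_apply, sub_eq_iff_eq_add'] at hc
    rw [hc]
    congr 1
    simp only [cauchyInt, Pi.add_apply]
    rw [← mul_add, ← integral_add]
    · congr 1
      refine integral_congr_ae (ae_of_all _ fun s => ?_)
      simp only []
      rw [← add_div, sub_sub_sub_cancel_right, (h.data (γ t)).quotient_jump (h.data p) s]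
      have : Mm (γ t) s * (Mm p s).adjugate = 1 + relDiff Mm (γ t) p s := by
        rw [relDiff, add_sub_cancel]
      rw [this, add_mul, one_mul, Matrix.add_apply]
    · have := (h.integrable_jumpDist (γ t) p)
      obtain ⟨C, hC⟩ := h.nrm_relJump_le p
      refine integrable_div_ofReal_sub (((h.integrable_weight.const_mul (C * 2))).mono'
        ((hWc t).matrix_elem i j).aestronglyMeasurable (ae_of_all _ fun s => ?_)) hz
      refine (norm_entry_le _ _ _).trans ((hC.2 (γ t) s).trans ?_)
      have h5 := norm_phase_sub_le_two (γ t) p s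
      have h6 : 1 ≤ (1 + |s|) ^ 2 := one_le_pow₀ (by linarith [abs_nonneg s])
      have h7 : (‖r₁ s‖ + ‖r₂ s‖) * ‖phase (γ t) s - phase p s‖
          ≤ 2 * ((1 + |s|) ^ 2 * (‖r₁ s‖ + ‖r₂ s‖)) := by
        have h8 : 0 ≤ ‖r₁ s‖ + ‖r₂ s‖ := by positivity
        nlinarith [mul_le_mul_of_nonneg_left h5 h8]
      have := mul_le_mul_of_nonneg_left h7 (by linarith [hC.1] : 0 ≤ C)
      linarith
    · exact integrable_div_ofReal_sub (hDi t i j ht.1).1 hz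
  have hMe : ∀ t, M (γ t) z i j = (M (γ t) z * (M p z).adjugate) i 0 * M p z 0 j
      + (M (γ t) z * (M p z).adjugate) i 1 * M p z 1 j := by
    intro t
    rw [← mul_apply2, mul_assoc, adj_mul ((h.data p).det_eq_one hz), mul_one]
  simp only [hMe]
  refine (((hE i 0).mul_const (M p z 0 j)).add ((hE i 1).mul_const (M p z 1 j))).congr_deriv ?_
  rw [Matrix.smul_apply, mul_apply2, smul_eq_mul]; ring

end RHFlow

namespace RHFlow

variable {σ : ℝ} {r₁ r₂ : ℝ → ℂ} {M : ℝ × ℝ → ℂ → Mat2} {Mp Mm : ℝ × ℝ → ℝ → Mat2}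

/-! ### Expansion coefficients at infinity -/

/-- The coefficient of `z ^ (-(k + 1))` in the expansion of `M`. -/
noncomputable def coefM (Mp Mm : ℝ × ℝ → ℝ → Mat2) (k : ℕ) (p : ℝ × ℝ) : Mat2 :=
  - mom k (dens Mp Mm p)

/-- Minus the coefficient of `z ^ (-(k + 1))` in the expansion of `M σ₃ M⁻¹`. -/
noncomputable def coefS (Mp Mm : ℝ × ℝ → ℝ → Mat2) (k : ℕ) (p : ℝ × ℝ) : Mat2 :=
  mom k (sdens Mp Mm p)

theorem continuous_coefM (h : RHFlow σ r₁ r₂ M Mp Mm) {k : ℕ} (hk : k ≤ 2) :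
    Continuous (coefM Mp Mm k) := (h.continuous_mom hk).neg

theorem smul_matC_dens (h : RHFlow σ r₁ r₂ M Mp Mm) {k : ℕ} (hk : k ≤ 2) (p : ℝ × ℝ) {z : ℂ}
    (hz : z.im ≠ 0) : z • matC k (dens Mp Mm p) z
      = matC (k + 1) (dens Mp Mm p) z + coefM Mp Mm k p := by
  obtain ⟨c, -, hc⟩ := h.rhoBdd_dens p
  rw [h.matC_succ hc hk hz, coefM, sub_eq_add_neg]

theorem smul_matC_sdens (h : RHFlow σ r₁ r₂ M Mp Mm) {k : ℕ} (hk : k ≤ 2) (p : ℝ × ℝ) {z : ℂ}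
    (hz : z.im ≠ 0) : z • matC k (sdens Mp Mm p) z
      = matC (k + 1) (sdens Mp Mm p) z - coefS Mp Mm k p := by
  obtain ⟨c, -, hc⟩ := h.rhoBdd_sdens p
  rw [h.matC_succ hc hk hz, coefS]

theorem matC_sdens_mul (h : RHFlow σ r₁ r₂ M Mp Mm) (p : ℝ × ℝ) {z : ℂ} (hz : z.im ≠ 0) :
    matC 0 (sdens Mp Mm p) z * M p z = M p z * sigma3 - sigma3 * M p z := by
  rw [← h.sandwich_eq p hz, sub_mul, mul_assoc, adj_mul ((h.data p).det_eq_one hz), mul_one]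

theorem I_mul_im_ne {y : ℝ} (hy : 0 < y) : (I * (y : ℂ)).im ≠ 0 := by simpa using hy.ne'

/-- The relations between the coefficients of `M` and those of `M σ₃ M⁻¹`. -/
theorem coefS_eq (h : RHFlow σ r₁ r₂ M Mp Mm) (p : ℝ × ℝ) :
    coefS Mp Mm 0 p = sigma3 * coefM Mp Mm 0 p - coefM Mp Mm 0 p * sigma3 ∧
    coefS Mp Mm 1 p = sigma3 * coefM Mp Mm 1 p - coefM Mp Mm 1 p * sigma3
      - coefS Mp Mm 0 p * coefM Mp Mm 0 p ∧
    coefS Mp Mm 2 p = sigma3 * coefM Mp Mm 2 p - coefM Mp Mm 2 p * sigma3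
      - coefS Mp Mm 0 p * coefM Mp Mm 1 p - coefS Mp Mm 1 p * coefM Mp Mm 0 p := by
  obtain ⟨c, -, hc⟩ := h.rhoBdd_dens p
  obtain ⟨c', -, hc'⟩ := h.rhoBdd_sdens p
  have ta : ∀ k, k ≤ 3 → Tendsto (fun y : ℝ => matC k (dens Mp Mm p) (I * y)) atTop (𝓝 0) :=
    fun k hk => h.tendsto_matC hc hk
  have tb : ∀ k, k ≤ 3 → Tendsto (fun y : ℝ => matC k (sdens Mp Mm p) (I * y)) atTop (𝓝 0) :=
    fun k hk => h.tendsto_matC hc' hk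
  have ra : ∀ k, k ≤ 2 → ∀ y : ℝ, 0 < y → (I * (y : ℂ)) • matC k (dens Mp Mm p) (I * y)
      = matC (k + 1) (dens Mp Mm p) (I * y) + coefM Mp Mm k p :=
    fun k hk y hy => h.smul_matC_dens hk p (I_mul_im_ne hy)
  have rb : ∀ k, k ≤ 2 → ∀ y : ℝ, 0 < y → (I * (y : ℂ)) • matC k (sdens Mp Mm p) (I * y)
      = matC (k + 1) (sdens Mp Mm p) (I * y) - coefS Mp Mm k p :=
    fun k hk y hy => h.smul_matC_sdens hk p (I_mul_im_ne hy)
  set a : ℕ → ℝ → Mat2 := fun k y => matC k (dens Mp Mm p) (I * y) with ha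
  set b : ℕ → ℝ → Mat2 := fun k y => matC k (sdens Mp Mm p) (I * y) with hb
  set P := fun k => coefM Mp Mm k p
  set B := fun k => coefS Mp Mm k p
  have e0 : ∀ y : ℝ, 0 < y → b 0 y * (1 + a 0 y) = a 0 y * sigma3 - sigma3 * a 0 y := by
    intro y hy
    have h1 := h.matC_sdens_mul p (I_mul_im_ne hy)
    rw [h.eq_one_add_matC p (I_mul_im_ne hy)] at h1
    simp only [ha, hb]
    rw [h1]; noncomm_ring
  have e1 : ∀ y : ℝ, 0 < y → (b 1 y - B 0) * (1 + a 0 y)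
      = (a 1 y + P 0) * sigma3 - sigma3 * (a 1 y + P 0) := by
    intro y hy
    have r1 := rb 0 (by norm_num) y hy
    have r2 := ra 0 (by norm_num) y hy
    change _ = b 1 y - B 0 at r1
    change _ = a 1 y + P 0 at r2
    rw [← r1, ← r2]
    simp only [smul_mul_assoc, mul_smul_comm, ← smul_sub]
    rw [e0 y hy]
  have t0 := ta 0 (by norm_num); have t1 := ta 1 (by norm_num)
  have t2 := ta 2 (by norm_num); have t3 := ta 3 (by norm_num)
  have s1 := tb 1 (by norm_num); have s2 := tb 2 (by norm_num); have s3 := tb 3 (by norm_num)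
  have l1 : B 0 = sigma3 * P 0 - P 0 * sigma3 := by
    have u1 := ((s1.sub_const (B 0)).mul (t0.const_add 1))
    have u2 := (((t1.add_const (P 0)).mul_const sigma3).sub ((t1.add_const (P 0)).const_mul sigma3))
    have := tendsto_nhds_unique (u1.congr' (by
      filter_upwards [eventually_gt_atTop 0] with y hy using e1 y hy)) u2
    simp only [zero_sub, zero_add, add_zero, mul_one] at this
    rw [← neg_inj, this, neg_sub]
  have e1' : ∀ y : ℝ, 0 < y → b 1 y * (1 + a 0 y) - B 0 * a 0 y = a 1 y * sigma3 - sigma3 * a 1 y := by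
    intro y hy
    have : b 1 y * (1 + a 0 y) - B 0 * a 0 y = (b 1 y - B 0) * (1 + a 0 y) + B 0 := by noncomm_ring
    rw [this, e1 y hy, l1]; noncomm_ring
  have e2 : ∀ y : ℝ, 0 < y → (b 2 y - B 1) * (1 + a 0 y) - B 0 * (a 1 y + P 0)
      = (a 2 y + P 1) * sigma3 - sigma3 * (a 2 y + P 1) := by
    intro y hy
    have r1 := rb 1 (by norm_num) y hy
    have r2 := ra 0 (by norm_num) y hy
    have r3 := ra 1 (by norm_num) y hy
    change _ = b 2 y - B 1 at r1
    change _ = a 1 y + P 0 at r2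
    change _ = a 2 y + P 1 at r3
    rw [← r1, ← r2, ← r3]
    simp only [smul_mul_assoc, mul_smul_comm, ← smul_sub]
    rw [e1' y hy]
  have l2 : B 1 = sigma3 * P 1 - P 1 * sigma3 - B 0 * P 0 := by
    have u1 := ((s2.sub_const (B 1)).mul (t0.const_add 1)).sub ((t1.add_const (P 0)).const_mul (B 0))
    have u2 := (((t2.add_const (P 1)).mul_const sigma3).sub ((t2.add_const (P 1)).const_mul sigma3))
    have := tendsto_nhds_unique (u1.congr' (by
      filter_upwards [eventually_gt_atTop 0] with y hy using e2 y hy)) u2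
    simp only [zero_sub, zero_add, add_zero, mul_one] at this
    rw [← neg_inj, eq_add_of_sub_eq this]; abel
  have e2' : ∀ y : ℝ, 0 < y → b 2 y * (1 + a 0 y) - B 1 * a 0 y - B 0 * a 1 y
      = a 2 y * sigma3 - sigma3 * a 2 y := by
    intro y hy
    have : b 2 y * (1 + a 0 y) - B 1 * a 0 y - B 0 * a 1 y
      = ((b 2 y - B 1) * (1 + a 0 y) - B 0 * (a 1 y + P 0)) + B 1 + B 0 * P 0 := by noncomm_ring
    rw [this, e2 y hy, l2]; noncomm_ring
  have e3 : ∀ y : ℝ, 0 < y → (b 3 y - B 2) * (1 + a 0 y) - B 1 * (a 1 y + P 0) - B 0 * (a 2 y + P 1)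
      = (a 3 y + P 2) * sigma3 - sigma3 * (a 3 y + P 2) := by
    intro y hy
    have r1 := rb 2 (by norm_num) y hy
    have r2 := ra 0 (by norm_num) y hy
    have r3 := ra 1 (by norm_num) y hy
    have r4 := ra 2 (by norm_num) y hy
    change _ = b 3 y - B 2 at r1
    change _ = a 1 y + P 0 at r2
    change _ = a 2 y + P 1 at r3
    change _ = a 3 y + P 2 at r4
    rw [← r1, ← r2, ← r3, ← r4]
    simp only [smul_mul_assoc, mul_smul_comm, ← smul_sub]
    rw [e2' y hy]
  refine ⟨l1, l2, ?_⟩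
  have u1 := (((s3.sub_const (B 2)).mul (t0.const_add 1)).sub
    ((t1.add_const (P 0)).const_mul (B 1))).sub ((t2.add_const (P 1)).const_mul (B 0))
  have u2 := (((t3.add_const (P 2)).mul_const sigma3).sub ((t3.add_const (P 2)).const_mul sigma3))
  have := tendsto_nhds_unique (u1.congr' (by
    filter_upwards [eventually_gt_atTop 0] with y hy using e3 y hy)) u2
  simp only [zero_sub, zero_add, add_zero, mul_one] at this
  have h5 := eq_add_of_sub_eq (eq_add_of_sub_eq this)
  change B 2 = sigma3 * P 2 - P 2 * sigma3 - B 0 * P 1 - B 1 * P 0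
  rw [← neg_inj, h5]; abel

theorem sigma3_sq : sigma3 * sigma3 = 1 := by
  ext i j; fin_cases i <;> fin_cases j <;> simp [sigma3]

/-- The relations coming from `(M σ₃ M⁻¹) ^ 2 = 1`. -/
theorem coefS_anticomm (h : RHFlow σ r₁ r₂ M Mp Mm) (p : ℝ × ℝ) :
    sigma3 * coefS Mp Mm 0 p + coefS Mp Mm 0 p * sigma3 = 0 ∧
    sigma3 * coefS Mp Mm 1 p + coefS Mp Mm 1 p * sigma3 = coefS Mp Mm 0 p * coefS Mp Mm 0 p ∧
    sigma3 * coefS Mp Mm 2 p + coefS Mp Mm 2 p * sigma3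
      = coefS Mp Mm 1 p * coefS Mp Mm 0 p + coefS Mp Mm 0 p * coefS Mp Mm 1 p := by
  obtain ⟨c', -, hc'⟩ := h.rhoBdd_sdens p
  have tb : ∀ k, k ≤ 3 → Tendsto (fun y : ℝ => matC k (sdens Mp Mm p) (I * y)) atTop (𝓝 0) :=
    fun k hk => h.tendsto_matC hc' hk
  have rb : ∀ k, k ≤ 2 → ∀ y : ℝ, 0 < y → (I * (y : ℂ)) • matC k (sdens Mp Mm p) (I * y)
      = matC (k + 1) (sdens Mp Mm p) (I * y) - coefS Mp Mm k p :=
    fun k hk y hy => h.smul_matC_sdens hk p (I_mul_im_ne hy)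
  set b : ℕ → ℝ → Mat2 := fun k y => matC k (sdens Mp Mm p) (I * y) with hb
  set B := fun k => coefS Mp Mm k p
  -- The square of `M σ₃ M⁻¹ = σ₃ + b 0` is `1`. The expansion again proceeds by repeated
  -- multiplication with `z = i y`.
  have e0 : ∀ y : ℝ, 0 < y → b 0 y * b 0 y + (sigma3 * b 0 y + b 0 y * sigma3) = 0 := by
    intro y hy
    have hz := I_mul_im_ne hy
    have h1 := h.sandwich_eq p hz
    have hdet := adj_mul ((h.data p).det_eq_one hz)
    have hdet' := mul_adj ((h.data p).det_eq_one hz)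
    set N := M p (I * y)
    have e : b 0 y = N * sigma3 * N.adjugate - sigma3 := h1.symm
    have : b 0 y * b 0 y + (sigma3 * b 0 y + b 0 y * sigma3)
        = (b 0 y + sigma3) * (b 0 y + sigma3) - sigma3 * sigma3 := by noncomm_ring
    rw [this, e, sub_add_cancel]
    calc _ = N * sigma3 * (N.adjugate * N) * sigma3 * N.adjugate - sigma3 * sigma3 := by noncomm_ring
      _ = N * (sigma3 * sigma3) * N.adjugate - sigma3 * sigma3 := by rw [hdet]; noncomm_ring
      _ = 0 := by rw [sigma3_sq, mul_one, hdet', sub_self]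
  have s0 := tb 0 (by norm_num)
  have s1 := tb 1 (by norm_num); have s2 := tb 2 (by norm_num); have s3 := tb 3 (by norm_num)
  have e1 : ∀ y : ℝ, 0 < y → (b 1 y - B 0) * b 0 y
      + (sigma3 * (b 1 y - B 0) + (b 1 y - B 0) * sigma3) = 0 := by
    intro y hy
    have r1 := rb 0 (by norm_num) y hy
    change _ = b 1 y - B 0 at r1
    rw [← r1]
    simp only [smul_mul_assoc, mul_smul_comm, ← smul_add]
    rw [e0 y hy, smul_zero]
  have l1 : sigma3 * B 0 + B 0 * sigma3 = 0 := by
    have u1 := ((s1.sub_const (B 0)).mul s0).add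
      (((s1.sub_const (B 0)).const_mul sigma3).add ((s1.sub_const (B 0)).mul_const sigma3))
    have := tendsto_nhds_unique (u1.congr' (by
      filter_upwards [eventually_gt_atTop 0] with y hy using e1 y hy)) tendsto_const_nhds
    simp only [zero_sub, mul_zero, zero_add, mul_neg, neg_mul] at this
    rw [← neg_inj, neg_add, this, neg_zero]
  have e1' : ∀ y : ℝ, 0 < y → b 1 y * b 0 y - B 0 * b 0 y
      + (sigma3 * b 1 y + b 1 y * sigma3) = 0 := by
    intro y hy
    have : b 1 y * b 0 y - B 0 * b 0 y + (sigma3 * b 1 y + b 1 y * sigma3)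
      = ((b 1 y - B 0) * b 0 y + (sigma3 * (b 1 y - B 0) + (b 1 y - B 0) * sigma3))
        + (sigma3 * B 0 + B 0 * sigma3) := by noncomm_ring
    rw [this, e1 y hy, l1, add_zero]
  have e2 : ∀ y : ℝ, 0 < y → (b 2 y - B 1) * b 0 y - B 0 * (b 1 y - B 0)
      + (sigma3 * (b 2 y - B 1) + (b 2 y - B 1) * sigma3) = 0 := by
    intro y hy
    have r1 := rb 1 (by norm_num) y hy
    have r0 := rb 0 (by norm_num) y hy
    change _ = b 2 y - B 1 at r1
    change _ = b 1 y - B 0 at r0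
    rw [← r1, ← r0]
    simp only [smul_mul_assoc, mul_smul_comm, ← smul_add, ← smul_sub]
    rw [e1' y hy, smul_zero]
  have l2 : sigma3 * B 1 + B 1 * sigma3 = B 0 * B 0 := by
    have u1 := (((s2.sub_const (B 1)).mul s0).sub ((s1.sub_const (B 0)).const_mul (B 0))).add
      (((s2.sub_const (B 1)).const_mul sigma3).add ((s2.sub_const (B 1)).mul_const sigma3))
    have := tendsto_nhds_unique (u1.congr' (by
      filter_upwards [eventually_gt_atTop 0] with y hy using e2 y hy)) tendsto_const_nhds
    simp only [zero_sub, mul_zero, mul_neg, neg_mul, neg_neg] at this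
    rw [← neg_add, ← sub_eq_add_neg, sub_eq_zero] at this
    exact this.symm
  have e2' : ∀ y : ℝ, 0 < y → b 2 y * b 0 y - B 1 * b 0 y - B 0 * b 1 y
      + (sigma3 * b 2 y + b 2 y * sigma3) = 0 := by
    intro y hy
    have : b 2 y * b 0 y - B 1 * b 0 y - B 0 * b 1 y + (sigma3 * b 2 y + b 2 y * sigma3)
      = ((b 2 y - B 1) * b 0 y - B 0 * (b 1 y - B 0)
      + (sigma3 * (b 2 y - B 1) + (b 2 y - B 1) * sigma3))
        + ((sigma3 * B 1 + B 1 * sigma3) - B 0 * B 0) := by noncomm_ring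
    rw [this, e2 y hy, l2, sub_self, add_zero]
  have e3 : ∀ y : ℝ, 0 < y → (b 3 y - B 2) * b 0 y - B 1 * (b 1 y - B 0) - B 0 * (b 2 y - B 1)
      + (sigma3 * (b 3 y - B 2) + (b 3 y - B 2) * sigma3) = 0 := by
    intro y hy
    have r2 := rb 2 (by norm_num) y hy
    have r1 := rb 1 (by norm_num) y hy
    have r0 := rb 0 (by norm_num) y hy
    change _ = b 3 y - B 2 at r2
    change _ = b 2 y - B 1 at r1
    change _ = b 1 y - B 0 at r0
    rw [← r2, ← r1, ← r0]
    simp only [smul_mul_assoc, mul_smul_comm, ← smul_add, ← smul_sub]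
    rw [e2' y hy, smul_zero]
  refine ⟨l1, l2, ?_⟩
  have u1 := ((((s3.sub_const (B 2)).mul s0).sub ((s1.sub_const (B 0)).const_mul (B 1))).sub
      ((s2.sub_const (B 1)).const_mul (B 0))).add
      (((s3.sub_const (B 2)).const_mul sigma3).add ((s3.sub_const (B 2)).mul_const sigma3))
  have := tendsto_nhds_unique (u1.congr' (by
    filter_upwards [eventually_gt_atTop 0] with y hy using e3 y hy)) tendsto_const_nhds
  simp only [zero_sub, mul_zero, mul_neg, neg_mul, sub_neg_eq_add, zero_add] at this
  rw [← neg_add, ← sub_eq_add_neg, sub_eq_zero] at this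
  exact this.symm

/-! ### Derivatives of the solution and of its coefficients -/

/-- The density carries one factor `s`. Writing `C_k` for the Cauchy integral of `s^k` times the
jump of `M σ₃ M⁻¹`, one has `C₁ = z C₀ + B₀` and `C₀ M = M σ₃ - σ₃ M`. -/
theorem hasDerivAt_fst (h : RHFlow σ r₁ r₂ M Mp Mm) (p : ℝ × ℝ) {z : ℂ} (hz : z.im ≠ 0)
    (i j : Fin 2) : HasDerivAt (fun x => M (x, p.2) z i j)
      (((I * z) • comm2 sigma3 (M p z) - I • (coefS Mp Mm 0 p * M p z)) i j) p.1 := by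
  have key := h.hasDerivAt_path (c := 1) (k := 1) (by norm_num) (γ := fun t => (p.1 + t, p.2))
    (p := p) (by simp) (by fun_prop) (fun t s => by simp only [theta]; ring) hz i j
  rw [← sub_self p.1] at key
  have h2 := key.comp_sub_const p.1 p.1
  simp only [add_sub_cancel] at h2
  refine h2.congr_deriv ?_
  have e1 := h.smul_matC_sdens (k := 0) (by norm_num) p hz
  rw [eq_sub_iff_add_eq, zero_add] at e1
  rw [← e1, add_mul, smul_mul_assoc, h.matC_sdens_mul p hz, comm2]
  simp only [Matrix.smul_apply, Matrix.add_apply, Matrix.sub_apply, smul_eq_mul]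
  push_cast; ring

/-- The same with `s³`: `C₃ = z³ C₀ + z² B₀ + z B₁ + B₂`. -/
theorem hasDerivAt_snd (h : RHFlow σ r₁ r₂ M Mp Mm) (p : ℝ × ℝ) {z : ℂ} (hz : z.im ≠ 0)
    (i j : Fin 2) : HasDerivAt (fun t => M (p.1, t) z i j)
      (((4 * I * z ^ 3) • comm2 sigma3 (M p z) - (4 * I) •
        ((z ^ 2 • coefS Mp Mm 0 p + z • coefS Mp Mm 1 p + coefS Mp Mm 2 p) * M p z)) i j) p.2 := by
  have key := h.hasDerivAt_path (c := 4) (k := 3) (by norm_num) (γ := fun t => (p.1, p.2 + t))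
    (p := p) (by simp) (by fun_prop) (fun t s => by simp only [theta]; ring) hz i j
  rw [← sub_self p.2] at key
  have h2 := key.comp_sub_const p.2 p.2
  simp only [add_sub_cancel] at h2
  refine h2.congr_deriv ?_
  have e1 := h.smul_matC_sdens (k := 0) (by norm_num) p hz
  have e2 := h.smul_matC_sdens (k := 1) (by norm_num) p hz
  have e3 := h.smul_matC_sdens (k := 2) (by norm_num) p hz
  rw [eq_sub_iff_add_eq] at e1 e2 e3
  norm_num at e1 e2 e3
  have e : matC 3 (sdens Mp Mm p) z * M p z = z ^ 3 • (M p z * sigma3 - sigma3 * M p z)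
      + (z ^ 2 • coefS Mp Mm 0 p + z • coefS Mp Mm 1 p + coefS Mp Mm 2 p) * M p z := by
    rw [← h.matC_sdens_mul p hz, ← smul_mul_assoc, ← add_mul, ← e3, ← e2, ← e1]
    congr 1
    module
  rw [e, comm2]
  simp only [Matrix.smul_apply, Matrix.add_apply, Matrix.sub_apply, smul_eq_mul]
  push_cast; ring

/-- The coefficients at infinity are limits of functions of `M(i y)`, whose `x`-derivatives are
known. Locally uniform convergence of those derivatives makes the coefficients differentiable
without differentiating the boundary values. -/
theorem hasDerivAt_of_limit {f f' : ℝ → ℝ → ℂ} {g g' : ℝ → ℂ} {x : ℝ}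
    (hf : ∀ y > 0, ∀ x, HasDerivAt (f y) (f' y x) x)
    (hg : ∀ x, Tendsto (fun y => f y x) atTop (𝓝 (g x)))
    (hu : Tendsto (fun n : ℝ × ℝ => f' n.1 n.2 - g' n.2) (atTop ×ˢ 𝓝 x) (𝓝 0)) :
    HasDerivAt g (g' x) x := by
  refine hasDerivAt_of_tendstoUniformlyOnFilter (l := atTop) (f := f) (f' := f') ?_ ?_
    (Eventually.of_forall hg)
  · rw [Metric.tendstoUniformlyOnFilter_iff]
    intro ε hε
    filter_upwards [(Metric.tendsto_nhds.1 hu) ε hε] with n hn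
    rw [dist_comm, dist_eq_norm]
    simpa using hn
  · have : ∀ᶠ n : ℝ × ℝ in atTop ×ˢ 𝓝 x, 0 < n.1 :=
      tendsto_fst.eventually (eventually_gt_atTop 0)
    filter_upwards [this] with n hn using hf n.1 hn n.2

theorem tendsto_matC_prod (h : RHFlow σ r₁ r₂ M Mp Mm) {k : ℕ} (hk : k ≤ 3) (q : ℝ × ℝ) :
    Tendsto (fun n : ℝ × (ℝ × ℝ) => matC k (dens Mp Mm n.2) (I * n.1)) (atTop ×ˢ 𝓝 q) (𝓝 0) := by
  refine tendsto_pi_nhds.2 fun i => tendsto_pi_nhds.2 fun j => ?_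
  have := h.tendstoUniformly_matC hk q i j
  rw [Metric.tendstoUniformlyOnFilter_iff] at this
  rw [Metric.tendsto_nhds]
  intro ε hε
  filter_upwards [this ε hε] with n hn
  rw [dist_comm]
  simpa using hn

theorem tendsto_matC_line (h : RHFlow σ r₁ r₂ M Mp Mm) {k : ℕ} (hk : k ≤ 3) (q₁ q₂ : ℝ) :
    Tendsto (fun n : ℝ × ℝ => matC k (dens Mp Mm (n.2, q₂)) (I * n.1)) (atTop ×ˢ 𝓝 q₁)
      (𝓝 0) := by
  have h0 : Tendsto (fun x : ℝ => (x, q₂)) (𝓝 q₁) (𝓝 (q₁, q₂)) :=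
    (by fun_prop : Continuous fun x : ℝ => (x, q₂)).tendsto q₁
  have h1 : Tendsto (fun n : ℝ × ℝ => (n.1, (n.2, q₂))) (atTop ×ˢ 𝓝 q₁)
      (atTop ×ˢ 𝓝 (q₁, q₂)) := tendsto_fst.prodMk (h0.comp tendsto_snd)
  have h2 := h.tendsto_matC_prod hk (q₁, q₂)
  have gen : ∀ K : ℝ × (ℝ × ℝ) → Mat2, Tendsto K (atTop ×ˢ 𝓝 (q₁, q₂)) (𝓝 0) →
      Tendsto (fun n : ℝ × ℝ => K (n.1, (n.2, q₂))) (atTop ×ˢ 𝓝 q₁) (𝓝 0) :=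
    fun K hK => hK.comp h1
  have h3 := gen _ h2
  dsimp only at h3
  exact h3

theorem continuous_coefS0 (h : RHFlow σ r₁ r₂ M Mp Mm) : Continuous (coefS Mp Mm 0) := by
  have e : coefS Mp Mm 0 = fun p => sigma3 * coefM Mp Mm 0 p - coefM Mp Mm 0 p * sigma3 :=
    funext fun p => (h.coefS_eq p).1
  have := h.continuous_coefM (k := 0) (by norm_num)
  rw [e]
  exact (continuous_const.mul this).sub (this.mul continuous_const)

/-- The term of order `z` cancels by the first relation of `coefS_eq`. What remains is a constant in
`z` plus Cauchy integrals that decay along the imaginary axis. -/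
theorem hasDerivAt_smul_sub_one (h : RHFlow σ r₁ r₂ M Mp Mm) (p : ℝ × ℝ) {z : ℂ} (hz : z.im ≠ 0)
    (i j : Fin 2) : HasDerivAt (fun x => z * (M (x, p.2) z i j - (1 : Mat2) i j))
      ((I • (coefS Mp Mm 1 p + (sigma3 * matC 2 (dens Mp Mm p) z - matC 2 (dens Mp Mm p) z * sigma3
        - coefS Mp Mm 0 p * matC 1 (dens Mp Mm p) z))) i j) p.1 := by
  refine (((h.hasDerivAt_fst p hz i j).sub_const ((1 : Mat2) i j)).const_mul z).congr_deriv ?_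
  obtain ⟨c0, c1, -⟩ := h.coefS_eq p
  have e1 := h.smul_matC_dens (k := 0) (by norm_num) p hz
  have e2 := h.smul_matC_dens (k := 1) (by norm_num) p hz
  rw [← sub_eq_iff_eq_add] at e1 e2
  norm_num at e1 e2
  have : (I * z) • comm2 sigma3 (M p z) - I • (coefS Mp Mm 0 p * M p z)
      = I • (z • (sigma3 * matC 0 (dens Mp Mm p) z - matC 0 (dens Mp Mm p) z * sigma3)
        - coefS Mp Mm 0 p * (1 + matC 0 (dens Mp Mm p) z)) := by
    rw [h.eq_one_add_matC p hz, comm2, mul_smul, ← smul_sub]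
    congr 3
    rw [mul_add, add_mul, mul_one, one_mul]
    abel
  rw [this, ← smul_eq_mul, ← Matrix.smul_apply]
  rw [smul_comm z I]
  have e3 : z • matC 0 (dens Mp Mm p) z = matC 1 (dens Mp Mm p) z + coefM Mp Mm 0 p := by
    rw [← e1, sub_add_cancel]
  have e4 : z • matC 1 (dens Mp Mm p) z = matC 2 (dens Mp Mm p) z + coefM Mp Mm 1 p := by
    rw [← e2, sub_add_cancel]
  rw [smul_sub z, smul_sub z, smul_sub z, ← mul_smul_comm z sigma3, ← smul_mul_assoc z _ sigma3,
    ← mul_smul_comm z (coefS Mp Mm 0 p), smul_add z, e3]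
  have e5 : z • (sigma3 * (matC 1 (dens Mp Mm p) z + coefM Mp Mm 0 p))
        - z • ((matC 1 (dens Mp Mm p) z + coefM Mp Mm 0 p) * sigma3)
      = sigma3 * (z • matC 1 (dens Mp Mm p) z) - (z • matC 1 (dens Mp Mm p) z) * sigma3
        + z • coefS Mp Mm 0 p := by
    rw [c0, mul_smul_comm, smul_mul_assoc, mul_add, add_mul, smul_add, smul_add, smul_sub]; abel
  rw [e5, e4, c1, mul_add (coefS Mp Mm 0 p), mul_smul_comm, mul_one]
  noncomm_ring

/-- Passage to the limit `z = i y → ∞` in the derivative of `z (M - 1)`. -/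
theorem hasDerivAt_coefM0 (h : RHFlow σ r₁ r₂ M Mp Mm) (p : ℝ × ℝ) (i j : Fin 2) :
    HasDerivAt (fun x => coefM Mp Mm 0 (x, p.2) i j) ((I • coefS Mp Mm 1 p) i j) p.1 := by
  set R : ℝ → ℝ → Mat2 := fun y x => sigma3 * matC 2 (dens Mp Mm (x, p.2)) (I * y)
      - matC 2 (dens Mp Mm (x, p.2)) (I * y) * sigma3
      - coefS Mp Mm 0 (x, p.2) * matC 1 (dens Mp Mm (x, p.2)) (I * y) with hR
  have hcont : Tendsto (fun n : ℝ × ℝ => coefS Mp Mm 0 (n.2, p.2)) (atTop ×ˢ 𝓝 p.1)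
      (𝓝 (coefS Mp Mm 0 p)) := by
    have : Continuous fun x => coefS Mp Mm 0 (x, p.2) := h.continuous_coefS0.comp (by fun_prop)
    exact (this.tendsto p.1).comp tendsto_snd
  have hRt : Tendsto (fun n : ℝ × ℝ => R n.1 n.2) (atTop ×ˢ 𝓝 p.1) (𝓝 0) := by
    have h1 := h.tendsto_matC_line (k := 1) (by norm_num) p.1 p.2
    have h2 := h.tendsto_matC_line (k := 2) (by norm_num) p.1 p.2
    simpa using ((h2.const_mul sigma3).sub (h2.mul_const sigma3)).sub (hcont.mul h1)
  refine hasDerivAt_of_limit (f := fun y x => (I * (y : ℂ)) * (M (x, p.2) (I * y) i j - (1 : Mat2) i j))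
    (f' := fun y x => (I • (coefS Mp Mm 1 (x, p.2) + R y x)) i j)
    (g' := fun x => (I • coefS Mp Mm 1 (x, p.2)) i j) (fun y hy x => ?_) (fun x => ?_) ?_
  · exact h.hasDerivAt_smul_sub_one (x, p.2) (I_mul_im_ne hy) i j
  · obtain ⟨c, -, hc⟩ := h.rhoBdd_dens (x, p.2)
    have h1 := (h.tendsto_matC hc (k := 1) (by norm_num)).add_const (coefM Mp Mm 0 (x, p.2))
    rw [zero_add] at h1
    have h2 := (tendsto_pi_nhds.1 ((tendsto_pi_nhds.1 h1) i)) j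
    refine h2.congr' ?_
    filter_upwards [eventually_gt_atTop 0] with y hy
    have := h.smul_matC_dens (k := 0) (by norm_num) (x, p.2) (I_mul_im_ne hy)
    rw [h.eq_one_add_matC (x, p.2) (I_mul_im_ne hy)]
    have h3 := congrFun (congrFun this i) j
    simp only [Matrix.add_apply, Matrix.smul_apply, smul_eq_mul] at h3 ⊢
    rw [add_sub_cancel_left, h3]
  · have h2 := ((tendsto_pi_nhds.1 ((tendsto_pi_nhds.1 hRt) i)) j).const_mul I
    simp only [Matrix.zero_apply, mul_zero] at h2
    refine h2.congr fun n => ?_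
    simp only [Matrix.smul_apply, Matrix.add_apply, smul_eq_mul]
    ring

/-- Passage to the limit in the derivative of `z (z (M - 1) - P₀)`, where `P₀` is the first
coefficient of `M`. The remainder involves `s³`, the highest power covered by the decay estimates,
so the next coefficient is not treated in this way. -/
theorem hasDerivAt_coefM1 (h : RHFlow σ r₁ r₂ M Mp Mm) (p : ℝ × ℝ) (i j : Fin 2) :
    HasDerivAt (fun x => coefM Mp Mm 1 (x, p.2) i j)
      ((I • (coefS Mp Mm 2 p + coefS Mp Mm 1 p * coefM Mp Mm 0 p)) i j) p.1 := by
  set R : ℝ → ℝ → Mat2 := fun y x => sigma3 * matC 3 (dens Mp Mm (x, p.2)) (I * y)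
      - matC 3 (dens Mp Mm (x, p.2)) (I * y) * sigma3
      - coefS Mp Mm 0 (x, p.2) * matC 2 (dens Mp Mm (x, p.2)) (I * y) with hR
  have hcont : Tendsto (fun n : ℝ × ℝ => coefS Mp Mm 0 (n.2, p.2)) (atTop ×ˢ 𝓝 p.1)
      (𝓝 (coefS Mp Mm 0 p)) := by
    have : Continuous fun x => coefS Mp Mm 0 (x, p.2) := h.continuous_coefS0.comp (by fun_prop)
    exact (this.tendsto p.1).comp tendsto_snd
  have hRt : Tendsto (fun n : ℝ × ℝ => R n.1 n.2) (atTop ×ˢ 𝓝 p.1) (𝓝 0) := by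
    have h1 := h.tendsto_matC_line (k := 2) (by norm_num) p.1 p.2
    have h2 := h.tendsto_matC_line (k := 3) (by norm_num) p.1 p.2
    simpa using ((h2.const_mul sigma3).sub (h2.mul_const sigma3)).sub (hcont.mul h1)
  refine hasDerivAt_of_limit (f := fun y x => (I * (y : ℂ)) *
      ((I * (y : ℂ)) * (M (x, p.2) (I * y) i j - (1 : Mat2) i j) - coefM Mp Mm 0 (x, p.2) i j))
    (f' := fun y x => (I • (coefS Mp Mm 2 (x, p.2)
      + coefS Mp Mm 1 (x, p.2) * coefM Mp Mm 0 (x, p.2) + R y x)) i j)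
    (g' := fun x => (I • (coefS Mp Mm 2 (x, p.2)
      + coefS Mp Mm 1 (x, p.2) * coefM Mp Mm 0 (x, p.2))) i j) (fun y hy x => ?_) (fun x => ?_) ?_
  · have hz := I_mul_im_ne hy
    refine (((h.hasDerivAt_smul_sub_one (x, p.2) hz i j).sub
      (h.hasDerivAt_coefM0 (x, p.2) i j)).const_mul (I * (y : ℂ))).congr_deriv ?_
    have e2 := h.smul_matC_dens (k := 1) (by norm_num) (x, p.2) hz
    have e3 := h.smul_matC_dens (k := 2) (by norm_num) (x, p.2) hz
    obtain ⟨-, -, c2⟩ := h.coefS_eq (x, p.2)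
    rw [← Matrix.sub_apply, ← smul_eq_mul, ← Matrix.smul_apply, ← smul_sub, add_sub_cancel_left,
      smul_comm _ I]
    have e4 : ∀ A B C : Mat2, (I * (y : ℂ)) • (sigma3 * A - A * sigma3 - C * B)
        = sigma3 * ((I * (y : ℂ)) • A) - ((I * (y : ℂ)) • A) * sigma3
          - C * ((I * (y : ℂ)) • B) := by
      intro A B C
      rw [smul_sub, smul_sub, mul_smul_comm, mul_smul_comm, smul_mul_assoc]
    norm_num at e2 e3
    rw [e4, e2, e3, c2]
    simp only [hR]
    noncomm_ring
  · obtain ⟨c, -, hc⟩ := h.rhoBdd_dens (x, p.2)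
    have h1 := (h.tendsto_matC hc (k := 2) (by norm_num)).add_const (coefM Mp Mm 1 (x, p.2))
    rw [zero_add] at h1
    have h2 := (tendsto_pi_nhds.1 ((tendsto_pi_nhds.1 h1) i)) j
    refine h2.congr' ?_
    filter_upwards [eventually_gt_atTop 0] with y hy
    have e1 := h.smul_matC_dens (k := 0) (by norm_num) (x, p.2) (I_mul_im_ne hy)
    have e2 := h.smul_matC_dens (k := 1) (by norm_num) (x, p.2) (I_mul_im_ne hy)
    rw [h.eq_one_add_matC (x, p.2) (I_mul_im_ne hy)]
    have h3 := congrFun (congrFun e1 i) j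
    have h4 := congrFun (congrFun e2 i) j
    simp only [Matrix.add_apply, Matrix.smul_apply, smul_eq_mul] at h3 h4 ⊢
    rw [add_sub_cancel_left, h3, add_sub_cancel_right, h4]
  · have h2 := ((tendsto_pi_nhds.1 ((tendsto_pi_nhds.1 hRt) i)) j).const_mul I
    simp only [Matrix.zero_apply, mul_zero] at h2
    refine h2.congr fun n => ?_
    simp only [Matrix.smul_apply, Matrix.add_apply, smul_eq_mul]
    ring

end RHFlow

/-! ### The matrices of the Lax pair in terms of the potential -/

/-- The algebraic identity behind the coefficient of the `t`-equation. -/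
theorem lax_coefficient_identity {B₀ B₁ B₂ : Mat2} (h0 : sigma3 * B₀ + B₀ * sigma3 = 0)
    (h1 : sigma3 * B₁ + B₁ * sigma3 = B₀ * B₀)
    (h2 : sigma3 * B₂ + B₂ * sigma3 = B₁ * B₀ + B₀ * B₁) (z : ℂ) :
    (4 * z ^ 2) • ((-I) • B₀)
      + (2 * I * z) • ((comm2 sigma3 B₁ + ((-I) • B₀) ^ 2) * sigma3)
      + (2 : ℂ) • ((-I) • B₀) ^ 3 - I • comm2 sigma3 (comm2 sigma3 B₂ + comm2 B₁ B₀)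
      + comm2 (comm2 sigma3 B₁) ((-I) • B₀)
    = (-(4 * I)) • (z ^ 2 • B₀ + z • B₁ + B₂) := by
  -- The left side is the `t`-coefficient with `Q = -i B₀`, `Q_x = [σ₃, B₁]` and `Q_xx = i [σ₃, [σ₃,
  -- B₂] + [B₁, B₀]]`. The anticommutators and `σ₃² = 1` move every `σ₃` to the right, after which
  -- the cubic terms and those with a trailing `σ₃` cancel.
  have k1 : sigma3 * B₁ * sigma3 = B₀ * B₀ * sigma3 - B₁ := by
    rw [← h1, add_mul, mul_assoc B₁, RHFlow.sigma3_sq]; noncomm_ring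
  have k2 : comm2 sigma3 B₁ = B₀ * B₀ - (2 : ℂ) • (B₁ * sigma3) := by
    rw [← h1, comm2]; module
  have k3 : sigma3 * B₂ = B₁ * B₀ + B₀ * B₁ - B₂ * sigma3 := eq_sub_of_add_eq h2
  have k0 : sigma3 * B₀ = - (B₀ * sigma3) := eq_neg_of_add_eq_zero_left h0
  have k1' : sigma3 * B₁ = B₀ * B₀ - B₁ * sigma3 := eq_sub_of_add_eq h1
  have q2 : ((-I) • B₀) ^ 2 = - (B₀ * B₀) := by
    rw [pow_two, smul_mul_smul_comm]; simp
  have q3 : ((-I) • B₀) ^ 3 = I • (B₀ * B₀ * B₀) := by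
    rw [pow_succ, q2, mul_smul_comm]; simp
  have z1 : (comm2 sigma3 B₁ + ((-I) • B₀) ^ 2) * sigma3 = (-2 : ℂ) • B₁ := by
    rw [q2, comm2, add_mul, sub_mul, k1, mul_assoc B₁, RHFlow.sigma3_sq, mul_one, neg_mul]
    module
  have c1 : comm2 (comm2 sigma3 B₁) B₀ = (2 : ℂ) • ((B₁ * B₀ + B₀ * B₁) * sigma3) := by
    have : B₁ * sigma3 * B₀ = - (B₁ * B₀ * sigma3) := by
      rw [mul_assoc, k0, mul_neg, mul_assoc]
    rw [comm2, k2, sub_mul, mul_sub, smul_mul_assoc, mul_smul_comm, this, add_mul, ← mul_assoc,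
      ← mul_assoc]
    module
  have c2 : comm2 sigma3 (comm2 B₁ B₀)
      = (2 : ℂ) • (B₀ * B₀ * B₀) := by
    have e1 : sigma3 * (B₁ * B₀) = B₀ * B₀ * B₀ + B₁ * B₀ * sigma3 := by
      rw [← mul_assoc, k1', sub_mul, mul_assoc B₁, k0, mul_neg, mul_assoc B₁]; abel
    have e2 : sigma3 * (B₀ * B₁) = - (B₀ * B₀ * B₀) + B₀ * B₁ * sigma3 := by
      rw [← mul_assoc, k0, neg_mul, mul_assoc B₀, k1', mul_sub]; noncomm_ring
    rw [comm2, comm2, mul_sub, sub_mul, e1, e2]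
    module
  have c3 : comm2 sigma3 (comm2 sigma3 B₂) = (4 : ℂ) • B₂ - (2 : ℂ) • ((B₁ * B₀ + B₀ * B₁) * sigma3) := by
    have e1 : sigma3 * B₂ * sigma3 = (B₁ * B₀ + B₀ * B₁) * sigma3 - B₂ := by
      rw [k3, sub_mul, mul_assoc B₂, RHFlow.sigma3_sq, mul_one]
    have : comm2 sigma3 (comm2 sigma3 B₂) = sigma3 * sigma3 * B₂ + B₂ * (sigma3 * sigma3)
        - (2 : ℂ) • (sigma3 * B₂ * sigma3) := by
      rw [comm2, comm2, mul_sub, sub_mul, ← mul_assoc, ← mul_assoc, mul_assoc B₂]; module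
    rw [this, RHFlow.sigma3_sq, e1, one_mul, mul_one]
    module
  have c4 : comm2 sigma3 (comm2 sigma3 B₂ + comm2 B₁ B₀)
      = comm2 sigma3 (comm2 sigma3 B₂) + comm2 sigma3 (comm2 B₁ B₀) := by
    simp only [comm2]; noncomm_ring
  have c5 : comm2 (comm2 sigma3 B₁) ((-I) • B₀) = (-I) • comm2 (comm2 sigma3 B₁) B₀ := by
    simp only [comm2, mul_smul_comm, smul_mul_assoc, smul_sub]
  rw [z1, q3, c5, c4, c3, c2, c1]
  module

namespace RHFlow

variable {σ : ℝ} {r₁ r₂ : ℝ → ℂ} {M : ℝ × ℝ → ℂ → Mat2} {Mp Mm : ℝ × ℝ → ℝ → Mat2}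

theorem continuous_coefS (h : RHFlow σ r₁ r₂ M Mp Mm) {k : ℕ} (hk : k ≤ 2) :
    Continuous (coefS Mp Mm k) := by
  have m0 := h.continuous_coefM (k := 0) (by norm_num)
  have m1 := h.continuous_coefM (k := 1) (by norm_num)
  have m2 := h.continuous_coefM (k := 2) (by norm_num)
  have c0 := h.continuous_coefS0
  have c1 : Continuous (coefS Mp Mm 1) := by
    rw [funext fun p => (h.coefS_eq p).2.1]
    exact ((continuous_const.mul m1).sub (m1.mul continuous_const)).sub (c0.mul m0)
  have c2 : Continuous (coefS Mp Mm 2) := by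
    rw [funext fun p => (h.coefS_eq p).2.2]
    exact (((continuous_const.mul m2).sub (m2.mul continuous_const)).sub (c0.mul m1)).sub (c1.mul m0)
  interval_cases k <;> assumption

theorem hasDerivAt_matrix_mul {F G : ℝ → Mat2} {F' G' : Mat2} {x : ℝ}
    (hF : ∀ i j, HasDerivAt (fun y => F y i j) (F' i j) x)
    (hG : ∀ i j, HasDerivAt (fun y => G y i j) (G' i j) x) (i j : Fin 2) :
    HasDerivAt (fun y => (F y * G y) i j) ((F' * G x + F x * G') i j) x := by
  simp only [Matrix.add_apply, mul_apply2]
  refine (((hF i 0).mul (hG 0 j)).add ((hF i 1).mul (hG 1 j))).congr_deriv ?_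
  ring

theorem comm2_smul (A B : Mat2) (c : ℂ) : comm2 A (c • B) = c • comm2 A B := by
  rw [comm2, comm2, mul_smul_comm, smul_mul_assoc, smul_sub]

theorem hasDerivAt_comm_sigma3 {F : ℝ → Mat2} {F' : Mat2} {x : ℝ}
    (hF : ∀ i j, HasDerivAt (fun y => F y i j) (F' i j) x) (i j : Fin 2) :
    HasDerivAt (fun y => comm2 sigma3 (F y) i j) (comm2 sigma3 F' i j) x := by
  simp only [comm2, Matrix.sub_apply, mul_apply2]
  exact (((hF 0 j).const_mul _).add ((hF 1 j).const_mul _)).sub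
    (((hF i 0).mul_const _).add ((hF i 1).mul_const _))

theorem hasDerivAt_coefS0 (h : RHFlow σ r₁ r₂ M Mp Mm) (p : ℝ × ℝ) (i j : Fin 2) :
    HasDerivAt (fun x => coefS Mp Mm 0 (x, p.2) i j) ((I • comm2 sigma3 (coefS Mp Mm 1 p)) i j)
      p.1 := by
  rw [← comm2_smul, show (fun x => coefS Mp Mm 0 (x, p.2) i j)
    = fun x => comm2 sigma3 (coefM Mp Mm 0 (x, p.2)) i j from
    funext fun x => by rw [(h.coefS_eq (x, p.2)).1, comm2]]
  exact hasDerivAt_comm_sigma3 (h.hasDerivAt_coefM0 p) i j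

theorem hasDerivAt_coefS1 (h : RHFlow σ r₁ r₂ M Mp Mm) (p : ℝ × ℝ) (i j : Fin 2) :
    HasDerivAt (fun x => coefS Mp Mm 1 (x, p.2) i j)
      ((I • (comm2 sigma3 (coefS Mp Mm 2 p) + comm2 (coefS Mp Mm 1 p) (coefS Mp Mm 0 p))) i j)
      p.1 := by
  rw [show (fun x => coefS Mp Mm 1 (x, p.2) i j) = fun x => comm2 sigma3 (coefM Mp Mm 1 (x, p.2)) i j
      - (coefS Mp Mm 0 (x, p.2) * coefM Mp Mm 0 (x, p.2)) i j from
    funext fun x => by rw [(h.coefS_eq (x, p.2)).2.1, comm2, ← Matrix.sub_apply]]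
  refine ((hasDerivAt_comm_sigma3 (h.hasDerivAt_coefM1 p) i j).sub
    (hasDerivAt_matrix_mul (h.hasDerivAt_coefS0 p) (h.hasDerivAt_coefM0 p) i j)).congr_deriv ?_
  -- Writing `B₀ = [σ₃, P₀]` combines the terms with `P₀` into `B₁ B₀`. The coefficients of `M`
  -- thereby drop out of the derivative of `B₁`.
  have e0 : coefS Mp Mm 1 p * coefS Mp Mm 0 p = coefS Mp Mm 1 p * (sigma3 * coefM Mp Mm 0 p)
      - coefS Mp Mm 1 p * (coefM Mp Mm 0 p * sigma3) := by
    rw [← mul_sub, (h.coefS_eq p).1]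
  rw [← Matrix.sub_apply]
  have e : comm2 sigma3 (I • (coefS Mp Mm 2 p + coefS Mp Mm 1 p * coefM Mp Mm 0 p))
      - (I • comm2 sigma3 (coefS Mp Mm 1 p) * coefM Mp Mm 0 p
        + coefS Mp Mm 0 p * I • coefS Mp Mm 1 p)
      = I • (comm2 sigma3 (coefS Mp Mm 2 p) + comm2 (coefS Mp Mm 1 p) (coefS Mp Mm 0 p)) := by
    rw [comm2_smul, smul_mul_assoc, mul_smul_comm, ← smul_add, ← smul_sub]
    congr 1
    simp only [comm2]
    rw [e0]
    noncomm_ring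
  rw [← e]

/-- `u` is the potential reconstructed from the flow. -/
def IsPotential (σ : ℝ) (Mp Mm : ℝ × ℝ → ℝ → Mat2) (u : ℝ → ℝ → ℝ) : Prop :=
  ∀ x t, laxQ σ u x t = (-I) • coefS Mp Mm 0 (x, t)

variable {u : ℝ → ℝ → ℝ}

theorem laxQ_eq (hu : IsPotential σ Mp Mm u) (t : ℝ) (i j : Fin 2) :
    (fun y => laxQ σ u y t i j) = fun y => -I * coefS Mp Mm 0 (y, t) i j := by
  funext y; rw [hu y t]; rfl

theorem hasDerivAt_laxQ (h : RHFlow σ r₁ r₂ M Mp Mm) (hu : IsPotential σ Mp Mm u) (x t : ℝ)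
    (i j : Fin 2) :
    HasDerivAt (fun y => laxQ σ u y t i j) (comm2 sigma3 (coefS Mp Mm 1 (x, t)) i j) x := by
  rw [laxQ_eq hu]
  refine ((h.hasDerivAt_coefS0 (x, t) i j).const_mul (-I)).congr_deriv ?_
  rw [Matrix.smul_apply, smul_eq_mul, ← mul_assoc, neg_mul, I_mul_I, neg_neg, one_mul]

theorem deriv_laxQ (h : RHFlow σ r₁ r₂ M Mp Mm) (hu : IsPotential σ Mp Mm u) (t : ℝ)
    (i j : Fin 2) : deriv (fun y => laxQ σ u y t i j)
      = fun x => comm2 sigma3 (coefS Mp Mm 1 (x, t)) i j :=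
  funext fun x => (h.hasDerivAt_laxQ hu x t i j).deriv

theorem hasDerivAt_deriv_laxQ (h : RHFlow σ r₁ r₂ M Mp Mm) (x t : ℝ)
    (i j : Fin 2) : HasDerivAt (fun x => comm2 sigma3 (coefS Mp Mm 1 (x, t)) i j)
      ((I • comm2 sigma3 (comm2 sigma3 (coefS Mp Mm 2 (x, t))
        + comm2 (coefS Mp Mm 1 (x, t)) (coefS Mp Mm 0 (x, t)))) i j) x := by
  rw [← comm2_smul]
  exact hasDerivAt_comm_sigma3 (h.hasDerivAt_coefS1 (x, t)) i j

theorem laxQx_eq (h : RHFlow σ r₁ r₂ M Mp Mm) (hu : IsPotential σ Mp Mm u) (x t : ℝ) :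
    laxQx σ u x t = comm2 sigma3 (coefS Mp Mm 1 (x, t)) := by
  ext i j
  exact (h.hasDerivAt_laxQ hu x t i j).deriv

theorem iteratedDeriv_laxQ (h : RHFlow σ r₁ r₂ M Mp Mm) (hu : IsPotential σ Mp Mm u) (t : ℝ)
    (i j : Fin 2) : iteratedDeriv 2 (fun y => laxQ σ u y t i j)
      = fun x => (I • comm2 sigma3 (comm2 sigma3 (coefS Mp Mm 2 (x, t))
        + comm2 (coefS Mp Mm 1 (x, t)) (coefS Mp Mm 0 (x, t)))) i j := by
  rw [iteratedDeriv_succ, iteratedDeriv_one, h.deriv_laxQ hu]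
  exact funext fun x => (h.hasDerivAt_deriv_laxQ x t i j).deriv

theorem laxQxx_eq (h : RHFlow σ r₁ r₂ M Mp Mm) (hu : IsPotential σ Mp Mm u) (x t : ℝ) :
    laxQxx σ u x t = I • comm2 sigma3 (comm2 sigma3 (coefS Mp Mm 2 (x, t))
        + comm2 (coefS Mp Mm 1 (x, t)) (coefS Mp Mm 0 (x, t))) := by
  ext i j
  exact congrFun (h.iteratedDeriv_laxQ hu t i j) x

theorem laxB_eq (h : RHFlow σ r₁ r₂ M Mp Mm) (hu : IsPotential σ Mp Mm u) (x t : ℝ) (z : ℂ) :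
    laxB σ u x t z = (-(4 * I)) • (z ^ 2 • coefS Mp Mm 0 (x, t) + z • coefS Mp Mm 1 (x, t)
      + coefS Mp Mm 2 (x, t)) := by
  obtain ⟨a0, a1, a2⟩ := h.coefS_anticomm (x, t)
  rw [← lax_coefficient_identity a0 a1 a2, laxB, h.laxQx_eq hu, h.laxQxx_eq hu, hu x t]

theorem satisfiesLaxX (h : RHFlow σ r₁ r₂ M Mp Mm) (hu : IsPotential σ Mp Mm u) :
    SatisfiesLaxX σ u fun x t => M (x, t) := by
  intro x t z hz i j
  refine (h.hasDerivAt_fst (x, t) hz i j).congr_deriv ?_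
  rw [hu x t, neg_smul, neg_mul, smul_mul_assoc, ← sub_eq_add_neg]

theorem satisfiesLaxT (h : RHFlow σ r₁ r₂ M Mp Mm) (hu : IsPotential σ Mp Mm u) :
    SatisfiesLaxT σ u fun x t => M (x, t) := by
  intro x t z hz i j
  refine (h.hasDerivAt_snd (x, t) hz i j).congr_deriv ?_
  rw [h.laxB_eq hu, neg_smul, neg_mul, smul_mul_assoc, ← sub_eq_add_neg]

theorem ofReal_potential (hu : IsPotential σ Mp Mm u) (x t : ℝ) :
    ((u x t : ℝ) : ℂ) = -I * coefS Mp Mm 0 (x, t) 0 1 := by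
  have := congrFun (congrFun (hu x t) 0) 1
  simpa [laxQ, _root_.offDiag] using this

theorem hasDerivAt_potential (h : RHFlow σ r₁ r₂ M Mp Mm) (hu : IsPotential σ Mp Mm u) (x t : ℝ) :
    HasDerivAt (fun y => u y t) (comm2 sigma3 (coefS Mp Mm 1 (x, t)) 0 1).re x := by
  have := h.hasDerivAt_laxQ hu x t 0 1
  have e : (fun y => laxQ σ u y t 0 1) = fun y => ((u y t : ℝ) : ℂ) := by
    funext y; simp [laxQ, _root_.offDiag]
  rw [e] at this
  exact reCLM.hasFDerivAt.comp_hasDerivAt x this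

theorem deriv_potential (h : RHFlow σ r₁ r₂ M Mp Mm) (hu : IsPotential σ Mp Mm u) (t : ℝ) :
    deriv (fun y => u y t) = fun x => (comm2 sigma3 (coefS Mp Mm 1 (x, t)) 0 1).re :=
  funext fun x => (h.hasDerivAt_potential hu x t).deriv

theorem hasDerivAt_deriv_potential (h : RHFlow σ r₁ r₂ M Mp Mm) (x t : ℝ) :
    HasDerivAt (fun x => (comm2 sigma3 (coefS Mp Mm 1 (x, t)) 0 1).re)
      ((I • comm2 sigma3 (comm2 sigma3 (coefS Mp Mm 2 (x, t))
        + comm2 (coefS Mp Mm 1 (x, t)) (coefS Mp Mm 0 (x, t)))) 0 1).re x :=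
  reCLM.hasFDerivAt.comp_hasDerivAt x (h.hasDerivAt_deriv_laxQ x t 0 1)

theorem iteratedDeriv_potential (h : RHFlow σ r₁ r₂ M Mp Mm) (hu : IsPotential σ Mp Mm u) (t : ℝ) :
    iteratedDeriv 2 (fun y => u y t) = fun x => ((I • comm2 sigma3 (comm2 sigma3
      (coefS Mp Mm 2 (x, t)) + comm2 (coefS Mp Mm 1 (x, t)) (coefS Mp Mm 0 (x, t)))) 0 1).re := by
  rw [iteratedDeriv_succ, iteratedDeriv_one, h.deriv_potential hu]
  exact funext fun x => (h.hasDerivAt_deriv_potential x t).deriv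

theorem Continuous.comm2 {X : Type*} [TopologicalSpace X] {F G : X → Mat2} (hF : Continuous F)
    (hG : Continuous G) : Continuous fun p => comm2 (F p) (G p) := (hF.mul hG).sub (hG.mul hF)

theorem continuousC2InX (h : RHFlow σ r₁ r₂ M Mp Mm) (hu : IsPotential σ Mp Mm u) :
    ContinuousC2InX u := by
  have c0 := h.continuous_coefS (k := 0) (by norm_num)
  have c1 := h.continuous_coefS (k := 1) (by norm_num)
  have c2 := h.continuous_coefS (k := 2) (by norm_num)
  have k1 : Continuous fun p : ℝ × ℝ => (comm2 sigma3 (coefS Mp Mm 1 p) 0 1).re :=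
    continuous_re.comp ((Continuous.comm2 continuous_const c1).matrix_elem 0 1)
  have k2 : Continuous fun p : ℝ × ℝ => ((I • comm2 sigma3 (comm2 sigma3 (coefS Mp Mm 2 p)
        + comm2 (coefS Mp Mm 1 p) (coefS Mp Mm 0 p))) 0 1).re :=
    continuous_re.comp (((Continuous.comm2 continuous_const
      ((Continuous.comm2 continuous_const c2).add (Continuous.comm2 c1 c0))).const_smul I).matrix_elem
        0 1)
  refine ⟨fun t => ?_, ?_, ?_, ?_⟩
  · have d1 : Differentiable ℝ fun y => u y t := fun x =>
      (h.hasDerivAt_potential hu x t).differentiableAt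
    rw [show (2 : WithTop ℕ∞) = 1 + 1 by norm_num, contDiff_succ_iff_deriv]
    refine ⟨d1, by simp, ?_⟩
    rw [contDiff_one_iff_deriv, h.deriv_potential hu]
    refine ⟨fun x => (h.hasDerivAt_deriv_potential x t).differentiableAt, ?_⟩
    rw [funext fun x => (h.hasDerivAt_deriv_potential x t).deriv]
    exact k2.comp (by fun_prop : Continuous fun x : ℝ => (x, t))
  · have : (fun p : ℝ × ℝ => u p.1 p.2) = fun p => (-I * coefS Mp Mm 0 p 0 1).re := by
      funext p
      rw [← ofReal_potential hu p.1 p.2, ofReal_re]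
    rw [this]
    exact continuous_re.comp (continuous_const.mul (c0.matrix_elem 0 1))
  · simp only [h.deriv_potential hu]
    exact k1
  · simp only [h.iteratedDeriv_potential hu]
    exact k2

end RHFlow

/-! ### Integration by parts on the plane -/

theorem integral_deriv_fst_eq_zero {F F' : ℝ × ℝ → ℂ} (hF : Continuous F) (hF' : Continuous F')
    (hc : HasCompactSupport F) (hc' : HasCompactSupport F')
    (hd : ∀ p, HasDerivAt (fun x => F (x, p.2)) (F' p) p.1) : ∫ p, F' p = 0 := by
  have hi := hF'.integrable_of_hasCompactSupport hc' (μ := (volume : Measure (ℝ × ℝ)))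
  rw [Measure.volume_eq_prod] at hi ⊢
  rw [integral_prod_symm _ hi]
  refine integral_eq_zero_of_ae (ae_of_all _ fun t => ?_)
  have he : IsClosedEmbedding fun x : ℝ => (x, t) :=
    IsClosedEmbedding.of_continuous_injective_isClosedMap (by fun_prop)
      (fun a b h => congrArg Prod.fst h) (isClosedMap_prodMk_right t)
  exact integral_eq_zero_of_hasDerivAt_of_integrable (f := fun x => F (x, t)) (fun x => hd (x, t))
    ((hF'.comp he.continuous).integrable_of_hasCompactSupport (hc'.comp_isClosedEmbedding he))
    ((hF.comp he.continuous).integrable_of_hasCompactSupport (hc.comp_isClosedEmbedding he))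

theorem integral_deriv_snd_eq_zero {F F' : ℝ × ℝ → ℂ} (hF : Continuous F) (hF' : Continuous F')
    (hc : HasCompactSupport F) (hc' : HasCompactSupport F')
    (hd : ∀ p, HasDerivAt (fun t => F (p.1, t)) (F' p) p.2) : ∫ p, F' p = 0 := by
  have h := integral_deriv_fst_eq_zero (F := F ∘ Prod.swap) (F' := F' ∘ Prod.swap)
    (hF.comp continuous_swap) (hF'.comp continuous_swap)
    (hc.comp_homeomorph (Homeomorph.prodComm ℝ ℝ)) (hc'.comp_homeomorph (Homeomorph.prodComm ℝ ℝ))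
    (fun p => hd p.swap)
  rw [Measure.volume_eq_prod] at h ⊢
  rw [← h]
  exact (integral_prod_swap F').symm

/-- A smooth compactly supported function on the plane with the partial derivatives that occur in
the equation. -/
structure IsTest (φ φx φxx φxxx φt : ℝ × ℝ → ℂ) : Prop where
  cont : Continuous φ
  cont_x : Continuous φx
  cont_xx : Continuous φxx
  cont_xxx : Continuous φxxx
  cont_t : Continuous φt
  supp : HasCompactSupport φ
  supp_x : HasCompactSupport φx
  supp_xx : HasCompactSupport φxx
  supp_xxx : HasCompactSupport φxxx
  supp_t : HasCompactSupport φt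
  deriv_x : ∀ p, HasDerivAt (fun x => φ (x, p.2)) (φx p) p.1
  deriv_xx : ∀ p, HasDerivAt (fun x => φx (x, p.2)) (φxx p) p.1
  deriv_xxx : ∀ p, HasDerivAt (fun x => φxx (x, p.2)) (φxxx p) p.1
  deriv_t : ∀ p, HasDerivAt (fun t => φ (p.1, t)) (φt p) p.2

theorem hasDerivAt_fst_of_contDiff {φ : ℝ × ℝ → ℝ} (hφ : ContDiff ℝ ∞ φ) (p : ℝ × ℝ) :
    HasDerivAt (fun x => φ (x, p.2)) (fderiv ℝ φ p (1, 0)) p.1 := by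
  have h1 := (hφ.differentiable (by simp)).differentiableAt.hasFDerivAt (x := p)
  have h2 : HasDerivAt (fun x : ℝ => (x, p.2)) ((1 : ℝ), (0 : ℝ)) p.1 :=
    (hasDerivAt_id p.1).prodMk (hasDerivAt_const p.1 p.2)
  exact h1.comp_hasDerivAt p.1 h2

theorem hasDerivAt_snd_of_contDiff {φ : ℝ × ℝ → ℝ} (hφ : ContDiff ℝ ∞ φ) (p : ℝ × ℝ) :
    HasDerivAt (fun t => φ (p.1, t)) (fderiv ℝ φ p (0, 1)) p.2 := by
  have h1 := (hφ.differentiable (by simp)).differentiableAt.hasFDerivAt (x := p)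
  have h2 : HasDerivAt (fun t : ℝ => (p.1, t)) ((0 : ℝ), (1 : ℝ)) p.2 :=
    (hasDerivAt_const p.2 p.1).prodMk (hasDerivAt_id p.2)
  exact h1.comp_hasDerivAt p.2 h2

theorem IsTest.of_contDiff {φ : ℝ × ℝ → ℝ} (hφ : ContDiff ℝ ∞ φ) (hc : HasCompactSupport φ) :
    IsTest (fun p => (φ p : ℂ)) (fun p => ((deriv (fun x => φ (x, p.2)) p.1 : ℝ) : ℂ))
      (fun p => ((iteratedDeriv 2 (fun x => φ (x, p.2)) p.1 : ℝ) : ℂ))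
      (fun p => ((iteratedDeriv 3 (fun x => φ (x, p.2)) p.1 : ℝ) : ℂ))
      (fun p => ((deriv (fun t => φ (p.1, t)) p.2 : ℝ) : ℂ)) := by
  have hs : ∀ {ψ : ℝ × ℝ → ℝ}, ContDiff ℝ ∞ ψ → ∀ v : ℝ × ℝ,
      ContDiff ℝ ∞ fun p => fderiv ℝ ψ p v := fun {ψ} h v =>
    (h.fderiv_right (m := ∞) (by simp)).clm_apply contDiff_const
  set φ₁ : ℝ × ℝ → ℝ := fun p => fderiv ℝ φ p (1, 0) with h₁
  have s₁ : ContDiff ℝ ∞ φ₁ := hs hφ _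
  have c₁ : HasCompactSupport φ₁ := hc.fderiv_apply (𝕜 := ℝ) (1, 0)
  set φ₂ : ℝ × ℝ → ℝ := fun p => fderiv ℝ φ₁ p (1, 0) with h₂
  have s₂ : ContDiff ℝ ∞ φ₂ := hs s₁ _
  have c₂ : HasCompactSupport φ₂ := c₁.fderiv_apply (𝕜 := ℝ) (1, 0)
  set φ₃ : ℝ × ℝ → ℝ := fun p => fderiv ℝ φ₂ p (1, 0) with h₃
  have s₃ : ContDiff ℝ ∞ φ₃ := hs s₂ _
  have c₃ : HasCompactSupport φ₃ := c₂.fderiv_apply (𝕜 := ℝ) (1, 0)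
  set φ₄ : ℝ × ℝ → ℝ := fun p => fderiv ℝ φ p (0, 1) with h₄
  have s₄ : ContDiff ℝ ∞ φ₄ := hs hφ _
  have c₄ : HasCompactSupport φ₄ := hc.fderiv_apply (𝕜 := ℝ) (0, 1)
  have d₁ : ∀ t, deriv (fun x => φ (x, t)) = fun x => φ₁ (x, t) := fun t =>
    funext fun x => (hasDerivAt_fst_of_contDiff hφ (x, t)).deriv
  have d₂ : ∀ t, deriv (fun x => φ₁ (x, t)) = fun x => φ₂ (x, t) := fun t =>
    funext fun x => (hasDerivAt_fst_of_contDiff s₁ (x, t)).deriv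
  have d₃ : ∀ t, deriv (fun x => φ₂ (x, t)) = fun x => φ₃ (x, t) := fun t =>
    funext fun x => (hasDerivAt_fst_of_contDiff s₂ (x, t)).deriv
  have d₄ : ∀ x, deriv (fun t => φ (x, t)) = fun t => φ₄ (x, t) := fun x =>
    funext fun t => (hasDerivAt_snd_of_contDiff hφ (x, t)).deriv
  have i₂ : ∀ t, iteratedDeriv 2 (fun x => φ (x, t)) = fun x => φ₂ (x, t) := fun t => by
    rw [iteratedDeriv_succ, iteratedDeriv_one, d₁, d₂]
  have i₃ : ∀ t, iteratedDeriv 3 (fun x => φ (x, t)) = fun x => φ₃ (x, t) := fun t => by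
    rw [iteratedDeriv_succ, i₂, d₃]
  simp only [d₁, i₂, i₃, d₄]
  have oc : ∀ {ψ : ℝ × ℝ → ℝ}, ContDiff ℝ ∞ ψ → Continuous fun p => (ψ p : ℂ) := fun h =>
    continuous_ofReal.comp h.continuous
  have os : ∀ {ψ : ℝ × ℝ → ℝ}, HasCompactSupport ψ → HasCompactSupport fun p => (ψ p : ℂ) :=
    fun h => h.comp_left (g := fun x : ℝ => (x : ℂ)) ofReal_zero
  exact ⟨oc hφ, oc s₁, oc s₂, oc s₃, oc s₄, os hc, os c₁, os c₂, os c₃, os c₄,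
    fun p => (hasDerivAt_fst_of_contDiff hφ p).ofReal_comp,
    fun p => (hasDerivAt_fst_of_contDiff s₁ p).ofReal_comp,
    fun p => (hasDerivAt_fst_of_contDiff s₂ p).ofReal_comp,
    fun p => (hasDerivAt_snd_of_contDiff hφ p).ofReal_comp⟩

theorem integrable_mul_test {f ψ : ℝ × ℝ → ℂ} (hf : Continuous f) (hψ : Continuous ψ)
    (hc : HasCompactSupport ψ) : Integrable fun p => f p * ψ p :=
  (hf.mul hψ).integrable_of_hasCompactSupport (hc.mul_left (f := f))

theorem integral_parts_fst {f f' ψ ψ' : ℝ × ℝ → ℂ} (hf : Continuous f) (hf' : Continuous f')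
    (hψ : Continuous ψ) (hψ' : Continuous ψ') (hc : HasCompactSupport ψ)
    (hc' : HasCompactSupport ψ') (df : ∀ p, HasDerivAt (fun x => f (x, p.2)) (f' p) p.1)
    (dψ : ∀ p, HasDerivAt (fun x => ψ (x, p.2)) (ψ' p) p.1) :
    ∫ p, (f' p * ψ p + f p * ψ' p) = 0 :=
  integral_deriv_fst_eq_zero (F := fun p => f p * ψ p) (hf.mul hψ)
    ((hf'.mul hψ).add (hf.mul hψ')) (hc.mul_left (f := f))
    ((hc.mul_left (f := f')).add (hc'.mul_left (f := f))) fun p => (df p).mul (dψ p)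

theorem integral_parts_snd {f f' ψ ψ' : ℝ × ℝ → ℂ} (hf : Continuous f) (hf' : Continuous f')
    (hψ : Continuous ψ) (hψ' : Continuous ψ') (hc : HasCompactSupport ψ)
    (hc' : HasCompactSupport ψ') (df : ∀ p, HasDerivAt (fun t => f (p.1, t)) (f' p) p.2)
    (dψ : ∀ p, HasDerivAt (fun t => ψ (p.1, t)) (ψ' p) p.2) :
    ∫ p, (f' p * ψ p + f p * ψ' p) = 0 :=
  integral_deriv_snd_eq_zero (F := fun p => f p * ψ p) (hf.mul hψ)
    ((hf'.mul hψ).add (hf.mul hψ')) (hc.mul_left (f := f))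
    ((hc.mul_left (f := f')).add (hc'.mul_left (f := f))) fun p => (df p).mul (dψ p)

/-- Convergence along the product filter at every point is locally uniform convergence. Compactness
of the support makes it uniform there. -/
theorem tendsto_integral_mul_test {f : ℝ → ℝ × ℝ → ℂ} {ψ : ℝ × ℝ → ℂ} (hψ : Continuous ψ)
    (hc : HasCompactSupport ψ)
    (hf : ∀ q, Tendsto (fun n : ℝ × (ℝ × ℝ) => f n.1 n.2) (atTop ×ˢ 𝓝 q) (𝓝 0)) :
    Tendsto (fun y => ∫ p, f y p * ψ p) atTop (𝓝 0) := by
  have hi : Integrable fun p => ‖ψ p‖ := (hψ.integrable_of_hasCompactSupport hc).norm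
  set N := ∫ p, ‖ψ p‖
  have hN : 0 ≤ N := integral_nonneg fun p => norm_nonneg _
  rw [Metric.tendsto_nhds]
  intro ε hε
  have hδ : 0 < ε / (N + 1) := by positivity
  have h1 : {n : ℝ × (ℝ × ℝ) | ‖f n.1 n.2‖ < ε / (N + 1)} ∈ atTop ×ˢ 𝓝ˢ (tsupport ψ) := by
    refine IsCompact.mem_prod_nhdsSet_of_forall hc fun q _ => ?_
    have := Metric.tendsto_nhds.1 (hf q) _ hδ
    simp only [dist_zero_right] at this
    exact this
  have h2 : ∀ᶠ y in atTop, ∀ p ∈ tsupport ψ, ‖f y p‖ < ε / (N + 1) :=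
    (Eventually.curry h1).mono fun y hy => hy.self_of_nhdsSet
  filter_upwards [h2] with y hy
  rw [dist_zero_right]
  calc ‖∫ p, f y p * ψ p‖ ≤ ∫ p, ε / (N + 1) * ‖ψ p‖ := by
        refine norm_integral_le_of_norm_le (hi.const_mul _) (ae_of_all _ fun p => ?_)
        rw [norm_mul]
        by_cases hp : p ∈ tsupport ψ
        · gcongr; exact (hy p hp).le
        · rw [image_eq_zero_of_notMem_tsupport hp]; simp
    _ = ε / (N + 1) * N := integral_const_mul _ _
    _ < ε := by rw [div_mul_eq_mul_div, div_lt_iff₀ (by positivity)]; nlinarith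

theorem integral_lincomb {α : Type*} [MeasurableSpace α] {μ : Measure α} {f g k : α → ℂ}
    (hf : Integrable f μ) (hg : Integrable g μ) (hk : Integrable k μ) (a b c : ℂ) :
    ∫ p, (a * f p + b * g p + c * k p) ∂μ
      = a * (∫ p, f p ∂μ) + b * (∫ p, g p ∂μ) + c * ∫ p, k p ∂μ := by
  rw [integral_add (f := fun p => a * f p + b * g p) ((hf.const_mul a).add (hg.const_mul b))
    (hk.const_mul c), integral_add (hf.const_mul a) (hg.const_mul b), integral_const_mul,
    integral_const_mul, integral_const_mul]

/-! ### The nonlocal equation in the sense of distributions -/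

/-- The pointwise identity behind the nonlinear equation. -/
theorem mkdv_identity {B₀ B₁ B₂ P₀ P₁ : Mat2}
    (h1 : sigma3 * B₁ + B₁ * sigma3 = B₀ * B₀)
    (h2 : sigma3 * B₂ + B₂ * sigma3 = B₁ * B₀ + B₀ * B₁)
    (c0 : B₀ = sigma3 * P₀ - P₀ * sigma3)
    (c1 : B₁ = sigma3 * P₁ - P₁ * sigma3 - B₀ * P₀) :
    8 * (B₁ * P₁ + B₂ * P₀) 0 1
      - ((2 * I) * ((I • (comm2 sigma3 B₂ + comm2 B₁ B₀) * B₀ + B₁ * I • comm2 sigma3 B₁) 0 1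
        - (I • comm2 sigma3 B₁ * B₁ + B₀ * I • (comm2 sigma3 B₂ + comm2 B₁ B₀)) 0 1)
        - (4 * I) * ((I • comm2 sigma3 B₁ * P₁ + B₀ * I • (B₂ + B₁ * P₀)) 0 1
        + (I • (comm2 sigma3 B₂ + comm2 B₁ B₀) * P₀ + B₁ * I • B₁) 0 1))
      = 12 * (B₀ 0 1 * B₀ 1 0 * B₁ 0 1) := by
  -- `B₀` is off-diagonal, the anticommutators determine the diagonals of `B₁` and `B₂`, and the
  -- commutators determine the relevant off-diagonal entries of `P₀` and `P₁`. The claim is then a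
  -- polynomial identity in the remaining entries.
  have e000 : B₀ 0 0 = 0 := by rw [c0]; simp only [Matrix.sub_apply, mul_apply2]; simp [sigma3]
  have e011 : B₀ 1 1 = 0 := by rw [c0]; simp only [Matrix.sub_apply, mul_apply2]; simp [sigma3]
  have e001 : P₀ 0 1 = B₀ 0 1 / 2 := by rw [c0]; simp only [Matrix.sub_apply, mul_apply2]; simp [sigma3]
  have e010 : P₀ 1 0 = - B₀ 1 0 / 2 := by rw [c0]; simp only [Matrix.sub_apply, mul_apply2]; simp [sigma3]
  have e101 : P₁ 0 1 = (B₁ 0 1 + B₀ 0 1 * P₀ 1 1) / 2 := by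
    have := congrFun (congrFun c1 0) 1
    simp only [Matrix.sub_apply, mul_apply2] at this
    simp [sigma3, e000] at this
    linear_combination (-1 / 2) * this
  have e100 : B₁ 0 0 = B₀ 0 1 * B₀ 1 0 / 2 := by
    have := congrFun (congrFun h1 0) 0
    simp only [Matrix.add_apply, mul_apply2] at this
    simp [sigma3, e000] at this
    linear_combination (1 / 2) * this
  have e111 : B₁ 1 1 = - (B₀ 0 1 * B₀ 1 0 / 2) := by
    have := congrFun (congrFun h1 1) 1
    simp only [Matrix.add_apply, mul_apply2] at this
    simp [sigma3, e011] at this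
    linear_combination (-1 / 2) * this
  have e200 : B₂ 0 0 = (B₁ 0 1 * B₀ 1 0 + B₀ 0 1 * B₁ 1 0) / 2 := by
    have := congrFun (congrFun h2 0) 0
    simp only [Matrix.add_apply, mul_apply2] at this
    simp [sigma3, e000] at this
    linear_combination (1 / 2) * this
  have e211 : B₂ 1 1 = - ((B₁ 0 1 * B₀ 1 0 + B₀ 0 1 * B₁ 1 0) / 2) := by
    have := congrFun (congrFun h2 1) 1
    simp only [Matrix.add_apply, mul_apply2] at this
    simp [sigma3, e011] at this
    linear_combination (-1 / 2) * this
  simp only [comm2, Matrix.add_apply, Matrix.sub_apply, Matrix.smul_apply, mul_apply2, sigma3,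
    smul_eq_mul, Matrix.of_apply, Matrix.cons_val_zero, Matrix.cons_val_one, Matrix.cons_val',
    Matrix.cons_val_fin_one, e000, e011, e001, e101, e100, e111, e200, e211]
  ring_nf
  simp only [I_sq]
  ring

namespace RHFlow

variable {σ : ℝ} {r₁ r₂ : ℝ → ℂ} {M : ℝ × ℝ → ℂ → Mat2} {Mp Mm : ℝ × ℝ → ℝ → Mat2}
  {φ φx φxx φxxx φt : ℝ × ℝ → ℂ} {u : ℝ → ℝ → ℝ}

theorem continuous_matC (h : RHFlow σ r₁ r₂ M Mp Mm) {k : ℕ} (hk : k ≤ 3) {z : ℂ} (hz : z.im ≠ 0) :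
    Continuous fun p => matC k (dens Mp Mm p) z := by
  induction k with
  | zero =>
    have e : (fun p => matC 0 (dens Mp Mm p) z) = fun p => M p z - 1 :=
      funext fun p => by rw [h.eq_one_add_matC p hz, add_sub_cancel_left]
    rw [e]
    exact (h.continuous_M hz).sub continuous_const
  | succ k ih =>
    have e : (fun p => matC (k + 1) (dens Mp Mm p) z)
        = fun p => z • matC k (dens Mp Mm p) z - coefM Mp Mm k p :=
      funext fun p => by rw [h.smul_matC_dens (by omega) p hz, add_sub_cancel_right]
    rw [e]
    exact ((ih (by omega)).const_smul z).sub (h.continuous_coefM (by omega))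

/-- The evolution equation for a fixed spectral parameter, tested. -/
theorem integral_evolution (h : RHFlow σ r₁ r₂ M Mp Mm) (hφ : IsTest φ φx φxx φxxx φt) {z : ℂ}
    (hz : z.im ≠ 0) : ∫ p, (M p z 0 1 * φt p - 4 * z ^ 2 * (M p z 0 1 * φx p)
      - 4 * I * (((z • coefS Mp Mm 1 p + coefS Mp Mm 2 p) * M p z) 0 1 * φ p)) = 0 := by
  have cM := h.continuous_M hz
  have c0 := h.continuous_coefS (k := 0) (by norm_num)
  have c1 := h.continuous_coefS (k := 1) (by norm_num)
  have c2 := h.continuous_coefS (k := 2) (by norm_num)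
  have cN : Continuous fun p => (z • coefS Mp Mm 1 p + coefS Mp Mm 2 p) * M p z :=
    ((c1.const_smul z).add c2).mul cM
  set X : ℝ × ℝ → Mat2 := fun p => (I * z) • comm2 sigma3 (M p z) - I • (coefS Mp Mm 0 p * M p z)
    with hX
  have q1 : Continuous fun p => comm2 sigma3 (M p z) := Continuous.comm2 continuous_const cM
  have q2 : Continuous fun p => coefS Mp Mm 0 p * M p z := c0.mul cM
  have cX : Continuous X := (q1.const_smul (I * z)).sub (q2.const_smul I)
  have m01 := cM.matrix_elem 0 1
  have x01 := cX.matrix_elem 0 1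
  have n01 := cN.matrix_elem 0 1
  -- The `x`-equation absorbs the cubic term and `B₀`: `M_t = 4 z² M_x - 4 i (z B₁ + B₂) M`. This
  -- form leaves fewer growing terms in the expansion.
  have dt : ∀ p : ℝ × ℝ, HasDerivAt (fun t => M (p.1, t) z 0 1) (4 * z ^ 2 * X p 0 1
      - 4 * I * ((z • coefS Mp Mm 1 p + coefS Mp Mm 2 p) * M p z) 0 1) p.2 := by
    intro p
    refine (h.hasDerivAt_snd p hz 0 1).congr_deriv ?_
    simp only [hX, add_mul, Matrix.sub_apply, Matrix.smul_apply, Matrix.add_apply, smul_eq_mul,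
      smul_mul_assoc]
    ring
  have e1 : ∫ p, ((4 * z ^ 2 * X p 0 1 - 4 * I * ((z • coefS Mp Mm 1 p + coefS Mp Mm 2 p)
      * M p z) 0 1) * φ p + M p z 0 1 * φt p) = 0 := integral_parts_snd m01 ((x01.const_mul (4 * z ^ 2)).sub (n01.const_mul (4 * I)))
    hφ.cont hφ.cont_t hφ.supp hφ.supp_t dt hφ.deriv_t
  have e2 := integral_parts_fst m01 x01 hφ.cont hφ.cont_x hφ.supp hφ.supp_x
    (fun p => h.hasDerivAt_fst p hz 0 1) hφ.deriv_x
  have i1 : Integrable fun p => (4 * z ^ 2 * X p 0 1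
      - 4 * I * ((z • coefS Mp Mm 1 p + coefS Mp Mm 2 p) * M p z) 0 1) * φ p + M p z 0 1 * φt p :=
    (integrable_mul_test ((x01.const_mul (4 * z ^ 2)).sub (n01.const_mul (4 * I))) hφ.cont
      hφ.supp).add (integrable_mul_test m01 hφ.cont_t hφ.supp_t)
  have i2 : Integrable fun p => X p 0 1 * φ p + M p z 0 1 * φx p :=
    (integrable_mul_test x01 hφ.cont hφ.supp).add (integrable_mul_test m01 hφ.cont_x hφ.supp_x)
  have := integral_sub i1 (i2.const_mul (4 * z ^ 2))
  rw [integral_const_mul, e1, e2, mul_zero, sub_zero] at this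
  rw [← this]
  refine integral_congr_ae (ae_of_all _ fun p => ?_)
  simp only
  ring

/-- The leading coefficient of the tested evolution equation at infinity. -/
theorem integral_coef_eq_zero (h : RHFlow σ r₁ r₂ M Mp Mm) (hφ : IsTest φ φx φxx φxxx φt) :
    ∫ p, (coefM Mp Mm 0 p 0 1 * φt p - 4 * (coefM Mp Mm 2 p 0 1 * φx p)
      - 4 * I * ((coefS Mp Mm 1 p * coefM Mp Mm 1 p + coefS Mp Mm 2 p * coefM Mp Mm 0 p) 0 1 * φ p))
      = 0 := by
  have c1 := h.continuous_coefS (k := 1) (by norm_num)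
  have c2 := h.continuous_coefS (k := 2) (by norm_num)
  have m0 := h.continuous_coefM (k := 0) (by norm_num)
  have m1 := h.continuous_coefM (k := 1) (by norm_num)
  have m2 := h.continuous_coefM (k := 2) (by norm_num)
  have iP : Integrable fun p => (coefM Mp Mm 0 p 0 1 * φt p - 4 * (coefM Mp Mm 2 p 0 1 * φx p)
      - 4 * I * ((coefS Mp Mm 1 p * coefM Mp Mm 1 p + coefS Mp Mm 2 p * coefM Mp Mm 0 p) 0 1
        * φ p)) :=
    ((integrable_mul_test (m0.matrix_elem 0 1) hφ.cont_t hφ.supp_t).sub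
      ((integrable_mul_test (m2.matrix_elem 0 1) hφ.cont_x hφ.supp_x).const_mul 4)).sub
      ((integrable_mul_test (((c1.mul m1).add (c2.mul m0)).matrix_elem 0 1) hφ.cont
        hφ.supp).const_mul (4 * I))
  set J : ℝ × ℝ → ℂ := fun p => (coefM Mp Mm 0 p 0 1 * φt p - 4 * (coefM Mp Mm 2 p 0 1 * φx p)
      - 4 * I * ((coefS Mp Mm 1 p * coefM Mp Mm 1 p + coefS Mp Mm 2 p * coefM Mp Mm 0 p) 0 1
        * φ p)) with hJ
  have e2 := integral_parts_fst (m0.matrix_elem 0 1) ((c1.const_smul I).matrix_elem 0 1) hφ.cont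
    hφ.cont_x hφ.supp hφ.supp_x (fun p => h.hasDerivAt_coefM0 p 0 1) hφ.deriv_x
  have e3 := integral_parts_fst (m1.matrix_elem 0 1)
    (((c2.add (c1.mul m0)).const_smul I).matrix_elem 0 1) hφ.cont
    hφ.cont_x hφ.supp hφ.supp_x (fun p => h.hasDerivAt_coefM1 p 0 1) hφ.deriv_x
  have i2 : Integrable fun p => (I • coefS Mp Mm 1 p) 0 1 * φ p + coefM Mp Mm 0 p 0 1 * φx p :=
    (integrable_mul_test ((c1.const_smul I).matrix_elem 0 1) hφ.cont hφ.supp).add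
      (integrable_mul_test (m0.matrix_elem 0 1) hφ.cont_x hφ.supp_x)
  have i3 : Integrable fun p => (I • (coefS Mp Mm 2 p + coefS Mp Mm 1 p * coefM Mp Mm 0 p)) 0 1
      * φ p + coefM Mp Mm 1 p 0 1 * φx p :=
    (integrable_mul_test (((c2.add (c1.mul m0)).const_smul I).matrix_elem 0 1) hφ.cont hφ.supp).add
      (integrable_mul_test (m1.matrix_elem 0 1) hφ.cont_x hφ.supp_x)
  set a : ℕ → ℝ → ℝ × ℝ → Mat2 := fun k y p => matC k (dens Mp Mm p) (I * y) with ha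
  have key : ∀ y : ℝ, 0 < y → ∫ p, J p = - ((∫ p, a 1 y p 0 1 * φt p)
      - 4 * (∫ p, a 3 y p 0 1 * φx p)
      - 4 * I * ∫ p, (coefS Mp Mm 1 p * a 2 y p + coefS Mp Mm 2 p * a 1 y p) 0 1 * φ p) := by
    intro y hy
    have hz := I_mul_im_ne hy
    have e1 := h.integral_evolution hφ hz
    have k1 := h.continuous_matC (k := 1) (by norm_num) hz
    have k2 := h.continuous_matC (k := 2) (by norm_num) hz
    have k3 := h.continuous_matC (k := 3) (by norm_num) hz
    have j1 : Integrable fun p => a 1 y p 0 1 * φt p := integrable_mul_test (k1.matrix_elem 0 1) hφ.cont_t hφ.supp_t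
    have j2 : Integrable fun p => 4 * (a 3 y p 0 1 * φx p) := (integrable_mul_test (k3.matrix_elem 0 1) hφ.cont_x hφ.supp_x).const_mul 4
    have j3 : Integrable fun p => 4 * I *
        ((coefS Mp Mm 1 p * a 2 y p + coefS Mp Mm 2 p * a 1 y p) 0 1 * φ p) :=
      (integrable_mul_test (((c1.mul k2).add (c2.mul k1)).matrix_elem 0 1) hφ.cont
      hφ.supp).const_mul (4 * I)
    rw [← integral_const_mul, ← integral_const_mul, ← integral_sub j1 j2,
      ← integral_sub (f := fun p => a 1 y p 0 1 * φt p - 4 * (a 3 y p 0 1 * φx p)) (j1.sub j2) j3,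
      eq_neg_iff_add_eq_zero, ← integral_add iP
      (g := fun p => a 1 y p 0 1 * φt p - 4 * (a 3 y p 0 1 * φx p) - 4 * I *
        ((coefS Mp Mm 1 p * a 2 y p + coefS Mp Mm 2 p * a 1 y p) 0 1 * φ p))
      ((j1.sub j2).sub j3)]
    set z : ℂ := I * y
    have cM := h.continuous_M hz
    have l1 : Integrable fun p => (M p z 0 1 * φt p - 4 * z ^ 2 * (M p z 0 1 * φx p)
      - 4 * I * (((z • coefS Mp Mm 1 p + coefS Mp Mm 2 p) * M p z) 0 1 * φ p)) :=
      ((integrable_mul_test (cM.matrix_elem 0 1) hφ.cont_t hφ.supp_t).sub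
        ((integrable_mul_test (cM.matrix_elem 0 1) hφ.cont_x hφ.supp_x).const_mul _)).sub
        ((integrable_mul_test ((((c1.const_smul z).add c2).mul cM).matrix_elem 0 1) hφ.cont
          hφ.supp).const_mul _)
    -- The tested equation is multiplied by `z` to reach the coefficient of `1/z`. Its terms of
    -- order `z²` and `z` are exactly `-4 z²` and `-4 z` times the weak forms of the `x`-derivatives
    -- of the first two coefficients of `M`, so adding those identities removes them.
    have tot := integral_lincomb l1 i3 i2 z (4 * z) (4 * z ^ 2)
    have e2' : ∫ p, ((I • coefS Mp Mm 1 p) 0 1 * φ p + coefM Mp Mm 0 p 0 1 * φx p) = 0 := e2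
    have e3' : ∫ p, ((I • (coefS Mp Mm 2 p + coefS Mp Mm 1 p * coefM Mp Mm 0 p)) 0 1
      * φ p + coefM Mp Mm 1 p 0 1 * φx p) = 0 := e3
    rw [e1, e2', e3', mul_zero, mul_zero, mul_zero, add_zero, add_zero] at tot
    rw [← tot]
    refine integral_congr_ae (ae_of_all _ fun p => ?_)
    have r : M p z = 1 + a 0 y p := h.eq_one_add_matC p hz
    have q : ∀ k, k ≤ 2 → ∀ i j, z * a k y p i j = a (k + 1) y p i j + coefM Mp Mm k p i j :=
      fun k hk i j => congrFun (congrFun (h.smul_matC_dens hk p hz) i) j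
    have q0 : ∀ i j, z * a 0 y p i j = a 1 y p i j + coefM Mp Mm 0 p i j := q 0 (by norm_num)
    have q1 : ∀ i j, z * a 1 y p i j = a 2 y p i j + coefM Mp Mm 1 p i j := q 1 (by norm_num)
    have q2 : ∀ i j, z * a 2 y p i j = a 3 y p i j + coefM Mp Mm 2 p i j := q 2 (by norm_num)
    simp only [hJ, r, add_mul, Matrix.add_apply, Matrix.smul_apply, smul_eq_mul,
      mul_apply2, Matrix.one_apply_ne (show (0 : Fin 2) ≠ 1 by decide), Matrix.one_apply_eq]
    have w3 : z ^ 3 * a 0 y p 0 1 = a 3 y p 0 1 + coefM Mp Mm 2 p 0 1 + z * coefM Mp Mm 1 p 0 1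
        + z ^ 2 * coefM Mp Mm 0 p 0 1 := by
      linear_combination z ^ 2 * q0 0 1 + z * q1 0 1 + q2 0 1
    have w2 : ∀ i j, z ^ 2 * a 0 y p i j = a 2 y p i j + coefM Mp Mm 1 p i j
        + z * coefM Mp Mm 0 p i j := fun i j => by
      linear_combination z * q0 i j + q1 i j
    linear_combination (-φt p) * q0 0 1 + 4 * φx p * w3
      + 4 * I * φ p * (coefS Mp Mm 1 p 0 0 * w2 0 1 + coefS Mp Mm 1 p 0 1 * w2 1 1
        + coefS Mp Mm 2 p 0 0 * q0 0 1 + coefS Mp Mm 2 p 0 1 * q0 1 1)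
  have tm : ∀ k, k ≤ 3 → ∀ q i j, Tendsto (fun n : ℝ × (ℝ × ℝ) => a k n.1 n.2 i j)
      (atTop ×ˢ 𝓝 q) (𝓝 0) := fun k hk q i j => by
    have := tendsto_pi_nhds.1 (tendsto_pi_nhds.1 (h.tendsto_matC_prod hk q) i) j
    simpa using this
  have tS : ∀ (F : ℝ × ℝ → Mat2), Continuous F → ∀ q i j,
      Tendsto (fun n : ℝ × (ℝ × ℝ) => F n.2 i j) (atTop ×ˢ 𝓝 q) (𝓝 (F q i j)) := fun F hF q i j =>
    ((hF.matrix_elem i j).tendsto q).comp tendsto_snd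
  have T1 := tendsto_integral_mul_test (f := fun y p => a 1 y p 0 1) hφ.cont_t hφ.supp_t
    (fun q => tm 1 (by norm_num) q 0 1)
  have T3 := tendsto_integral_mul_test (f := fun y p => a 3 y p 0 1) hφ.cont_x hφ.supp_x
    (fun q => tm 3 (by norm_num) q 0 1)
  have T2 := tendsto_integral_mul_test (f := fun y p =>
    (coefS Mp Mm 1 p * a 2 y p + coefS Mp Mm 2 p * a 1 y p) 0 1) hφ.cont hφ.supp (fun q => by
      simp only [Matrix.add_apply, mul_apply2]
      have := (((tS _ c1 q 0 0).mul (tm 2 (by norm_num) q 0 1)).add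
        ((tS _ c1 q 0 1).mul (tm 2 (by norm_num) q 1 1))).add
        (((tS _ c2 q 0 0).mul (tm 1 (by norm_num) q 0 1)).add
        ((tS _ c2 q 0 1).mul (tm 1 (by norm_num) q 1 1)))
      simpa using this)
  have T := ((T1.sub (T3.const_mul 4)).sub (T2.const_mul (4 * I))).neg
  have T' := T.congr' (f₂ := fun _ => ∫ p, J p) (by
    filter_upwards [eventually_gt_atTop 0] with y hy using (key y hy).symm)
  have := tendsto_nhds_unique tendsto_const_nhds T'
  simpa using this

/-- The weak evolution of the first coefficient `P₀` of `M` contains the third one, `P₂`, under an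
`x`-derivative. Its upper right entry is determined by `B₂`, hence by `u_xx`, up to the function
called `G`, which is classically differentiable in `x`. Thus `u_xxx` occurs only in weak form, and
the rest is a pointwise identity. -/
theorem solvesNonlocalMKdV (h : RHFlow σ r₁ r₂ M Mp Mm) (hu : IsPotential σ Mp Mm u) :
    SolvesNonlocalMKdV σ u := by
  intro φ₀ hφs hφc
  have hφ := IsTest.of_contDiff hφs hφc
  have cb := h.continuous_coefS (k := 0) (by norm_num)
  have c1 := h.continuous_coefS (k := 1) (by norm_num)
  have c2 := h.continuous_coefS (k := 2) (by norm_num)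
  have m0 := h.continuous_coefM (k := 0) (by norm_num)
  have m1 := h.continuous_coefM (k := 1) (by norm_num)
  have m2 := h.continuous_coefM (k := 2) (by norm_num)
  set φ : ℝ × ℝ → ℂ := fun p => (φ₀ p : ℂ)
  set φx : ℝ × ℝ → ℂ := fun p => ((deriv (fun x => φ₀ (x, p.2)) p.1 : ℝ) : ℂ)
  set φxx : ℝ × ℝ → ℂ := fun p => ((iteratedDeriv 2 (fun x => φ₀ (x, p.2)) p.1 : ℝ) : ℂ)
  set φxxx : ℝ × ℝ → ℂ := fun p => ((iteratedDeriv 3 (fun x => φ₀ (x, p.2)) p.1 : ℝ) : ℂ)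
  set φt : ℝ × ℝ → ℂ := fun p => ((deriv (fun t => φ₀ (p.1, t)) p.2 : ℝ) : ℂ)
  set U : ℝ × ℝ → ℂ := fun p => -I * coefS Mp Mm 0 p 0 1 with hU
  set U₁ : ℝ × ℝ → ℂ := fun p => comm2 sigma3 (coefS Mp Mm 1 p) 0 1 with hU₁
  set B0x : ℝ × ℝ → Mat2 := fun p => I • comm2 sigma3 (coefS Mp Mm 1 p) with hB0x
  set B1x : ℝ × ℝ → Mat2 := fun p => I • (comm2 sigma3 (coefS Mp Mm 2 p)
    + comm2 (coefS Mp Mm 1 p) (coefS Mp Mm 0 p)) with hB1x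
  set P0x : ℝ × ℝ → Mat2 := fun p => I • coefS Mp Mm 1 p with hP0x
  set P1x : ℝ × ℝ → Mat2 := fun p => I • (coefS Mp Mm 2 p + coefS Mp Mm 1 p * coefM Mp Mm 0 p)
    with hP1x
  set U₂ : ℝ × ℝ → ℂ := fun p => (I • comm2 sigma3 (comm2 sigma3 (coefS Mp Mm 2 p)
    + comm2 (coefS Mp Mm 1 p) (coefS Mp Mm 0 p))) 0 1 with hU₂
  have k1 : Continuous fun p => comm2 sigma3 (coefS Mp Mm 1 p) := Continuous.comm2 continuous_const c1
  have k2 : Continuous fun p => comm2 sigma3 (coefS Mp Mm 2 p)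
      + comm2 (coefS Mp Mm 1 p) (coefS Mp Mm 0 p) :=
    (Continuous.comm2 continuous_const c2).add (Continuous.comm2 c1 cb)
  have kB0x : Continuous B0x := k1.const_smul I
  have kB1x : Continuous B1x := k2.const_smul I
  have kP0x : Continuous P0x := c1.const_smul I
  have kP1x : Continuous P1x := (c2.add (c1.mul m0)).const_smul I
  have kU : Continuous U := continuous_const.mul (cb.matrix_elem 0 1)
  have kU₁ : Continuous U₁ := k1.matrix_elem 0 1
  have k3 : Continuous fun p => comm2 sigma3 (comm2 sigma3 (coefS Mp Mm 2 p)
      + comm2 (coefS Mp Mm 1 p) (coefS Mp Mm 0 p)) := Continuous.comm2 continuous_const k2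
  have kU₂ : Continuous U₂ := (k3.const_smul I).matrix_elem 0 1
  have dU : ∀ p, HasDerivAt (fun x => U (x, p.2)) (U₁ p) p.1 := fun p => by
    refine ((h.hasDerivAt_coefS0 p 0 1).const_mul (-I)).congr_deriv ?_
    rw [Matrix.smul_apply, smul_eq_mul, ← mul_assoc, neg_mul, I_mul_I, neg_neg, one_mul]
  have dU₁ : ∀ p, HasDerivAt (fun x => U₁ (x, p.2)) (U₂ p) p.1 := fun p =>
    h.hasDerivAt_deriv_laxQ p.1 p.2 0 1
  set G : ℝ × ℝ → ℂ := fun p =>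
    (2 * I) * ((coefS Mp Mm 1 p * coefS Mp Mm 0 p) 0 1 - (coefS Mp Mm 0 p * coefS Mp Mm 1 p) 0 1)
    - (4 * I) * ((coefS Mp Mm 0 p * coefM Mp Mm 1 p) 0 1 + (coefS Mp Mm 1 p * coefM Mp Mm 0 p) 0 1)
    with hG
  set G' : ℝ × ℝ → ℂ := fun p =>
    (2 * I) * ((B1x p * coefS Mp Mm 0 p + coefS Mp Mm 1 p * B0x p) 0 1
      - (B0x p * coefS Mp Mm 1 p + coefS Mp Mm 0 p * B1x p) 0 1)
    - (4 * I) * ((B0x p * coefM Mp Mm 1 p + coefS Mp Mm 0 p * P1x p) 0 1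
      + (B1x p * coefM Mp Mm 0 p + coefS Mp Mm 1 p * P0x p) 0 1) with hG'
  have kG : Continuous G :=
    (continuous_const.mul (((c1.mul cb).matrix_elem 0 1).sub ((cb.mul c1).matrix_elem 0 1))).sub
      (continuous_const.mul (((cb.mul m1).matrix_elem 0 1).add ((c1.mul m0).matrix_elem 0 1)))
  have kG' : Continuous G' :=
    (continuous_const.mul ((((kB1x.mul cb).add (c1.mul kB0x)).matrix_elem 0 1).sub
      (((kB0x.mul c1).add (cb.mul kB1x)).matrix_elem 0 1))).sub
      (continuous_const.mul ((((kB0x.mul m1).add (cb.mul kP1x)).matrix_elem 0 1).add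
      (((kB1x.mul m0).add (c1.mul kP0x)).matrix_elem 0 1)))
  have dG : ∀ p, HasDerivAt (fun x => G (x, p.2)) (G' p) p.1 := fun p => by
    have d0 := h.hasDerivAt_coefS0 p
    have d1 := h.hasDerivAt_coefS1 p
    have e0 := h.hasDerivAt_coefM0 p
    have e1 := h.hasDerivAt_coefM1 p
    exact (((hasDerivAt_matrix_mul d1 d0 0 1).sub (hasDerivAt_matrix_mul d0 d1 0 1)).const_mul
      (2 * I)).sub (((hasDerivAt_matrix_mul d0 e1 0 1).add
        (hasDerivAt_matrix_mul d1 e0 0 1)).const_mul (4 * I))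
  have E1 := h.integral_coef_eq_zero hφ
  have E2 := integral_parts_fst kG kG' hφ.cont hφ.cont_x hφ.supp hφ.supp_x dG hφ.deriv_x
  have E3 := integral_parts_fst kU kU₁ hφ.cont_xx hφ.cont_xxx hφ.supp_xx hφ.supp_xxx dU hφ.deriv_xxx
  have E4 := integral_parts_fst kU₁ kU₂ hφ.cont_x hφ.cont_xx hφ.supp_x hφ.supp_xx dU₁ hφ.deriv_xx
  have i1 : Integrable fun p => (coefM Mp Mm 0 p 0 1 * φt p - 4 * (coefM Mp Mm 2 p 0 1 * φx p)
      - 4 * I * ((coefS Mp Mm 1 p * coefM Mp Mm 1 p + coefS Mp Mm 2 p * coefM Mp Mm 0 p) 0 1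
        * φ p)) :=
    ((integrable_mul_test (m0.matrix_elem 0 1) hφ.cont_t hφ.supp_t).sub
      ((integrable_mul_test (m2.matrix_elem 0 1) hφ.cont_x hφ.supp_x).const_mul 4)).sub
      ((integrable_mul_test (((c1.mul m1).add (c2.mul m0)).matrix_elem 0 1) hφ.cont
        hφ.supp).const_mul (4 * I))
  have i2 : Integrable fun p => G' p * φ p + G p * φx p :=
    (integrable_mul_test kG' hφ.cont hφ.supp).add (integrable_mul_test kG hφ.cont_x hφ.supp_x)
  have i3 : Integrable fun p => U₁ p * φxx p + U p * φxxx p :=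
    (integrable_mul_test kU₁ hφ.cont_xx hφ.supp_xx).add
      (integrable_mul_test kU hφ.cont_xxx hφ.supp_xxx)
  have i4 : Integrable fun p => U₂ p * φx p + U₁ p * φxx p :=
    (integrable_mul_test kU₂ hφ.cont_x hφ.supp_x).add
      (integrable_mul_test kU₁ hφ.cont_xx hφ.supp_xx)
  -- The factor `2 i` turns the `P₀` entry into `-u`. The difference of the last two identities is
  -- `u_xx φ_x - u φ_xxx`; its first term cancels the `B₂` part of `-8 i P₂ φ_x`, and the remaining
  -- multiple of `φ_x` is `G`, removed by the factor `-1`.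
  have tot := integral_lincomb i1 i2 (i4.sub i3) (2 * I) (-1) 1
  have E5 : ∫ p, ((fun p => U₂ p * φx p + U₁ p * φxx p)
      - (fun p => U₁ p * φxx p + U p * φxxx p)) p = 0 := by
    simp only [Pi.sub_apply]
    rw [integral_sub i4 i3, E3, E4, sub_zero]
  rw [E1, E2, E5, mul_zero, mul_zero, mul_zero, add_zero, add_zero] at tot
  rw [← ofReal_eq_zero, ← integral_complex_ofReal, ← tot]
  refine integral_congr_ae (ae_of_all _ fun p => ?_)
  obtain ⟨a0, a1, a2⟩ := h.coefS_anticomm p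
  obtain ⟨b0, b1, b2⟩ := h.coefS_eq p
  have N := mkdv_identity a1 a2 b0 b1
  have u1 : ((u p.1 p.2 : ℝ) : ℂ) = U p := ofReal_potential hu p.1 p.2
  have u2 : (σ : ℂ) * ((u (-p.1) (-p.2) : ℝ) : ℂ) = I * coefS Mp Mm 0 p 1 0 := by
    have := congrFun (congrFun (hu p.1 p.2) 1) 0
    simp [laxQ, _root_.offDiag] at this
    exact this
  have u3 : ((deriv (fun y => u y p.2) p.1 : ℝ) : ℂ) = U₁ p := by
    have d := h.hasDerivAt_laxQ hu p.1 p.2 0 1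
    have e : (fun y => laxQ σ u y p.2 0 1) = fun y => ((u y p.2 : ℝ) : ℂ) := by
      funext y; simp [laxQ, _root_.offDiag]
    rw [e] at d
    have d2 := (h.hasDerivAt_potential hu p.1 p.2).differentiableAt.hasDerivAt.ofReal_comp
    exact d2.unique d
  have s1 : U₁ p = 2 * coefS Mp Mm 1 p 0 1 := by
    simp only [hU₁, comm2, Matrix.sub_apply, mul_apply2]; simp [sigma3]; ring
  have s0 : coefS Mp Mm 0 p 0 1 = 2 * coefM Mp Mm 0 p 0 1 := by
    rw [b0]; simp only [Matrix.sub_apply, mul_apply2]; simp [sigma3]; ring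
  have s2 : coefM Mp Mm 2 p 0 1 = (coefS Mp Mm 2 p 0 1 + (coefS Mp Mm 0 p * coefM Mp Mm 1 p) 0 1
      + (coefS Mp Mm 1 p * coefM Mp Mm 0 p) 0 1) / 2 := by
    have := congrFun (congrFun b2 0) 1
    rw [Matrix.sub_apply, Matrix.sub_apply, Matrix.sub_apply, mul_apply2 sigma3,
      mul_apply2 _ sigma3] at this
    simp [sigma3] at this
    linear_combination (-1 / 2) * this
  have s3 : U₂ p = 4 * I * coefS Mp Mm 2 p 0 1 + 2 * I * ((coefS Mp Mm 1 p * coefS Mp Mm 0 p) 0 1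
      - (coefS Mp Mm 0 p * coefS Mp Mm 1 p) 0 1) := by
    have : ∀ A : Mat2, comm2 sigma3 A 0 1 = 2 * A 0 1 := fun A => by
      simp only [comm2, Matrix.sub_apply, mul_apply2]; simp [sigma3]; ring
    simp only [hU₂, Matrix.smul_apply, this, Matrix.add_apply, smul_eq_mul]
    rw [comm2, Matrix.sub_apply]
    ring
  have N' : 8 * (coefS Mp Mm 1 p * coefM Mp Mm 1 p + coefS Mp Mm 2 p * coefM Mp Mm 0 p) 0 1 - G' p
      = 12 * (coefS Mp Mm 0 p 0 1 * coefS Mp Mm 0 p 1 0 * coefS Mp Mm 1 p 0 1) := N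
  push_cast
  have u4 : 6 * (σ : ℂ) * (u p.1 p.2 : ℂ) * (u (-p.1) (-p.2) : ℂ)
      * ((deriv (fun y => u y p.2) p.1 : ℝ) : ℂ)
      = 12 * (coefS Mp Mm 0 p 0 1 * coefS Mp Mm 0 p 1 0 * coefS Mp Mm 1 p 0 1) := by
    rw [u1, u3, s1, hU]
    linear_combination (-12 * I * coefS Mp Mm 0 p 0 1 * coefS Mp Mm 1 p 0 1) * u2
      - 12 * coefS Mp Mm 0 p 0 1 * coefS Mp Mm 0 p 1 0 * coefS Mp Mm 1 p 0 1 * I_mul_I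
  have gU : U p = -I * coefS Mp Mm 0 p 0 1 := rfl
  have gG : G p = (2 * I) * ((coefS Mp Mm 1 p * coefS Mp Mm 0 p) 0 1
      - (coefS Mp Mm 0 p * coefS Mp Mm 1 p) 0 1) - (4 * I) *
      ((coefS Mp Mm 0 p * coefM Mp Mm 1 p) 0 1 + (coefS Mp Mm 1 p * coefM Mp Mm 0 p) 0 1) := rfl
  rw [u4, u1, ← N', Pi.sub_apply, s3, s2, gG, gU, s0]
  simp only [φ, φx, φxxx, φt]
  linear_combination (8 * (coefS Mp Mm 1 p * coefM Mp Mm 1 p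
    + coefS Mp Mm 2 p * coefM Mp Mm 0 p) 0 1 * (φ₀ p : ℂ)) * I_mul_I

end RHFlow

/-! ### Translations of weakly differentiable functions -/

/-- The variance of `f` about its mean on an interval of length `h` is nonnegative. -/
theorem sq_integral_le {f : ℝ → ℝ} {h : ℝ} (hh : 0 < h) (hf : Integrable f (volume.restrict (Ioc 0 h)))
    (hf2 : Integrable (fun τ => f τ ^ 2) (volume.restrict (Ioc 0 h))) :
    (∫ τ in Ioc 0 h, f τ) ^ 2 ≤ h * ∫ τ in Ioc 0 h, f τ ^ 2 := by
  set m := (∫ τ in Ioc 0 h, f τ) / h with hm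
  have e1 : ∫ τ in Ioc 0 h, f τ = h * m := by rw [hm]; field_simp
  have h0 : 0 ≤ ∫ τ in Ioc 0 h, (f τ - m) ^ 2 := integral_nonneg fun τ => sq_nonneg _
  have hv : (volume : Measure ℝ).real (Ioc 0 h) = h := by simp [hh.le]
  have e2 : ∫ τ in Ioc 0 h, (f τ - m) ^ 2 = (∫ τ in Ioc 0 h, f τ ^ 2) - 2 * m * (h * m) + h * m ^ 2 := by
    have : ∀ τ, (f τ - m) ^ 2 = f τ ^ 2 - 2 * m * f τ + m ^ 2 := fun τ => by ring
    simp only [this]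
    rw [integral_add (f := fun τ => f τ ^ 2 - 2 * m * f τ) (hf2.sub (hf.const_mul _))
      (integrable_const _), integral_sub hf2 (hf.const_mul _), integral_const_mul, e1]
    simp [hv]
  rw [e1]
  rw [e2] at h0
  nlinarith

theorem integrable_comp_add {E : Type*} [NormedAddCommGroup E] {f : ℝ → E} (hf : Integrable f) (h : ℝ) :
    Integrable (fun z : ℝ × ℝ => f (z.1 + z.2)) ((volume.restrict (Ioc 0 h)).prod volume) :=
  (measurePreserving_prod_add (volume.restrict (Ioc 0 h)) (volume : Measure ℝ)).integrable_comp_of_integrable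
    (g := fun z : ℝ × ℝ => f z.2) (hf.comp_snd _)

/-- Both sides are tested against `φ`. The average `ψ s = ∫₀ʰ φ (s - τ) dτ` is again a test function
with `ψ' s = φ s - φ (s - h)`, so the definition of the weak derivative applied to `ψ`, followed by
Fubini, is the claim. -/
theorem IsWeakDeriv.translate {f g : ℝ → ℂ} (hw : IsWeakDeriv f g) (hf : Continuous f)
    (hg : Integrable g) {h : ℝ} (hh : 0 < h) :
    ∀ᵐ s, f (s + h) - f s = ∫ τ in Ioc 0 h, g (τ + s) := by
  have hG := integrable_comp_add hg h
  refine ae_eq_of_integral_contDiff_smul_eq ?_ hG.integral_prod_right.locallyIntegrable ?_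
  · exact Continuous.locallyIntegrable (by fun_prop)
  intro φ hφ hc
  obtain ⟨B, hB⟩ := hφ.continuous.bounded_above_of_compact_support hc
  set ψ : ℝ → ℝ := fun s => ∫ τ in Ioc 0 h, φ (s - τ) with hψ
  have hψ2 : ∀ s, ψ s = ∫ τ in (s - h)..s, φ τ := by
    intro s
    rw [hψ]
    simp only
    rw [← intervalIntegral.integral_of_le hh.le, intervalIntegral.integral_comp_sub_left, sub_zero]
  have dψ : ∀ s, HasDerivAt ψ (φ s - φ (s - h)) s := by
    intro s
    have h1 : ∀ s, HasDerivAt (fun s => ∫ τ in (0 : ℝ)..s, φ τ) (φ s) s := fun s =>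
      hφ.continuous.integral_hasStrictDerivAt 0 s |>.hasDerivAt
    have h2 := (h1 (s - h)).comp_sub_const s h
    have e : ψ = fun s => (∫ τ in (0 : ℝ)..s, φ τ) - ∫ τ in (0 : ℝ)..(s - h), φ τ := by
      funext s
      rw [hψ2, intervalIntegral.integral_interval_sub_left] <;>
        exact hφ.continuous.intervalIntegrable _ _
    rw [e]
    exact (h1 s).sub h2
  have sψ : ContDiff ℝ ∞ ψ := by
    rw [contDiff_infty_iff_deriv]
    refine ⟨fun s => (dψ s).differentiableAt, ?_⟩
    rw [funext fun s => (dψ s).deriv]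
    exact hφ.sub (hφ.comp (contDiff_id.sub contDiff_const))
  have cψ : HasCompactSupport ψ := by
    obtain ⟨R, hR⟩ := hc.isCompact.isBounded.subset_closedBall (0 : ℝ)
    refine HasCompactSupport.of_support_subset_isCompact (isCompact_closedBall (0 : ℝ) (R + h))
      fun s hs => ?_
    by_contra hns
    refine hs ?_
    rw [hψ]
    refine setIntegral_eq_zero_of_forall_eq_zero fun τ hτ => ?_
    refine image_eq_zero_of_notMem_tsupport fun hmem => hns ?_
    have := hR hmem
    simp only [Metric.mem_closedBall, dist_zero_right, Real.norm_eq_abs] at this ⊢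
    have h3 := abs_le.1 this
    rw [abs_le]
    constructor <;> linarith [hτ.1, hτ.2]
  have key := hw ψ sψ cψ
  simp only [fun s => (dψ s).deriv] at key
  have icφ : Integrable fun s => f s * (φ s : ℂ) :=
    (hf.mul (continuous_ofReal.comp hφ.continuous)).integrable_of_hasCompactSupport
      (HasCompactSupport.mul_left (hc.comp_left (g := fun x : ℝ => (x : ℂ)) ofReal_zero))
  have icφh : Integrable fun s => f (s + h) * (φ s : ℂ) :=
    ((hf.comp (by fun_prop : Continuous fun s : ℝ => s + h)).mul
      (continuous_ofReal.comp hφ.continuous)).integrable_of_hasCompactSupport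
      (HasCompactSupport.mul_left (hc.comp_left (g := fun x : ℝ => (x : ℂ)) ofReal_zero))
  have icφh' : Integrable fun s => f s * (φ (s - h) : ℂ) := by
    have := icφh.comp_sub_right h
    simpa using this
  have lhs : ∫ s, f s * ((φ s - φ (s - h) : ℝ) : ℂ) = - ∫ s, φ s • (f (s + h) - f s) := by
    have e1 : ∫ s, f s * (φ (s - h) : ℂ) = ∫ s, f (s + h) * (φ s : ℂ) := by
      rw [← integral_add_right_eq_self (fun s => f s * (φ (s - h) : ℂ)) h]
      simp
    have e2 : ∀ s, f s * ((φ s - φ (s - h) : ℝ) : ℂ) = f s * φ s - f s * (φ (s - h) : ℂ) :=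
      fun s => by push_cast; ring
    have e3 : ∀ s, φ s • (f (s + h) - f s) = f (s + h) * φ s - f s * φ s := fun s => by
      rw [real_smul]; ring
    simp only [e2, e3]
    rw [integral_sub icφ icφh', integral_sub icφh icφ, e1]; ring
  rw [lhs, neg_inj] at key
  rw [key]
  have i1 : Integrable (fun z : ℝ × ℝ => g z.2 * (φ (z.2 - z.1) : ℂ))
      ((volume.restrict (Ioc 0 h)).prod volume) := by
    refine (hg.comp_snd _).mul_bdd (c := B) ?_ (ae_of_all _ fun z => ?_)
    · have : Continuous fun z : ℝ × ℝ => (φ (z.2 - z.1) : ℂ) :=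
        continuous_ofReal.comp (hφ.continuous.comp (by fun_prop))
      exact this.aestronglyMeasurable
    · rw [norm_real]; exact hB _
  have i2 : Integrable (fun z : ℝ × ℝ => g (z.1 + z.2) * (φ z.2 : ℂ))
      ((volume.restrict (Ioc 0 h)).prod volume) := by
    refine hG.mul_bdd (c := B) ?_ (ae_of_all _ fun z => ?_)
    · have : Continuous fun z : ℝ × ℝ => (φ z.2 : ℂ) :=
        continuous_ofReal.comp (hφ.continuous.comp (by fun_prop))
      exact this.aestronglyMeasurable
    · rw [norm_real]; exact hB _
  have s1 := integral_integral_swap (f := fun τ s => g s * (φ (s - τ) : ℂ)) i1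
  have s2 := integral_integral_swap (f := fun τ s => g (τ + s) * (φ s : ℂ)) i2
  have s3 : ∀ τ, ∫ s, g s * (φ (s - τ) : ℂ) = ∫ s, g (τ + s) * (φ s : ℂ) := by
    intro τ
    rw [← integral_add_left_eq_self (fun s => g s * (φ (s - τ) : ℂ)) τ]
    simp
  simp only [s3] at s1
  rw [s1] at s2
  have e1 : ∀ s, g s * ((ψ s : ℝ) : ℂ) = ∫ τ in Ioc 0 h, g s * (φ (s - τ) : ℂ) := by
    intro s
    rw [integral_const_mul, hψ]
    congr 1
    exact integral_complex_ofReal.symm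
  have e2 : ∀ s, φ s • (∫ τ in Ioc 0 h, g (τ + s)) = ∫ τ in Ioc 0 h, g (τ + s) * (φ s : ℂ) := by
    intro s
    rw [integral_mul_const, real_smul, mul_comm]
  simp only [e1, e2]
  exact s2

/-- The weighted `L²` modulus of continuity of a function with a weak derivative in the weighted
space. -/
theorem IsWeakDeriv.integral_translate_le {f g : ℝ → ℂ} (hw : IsWeakDeriv f g) (hf : Continuous f)
    (hg : Integrable g) (hg2 : Integrable fun s => ((1 + |s|) * ‖g s‖) ^ 2) {h : ℝ} (hh : 0 < h)
    (hh1 : h ≤ 1) : Integrable (fun s => ((1 + |s|) * ‖f (s + h) - f s‖) ^ 2) ∧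
      ∫ s, ((1 + |s|) * ‖f (s + h) - f s‖) ^ 2
        ≤ 4 * h ^ 2 * ∫ s, ((1 + |s|) * ‖g s‖) ^ 2 := by
  set N : ℝ → ℝ := fun s => ((1 + |s|) * ‖g s‖) ^ 2 with hN
  have iN := integrable_comp_add hg2 h
  have iG := integrable_comp_add hg h
  have b : ∀ᵐ s, ((1 + |s|) * ‖f (s + h) - f s‖) ^ 2 ≤ 4 * h * ∫ τ in Ioc 0 h, N (τ + s) := by
    filter_upwards [hw.translate hf hg hh, iN.prod_left_ae, iG.prod_left_ae] with s h1 h2 h3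
    have hcmp : ∀ τ ∈ Ioc 0 h, ((1 + |s|) * ‖g (τ + s)‖) ^ 2 ≤ 4 * N (τ + s) := by
      intro τ hτ
      -- The weight changes by at most the factor `2` under a shift of length at most one. Squared,
      -- this is the `4` in the constant; one `h` comes from Cauchy-Schwarz and one from integrating
      -- over `τ`.
      have h4 : 1 + |s| ≤ 2 * (1 + |τ + s|) := by
        have : |s| ≤ |τ + s| + |τ| := by
          have := abs_sub (τ + s) τ
          simpa using this
        rw [abs_of_pos hτ.1] at this
        linarith [hτ.2, abs_nonneg (τ + s)]
      have : (1 + |s|) * ‖g (τ + s)‖ ≤ 2 * ((1 + |τ + s|) * ‖g (τ + s)‖) := by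
        rw [← mul_assoc]; gcongr
      calc _ ≤ (2 * ((1 + |τ + s|) * ‖g (τ + s)‖)) ^ 2 := by gcongr
        _ = 4 * N (τ + s) := by rw [hN]; ring
    have i4 : Integrable (fun τ => ((1 + |s|) * ‖g (τ + s)‖) ^ 2) (volume.restrict (Ioc 0 h)) := by
      refine (h2.const_mul 4).mono' ?_ ?_
      · exact ((h3.aestronglyMeasurable.norm).const_mul _).pow 2
      · filter_upwards [ae_restrict_mem measurableSet_Ioc] with τ hτ
        rw [Real.norm_of_nonneg (by positivity)]
        exact hcmp τ hτ
    calc ((1 + |s|) * ‖f (s + h) - f s‖) ^ 2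
        ≤ (∫ τ in Ioc 0 h, (1 + |s|) * ‖g (τ + s)‖) ^ 2 := by
          rw [h1, integral_const_mul]
          gcongr
          exact norm_integral_le_integral_norm _
      _ ≤ h * ∫ τ in Ioc 0 h, ((1 + |s|) * ‖g (τ + s)‖) ^ 2 :=
          sq_integral_le hh (h3.norm.const_mul _) i4
      _ ≤ h * ∫ τ in Ioc 0 h, 4 * N (τ + s) := by
          refine mul_le_mul_of_nonneg_left ?_ hh.le
          exact setIntegral_mono_on i4 (h2.const_mul 4) measurableSet_Ioc hcmp
      _ = 4 * h * ∫ τ in Ioc 0 h, N (τ + s) := by rw [integral_const_mul]; ring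
  have iM : Integrable fun s => 4 * h * ∫ τ in Ioc 0 h, N (τ + s) :=
    iN.integral_prod_right.const_mul _
  have hc : Continuous fun s => ((1 + |s|) * ‖f (s + h) - f s‖) ^ 2 := by fun_prop
  have i5 : Integrable (fun s => ((1 + |s|) * ‖f (s + h) - f s‖) ^ 2) := by
    refine iM.mono' hc.aestronglyMeasurable ?_
    filter_upwards [b] with s hs
    rw [Real.norm_of_nonneg (by positivity)]
    exact hs
  refine ⟨i5, (integral_mono_ae i5 iM b).trans_eq ?_⟩
  rw [integral_const_mul, ← integral_integral_swap (f := fun τ s => N (τ + s)) iN]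
  simp only [integral_add_left_eq_self N]
  have hv : (volume : Measure ℝ).real (Ioc 0 h) = h := by simp [hh.le]
  simp [hv]
  ring

/-- The translates of `f` are Lipschitz in the weighted `L²` space. -/
def TranslationBound (f : ℝ → ℂ) : Prop :=
  ∃ C : ℝ, 0 ≤ C ∧ ∀ h : ℝ, 0 < h → h ≤ 1 →
    Integrable (fun s => ((1 + |s|) * ‖f (s + h) - f s‖) ^ 2) ∧
      ∫ s, ((1 + |s|) * ‖f (s + h) - f s‖) ^ 2 ≤ C * h ^ 2

/-- A weighted estimate for the Cauchy integral up to the real line. -/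
theorem norm_mul_cauchyInt_le {f : ℝ → ℂ} {w : ℝ → ℝ}
    (hfw : ∀ s, (1 + |s|) * ‖f s‖ ≤ w s) {A h : ℝ} (hh : 0 < h) (iw : Integrable fun s => w s ^ 2)
    (hA : ∫ s, w s ^ 2 ≤ A * h ^ 2) {z : ℂ} (hz : z.im ≠ 0) :
    ‖z‖ * ‖cauchyInt f z‖ ≤ h * ((A + (∫ s : ℝ, ((1 + |s|) ^ 2)⁻¹) + Real.pi)
      * (1 + (√|z.im|)⁻¹)) := by
  set y := |z.im| with hy
  have hy0 : 0 < y := abs_pos.2 hz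
  set q := √y with hq
  have hq0 : 0 < q := Real.sqrt_pos.2 hy0
  have hqy : q * q = y := Real.mul_self_sqrt hy0.le
  obtain ⟨ip, ep⟩ := integral_poisson hy0 z.re
  set I₀ := ∫ s : ℝ, ((1 + |s|) ^ 2)⁻¹ with hI₀
  have hI0 : 0 ≤ I₀ := integral_nonneg fun s => by positivity
  have hAh : 0 ≤ A * h ^ 2 := (integral_nonneg fun s => sq_nonneg _).trans hA
  have hA0 : 0 ≤ A := by
    by_contra hneg
    have : A * h ^ 2 < 0 := mul_neg_of_neg_of_pos (not_le.1 hneg) (by positivity)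
    linarith
  have nz : ∀ s : ℝ, 0 < ‖(s : ℂ) - z‖ := fun s => norm_pos_iff.2 (ofReal_sub_ne_zero hz s)
  have nsq : ∀ s : ℝ, ‖(s : ℂ) - z‖ ^ 2 = (s - z.re) ^ 2 + y ^ 2 := fun s => by
    rw [norm_ofReal_sub_sq, hy, sq_abs]
  have w0 : ∀ s, 0 ≤ w s := fun s => (by positivity : 0 ≤ (1 + |s|) * ‖f s‖).trans (hfw s)
  -- From `|z| ≤ |s - z| + |s|` come two products, each estimated by Young's inequality. The
  -- parameters `h` and `h √y` make all contributions `O(h)`; the Poisson integral `π / y` times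
  -- `√y` is the source of the factor `y^(-1/2)`.
  set G : ℝ → ℝ := fun s => (h⁻¹ * w s ^ 2 + h * ((1 + |s|) ^ 2)⁻¹)
      + ((h * q)⁻¹ * w s ^ 2 + h * q * ((s - z.re) ^ 2 + y ^ 2)⁻¹) with hG
  have j1 : Integrable fun s => h⁻¹ * w s ^ 2 + h * ((1 + |s|) ^ 2)⁻¹ :=
    (iw.const_mul _).add (integrable_inv_one_add_abs_sq.const_mul _)
  have j2 : Integrable fun s => (h * q)⁻¹ * w s ^ 2 + h * q * ((s - z.re) ^ 2 + y ^ 2)⁻¹ :=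
    (iw.const_mul _).add (ip.const_mul _)
  have pt : ∀ s : ℝ, ‖z‖ * ‖f s / ((s : ℂ) - z)‖ ≤ G s := by
    intro s
    have hn := nz s
    have h1 : ‖z‖ ≤ ‖(s : ℂ) - z‖ + |s| := by
      have := norm_sub_le (s : ℂ) ((s : ℂ) - z)
      rw [sub_sub_cancel, norm_real, Real.norm_eq_abs] at this
      linarith
    have h2 : ‖z‖ * ‖f s / ((s : ℂ) - z)‖ ≤ ‖f s‖ + |s| * ‖f s‖ / ‖(s : ℂ) - z‖ := by
      rw [norm_div, ← mul_div_assoc, div_le_iff₀ hn, add_mul, div_mul_cancel₀ _ hn.ne']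
      nlinarith [norm_nonneg (f s)]
    have h3 : ‖f s‖ ≤ w s * (1 + |s|)⁻¹ := by
      rw [← div_eq_mul_inv, le_div_iff₀ (by positivity), mul_comm]; exact hfw s
    have h4 : |s| * ‖f s‖ / ‖(s : ℂ) - z‖ ≤ w s * ‖(s : ℂ) - z‖⁻¹ := by
      rw [div_eq_mul_inv]
      gcongr
      exact le_trans (by gcongr; linarith) (hfw s)
    have am : ∀ a b c : ℝ, 0 < c → a * b ≤ c⁻¹ * a ^ 2 + c * b ^ 2 := by
      intro a b c hc
      have e : c⁻¹ * a ^ 2 + c * b ^ 2 - a * b = c⁻¹ * ((a - c * b / 2) ^ 2 + 3 / 4 * (c * b) ^ 2) := by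
        field_simp; ring
      have : 0 ≤ c⁻¹ * ((a - c * b / 2) ^ 2 + 3 / 4 * (c * b) ^ 2) := by positivity
      linarith
    have h5 := am (w s) (1 + |s|)⁻¹ h hh
    have h6 := am (w s) ‖(s : ℂ) - z‖⁻¹ (h * q) (by positivity)
    rw [inv_pow] at h5
    rw [inv_pow, nsq] at h6
    calc _ ≤ ‖f s‖ + |s| * ‖f s‖ / ‖(s : ℂ) - z‖ := h2
      _ ≤ w s * (1 + |s|)⁻¹ + w s * ‖(s : ℂ) - z‖⁻¹ := add_le_add h3 h4
      _ ≤ _ := add_le_add h5 h6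
  have hint : ∫ s, G s = (h⁻¹ * (∫ s, w s ^ 2) + h * I₀)
      + ((h * q)⁻¹ * (∫ s, w s ^ 2) + h * q * (Real.pi / y)) := by
    rw [hG, integral_add j1 j2, integral_add (iw.const_mul _)
      (integrable_inv_one_add_abs_sq.const_mul _), integral_add (iw.const_mul _) (ip.const_mul _),
      integral_const_mul, integral_const_mul, integral_const_mul, integral_const_mul, ep]
  have main : ‖z‖ * ‖cauchyInt f z‖ ≤ ∫ s, G s := by
    have e : ‖z‖ * ‖cauchyInt f z‖ = ‖(2 * Real.pi * I : ℂ)⁻¹‖ * ‖∫ s : ℝ, z * (f s / ((s : ℂ) - z))‖ := by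
      rw [integral_const_mul, cauchyInt, norm_mul, norm_mul]; ring
    rw [e]
    have : ‖∫ s : ℝ, z * (f s / ((s : ℂ) - z))‖ ≤ ∫ s, G s := by
      refine norm_integral_le_of_norm_le (j1.add j2) (ae_of_all _ fun s => ?_)
      rw [norm_mul]; exact pt s
    calc _ ≤ 1 * ∫ s, G s := mul_le_mul norm_two_pi_I_inv_le this (norm_nonneg _) zero_le_one
      _ = _ := one_mul _
  refine main.trans ?_
  rw [hint]
  have k1 : h⁻¹ * (∫ s, w s ^ 2) ≤ h * A := by
    calc _ ≤ h⁻¹ * (A * h ^ 2) := by gcongr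
      _ = h * A := by field_simp
  have k2 : (h * q)⁻¹ * (∫ s, w s ^ 2) ≤ h * A * q⁻¹ := by
    calc _ ≤ (h * q)⁻¹ * (A * h ^ 2) := by gcongr
      _ = h * A * q⁻¹ := by field_simp
  have k3 : h * q * (Real.pi / y) = h * Real.pi * q⁻¹ := by
    rw [← hqy]; field_simp
  have hqi : 0 < q⁻¹ := inv_pos.2 hq0
  have hpi := Real.pi_pos
  rw [k3]
  have : 0 ≤ h * I₀ * q⁻¹ + h * Real.pi := by positivity
  nlinarith

/-! ### Regularity of the solution in the spectral parameter -/

/-- Translation of the spectral parameter. -/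
theorem RHData.translate {V Mp Mm : ℝ → Mat2} {M : ℂ → Mat2} (hd : RHData V Mp Mm M) (h : ℝ) :
    RHData (fun s => V (s + h)) (fun s => Mp (s + h)) (fun s => Mm (s + h)) (fun z => M (z + h)) := by
  refine ⟨fun i j => (hd.cut i j).comp_add h, fun i j => ?_, fun s => hd.jump _, fun s => hd.detV _⟩
  obtain ⟨C, hC⟩ := hd.decays i j
  refine ⟨C * (1 + |h|), fun z hz => ?_⟩
  have h1 := hC (z + h) (by simpa using hz)
  have h2 : 1 + ‖z‖ ≤ (1 + ‖z + h‖) * (1 + |h|) := by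
    have : ‖z‖ ≤ ‖z + h‖ + |h| := by
      have := norm_sub_le (z + h) (h : ℂ)
      rwa [add_sub_cancel_right, norm_real, Real.norm_eq_abs] at this
    nlinarith [norm_nonneg (z + h), abs_nonneg h]
  calc _ ≤ ‖(M (z + h) - 1) i j‖ * ((1 + ‖z + h‖) * (1 + |h|)) := by gcongr
    _ = ‖(M (z + h) - 1) i j‖ * (1 + ‖z + h‖) * (1 + |h|) := by ring
    _ ≤ C * (1 + |h|) := by gcongr

/-- The quotient `M(z + h) M(z)⁻¹` is normalized, and its jump is bounded by `V(s + h) - V(s)`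
because all boundary values are bounded; no smallness of the relative jump is needed. Division by
`h` will bound `z M'(z)`. -/
theorem RHData.nrm_translate_sub_le {V Mp Mm : ℝ → Mat2} {M : ℂ → Mat2} (hd : RHData V Mp Mm M)
    {v A : ℝ} (hv : ∀ s, nrm (V s) ≤ v) :
    ∃ K : ℝ, 0 ≤ K ∧ ∀ h : ℝ, 0 < h → (Integrable fun s => ((1 + |s|) * nrm (V (s + h) - V s)) ^ 2) →
      (∫ s, ((1 + |s|) * nrm (V (s + h) - V s)) ^ 2) ≤ A * h ^ 2 → ∀ z : ℂ, z.im ≠ 0 →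
      ‖z‖ * nrm (M (z + h) - M z) ≤ h * (K * (1 + (√|z.im|)⁻¹)) := by
  obtain ⟨m, hm1, hmz, -, hmm⟩ := hd.bounded
  have hv0 : 0 ≤ v := (nrm_nonneg _).trans (hv 0)
  have hm0 : 0 ≤ m := zero_le_one.trans hm1
  set c := m * m * (m * (v * m)) with hc
  have hc0 : 0 ≤ c := by positivity
  set D := c ^ 2 * |A| + (∫ s : ℝ, ((1 + |s|) ^ 2)⁻¹) + Real.pi with hD
  have hI : 0 ≤ ∫ s : ℝ, ((1 + |s|) ^ 2)⁻¹ := integral_nonneg fun s => by positivity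
  have hD0 : 0 ≤ D := by have := Real.pi_pos; positivity
  refine ⟨4 * D * m, by positivity, fun h hh iw hA z hz => ?_⟩
  have hs := hd.translate h
  have hcont : Continuous fun s => nrm (V (s + h) - V s) :=
    (hs.continuous_V.sub hd.continuous_V).nrm
  set W := relJump (fun s => V (s + h)) V Mm with hW
  have nW : ∀ s, nrm (W s) ≤ m * (v * m) * nrm (V (s + h) - V s) := fun s => by
    calc nrm (W s) ≤ nrm (Mm s * (V (s + h) - V s)) * nrm ((V s).adjugate * (Mm s).adjugate) :=
          nrm_mul_le _ _
      _ ≤ (nrm (Mm s) * nrm (V (s + h) - V s)) * (nrm (V s).adjugate * nrm (Mm s).adjugate) :=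
          mul_le_mul (nrm_mul_le _ _) (nrm_mul_le _ _) (nrm_nonneg _)
            (mul_nonneg (nrm_nonneg _) (nrm_nonneg _))
      _ ≤ (m * nrm (V (s + h) - V s)) * (v * m) := by
          rw [nrm_adjugate, nrm_adjugate]
          have := nrm_nonneg (V (s + h) - V s)
          have := nrm_nonneg (V s); have := nrm_nonneg (Mm s)
          gcongr
          · exact hmm s
          · exact hv s
          · exact hmm s
      _ = _ := by ring
  set J : ℝ → Mat2 := fun s => Mm (s + h) * (Mm s).adjugate * W s with hJ
  have nJ : ∀ s, nrm (J s) ≤ c * nrm (V (s + h) - V s) := fun s => by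
    calc nrm (J s) ≤ nrm (Mm (s + h) * (Mm s).adjugate) * nrm (W s) := nrm_mul_le _ _
      _ ≤ (nrm (Mm (s + h)) * nrm (Mm s).adjugate) * (m * (v * m) * nrm (V (s + h) - V s)) :=
          mul_le_mul (nrm_mul_le _ _) (nW s) (nrm_nonneg _)
            (mul_nonneg (nrm_nonneg _) (nrm_nonneg _))
      _ ≤ (m * m) * (m * (v * m) * nrm (V (s + h) - V s)) := by
          rw [nrm_adjugate]
          have := nrm_nonneg (V (s + h) - V s)
          have := nrm_nonneg (Mm s); have := nrm_nonneg (Mm (s + h))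
          gcongr
          · exact hmm _
          · exact hmm s
      _ = _ := by rw [hc]; ring
  have ent : ∀ i j, (M (z + h) * (M z).adjugate - 1) i j = cauchyInt (fun s => J s i j) z := by
    intro i j
    have := ((hs.quotient_cut hd).sub (MatCut.const 1)).cauchy (hs.quotient_decays hd) hz i j
    rw [this]
    congr 1
    funext s
    have := hs.quotient_jump hd s
    rw [sub_sub_sub_cancel_right, this]
  have bd : ∀ i j, ‖z‖ * ‖(M (z + h) * (M z).adjugate - 1) i j‖ ≤ h * (D * (1 + (√|z.im|)⁻¹)) := by
    intro i j
    rw [ent i j]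
    have e : ∀ s, (c * ((1 + |s|) * nrm (V (s + h) - V s))) ^ 2
        = c ^ 2 * ((1 + |s|) * nrm (V (s + h) - V s)) ^ 2 := fun s => by ring
    refine norm_mul_cauchyInt_le (w := fun s => c * ((1 + |s|) * nrm (V (s + h) - V s)))
      (fun s => ?_) hh ?_ ?_ hz
    · calc _ ≤ (1 + |s|) * (c * nrm (V (s + h) - V s)) := by
            gcongr; exact (norm_entry_le _ i j).trans (nJ s)
        _ = _ := by ring
    · simp only [e]; exact iw.const_mul _
    · simp only [e]
      rw [integral_const_mul, mul_assoc]
      gcongr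
      exact hA.trans (by gcongr; exact le_abs_self A)
  have e : M (z + h) - M z = (M (z + h) * (M z).adjugate - 1) * M z := by
    rw [sub_mul, mul_assoc, adj_mul (hd.det_eq_one hz), mul_one, one_mul]
  have b4 : ‖z‖ * nrm (M (z + h) * (M z).adjugate - 1) ≤ 4 * (h * (D * (1 + (√|z.im|)⁻¹))) := by
    have := bd 0 0; have := bd 0 1; have := bd 1 0; have := bd 1 1
    unfold nrm
    linarith
  calc ‖z‖ * nrm (M (z + h) - M z) ≤ ‖z‖ * (nrm (M (z + h) * (M z).adjugate - 1) * nrm (M z)) := by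
        rw [e]; gcongr; exact nrm_mul_le _ _
    _ = (‖z‖ * nrm (M (z + h) * (M z).adjugate - 1)) * nrm (M z) := by ring
    _ ≤ (4 * (h * (D * (1 + (√|z.im|)⁻¹)))) * m := by
        refine mul_le_mul b4 (hmz z hz) (nrm_nonneg _) ?_
        positivity
    _ = _ := by ring

namespace RHFlow

variable {σ : ℝ} {r₁ r₂ : ℝ → ℂ} {M : ℝ × ℝ → ℂ → Mat2} {Mp Mm : ℝ × ℝ → ℝ → Mat2}

theorem norm_phase_translate_le (p : ℝ × ℝ) (s : ℝ) {h : ℝ} (hh : 0 < h) (hh1 : h ≤ 1) :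
    ‖phase p (s + h) - phase p s‖ ≤ 2 * (|p.1| + 12 * |p.2|) * h * (1 + |s|) ^ 2 := by
  -- Reading the value of `θ` as a new point, with spectral parameter `1`, makes the estimate for
  -- phases at two points applicable to two spectral parameters.
  have e : ∀ s', phase p s' = phase (theta p.1 p.2 s', 0) 1 := fun s' => by
    unfold phase theta; simp
  have e2 : ∀ a : ℝ, theta (a, (0 : ℝ)).1 (a, (0 : ℝ)).2 1 = a := fun a => by simp [theta]
  rw [e, e s]
  refine (norm_phase_sub_le _ _ _).trans ?_
  rw [e2, e2]
  have h1 : theta p.1 p.2 (s + h) - theta p.1 p.2 s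
      = h * (p.1 + 4 * p.2 * (3 * s ^ 2 + 3 * s * h + h ^ 2)) := by unfold theta; ring
  have h2 : |3 * s ^ 2 + 3 * s * h + h ^ 2| ≤ 3 * (1 + |s|) ^ 2 := by
    rw [abs_le]
    constructor <;> nlinarith [abs_nonneg s, sq_abs s, neg_abs_le s, le_abs_self s,
      mul_nonneg (abs_nonneg s) hh.le, mul_le_of_le_one_right (abs_nonneg s) hh1]
  have h3 : |p.1 + 4 * p.2 * (3 * s ^ 2 + 3 * s * h + h ^ 2)|
      ≤ (|p.1| + 12 * |p.2|) * (1 + |s|) ^ 2 := by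
    refine (abs_add_le _ _).trans ?_
    rw [abs_mul, abs_mul, abs_of_pos (by norm_num : (0 : ℝ) < 4)]
    have : |p.1| ≤ |p.1| * (1 + |s|) ^ 2 := by
      refine le_mul_of_one_le_right (abs_nonneg _) ?_
      nlinarith [abs_nonneg s]
    have : 4 * |p.2| * |3 * s ^ 2 + 3 * s * h + h ^ 2| ≤ 4 * |p.2| * (3 * (1 + |s|) ^ 2) := by gcongr
    linarith
  rw [h1, abs_mul, abs_of_pos hh]
  calc _ ≤ 2 * (h * ((|p.1| + 12 * |p.2|) * (1 + |s|) ^ 2)) := by gcongr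
    _ = _ := by ring

theorem nrm_jump_translate_le (h : RHFlow σ r₁ r₂ M Mp Mm) {v : ℝ}
    (hv : ∀ s, ‖r₁ s‖ + ‖r₂ s‖ ≤ v) (p : ℝ × ℝ) (s τ : ℝ) :
    nrm (jumpAt σ r₁ r₂ p (s + τ) - jumpAt σ r₁ r₂ p s)
      ≤ (v + 1) * (‖r₁ (s + τ) - r₁ s‖ + ‖r₂ (s + τ) - r₂ s‖)
        + (‖r₁ s‖ + ‖r₂ s‖) * ‖phase p (s + τ) - phase p s‖ := by
  have hσ := h.norm_sigma
  have cj : ‖(starRingEnd ℂ) (phase p (s + τ)) - (starRingEnd ℂ) (phase p s)‖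
      = ‖phase p (s + τ) - phase p s‖ := by rw [← map_sub, RCLike.norm_conj]
  have g : ∀ a b c d : ℂ, ‖a * b - c * d‖ ≤ ‖a - c‖ * ‖b‖ + ‖c‖ * ‖b - d‖ := fun a b c d => by
    have : a * b - c * d = (a - c) * b + c * (b - d) := by ring
    rw [this]
    refine (norm_add_le _ _).trans ?_
    rw [norm_mul, norm_mul]
  have v2 : ‖r₂ (s + τ)‖ ≤ v := by linarith [hv (s + τ), norm_nonneg (r₁ (s + τ))]
  have v1 : ‖r₁ s‖ ≤ v := by linarith [hv s, norm_nonneg (r₂ s)]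
  have e1 : ‖(1 + (σ : ℂ) * r₁ (s + τ) * r₂ (s + τ)) - (1 + (σ : ℂ) * r₁ s * r₂ s)‖
      ≤ v * ‖r₁ (s + τ) - r₁ s‖ + v * ‖r₂ (s + τ) - r₂ s‖ := by
    have : (1 + (σ : ℂ) * r₁ (s + τ) * r₂ (s + τ)) - (1 + (σ : ℂ) * r₁ s * r₂ s)
        = (σ : ℂ) * (r₁ (s + τ) * r₂ (s + τ) - r₁ s * r₂ s) := by ring
    rw [this, norm_mul, hσ, one_mul]
    refine (g _ _ _ _).trans ?_
    rw [mul_comm]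
    gcongr
  have e2 : ‖(σ : ℂ) * r₂ (s + τ) * phase p (s + τ) - (σ : ℂ) * r₂ s * phase p s‖
      ≤ ‖r₂ (s + τ) - r₂ s‖ + ‖r₂ s‖ * ‖phase p (s + τ) - phase p s‖ := by
    rw [mul_assoc, mul_assoc, ← mul_sub, norm_mul, hσ, one_mul]
    refine (g _ _ _ _).trans ?_
    rw [norm_phase, mul_one]
  have e3 : ‖r₁ (s + τ) * (starRingEnd ℂ) (phase p (s + τ)) - r₁ s * (starRingEnd ℂ) (phase p s)‖
      ≤ ‖r₁ (s + τ) - r₁ s‖ + ‖r₁ s‖ * ‖phase p (s + τ) - phase p s‖ := by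
    refine (g _ _ _ _).trans ?_
    rw [RCLike.norm_conj, norm_phase, mul_one, cj]
  rw [jumpAt_eq, jumpAt_eq, nrm]
  simp only [Matrix.sub_apply, Matrix.of_apply, Matrix.cons_val_zero, Matrix.cons_val_one,
    Matrix.cons_val', Matrix.cons_val_fin_one, sub_self, norm_zero, add_zero]
  linarith

/-- The increments of `r₁`, `r₂` are controlled by the assumed translation bounds. The increment of
the phase grows like `(1 + |s|)²`, which together with the weight `1 + |s|` uses up the `L^{2,3}`
bound. -/
theorem exists_translation_bound (h : RHFlow σ r₁ r₂ M Mp Mm) (h₁ : TranslationBound r₁)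
    (h₂ : TranslationBound r₂) (p : ℝ × ℝ) : ∃ A : ℝ, ∀ τ : ℝ, 0 < τ → τ ≤ 1 →
      (Integrable fun s => ((1 + |s|) *
        nrm (jumpAt σ r₁ r₂ p (s + τ) - jumpAt σ r₁ r₂ p s)) ^ 2) ∧
      (∫ s, ((1 + |s|) * nrm (jumpAt σ r₁ r₂ p (s + τ) - jumpAt σ r₁ r₂ p s)) ^ 2)
        ≤ A * τ ^ 2 := by
  obtain ⟨v, hv1, hv, -, -⟩ := h.exists_jump_bound
  have hv' : ∀ s, ‖r₁ s‖ + ‖r₂ s‖ ≤ v := fun s => by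
    have := hv s
    nlinarith [mul_nonneg (add_nonneg (norm_nonneg (r₁ s)) (norm_nonneg (r₂ s))) (abs_nonneg s)]
  obtain ⟨C₁, -, hC₁⟩ := h₁
  obtain ⟨C₂, -, hC₂⟩ := h₂
  set κ := 2 * (|p.1| + 12 * |p.2|) with hκ
  have hκ0 : 0 ≤ κ := by positivity
  set L := ∫ s, ((1 + |s|) ^ 3 * (‖r₁ s‖ + ‖r₂ s‖)) ^ 2 with hL
  refine ⟨3 * (v + 1) ^ 2 * C₁ + 3 * (v + 1) ^ 2 * C₂ + 3 * κ ^ 2 * L, fun τ hτ hτ1 => ?_⟩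
  obtain ⟨i1, b1⟩ := hC₁ τ hτ hτ1
  obtain ⟨i2, b2⟩ := hC₂ τ hτ hτ1
  set G : ℝ → ℝ := fun s => 3 * (v + 1) ^ 2 * ((1 + |s|) * ‖r₁ (s + τ) - r₁ s‖) ^ 2
      + 3 * (v + 1) ^ 2 * ((1 + |s|) * ‖r₂ (s + τ) - r₂ s‖) ^ 2
      + 3 * (κ * τ) ^ 2 * ((1 + |s|) ^ 3 * (‖r₁ s‖ + ‖r₂ s‖)) ^ 2 with hG
  have iG : Integrable G := ((i1.const_mul _).add (i2.const_mul _)).add (h.l2.const_mul _)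
  have pt : ∀ s, ((1 + |s|) * nrm (jumpAt σ r₁ r₂ p (s + τ) - jumpAt σ r₁ r₂ p s)) ^ 2 ≤ G s := by
    intro s
    have q1 := h.nrm_jump_translate_le hv' p s τ
    have q2 := norm_phase_translate_le p s hτ hτ1
    have q3 : (1 + |s|) * nrm (jumpAt σ r₁ r₂ p (s + τ) - jumpAt σ r₁ r₂ p s)
        ≤ (v + 1) * ((1 + |s|) * ‖r₁ (s + τ) - r₁ s‖) + (v + 1) * ((1 + |s|) * ‖r₂ (s + τ) - r₂ s‖)
          + (κ * τ) * ((1 + |s|) ^ 3 * (‖r₁ s‖ + ‖r₂ s‖)) := by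
      calc _ ≤ (1 + |s|) * ((v + 1) * (‖r₁ (s + τ) - r₁ s‖ + ‖r₂ (s + τ) - r₂ s‖)
            + (‖r₁ s‖ + ‖r₂ s‖) * (κ * τ * (1 + |s|) ^ 2)) := by
            gcongr
            refine q1.trans ?_
            gcongr
        _ = _ := by ring
    have q4 : ∀ a b c : ℝ, (a + b + c) ^ 2 ≤ 3 * (a ^ 2 + b ^ 2 + c ^ 2) := fun a b c => by
      nlinarith [sq_nonneg (a - b), sq_nonneg (a - c), sq_nonneg (b - c)]
    calc _ ≤ _ := pow_le_pow_left₀ (mul_nonneg (by positivity) (nrm_nonneg _)) q3 2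
      _ ≤ _ := q4 _ _ _
      _ = G s := by rw [hG]; ring
  have hc : Continuous fun s => ((1 + |s|) *
      nrm (jumpAt σ r₁ r₂ p (s + τ) - jumpAt σ r₁ r₂ p s)) ^ 2 := by
    have hV := (h.data p).continuous_V
    have : Continuous fun s => nrm (jumpAt σ r₁ r₂ p (s + τ) - jumpAt σ r₁ r₂ p s) :=
      Continuous.nrm ((hV.comp (by fun_prop : Continuous fun s : ℝ => s + τ)).sub hV)
    fun_prop
  have i3 := iG.mono' hc.aestronglyMeasurable (ae_of_all _ fun s => by
    rw [Real.norm_of_nonneg (by positivity)]; exact pt s)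
  refine ⟨i3, (integral_mono i3 iG pt).trans ?_⟩
  have : ∫ s, G s = 3 * (v + 1) ^ 2 * (∫ s, ((1 + |s|) * ‖r₁ (s + τ) - r₁ s‖) ^ 2)
      + 3 * (v + 1) ^ 2 * (∫ s, ((1 + |s|) * ‖r₂ (s + τ) - r₂ s‖) ^ 2) + 3 * (κ * τ) ^ 2 * L := by
    rw [hG, integral_add (f := fun s => 3 * (v + 1) ^ 2 * ((1 + |s|) * ‖r₁ (s + τ) - r₁ s‖) ^ 2
      + 3 * (v + 1) ^ 2 * ((1 + |s|) * ‖r₂ (s + τ) - r₂ s‖) ^ 2)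
      ((i1.const_mul _).add (i2.const_mul _)) (h.l2.const_mul _),
      integral_add (i1.const_mul _) (i2.const_mul _), integral_const_mul, integral_const_mul,
      integral_const_mul]
  rw [this]
  have hv0 : 0 ≤ 3 * (v + 1) ^ 2 := by positivity
  nlinarith [mul_le_mul_of_nonneg_left b1 hv0, mul_le_mul_of_nonneg_left b2 hv0]

end RHFlow

/-! ### The limit at infinity, uniformly up to the real line -/

/-- Mean value inequality against the primitive of `1 + τ^(-1/2)`. The bound stays finite as `a →
0`, since the singularity is integrable. -/
theorem norm_sub_le_of_deriv_inv_sqrt {γ γ' : ℝ → ℂ} {K : ℝ}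
    (hd : ∀ τ, 0 < τ → HasDerivAt γ (γ' τ) τ) (hb : ∀ τ, 0 < τ → ‖γ' τ‖ ≤ K * (1 + (√τ)⁻¹))
    {a b : ℝ} (ha : 0 < a) (hab : a ≤ b) : ‖γ b - γ a‖ ≤ K * ((b - a) + 2 * (√b - √a)) := by
  have hpos : ∀ τ ∈ Icc a b, 0 < τ := fun τ hτ => ha.trans_le hτ.1
  have hB : ∀ τ, 0 < τ → HasDerivAt (fun τ => K * ((τ - a) + 2 * (√τ - √a)))
      (K * (1 + (√τ)⁻¹)) τ := fun τ hτ => by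
    have h1 := ((Real.hasDerivAt_sqrt hτ.ne').sub_const (√a)).const_mul 2
    have h2 := (((hasDerivAt_id τ).sub_const a).add h1).const_mul K
    refine h2.congr_deriv ?_
    have : √τ ≠ 0 := (Real.sqrt_pos.2 hτ).ne'
    field_simp
  refine image_norm_le_of_norm_deriv_right_le_deriv_boundary' (f := fun τ => γ τ - γ a) (f' := γ')
    (B := fun τ => K * ((τ - a) + 2 * (√τ - √a))) (B' := fun τ => K * (1 + (√τ)⁻¹)) (a := a) (b := b)
    ?_ ?_ ?_ ?_ ?_ ?_ ⟨hab, le_rfl⟩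
  · exact fun τ hτ => ((hd τ (hpos τ hτ)).sub_const _).continuousAt.continuousWithinAt
  · exact fun τ hτ => ((hd τ (hpos τ ⟨hτ.1, hτ.2.le⟩)).sub_const _).hasDerivWithinAt
  · simp
  · exact fun τ hτ => (hB τ (hpos τ hτ)).continuousAt.continuousWithinAt
  · exact fun τ hτ => (hB τ (hpos τ ⟨hτ.1, hτ.2.le⟩)).hasDerivWithinAt
  · exact fun τ hτ => hb τ (hpos τ ⟨hτ.1, hτ.2.le⟩)

/-- A point closer than `δ` to the line is joined by a vertical segment to height `δ`. The change of
`F` along it is at most `K (δ + 2 √δ)`, independently of the real part, so convergence at each fixed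
distance from the line suffices. -/
theorem tendsto_atInftyOffReal {F F' : ℂ → ℂ} {K : ℝ} {c : ℂ} (hK : 0 ≤ K)
    (hd : ∀ z : ℂ, z.im ≠ 0 → HasDerivAt F (F' z) z)
    (hb : ∀ z : ℂ, z.im ≠ 0 → ‖F' z‖ ≤ K * (1 + (√|z.im|)⁻¹))
    (hF : ∀ δ : ℝ, 0 < δ → Tendsto F (Bornology.cobounded ℂ ⊓ 𝓟 {z : ℂ | δ ≤ |z.im|}) (𝓝 c)) :
    Tendsto F atInftyOffReal (𝓝 c) := by
  rw [Metric.tendsto_nhds]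
  intro ε hε
  obtain ⟨δ, hδ0, hδ⟩ : ∃ δ : ℝ, 0 < δ ∧ K * (δ + 2 * √δ) < ε / 2 := by
    have : Tendsto (fun δ : ℝ => K * (δ + 2 * √δ)) (𝓝[>] 0) (𝓝 (K * (0 + 2 * √0))) :=
      ((by fun_prop : Continuous fun δ : ℝ => K * (δ + 2 * √δ)).tendsto 0).mono_left
        nhdsWithin_le_nhds
    rw [Real.sqrt_zero, mul_zero, add_zero, mul_zero] at this
    exact ((eventually_mem_nhdsWithin (a := (0 : ℝ)) (s := Ioi 0)).and
      (this.eventually_lt_const (half_pos hε))).exists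
  have h1 := (Metric.tendsto_nhds.1 (hF δ hδ0)) (ε / 2) (half_pos hε)
  rw [eventually_inf_principal, Filter.hasBasis_cobounded_norm.eventually_iff] at h1
  obtain ⟨R, -, hR⟩ := h1
  rw [atInftyOffReal, eventually_inf_principal, Filter.hasBasis_cobounded_norm.eventually_iff]
  refine ⟨R + δ, trivial, fun z hz hzi => ?_⟩
  have hzi : z.im ≠ 0 := hzi
  have hz : R + δ ≤ ‖z‖ := hz
  rcases le_or_gt δ |z.im| with hc | hc
  · exact (hR (show R ≤ ‖z‖ by linarith) hc).trans (half_lt_self hε)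
  obtain ⟨s, hs1, hs⟩ : ∃ s : ℝ, |s| = 1 ∧ z.im = s * |z.im| := by
    rcases lt_or_gt_of_ne hzi with h | h
    · exact ⟨-1, by simp, by rw [abs_of_neg h]; ring⟩
    · exact ⟨1, by simp, by rw [abs_of_pos h]; ring⟩
  have hs0 : s ≠ 0 := fun h => by simp [h] at hs1
  set ζ : ℝ → ℂ := fun τ => (z.re : ℂ) + I * s * τ with hζ
  have ζim : ∀ τ, (ζ τ).im = s * τ := fun τ => by simp [hζ]
  have ζz : ζ |z.im| = z := by
    apply Complex.ext
    · simp [hζ]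
    · rw [ζim, ← hs]
  have ζd : ∀ τ, HasDerivAt ζ (I * s) τ := fun τ => by
    have := ((hasDerivAt_id τ).ofReal_comp.const_mul (I * (s : ℂ))).const_add (z.re : ℂ)
    simpa [hζ] using this
  have ns : ‖I * (s : ℂ)‖ = 1 := by simp [hs1]
  have im0 : ∀ τ, 0 < τ → (ζ τ).im ≠ 0 := fun τ hτ => by
    rw [ζim]; exact mul_ne_zero hs0 hτ.ne'
  have v := norm_sub_le_of_deriv_inv_sqrt (γ := fun τ => F (ζ τ)) (γ' := fun τ => F' (ζ τ) * (I * s))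
    (K := K) (fun τ hτ => (hd _ (im0 τ hτ)).comp_of_eq τ (ζd τ) rfl) (fun τ hτ => by
      have := hb _ (im0 τ hτ)
      rw [norm_mul, ns, mul_one]
      rwa [ζim, abs_mul, hs1, one_mul, abs_of_pos hτ] at this) (abs_pos.2 hzi) hc.le
  have v2 : dist (F (ζ δ)) (F z) ≤ K * (δ + 2 * √δ) := by
    rw [ζz] at v
    rw [dist_eq_norm]
    refine v.trans ?_
    gcongr <;> linarith [abs_nonneg z.im, Real.sqrt_nonneg |z.im|]
  have v3 : dist (F (ζ δ)) c < ε / 2 := by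
    refine hR ?_ ?_
    · show R ≤ ‖ζ δ‖
      have e : z - ζ δ = I * s * ((|z.im| - δ : ℝ) : ℂ) := by
        nth_rewrite 1 [← ζz]; simp only [hζ]; push_cast; ring
      have : ‖z - ζ δ‖ ≤ δ := by
        rw [e, norm_mul, ns, one_mul, norm_real, Real.norm_eq_abs, abs_le]
        constructor <;> linarith [abs_nonneg z.im]
      linarith [norm_sub_norm_le z (ζ δ)]
    · show δ ≤ |(ζ δ).im|
      rw [ζim, abs_mul, hs1, one_mul, abs_of_pos hδ0]
  have := dist_triangle (F z) (F (ζ δ)) c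
  rw [dist_comm] at v2
  linarith

theorem tendsto_cauchyInt_strip {f : ℝ → ℂ} (hf : Integrable f) {δ : ℝ} (hδ : 0 < δ) :
    Tendsto (cauchyInt f) (Bornology.cobounded ℂ ⊓ 𝓟 {z : ℂ | δ ≤ |z.im|}) (𝓝 0) := by
  have hcg : (Bornology.cobounded ℂ).IsCountablyGenerated := by
    rw [← comap_norm_atTop]; infer_instance
  have key : Tendsto (fun z : ℂ => ∫ s : ℝ, f s / ((s : ℂ) - z))
      (Bornology.cobounded ℂ ⊓ 𝓟 {z : ℂ | δ ≤ |z.im|}) (𝓝 (∫ _ : ℝ, (0 : ℂ))) := by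
    refine tendsto_integral_filter_of_dominated_convergence (fun s => ‖f s‖ / δ) ?_ ?_
      (hf.norm.div_const _) ?_
    · rw [eventually_inf_principal]
      refine Eventually.of_forall fun z (hz : δ ≤ |z.im|) => ?_
      exact (integrable_div_ofReal_sub hf (abs_pos.1 (hδ.trans_le hz))).aestronglyMeasurable
    · rw [eventually_inf_principal]
      refine Eventually.of_forall fun z (hz : δ ≤ |z.im|) => ae_of_all _ fun s => ?_
      rw [norm_div]
      gcongr
      exact hz.trans (abs_im_le_norm_ofReal_sub s z)
    · refine ae_of_all _ fun s => ?_
      have : Tendsto (fun z : ℂ => (s : ℂ) - z) (Bornology.cobounded ℂ) (Bornology.cobounded ℂ) := by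
        rw [← tendsto_norm_atTop_iff_cobounded]
        refine tendsto_atTop_mono (fun z => ?_)
          (tendsto_atTop_add_const_right _ (-‖(s : ℂ)‖) tendsto_norm_cobounded_atTop)
        have := norm_sub_norm_le z (s : ℂ)
        rw [norm_sub_rev] at this
        linarith
      have h2 := (tendsto_inv₀_cobounded.comp this).const_mul (f s)
      rw [mul_zero] at h2
      refine (h2.congr fun z => ?_).mono_left inf_le_left
      simp [div_eq_mul_inv]
  have := key.const_mul (2 * Real.pi * I : ℂ)⁻¹
  rw [integral_zero, mul_zero] at this
  exact this

namespace RHFlow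

variable {σ : ℝ} {r₁ r₂ : ℝ → ℂ} {M : ℝ × ℝ → ℂ → Mat2} {Mp Mm : ℝ × ℝ → ℝ → Mat2}

/-- The derivative of `z M` is `M + z M'`. The first term is bounded, and the second is a limit of
the translation quotients, of size `1 + |Im z|^(-1/2)`. Away from the line, `z M` is a coefficient
plus a Cauchy integral of an integrable density. -/
theorem tendsto_atInftyOffReal (h : RHFlow σ r₁ r₂ M Mp Mm) (h₁ : TranslationBound r₁)
    (h₂ : TranslationBound r₂) (p : ℝ × ℝ) {i j : Fin 2} (hij : i ≠ j) :
    Tendsto (fun z : ℂ => z * M p z i j) atInftyOffReal (𝓝 (coefM Mp Mm 0 p i j)) := by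
  obtain ⟨A, hA⟩ := h.exists_translation_bound h₁ h₂ p
  obtain ⟨m, hm1, hmz, -, -⟩ := (h.data p).bounded
  obtain ⟨v, hv⟩ : ∃ v, ∀ s, nrm (jumpAt σ r₁ r₂ p s) ≤ v := by
    obtain ⟨v, hv1, -, hv, -⟩ := h.exists_jump_bound
    exact ⟨v, fun s => hv p s⟩
  obtain ⟨K, hK0, hK⟩ := (h.data p).nrm_translate_sub_le (A := A) hv
  set f : ℂ → ℂ := fun z => M p z i j with hf
  have hfd : ∀ z : ℂ, z.im ≠ 0 → HasDerivAt f (deriv f z) z := fun z hz =>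
    (((h.data p).cut i j).diff.differentiableAt (isOpen_off_real.mem_nhds hz)).hasDerivAt
  have hf' : ∀ z : ℂ, z.im ≠ 0 → ‖z * deriv f z‖ ≤ K * (1 + (√|z.im|)⁻¹) := fun z hz => by
    have l : HasDerivAt (fun τ : ℝ => z + τ) 1 (0 : ℝ) := by
      simpa using (hasDerivAt_id (0 : ℝ)).ofReal_comp.const_add z
    have d : HasDerivAt (fun τ : ℝ => z * f (z + τ)) (z * (deriv f z * 1)) (0 : ℝ) :=
      HasDerivAt.const_mul z (HasDerivAt.comp_of_eq (0 : ℝ) (hfd z hz) l (by simp))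
    rw [mul_one] at d
    have t := (hasDerivAt_iff_tendsto_slope_zero.1 d).mono_left
      (nhdsWithin_mono (0 : ℝ) (show Ioi (0 : ℝ) ⊆ {0}ᶜ from fun τ hτ => (mem_Ioi.1 hτ).ne'))
    refine le_of_tendsto t.norm ?_
    filter_upwards [Ioc_mem_nhdsGT (zero_lt_one : (0 : ℝ) < 1)] with τ hτ
    obtain ⟨a1, a2⟩ := hA τ hτ.1 hτ.2
    have a3 := hK τ hτ.1 a1 a2 z hz
    rw [zero_add, ofReal_zero, add_zero, ← mul_sub, norm_smul, norm_mul, norm_inv,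
      Real.norm_of_nonneg hτ.1.le, inv_mul_le_iff₀ hτ.1]
    refine le_trans ?_ a3
    gcongr
    exact norm_entry_le (M p (z + τ) - M p z) i j
  refine _root_.tendsto_atInftyOffReal (F' := fun z => f z + z * deriv f z) (K := m + K)
    (by linarith) (fun z hz => ?_) (fun z hz => ?_) fun δ hδ => ?_
  · have := (hasDerivAt_id z).mul (hfd z hz)
    refine this.congr_deriv ?_
    simp
  · have b1 : ‖f z‖ ≤ m := (norm_entry_le (M p z) i j).trans (hmz z hz)
    have : 0 ≤ (√|z.im|)⁻¹ := by positivity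
    calc _ ≤ ‖f z‖ + ‖z * deriv f z‖ := norm_add_le _ _
      _ ≤ m + K * (1 + (√|z.im|)⁻¹) := add_le_add b1 (hf' z hz)
      _ ≤ _ := by nlinarith
  · obtain ⟨c, -, hc⟩ := h.rhoBdd_dens p
    have ii : Integrable fun s : ℝ => (s : ℂ) ^ (0 + 1) * dens Mp Mm p s i j :=
      h.integrable_pow_mul hc (by norm_num) i j
    have t := (tendsto_cauchyInt_strip ii hδ).add_const (coefM Mp Mm 0 p i j)
    rw [zero_add (coefM Mp Mm 0 p i j)] at t
    refine t.congr' ?_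
    rw [EventuallyEq, eventually_inf_principal]
    refine Eventually.of_forall fun z (hz : δ ≤ |z.im|) => ?_
    have hz0 : z.im ≠ 0 := abs_pos.1 (hδ.trans_le hz)
    have e := congrFun (congrFun (h.smul_matC_dens (k := 0) (by norm_num) p hz0) i) j
    rw [h.eq_one_add_matC p hz0]
    simp only [Matrix.add_apply, Matrix.smul_apply, smul_eq_mul, Matrix.one_apply_ne hij,
      zero_add] at e ⊢
    rw [e]
    simp [matC]

end RHFlow

/-! ### The weighted spaces -/

theorem bracket_sq (s : ℝ) : bracket s ^ 2 = 1 + s ^ 2 := Real.sq_sqrt (by positivity)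

theorem bracket_pos (s : ℝ) : 0 < bracket s := Real.sqrt_pos.2 (by positivity)

theorem continuous_bracket : Continuous bracket := by unfold bracket; fun_prop

theorem MemL2k.aestronglyMeasurable {k : ℕ} {f : ℝ → ℂ} (h : MemL2k k f) :
    AEStronglyMeasurable f := by
  have hc : Continuous fun s => (((bracket s ^ k : ℝ) : ℂ))⁻¹ :=
    Continuous.inv₀ (continuous_ofReal.comp (continuous_bracket.pow k)) fun s =>
      ofReal_ne_zero.2 (pow_pos (bracket_pos s) k).ne'
  refine (hc.aestronglyMeasurable.mul h.1).congr (ae_of_all _ fun s => ?_)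
  exact inv_mul_cancel_left₀ (ofReal_ne_zero.2 (pow_pos (bracket_pos s) k).ne') _

theorem MemL2k.integrable_sq {k : ℕ} {f : ℝ → ℂ} (h : MemL2k k f) :
    Integrable fun s => ((1 + |s|) ^ k * ‖f s‖) ^ 2 := by
  have hc : Continuous fun s : ℝ => (1 + |s|) ^ k := by fun_prop
  refine (((memLp_two_iff_integrable_sq_norm h.1).1 h).const_mul (2 ^ k)).mono'
    ((hc.aestronglyMeasurable.mul h.aestronglyMeasurable.norm).pow 2) (ae_of_all _ fun s => ?_)
  rw [Real.norm_of_nonneg (sq_nonneg _), norm_mul, norm_real,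
    Real.norm_of_nonneg (pow_pos (bracket_pos s) k).le, mul_pow, mul_pow, ← pow_mul, ← pow_mul,
    mul_comm k 2, pow_mul, pow_mul, bracket_sq, ← mul_assoc, ← mul_pow]
  gcongr
  nlinarith [sq_nonneg (1 - |s|), sq_abs s]

theorem MemL2k.integrable {f : ℝ → ℂ} (h : MemL2k 1 f) : Integrable f := by
  have h2 := h.integrable_sq
  simp only [pow_one] at h2
  refine (h2.add integrable_inv_one_add_abs_sq).mono' h.aestronglyMeasurable (ae_of_all _ fun s => ?_)
  have hp : 0 < 1 + |s| := by positivity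
  have e : ‖f s‖ = ((1 + |s|) * ‖f s‖) * (1 + |s|)⁻¹ := by field_simp
  have := two_mul_le_add_sq ((1 + |s|) * ‖f s‖) (1 + |s|)⁻¹
  rw [inv_pow] at this
  have h0 := norm_nonneg (f s)
  show ‖f s‖ ≤ ((1 + |s|) * ‖f s‖) ^ 2 + ((1 + |s|) ^ 2)⁻¹
  linarith

theorem MemH11.translationBound {f : ℝ → ℂ} (h : MemH11 f) (hf : Continuous f) :
    TranslationBound f := by
  obtain ⟨-, g, hw, hg⟩ := h
  have h2 := hg.integrable_sq
  simp only [pow_one] at h2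
  refine ⟨4 * ∫ s, ((1 + |s|) * ‖g s‖) ^ 2,
    mul_nonneg (by norm_num) (integral_nonneg fun s => sq_nonneg _), fun τ hτ hτ1 => ?_⟩
  obtain ⟨a, b⟩ := hw.integral_translate_le hf hg.integrable h2 hτ hτ1
  exact ⟨a, b.trans (le_of_eq (by ring))⟩

/-! ### Volterra equations -/

/-- The product rule for indefinite integrals. -/
theorem mul_eq_add_integral_Ioi {𝕜 : Type*} [RCLike 𝕜] {f g F G : ℝ → 𝕜} {c d : 𝕜} {x : ℝ}
    (hf : IntegrableOn f (Ioi x)) (hg : IntegrableOn g (Ioi x))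
    (hF : ∀ y, x ≤ y → F y = c + ∫ s in Ioi y, f s) (hG : ∀ y, x ≤ y → G y = d + ∫ s in Ioi y, g s) :
    F x * G x = c * d + ∫ y in Ioi x, (f y * G y + F y * g y) := by
  set ν := (volume : Measure ℝ).restrict (Ioi x) with hν
  have tail : ∀ (k : ℝ → 𝕜) (y : ℝ), x ≤ y → ∫ s in Ioi y, k s = ∫ s, (Ioi y).indicator k s ∂ν := by
    intro k y hy
    rw [integral_indicator measurableSet_Ioi, hν, Measure.restrict_restrict measurableSet_Ioi,
      inter_eq_left.2 (Ioi_subset_Ioi hy)]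
  have hK : Integrable (fun w : ℝ × ℝ => f w.1 * g w.2) (ν.prod ν) := Integrable.mul_prod hf hg
  have hK1 : Integrable (fun w : ℝ × ℝ => f w.1 * (Ioi w.1).indicator g w.2) (ν.prod ν) := by
    refine (hK.indicator (measurableSet_lt measurable_fst measurable_snd)).congr
      (ae_of_all _ fun w => ?_)
    by_cases h : w.1 < w.2 <;> simp [indicator, h]
  have hK2 : Integrable (fun w : ℝ × ℝ => (Ioi w.2).indicator f w.1 * g w.2) (ν.prod ν) := by
    refine (hK.indicator (measurableSet_lt measurable_snd measurable_fst)).congr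
      (ae_of_all _ fun w => ?_)
    by_cases h : w.2 < w.1 <;> simp [indicator, h]
  have i1 : Integrable (fun y => f y * ∫ s, (Ioi y).indicator g s ∂ν) ν := by
    refine hK1.integral_prod_left.congr (ae_of_all _ fun y => ?_)
    exact integral_const_mul (f y) ((Ioi y).indicator g)
  have i2 : Integrable (fun s => (∫ y, (Ioi s).indicator f y ∂ν) * g s) ν := by
    refine hK2.integral_prod_right.congr (ae_of_all _ fun s => ?_)
    exact integral_mul_const (g s) ((Ioi s).indicator f)
  -- The product of the integrals is an integral over the quadrant, split by Fubini into `y < s` and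
  -- `s < y`; the diagonal is a null set. Since `f` and `g` are merely integrable, this replaces the
  -- pointwise product rule.
  have key : (∫ y, f y * (∫ s, (Ioi y).indicator g s ∂ν) ∂ν)
      + ∫ s, (∫ y, (Ioi s).indicator f y ∂ν) * g s ∂ν = (∫ y, f y ∂ν) * ∫ s, g s ∂ν := by
    have e2 : ∫ s, (∫ y, (Ioi s).indicator f y ∂ν) * g s ∂ν
        = ∫ y, f y * (∫ s, (Iio y).indicator g s ∂ν) ∂ν := by
      have : ∫ s, (∫ y, (Ioi s).indicator f y ∂ν) * g s ∂ν
          = ∫ s, ∫ y, (Ioi s).indicator f y * g s ∂ν ∂ν := by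
        congr 1; funext s; exact (integral_mul_const _ _).symm
      rw [this, ← integral_integral_swap (f := fun y s => (Ioi s).indicator f y * g s) hK2]
      congr 1; funext y
      rw [← integral_const_mul]
      congr 1; funext s
      by_cases h : s < y <;> simp [indicator, h]
    have i3 : Integrable (fun y => f y * (∫ s, (Iio y).indicator g s ∂ν)) ν := by
      refine hK2.integral_prod_left.congr (ae_of_all _ fun y => ?_)
      show ∫ s, (Ioi s).indicator f y * g s ∂ν = f y * ∫ s, (Iio y).indicator g s ∂ν
      rw [← integral_const_mul]
      congr 1; funext s
      by_cases h : s < y <;> simp [indicator, h]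
    rw [e2, ← integral_add i1 i3, ← integral_mul_const]
    congr 1; funext y
    rw [← mul_add, ← integral_add (hg.indicator measurableSet_Ioi) (hg.indicator measurableSet_Iio)]
    congr 1
    refine integral_congr_ae ?_
    have : ∀ᵐ s ∂ν, s ≠ y := ae_restrict_of_ae (measure_eq_zero_iff_ae_notMem.1 (measure_singleton y))
    filter_upwards [this] with s hs
    rcases lt_or_gt_of_ne hs with h | h
    · simp [indicator, h, h.le]
    · simp [indicator, h, h.le]
  have e3 : ∫ y in Ioi x, (f y * G y + F y * g y)
      = ∫ y, ((d * f y + f y * ∫ s, (Ioi y).indicator g s ∂ν)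
        + (c * g y + (∫ s, (Ioi y).indicator f s ∂ν) * g y)) ∂ν := by
    refine setIntegral_congr_fun measurableSet_Ioi fun y hy => ?_
    rw [hF y (le_of_lt hy), hG y (le_of_lt hy), tail f y (le_of_lt hy), tail g y (le_of_lt hy)]
    ring
  rw [e3, integral_add (f := fun y => d * f y + f y * ∫ s, (Ioi y).indicator g s ∂ν)
    (g := fun y => c * g y + (∫ s, (Ioi y).indicator f s ∂ν) * g y)
    ((hf.const_mul d).add i1) ((hg.const_mul c).add i2),
    integral_add (hf.const_mul d) i1, integral_add (hg.const_mul c) i2, integral_const_mul,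
    integral_const_mul, hF x le_rfl, hG x le_rfl]
  linear_combination -key

theorem norm_exp_kernel_le {z : ℂ} (hz : 0 ≤ z.im) {w : ℝ} (hw : 0 ≤ w) :
    ‖exp (2 * I * z * (w : ℂ))‖ ≤ 1 := by
  rw [norm_exp, Real.exp_le_one_iff]
  have : (2 * I * z * (w : ℂ)).re = -(2 * (z.im * w)) := by simp; ring
  rw [this]
  have := mul_nonneg hz hw
  linarith

/-- The Volterra operator with kernel `exp (2 i z (y - x))`. -/
noncomputable def volT (z : ℂ) (g p : ℝ → ℂ) (x : ℝ) : ℂ :=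
  ∫ y in Ioi x, exp (2 * I * z * ((y - x : ℝ) : ℂ)) * (g y * p y)

theorem aestronglyMeasurable_volT_integrand {g p : ℝ → ℂ} (hg : Integrable g) (hp : Continuous p)
    (z : ℂ) (x : ℝ) : AEStronglyMeasurable
      (fun y => exp (2 * I * z * ((y - x : ℝ) : ℂ)) * (g y * p y)) := by
  have : Continuous fun y : ℝ => exp (2 * I * z * ((y - x : ℝ) : ℂ)) := by fun_prop
  exact this.aestronglyMeasurable.mul (hg.1.mul hp.aestronglyMeasurable)

theorem norm_volT_integrand_le {g p : ℝ → ℂ} {z : ℂ} (hz : 0 ≤ z.im) {x y : ℝ} (hxy : x ≤ y) :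
    ‖exp (2 * I * z * ((y - x : ℝ) : ℂ)) * (g y * p y)‖ ≤ ‖g y‖ * ‖p y‖ := by
  rw [norm_mul, norm_mul]
  exact mul_le_of_le_one_left (by positivity) (norm_exp_kernel_le hz (sub_nonneg.2 hxy))

theorem integrableOn_volT {g p : ℝ → ℂ} (hg : Integrable g) (hp : Continuous p) {C : ℝ}
    (hC : ∀ y, ‖p y‖ ≤ C) {z : ℂ} (hz : 0 ≤ z.im) (x : ℝ) :
    IntegrableOn (fun y => exp (2 * I * z * ((y - x : ℝ) : ℂ)) * (g y * p y)) (Ioi x) := by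
  refine (hg.norm.mul_const C).integrableOn.mono'
    (aestronglyMeasurable_volT_integrand hg hp z x).restrict ?_
  filter_upwards [ae_restrict_mem measurableSet_Ioi] with y hy
  exact (norm_volT_integrand_le hz (le_of_lt hy)).trans (by gcongr; exact hC y)

theorem norm_volT_le {g p : ℝ → ℂ} {z : ℂ} (hz : 0 ≤ z.im) {A : ℝ → ℝ} {x : ℝ}
    (hA : ∀ y, ‖p y‖ ≤ A y) (hi : IntegrableOn (fun y => ‖g y‖ * A y) (Ioi x)) :
    ‖volT z g p x‖ ≤ ∫ y in Ioi x, ‖g y‖ * A y := by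
  refine norm_integral_le_of_norm_le hi ?_
  filter_upwards [ae_restrict_mem measurableSet_Ioi] with y hy
  exact (norm_volT_integrand_le hz (le_of_lt hy)).trans (by gcongr; exact hA y)

theorem continuous_volT {g p : ℝ → ℂ} (hg : Integrable g) (hp : Continuous p) {C : ℝ}
    (hC : ∀ y, ‖p y‖ ≤ C) {z : ℂ} (hz : 0 ≤ z.im) : Continuous (volT z g p) := by
  have e : volT z g p = fun x => ∫ y, (Ioi x).indicator
      (fun y => exp (2 * I * z * ((y - x : ℝ) : ℂ)) * (g y * p y)) y := by
    funext x; rw [integral_indicator measurableSet_Ioi]; rfl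
  rw [e, continuous_iff_continuousAt]
  intro x₀
  refine tendsto_integral_filter_of_dominated_convergence (fun y => ‖g y‖ * C) ?_ ?_
    (hg.norm.mul_const C) ?_
  · exact Eventually.of_forall fun x =>
      (aestronglyMeasurable_volT_integrand hg hp z x).indicator measurableSet_Ioi
  · refine Eventually.of_forall fun x => ae_of_all _ fun y => ?_
    by_cases h : x < y
    · rw [indicator_of_mem (mem_Ioi.2 h)]
      exact (norm_volT_integrand_le hz h.le).trans (by gcongr; exact hC y)
    · rw [indicator_of_notMem (by simpa using h), norm_zero]
      exact mul_nonneg (norm_nonneg _) ((norm_nonneg _).trans (hC y))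
  · have : ∀ᵐ y : ℝ, y ≠ x₀ := measure_eq_zero_iff_ae_notMem.1 (measure_singleton x₀)
    filter_upwards [this] with y hy
    rcases lt_or_gt_of_ne hy with h | h
    · refine tendsto_const_nhds.congr' ?_
      filter_upwards [eventually_gt_nhds h] with x hx
      rw [indicator_of_notMem (by simpa using h.le), indicator_of_notMem (by simpa using hx.le)]
    · rw [indicator_of_mem (mem_Ioi.2 h)]
      have c : Continuous fun x : ℝ => exp (2 * I * z * ((y - x : ℝ) : ℂ)) * (g y * p y) := by
        fun_prop
      refine (c.tendsto x₀).congr' ?_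
      filter_upwards [eventually_lt_nhds h] with x hx
      rw [indicator_of_mem (mem_Ioi.2 hx)]

/-- The exponential weight which makes the Volterra operators contractions. -/
noncomputable def tailExp (h : ℝ → ℝ) (x : ℝ) : ℝ := Real.exp (∫ y in Ioi x, h y)

theorem continuous_tail {h : ℝ → ℝ} (hh : Integrable h) : Continuous fun x => ∫ y in Ioi x, h y := by
  have e : (fun x => ∫ y in Ioi x, h y) = fun x => (volT 0 (fun y => (h y : ℂ)) (fun _ => 1) x).re := by
    funext x
    simp only [volT, mul_zero, zero_mul, exp_zero, one_mul, mul_one]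
    rw [integral_complex_ofReal, ofReal_re]
  rw [e]
  exact continuous_re.comp (continuous_volT (C := 1) hh.ofReal continuous_const (by simp) (by simp))

theorem tail_nonneg {h : ℝ → ℝ} (h0 : ∀ y, 0 ≤ h y) (x : ℝ) : 0 ≤ ∫ y in Ioi x, h y :=
  integral_nonneg h0

theorem tail_le {h : ℝ → ℝ} (hh : Integrable h) (h0 : ∀ y, 0 ≤ h y) (x : ℝ) :
    ∫ y in Ioi x, h y ≤ ∫ y, h y := setIntegral_le_integral hh (ae_of_all _ h0)

/-- The tail integral need not be differentiable everywhere, so its powers are handled by induction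
with the integrated product rule. -/
theorem integral_mul_tail_pow {h : ℝ → ℝ} (hh : Integrable h) (h0 : ∀ y, 0 ≤ h y) (n : ℕ) (x : ℝ) :
    ∫ y in Ioi x, h y * (∫ s in Ioi y, h s) ^ n = (∫ s in Ioi x, h s) ^ (n + 1) / (n + 1) := by
  induction n generalizing x with
  | zero => simp
  | succ n ih =>
    set H : ℝ → ℝ := fun x => ∫ s in Ioi x, h s with hH
    have hHc : Continuous H := continuous_tail hh
    have ii : Integrable fun y => h y * H y ^ n := by
      refine hh.mul_bdd (c := (∫ s, h s) ^ n) (hHc.pow n).aestronglyMeasurable (ae_of_all _ fun y => ?_)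
      rw [norm_pow, Real.norm_of_nonneg (tail_nonneg h0 y)]
      exact pow_le_pow_left₀ (tail_nonneg h0 y) (tail_le hh h0 y) n
    have := mul_eq_add_integral_Ioi (𝕜 := ℝ) (f := h) (g := fun y => h y * H y ^ n) (F := H)
      (G := fun y => H y ^ (n + 1) / (n + 1)) (c := 0) (d := 0) (x := x) hh.integrableOn
      ii.integrableOn (fun y _ => by simp [hH]) (fun y _ => by rw [zero_add]; exact (ih y).symm)
    have e : ∀ y, h y * (H y ^ (n + 1) / (n + 1)) + H y * (h y * H y ^ n)
        = (((n : ℝ) + 2) / (n + 1)) * (h y * H y ^ (n + 1)) := fun y => by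
      have : (n : ℝ) + 1 ≠ 0 := by positivity
      field_simp; ring
    simp only [e] at this
    rw [integral_const_mul, mul_zero, zero_add] at this
    have h1 : (n : ℝ) + 1 ≠ 0 := by positivity
    have h2 : (n : ℝ) + 2 ≠ 0 := by positivity
    have h3 : ∫ y in Ioi x, h y * H y ^ (n + 1) = (n + 1) / (n + 2) * (H x * (H x ^ (n + 1) / (n + 1))) := by
      rw [this]; field_simp
    rw [h3]
    push_cast
    field_simp
    ring

theorem integrable_mul_tailExp {f h : ℝ → ℝ} (hf : Integrable f) (hh : Integrable h)
    (h0 : ∀ y, 0 ≤ h y) : Integrable fun y => f y * tailExp h y := by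
  refine hf.mul_bdd (c := Real.exp (∫ s, h s)) (Real.continuous_exp.comp
    (continuous_tail hh)).aestronglyMeasurable (ae_of_all _ fun y => ?_)
  rw [tailExp, Real.norm_of_nonneg (Real.exp_pos _).le]
  exact Real.exp_le_exp.2 (tail_le hh h0 y)

/-- The integrated form of `-(e^H)' = h e^H` for the tail integral `H`, obtained by summing the
exponential series term by term. -/
theorem integral_mul_tailExp {h : ℝ → ℝ} (hh : Integrable h) (h0 : ∀ y, 0 ≤ h y) (x : ℝ) :
    ∫ y in Ioi x, h y * tailExp h y = tailExp h x - 1 := by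
  set H : ℝ → ℝ := fun x => ∫ s in Ioi x, h s with hH
  have hHc : Continuous H := continuous_tail hh
  have s1 : ∀ w : ℝ, HasSum (fun n : ℕ => w ^ n / n.factorial) (Real.exp w) := fun w => by
    rw [Real.exp_eq_exp_ℝ]; exact NormedSpace.expSeries_div_hasSum_exp w
  have pt : ∀ y, HasSum (fun n : ℕ => h y * (H y ^ n / n.factorial)) (h y * tailExp h y) :=
    fun y => (s1 (H y)).mul_left _
  have key := hasSum_integral_of_dominated_convergence (μ := volume.restrict (Ioi x))
    (F := fun (n : ℕ) y => h y * (H y ^ n / n.factorial)) (f := fun y => h y * tailExp h y)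
    (fun n y => h y * (H y ^ n / n.factorial))
    (fun n => (hh.1.mul (hHc.pow n |>.div_const _).aestronglyMeasurable).restrict)
    (fun n => ae_of_all _ fun y => by
      rw [Real.norm_of_nonneg]
      have := tail_nonneg h0 y
      exact mul_nonneg (h0 y) (div_nonneg (pow_nonneg this n) (by positivity)))
    (ae_of_all _ fun y => (pt y).summable)
    (by
      simp only [fun y => (pt y).tsum_eq]
      exact (integrable_mul_tailExp hh hh h0).integrableOn)
    (ae_of_all _ pt)
  have e : ∀ n : ℕ, ∫ y in Ioi x, h y * (H y ^ n / n.factorial)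
      = H x ^ (n + 1) / (n + 1).factorial := fun n => by
    have : ∀ y, h y * (H y ^ n / n.factorial) = (n.factorial : ℝ)⁻¹ * (h y * H y ^ n) := fun y => by
      field_simp
    simp only [this]
    rw [integral_const_mul, integral_mul_tail_pow hh h0, Nat.factorial_succ]
    push_cast
    field_simp
    rfl
  simp only [e] at key
  have k2 := (hasSum_nat_add_iff' (f := fun n : ℕ => H x ^ n / n.factorial) 1).2 (s1 (H x))
  simp only [Finset.range_one, Finset.sum_singleton, pow_zero, Nat.factorial_zero, Nat.cast_one,
    div_one] at k2
  exact key.unique k2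

/-- A dominated integral of holomorphic functions is holomorphic. -/
theorem differentiableOn_integral_of_dominated {α : Type*} [MeasurableSpace α] {μ : Measure α}
    {F : ℂ → α → ℂ} {U : Set ℂ} {B : α → ℝ} (hU : IsOpen U)
    (hm : ∀ z ∈ U, AEStronglyMeasurable (F z) μ)
    (hd : ∀ᵐ y ∂μ, DifferentiableOn ℂ (fun z => F z y) U) (hb : ∀ᵐ y ∂μ, ∀ z ∈ U, ‖F z y‖ ≤ B y)
    (hB : Integrable B μ) : DifferentiableOn ℂ (fun z => ∫ y, F z y ∂μ) U := by
  intro z₀ hz₀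
  obtain ⟨r, hr, hrU⟩ := Metric.isOpen_iff.1 hU z₀ hz₀
  have hr2 : 0 < r / 2 := half_pos hr
  -- The derivative is a pointwise limit of difference quotients along a sequence, hence measurable.
  -- Cauchy's estimate on circles of radius `r / 2` later provides the domination.
  have hm' : AEStronglyMeasurable (fun y => deriv (fun z => F z y) z₀) μ := by
    set w : ℕ → ℂ := fun n => ((r / 2 / (n + 1) : ℝ) : ℂ) with hw
    have w0 : ∀ n, w n ≠ 0 := fun n => ofReal_ne_zero.2 (by positivity)
    have wU : ∀ n, z₀ + w n ∈ U := fun n => hrU (by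
      rw [Metric.mem_ball, dist_eq_norm, add_sub_cancel_left, hw, norm_real,
        Real.norm_of_nonneg (by positivity)]
      have : r / 2 / ((n : ℝ) + 1) ≤ r / 2 := div_le_self hr2.le (by linarith [n.cast_nonneg (α := ℝ)])
      linarith)
    have wt : Tendsto w atTop (𝓝[≠] 0) := by
      refine tendsto_nhdsWithin_iff.2 ⟨?_, Eventually.of_forall w0⟩
      have : Tendsto (fun n : ℕ => r / 2 / ((n : ℝ) + 1)) atTop (𝓝 0) :=
        tendsto_const_div_atTop_nhds_zero_nat (r / 2) |>.comp (tendsto_add_atTop_nat 1) |>.congr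
          fun n => by simp
      have h2 := (continuous_ofReal.tendsto 0).comp this
      rw [ofReal_zero] at h2
      exact h2
    refine aestronglyMeasurable_of_tendsto_ae atTop
      (f := fun n y => (w n)⁻¹ • (F (z₀ + w n) y - F z₀ y))
      (fun n => AEStronglyMeasurable.const_smul (f := fun y => F (z₀ + w n) y - F z₀ y)
        ((hm _ (wU n)).sub (hm z₀ hz₀)) (w n)⁻¹) ?_
    filter_upwards [hd] with y hy
    have := (hy.differentiableAt (hU.mem_nhds hz₀)).hasDerivAt
    exact (hasDerivAt_iff_tendsto_slope_zero.1 this).comp wt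
  have key := hasDerivAt_integral_of_dominated_loc_of_deriv_le (μ := μ) (F := F)
    (F' := fun z y => deriv (fun z => F z y) z) (x₀ := z₀) (bound := fun y => B y / (r / 2))
    (Metric.ball_mem_nhds z₀ hr2) (by filter_upwards [hU.mem_nhds hz₀] with z hz using hm z hz)
    (hB.mono' (hm z₀ hz₀) (hb.mono fun y hy => hy z₀ hz₀)) hm' ?_ (hB.div_const _) ?_
  · exact key.2.differentiableAt.differentiableWithinAt
  · filter_upwards [hd, hb] with y hy hby z hz
    have hsub : Metric.closedBall z (r / 2) ⊆ U := fun w hw => hrU (by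
      rw [Metric.mem_ball]
      rw [Metric.mem_closedBall] at hw
      rw [Metric.mem_ball] at hz
      linarith [dist_triangle w z z₀])
    refine norm_deriv_le_of_forall_mem_sphere_norm_le hr2
      ((hy.mono hsub).diffContOnCl_ball subset_rfl) fun w hw => hby w (hsub (Metric.sphere_subset_closedBall hw))
  · filter_upwards [hd] with y hy z hz
    exact (hy.differentiableAt (hU.mem_nhds (hrU (Metric.ball_subset_ball (by linarith) hz)))).hasDerivAt

/-- `z → ∞` in the closed upper half-plane. -/
noncomputable def atInftyUpper : Filter ℂ := Bornology.cobounded ℂ ⊓ 𝓟 {z : ℂ | 0 ≤ z.im}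

instance : atInftyUpper.IsCountablyGenerated := by
  have : (Bornology.cobounded ℂ).IsCountablyGenerated := by
    rw [← comap_norm_atTop]; infer_instance
  unfold atInftyUpper
  infer_instance

theorem eventually_atInftyUpper : ∀ᶠ z in atInftyUpper, 0 ≤ z.im :=
  mem_inf_of_right (mem_principal_self _)

theorem im_ofReal_mul_nonneg {e : ℝ} (he : 0 ≤ e) {z : ℂ} (hz : 0 ≤ z.im) : 0 ≤ ((e : ℂ) * z).im := by
  simpa using mul_nonneg he hz

section Parameter

variable {g : ℝ → ℂ} {P : ℂ → ℝ → ℂ} {C e : ℝ}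

/-- The factor `e` serves both Volterra equations: `0` for the one without an exponential kernel,
`1` for the other. -/
theorem tendsto_volT (hg : Integrable g) (hp : ∀ z : ℂ, 0 ≤ z.im → Continuous (P z))
    (hC : ∀ z : ℂ, 0 ≤ z.im → ∀ y, ‖P z y‖ ≤ C) (he : 0 ≤ e) (x : ℝ) {l : Filter ℂ}
    [l.IsCountablyGenerated] (hl : ∀ᶠ z in l, 0 ≤ z.im) {k : ℝ → ℂ}
    (hk : ∀ y, x < y → Tendsto (fun z => exp (2 * I * (e * z) * ((y - x : ℝ) : ℂ)) * (g y * P z y)) l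
      (𝓝 (k y))) :
    Tendsto (fun z => volT (e * z) g (P z) x) l (𝓝 (∫ y in Ioi x, k y)) := by
  refine tendsto_integral_filter_of_dominated_convergence (fun y => ‖g y‖ * C) ?_ ?_
    (hg.norm.mul_const C).integrableOn ?_
  · filter_upwards [hl] with z hz
    exact (aestronglyMeasurable_volT_integrand hg (hp z hz) _ x).restrict
  · filter_upwards [hl] with z hz
    filter_upwards [ae_restrict_mem measurableSet_Ioi] with y hy
    exact (norm_volT_integrand_le (im_ofReal_mul_nonneg he hz) (le_of_lt hy)).trans
      (by gcongr; exact hC z hz y)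
  · filter_upwards [ae_restrict_mem measurableSet_Ioi] with y hy
    exact hk y hy

theorem continuousOn_volT (hg : Integrable g) (hp : ∀ z : ℂ, 0 ≤ z.im → Continuous (P z))
    (hC : ∀ z : ℂ, 0 ≤ z.im → ∀ y, ‖P z y‖ ≤ C) (he : 0 ≤ e)
    (hz : ∀ y, ContinuousOn (fun z => P z y) {z | 0 ≤ z.im}) (x : ℝ) :
    ContinuousOn (fun z => volT (e * z) g (P z) x) {z | 0 ≤ z.im} := by
  intro z₀ hz₀
  refine tendsto_volT hg hp hC he x self_mem_nhdsWithin
    (k := fun y => exp (2 * I * (e * z₀) * ((y - x : ℝ) : ℂ)) * (g y * P z₀ y)) fun y _ => ?_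
  have : Continuous fun z : ℂ => exp (2 * I * (e * z) * ((y - x : ℝ) : ℂ)) := by fun_prop
  exact (this.tendsto z₀).mono_left nhdsWithin_le_nhds |>.mul ((hz y z₀ hz₀).const_mul (g y))

theorem differentiableOn_volT (hg : Integrable g) (hp : ∀ z : ℂ, 0 ≤ z.im → Continuous (P z))
    (hC : ∀ z : ℂ, 0 ≤ z.im → ∀ y, ‖P z y‖ ≤ C) (he : 0 ≤ e)
    (hz : ∀ y, DifferentiableOn ℂ (fun z => P z y) {z | 0 < z.im}) (x : ℝ) :
    DifferentiableOn ℂ (fun z => volT (e * z) g (P z) x) {z | 0 < z.im} := by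
  refine differentiableOn_integral_of_dominated (B := fun y => ‖g y‖ * C)
    (isOpen_lt continuous_const continuous_im) (fun z hz => ?_) (ae_of_all _ fun y => ?_) ?_
    (hg.norm.mul_const C).integrableOn
  · exact (aestronglyMeasurable_volT_integrand hg (hp z (le_of_lt hz)) _ x).restrict
  · have : Differentiable ℂ fun z : ℂ => exp (2 * I * (e * z) * ((y - x : ℝ) : ℂ)) := by fun_prop
    exact this.differentiableOn.mul ((hz y).const_mul (g y))
  · filter_upwards [ae_restrict_mem measurableSet_Ioi] with y hy z hz
    exact (norm_volT_integrand_le (im_ofReal_mul_nonneg he (le_of_lt hz)) (le_of_lt hy)).trans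
      (by gcongr; exact hC z (le_of_lt hz) y)

theorem tendsto_volT_zero (hg : Integrable g) (hp : ∀ z : ℂ, 0 ≤ z.im → Continuous (P z))
    (hC : ∀ z : ℂ, 0 ≤ z.im → ∀ y, ‖P z y‖ ≤ C) (he : 0 ≤ e)
    (hz : ∀ y, Tendsto (fun z => P z y) atInftyUpper (𝓝 0)) (x : ℝ) :
    Tendsto (fun z => volT (e * z) g (P z) x) atInftyUpper (𝓝 0) := by
  have := tendsto_volT hg hp hC he x eventually_atInftyUpper (k := fun _ => 0) fun y hy => by
    have h1 := (hz y).norm.const_mul ‖g y‖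
    rw [norm_zero, mul_zero] at h1
    refine squeeze_zero_norm' ?_ h1
    filter_upwards [eventually_atInftyUpper] with z hz
    exact norm_volT_integrand_le (im_ofReal_mul_nonneg he hz) hy.le
  simpa using this

end Parameter

theorem volT_sub {g p p' : ℝ → ℂ} (hg : Integrable g) (hp : Continuous p) (hp' : Continuous p')
    {C C' : ℝ} (hC : ∀ y, ‖p y‖ ≤ C) (hC' : ∀ y, ‖p' y‖ ≤ C') {z : ℂ} (hz : 0 ≤ z.im) (x : ℝ) :
    volT z g (fun y => p y - p' y) x = volT z g p x - volT z g p' x := by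
  rw [volT, volT, volT, ← integral_sub (integrableOn_volT hg hp hC hz x)
    (integrableOn_volT hg hp' hC' hz x)]
  congr 1; funext y; ring

theorem volT_sub_left {g g' p : ℝ → ℂ} (hg : Integrable g) (hg' : Integrable g') (hp : Continuous p)
    {C : ℝ} (hC : ∀ y, ‖p y‖ ≤ C) {z : ℂ} (hz : 0 ≤ z.im) (x : ℝ) :
    volT z (fun y => g y - g' y) p x = volT z g p x - volT z g' p x := by
  rw [volT, volT, volT, ← integral_sub (integrableOn_volT hg hp hC hz x)
    (integrableOn_volT hg' hp hC hz x)]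
  congr 1; funext y; ring

/-- One integration by parts: the kernel equals `1` at `x` and is bounded by `1` beyond it for `z`
in the closed upper half-plane. -/
theorem norm_mul_volT_le_of_smooth {φ : ℝ → ℂ} (hφ : ContDiff ℝ 1 φ) (hc : HasCompactSupport φ)
    {z : ℂ} (hz : 0 ≤ z.im) (x : ℝ) :
    ‖z‖ * ‖volT z φ (fun _ => 1) x‖ ≤ ‖φ x‖ + ∫ y, ‖deriv φ y‖ := by
  have iφ : Integrable φ := hφ.continuous.integrable_of_hasCompactSupport hc
  have cφ' : Continuous (deriv φ) := hφ.continuous_deriv le_rfl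
  have iφ' : Integrable (deriv φ) := cφ'.integrable_of_hasCompactSupport hc.deriv
  set ε : ℝ → ℂ := fun y => exp (2 * I * z * ((y - x : ℝ) : ℂ)) with hε
  have hd : ∀ y, HasDerivAt (fun y => ε y * φ y) (2 * I * z * (ε y * (φ y * 1)) + ε y * (deriv φ y * 1)) y := by
    intro y
    have h1 : HasDerivAt (fun y : ℝ => 2 * I * z * ((y - x : ℝ) : ℂ)) (2 * I * z) y := by
      simpa using ((hasDerivAt_id y).sub_const x).ofReal_comp.const_mul (2 * I * z)
    refine (h1.cexp.mul (hφ.differentiable (by norm_num) y).hasDerivAt).congr_deriv ?_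
    simp only [hε]; ring
  have i1 := integrableOn_volT iφ (continuous_const (y := (1 : ℂ))) (C := 1) (by simp) hz x
  have i2 := integrableOn_volT iφ' (continuous_const (y := (1 : ℂ))) (C := 1) (by simp) hz x
  have ht : Tendsto (fun y => ε y * φ y) atTop (𝓝 0) := by
    have h0 : Tendsto φ atTop (𝓝 0) := hc.is_zero_at_infty.mono_left atTop_le_cocompact
    have := h0.norm
    rw [norm_zero] at this
    refine squeeze_zero_norm' ?_ this
    filter_upwards [eventually_ge_atTop x] with y hy
    rw [norm_mul]
    exact mul_le_of_le_one_left (norm_nonneg _) (norm_exp_kernel_le hz (sub_nonneg.2 hy))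
  have key := integral_Ioi_of_hasDerivAt_of_tendsto' (a := x) (fun y _ => hd y)
    ((i1.const_mul (2 * I * z)).add i2) ht
  rw [integral_add (i1.const_mul (2 * I * z)) i2, integral_const_mul] at key
  have e0 : ε x = 1 := by simp [hε]
  have k2 : 2 * I * z * volT z φ (fun _ => 1) x = -φ x - volT z (deriv φ) (fun _ => 1) x := by
    rw [volT, volT]
    rw [e0] at key
    linear_combination key
  have n2 : ‖volT z (deriv φ) (fun _ => 1) x‖ ≤ ∫ y, ‖deriv φ y‖ := by
    refine (norm_volT_le hz (A := fun _ => 1) (by simp) (by simpa using iφ'.norm.integrableOn)).trans ?_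
    simp only [mul_one]
    exact setIntegral_le_integral iφ'.norm (ae_of_all _ fun y => norm_nonneg _)
  have n1 : 2 * (‖z‖ * ‖volT z φ (fun _ => 1) x‖) ≤ ‖φ x‖ + ∫ y, ‖deriv φ y‖ := by
    calc _ = ‖2 * I * z * volT z φ (fun _ => 1) x‖ := by simp; ring
      _ ≤ ‖φ x‖ + ‖volT z (deriv φ) (fun _ => 1) x‖ := by
          rw [k2]; exact (norm_sub_le _ _).trans (by rw [norm_neg])
      _ ≤ _ := by gcongr
  have : 0 ≤ ‖z‖ * ‖volT z φ (fun _ => 1) x‖ := by positivity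
  linarith

/-- The Riemann-Lebesgue lemma in the closed upper half-plane. -/
theorem tendsto_volT_one {g : ℝ → ℂ} (hg : Integrable g) (x : ℝ) :
    Tendsto (fun z => volT z g (fun _ => 1) x) atInftyUpper (𝓝 0) := by
  rw [Metric.tendsto_nhds]
  intro ε hε
  obtain ⟨φ, hc, hφ, hgφ⟩ := (memLp_one_iff_integrable.2 hg).exist_eLpNorm_sub_le (by simp) le_rfl
    (half_pos hε)
  have iφ : Integrable φ := hφ.continuous.integrable_of_hasCompactSupport hc
  have hd : ∫ y, ‖g y - φ y‖ ≤ ε / 2 := by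
    rw [integral_norm_eq_lintegral_enorm (f := fun y => g y - φ y) (hg.sub iφ).1]
    rw [eLpNorm_one_eq_lintegral_enorm] at hgφ
    exact ENNReal.toReal_le_of_le_ofReal (half_pos hε).le hgφ
  set K := ‖φ x‖ + ∫ y, ‖deriv φ y‖ with hK
  have hK0 : 0 ≤ K := add_nonneg (norm_nonneg _) (integral_nonneg fun y => norm_nonneg _)
  have hlarge : ∀ᶠ z in atInftyUpper, 2 * K / ε < ‖z‖ :=
    mem_inf_of_left (tendsto_norm_cobounded_atTop.eventually (eventually_gt_atTop _))
  filter_upwards [hlarge, eventually_atInftyUpper] with z hz hzi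
  have hz0 : 0 < ‖z‖ := lt_of_le_of_lt (by positivity) hz
  have b1 := norm_mul_volT_le_of_smooth (hφ.of_le (by exact_mod_cast le_top)) hc hzi x
  have b2 : ‖volT z φ (fun _ => 1) x‖ < ε / 2 := by
    rw [div_lt_iff₀ hε] at hz
    by_contra! hge
    nlinarith [mul_le_mul_of_nonneg_left hge hz0.le]
  have b3 := volT_sub_left hg iφ (continuous_const (y := (1 : ℂ))) (C := 1) (by simp) hzi x
  have b4 : ‖volT z (fun y => g y - φ y) (fun _ => 1) x‖ ≤ ε / 2 := by
    have i : Integrable fun y => g y - φ y := hg.sub iφ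
    refine (norm_volT_le hzi (A := fun _ => 1) (by simp) (by simpa using i.norm.integrableOn)).trans ?_
    simp only [mul_one]
    exact (setIntegral_le_integral i.norm (ae_of_all _ fun y => norm_nonneg _)).trans hd
  rw [dist_zero_right]
  have : volT z g (fun _ => 1) x
      = volT z (fun y => g y - φ y) (fun _ => 1) x + volT z φ (fun _ => 1) x := by rw [b3]; ring
  rw [this]
  linarith [norm_add_le (volT z (fun y => g y - φ y) (fun _ => 1) x) (volT z φ (fun _ => 1) x)]

/-- Bounded continuous solutions of a pair of Volterra equations. -/
structure IsVol (f g : ℝ → ℂ) (z : ℂ) (p q : ℝ → ℂ) : Prop where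
  cont_fst : Continuous p
  cont_snd : Continuous q
  bdd_fst : ∃ C : ℝ, ∀ x, ‖p x‖ ≤ C
  bdd_snd : ∃ C : ℝ, ∀ x, ‖q x‖ ≤ C
  eq_fst : ∀ x, p x = 1 - volT 0 f q x
  eq_snd : ∀ x, q x = volT z g p x

/-- The Picard iterates of the Volterra equations. -/
noncomputable def volIter (f g : ℝ → ℂ) (z : ℂ) : ℕ → (ℝ → ℂ) × (ℝ → ℂ)
  | 0 => (fun _ => 1, fun _ => 0)
  | n + 1 => (fun x => 1 - volT 0 f (volIter f g z n).2 x, volT z g (volIter f g z n).1)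

/-- The rate of the contraction weight. -/
noncomputable def volRate (f g : ℝ → ℂ) (y : ℝ) : ℝ := 2 * (‖f y‖ + ‖g y‖)

section

variable {f g : ℝ → ℂ}

theorem volRate_nonneg (y : ℝ) : 0 ≤ volRate f g y := by unfold volRate; positivity

theorem integrable_volRate (hf : Integrable f) (hg : Integrable g) : Integrable (volRate f g) :=
  (hf.norm.add hg.norm).const_mul 2

theorem one_le_tailExp {h : ℝ → ℝ} (h0 : ∀ y, 0 ≤ h y) (x : ℝ) : 1 ≤ tailExp h x :=
  Real.one_le_exp (tail_nonneg h0 x)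

theorem tailExp_le {h : ℝ → ℝ} (hh : Integrable h) (h0 : ∀ y, 0 ≤ h y) (x : ℝ) :
    tailExp h x ≤ Real.exp (∫ y, h y) := Real.exp_le_exp.2 (tail_le hh h0 x)

/-- In the norm weighted by `tailExp` the Volterra operator is a contraction by `1/2`, uniformly in
`z`: the factor `2` in the rate produces `A / 2`. The term `-1` leaves room for the inhomogeneity
`1`. -/
theorem norm_volT_le_tailExp {h : ℝ → ℝ} (hh : Integrable h) (h0 : ∀ y, 0 ≤ h y) {k p : ℝ → ℂ}
    (hk : Integrable k) (hkh : ∀ y, 2 * ‖k y‖ ≤ h y) {z : ℂ} (hz : 0 ≤ z.im) {A : ℝ} (hA : 0 ≤ A)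
    (hp : ∀ y, ‖p y‖ ≤ A * tailExp h y) (x : ℝ) : ‖volT z k p x‖ ≤ A / 2 * (tailExp h x - 1) := by
  have i1 : Integrable fun y => ‖k y‖ * (A * tailExp h y) := by
    refine ((integrable_mul_tailExp hk.norm hh h0).const_mul A).congr (ae_of_all _ fun y => ?_)
    ring
  refine (norm_volT_le hz hp i1.integrableOn).trans ?_
  rw [← integral_mul_tailExp hh h0, ← integral_const_mul]
  refine integral_mono i1.integrableOn ((integrable_mul_tailExp hh hh h0).const_mul _).integrableOn
    fun y => ?_
  have := hkh y
  have hE : 0 ≤ A * tailExp h y := mul_nonneg hA (Real.exp_pos _).le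
  show ‖k y‖ * (A * tailExp h y) ≤ A / 2 * (h y * tailExp h y)
  nlinarith

theorem two_norm_fst_le (y : ℝ) : 2 * ‖f y‖ ≤ volRate f g y := by
  unfold volRate; linarith [norm_nonneg (g y)]

theorem two_norm_snd_le (y : ℝ) : 2 * ‖g y‖ ≤ volRate f g y := by
  unfold volRate; linarith [norm_nonneg (f y)]

theorem zero_im_nonneg : 0 ≤ (0 : ℂ).im := le_rfl

theorem volIter_spec (hf : Integrable f) (hg : Integrable g) {z : ℂ} (hz : 0 ≤ z.im) (n : ℕ) :
    (Continuous (volIter f g z n).1 ∧ Continuous (volIter f g z n).2) ∧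
      (∀ x, ‖(volIter f g z n).1 x‖ ≤ tailExp (volRate f g) x) ∧
        ∀ x, ‖(volIter f g z n).2 x‖ ≤ tailExp (volRate f g) x := by
  have hh := integrable_volRate hf hg
  have h0 := volRate_nonneg (f := f) (g := g)
  have h1 := one_le_tailExp h0
  induction n with
  | zero =>
    refine ⟨⟨continuous_const, continuous_const⟩, fun x => ?_, fun x => ?_⟩
    · simpa [volIter] using h1 x
    · simpa [volIter] using zero_le_one.trans (h1 x)
  | succ n ih =>
    obtain ⟨⟨c1, c2⟩, b1, b2⟩ := ih
    have k1 := fun x => (b1 x).trans (tailExp_le hh h0 x)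
    have k2 := fun x => (b2 x).trans (tailExp_le hh h0 x)
    refine ⟨⟨continuous_const.sub (continuous_volT hf c2 k2 zero_im_nonneg),
      continuous_volT hg c1 k1 hz⟩, fun x => ?_, fun x => ?_⟩
    · have := norm_volT_le_tailExp hh h0 hf two_norm_fst_le zero_im_nonneg zero_le_one
        (fun y => by rw [one_mul]; exact b2 y) x
      have h2 := norm_sub_le 1 (volT 0 f (volIter f g z n).2 x)
      rw [norm_one] at h2
      show ‖1 - volT 0 f (volIter f g z n).2 x‖ ≤ _
      linarith [h1 x]
    · have := norm_volT_le_tailExp hh h0 hg two_norm_snd_le hz zero_le_one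
        (fun y => by rw [one_mul]; exact b1 y) x
      show ‖volT z g (volIter f g z n).1 x‖ ≤ _
      linarith [h1 x]

/-- The contraction improves any a priori bound `1 + C 2⁻ⁿ` to `1 + C 2⁻⁽ⁿ⁺¹⁾`, so the unknown
constant `C` disappears in the limit and the bound is uniform in `z`. -/
theorem IsVol.norm_le (hf : Integrable f) (hg : Integrable g) {z : ℂ} (hz : 0 ≤ z.im) {p q : ℝ → ℂ}
    (h : IsVol f g z p q) :
    (∀ x, ‖p x‖ ≤ tailExp (volRate f g) x) ∧ ∀ x, ‖q x‖ ≤ tailExp (volRate f g) x := by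
  have hh := integrable_volRate hf hg
  have h0 := volRate_nonneg (f := f) (g := g)
  have h1 := one_le_tailExp h0
  obtain ⟨C₁, hC₁⟩ := h.bdd_fst
  obtain ⟨C₂, hC₂⟩ := h.bdd_snd
  set C := max C₁ C₂
  have hC0 : 0 ≤ C := (norm_nonneg _).trans ((hC₁ 0).trans (le_max_left _ _))
  have key : ∀ n : ℕ, (∀ x, ‖p x‖ ≤ (1 + C * (1 / 2) ^ n) * tailExp (volRate f g) x) ∧
      ∀ x, ‖q x‖ ≤ (1 + C * (1 / 2) ^ n) * tailExp (volRate f g) x := by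
    intro n
    induction n with
    | zero =>
      have : ∀ x, C ≤ (1 + C * (1 / 2) ^ 0) * tailExp (volRate f g) x := fun x => by
        have := h1 x
        rw [pow_zero, mul_one]; nlinarith
      exact ⟨fun x => (hC₁ x).trans ((le_max_left _ _).trans (this x)),
        fun x => (hC₂ x).trans ((le_max_right _ _).trans (this x))⟩
    | succ n ih =>
      have hA : 0 ≤ 1 + C * (1 / 2) ^ n := by positivity
      have hD : 0 ≤ C * (1 / 2) ^ n := by positivity
      rw [pow_succ]
      refine ⟨fun x => ?_, fun x => ?_⟩
      · have := norm_volT_le_tailExp hh h0 hf two_norm_fst_le zero_im_nonneg hA ih.2 x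
        have h2 := norm_sub_le 1 (volT 0 f q x)
        rw [norm_one] at h2
        rw [h.eq_fst]
        nlinarith [h1 x]
      · have := norm_volT_le_tailExp hh h0 hg two_norm_snd_le hz hA ih.1 x
        rw [h.eq_snd]
        nlinarith [h1 x]
  have lim : ∀ x, Tendsto (fun n : ℕ => (1 + C * (1 / 2) ^ n) * tailExp (volRate f g) x) atTop
      (𝓝 (tailExp (volRate f g) x)) := fun x => by
    have := (((tendsto_pow_atTop_nhds_zero_of_lt_one (r := (1 / 2 : ℝ)) (by norm_num)
      (by norm_num)).const_mul C).const_add 1).mul_const (tailExp (volRate f g) x)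
    simpa using this
  exact ⟨fun x => ge_of_tendsto' (lim x) fun n => (key n).1 x,
    fun x => ge_of_tendsto' (lim x) fun n => (key n).2 x⟩

/-- Geometric convergence of the Picard iteration with a rate independent of `z`. It yields
uniqueness, and it transfers analyticity and limits from the iterates to the solution. -/
theorem IsVol.norm_sub_volIter_le (hf : Integrable f) (hg : Integrable g) {z : ℂ} (hz : 0 ≤ z.im)
    {p q : ℝ → ℂ} (h : IsVol f g z p q) (n : ℕ) :
    (∀ x, ‖p x - (volIter f g z n).1 x‖ ≤ 2 * (1 / 2) ^ n * tailExp (volRate f g) x) ∧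
      ∀ x, ‖q x - (volIter f g z n).2 x‖ ≤ 2 * (1 / 2) ^ n * tailExp (volRate f g) x := by
  have hh := integrable_volRate hf hg
  have h0 := volRate_nonneg (f := f) (g := g)
  have h1 := one_le_tailExp h0
  obtain ⟨b1, b2⟩ := h.norm_le hf hg hz
  induction n with
  | zero =>
    refine ⟨fun x => ?_, fun x => ?_⟩
    · have := norm_sub_le (p x) 1
      rw [norm_one] at this
      simp only [volIter, pow_zero, mul_one]
      linarith [b1 x, h1 x]
    · simp only [volIter, pow_zero, mul_one, sub_zero]
      linarith [b2 x, h1 x]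
  | succ n ih =>
    obtain ⟨⟨c1, c2⟩, d1, d2⟩ := volIter_spec hf hg hz n
    have k1 := fun x => (d1 x).trans (tailExp_le hh h0 x)
    have k2 := fun x => (d2 x).trans (tailExp_le hh h0 x)
    have l1 := fun x => (b1 x).trans (tailExp_le hh h0 x)
    have l2 := fun x => (b2 x).trans (tailExp_le hh h0 x)
    have hA : (0 : ℝ) ≤ 2 * (1 / 2) ^ n := by positivity
    rw [pow_succ]
    refine ⟨fun x => ?_, fun x => ?_⟩
    · have := norm_volT_le_tailExp hh h0 hf two_norm_fst_le zero_im_nonneg hA ih.2 x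
      rw [volT_sub hf h.cont_snd c2 l2 k2 zero_im_nonneg] at this
      have e : p x - (volIter f g z (n + 1)).1 x
          = -(volT 0 f q x - volT 0 f (volIter f g z n).2 x) := by
        rw [h.eq_fst, volIter]; ring
      rw [e, norm_neg]
      linarith
    · have := norm_volT_le_tailExp hh h0 hg two_norm_snd_le hz hA ih.1 x
      rw [volT_sub hg h.cont_fst c1 l1 k1 hz] at this
      rw [h.eq_snd, volIter]
      linarith

theorem IsVol.tendsto_volIter (hf : Integrable f) (hg : Integrable g) {z : ℂ} (hz : 0 ≤ z.im)
    {p q : ℝ → ℂ} (h : IsVol f g z p q) (x : ℝ) :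
    Tendsto (fun n => (volIter f g z n).1 x) atTop (𝓝 (p x)) ∧
      Tendsto (fun n => (volIter f g z n).2 x) atTop (𝓝 (q x)) := by
  have lim : Tendsto (fun n : ℕ => 2 * (1 / 2) ^ n * tailExp (volRate f g) x) atTop (𝓝 0) := by
    have := ((tendsto_pow_atTop_nhds_zero_of_lt_one (r := (1 / 2 : ℝ)) (by norm_num)
      (by norm_num)).const_mul 2).mul_const (tailExp (volRate f g) x)
    simpa using this
  constructor
  · refine tendsto_iff_norm_sub_tendsto_zero.2 (squeeze_zero (fun n => norm_nonneg _) (fun n => ?_) lim)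
    rw [norm_sub_rev]
    exact (h.norm_sub_volIter_le hf hg hz n).1 x
  · refine tendsto_iff_norm_sub_tendsto_zero.2 (squeeze_zero (fun n => norm_nonneg _) (fun n => ?_) lim)
    rw [norm_sub_rev]
    exact (h.norm_sub_volIter_le hf hg hz n).2 x

theorem IsVol.unique (hf : Integrable f) (hg : Integrable g) {z : ℂ} (hz : 0 ≤ z.im)
    {p q p' q' : ℝ → ℂ} (h : IsVol f g z p q) (h' : IsVol f g z p' q') : p = p' ∧ q = q' :=
  ⟨funext fun x => tendsto_nhds_unique (h.tendsto_volIter hf hg hz x).1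
    (h'.tendsto_volIter hf hg hz x).1, funext fun x =>
    tendsto_nhds_unique (h.tendsto_volIter hf hg hz x).2 (h'.tendsto_volIter hf hg hz x).2⟩

theorem volIter_regular (hf : Integrable f) (hg : Integrable g) (n : ℕ) (x : ℝ) :
    (ContinuousOn (fun z => (volIter f g z n).1 x) {z | 0 ≤ z.im} ∧
      ContinuousOn (fun z => (volIter f g z n).2 x) {z | 0 ≤ z.im}) ∧
    (DifferentiableOn ℂ (fun z => (volIter f g z n).1 x) {z | 0 < z.im} ∧
      DifferentiableOn ℂ (fun z => (volIter f g z n).2 x) {z | 0 < z.im}) ∧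
    (Tendsto (fun z => (volIter f g z n).1 x) atInftyUpper (𝓝 1) ∧
      Tendsto (fun z => (volIter f g z n).2 x) atInftyUpper (𝓝 0)) := by
  have hh := integrable_volRate hf hg
  have h0 := volRate_nonneg (f := f) (g := g)
  induction n generalizing x with
  | zero =>
    exact ⟨⟨continuousOn_const, continuousOn_const⟩, ⟨differentiableOn_const _,
      differentiableOn_const _⟩, tendsto_const_nhds, tendsto_const_nhds⟩
  | succ n ih =>
    have c1 : ∀ z : ℂ, 0 ≤ z.im → Continuous (volIter f g z n).1 := fun z hz =>
      (volIter_spec hf hg hz n).1.1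
    have c2 : ∀ z : ℂ, 0 ≤ z.im → Continuous (volIter f g z n).2 := fun z hz =>
      (volIter_spec hf hg hz n).1.2
    have b1 : ∀ z : ℂ, 0 ≤ z.im → ∀ y, ‖(volIter f g z n).1 y‖ ≤ Real.exp (∫ y, volRate f g y) :=
      fun z hz y => ((volIter_spec hf hg hz n).2.1 y).trans (tailExp_le hh h0 y)
    have b2 : ∀ z : ℂ, 0 ≤ z.im → ∀ y, ‖(volIter f g z n).2 y‖ ≤ Real.exp (∫ y, volRate f g y) :=
      fun z hz y => ((volIter_spec hf hg hz n).2.2 y).trans (tailExp_le hh h0 y)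
    have e1 : (fun z => (volIter f g z (n + 1)).1 x)
        = fun z => 1 - volT (((0 : ℝ) : ℂ) * z) f (volIter f g z n).2 x := by
      funext z; rw [volIter, ofReal_zero, zero_mul]
    have e2 : (fun z => (volIter f g z (n + 1)).2 x)
        = fun z => volT (((1 : ℝ) : ℂ) * z) g (volIter f g z n).1 x := by
      funext z; rw [volIter, ofReal_one, one_mul]
    rw [e1, e2]
    refine ⟨⟨continuousOn_const.sub (continuousOn_volT hf c2 b2 le_rfl (fun y => (ih y).1.2) x),
      continuousOn_volT hg c1 b1 zero_le_one (fun y => (ih y).1.1) x⟩,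
      ⟨(differentiableOn_const _).sub (differentiableOn_volT hf c2 b2 le_rfl
        (fun y => (ih y).2.1.2) x),
      differentiableOn_volT hg c1 b1 zero_le_one (fun y => (ih y).2.1.1) x⟩, ?_, ?_⟩
    · have := (tendsto_volT_zero hf c2 b2 le_rfl (fun y => (ih y).2.2.2) x).const_sub 1
      rwa [sub_zero] at this
    -- The first component tends to `1`, not to `0`. The constant part is treated by the
    -- Riemann-Lebesgue lemma and the difference by dominated convergence.
    · have c3 : ∀ z : ℂ, 0 ≤ z.im → Continuous fun y => (volIter f g z n).1 y - 1 := fun z hz =>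
        (c1 z hz).sub continuous_const
      have b3 : ∀ z : ℂ, 0 ≤ z.im → ∀ y, ‖(volIter f g z n).1 y - 1‖
          ≤ Real.exp (∫ y, volRate f g y) + 1 := fun z hz y =>
        (norm_sub_le _ _).trans (by rw [norm_one]; gcongr; exact b1 z hz y)
      have t := (tendsto_volT_zero (P := fun z y => (volIter f g z n).1 y - 1) hg c3 b3 zero_le_one
        (fun y => by
          have := (ih y).2.2.1.sub_const 1
          rwa [sub_self] at this) x).add (tendsto_volT_one hg x)
      rw [add_zero] at t
      refine t.congr' ?_
      filter_upwards [eventually_atInftyUpper] with z hz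
      rw [ofReal_one, one_mul, volT_sub hg (c1 z hz) continuous_const (b1 z hz) (C' := 1) (by simp) hz]
      ring

variable {P Q : ℂ → ℝ → ℂ}

theorem IsVol.tendstoUniformlyOn (hf : Integrable f) (hg : Integrable g)
    (h : ∀ z : ℂ, 0 ≤ z.im → IsVol f g z (P z) (Q z)) (x : ℝ) :
    TendstoUniformlyOn (fun n z => (volIter f g z n).1 x) (fun z => P z x) atTop {z | 0 ≤ z.im} ∧
    TendstoUniformlyOn (fun n z => (volIter f g z n).2 x) (fun z => Q z x) atTop {z | 0 ≤ z.im} := by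
  have lim : Tendsto (fun n : ℕ => 2 * (1 / 2) ^ n * tailExp (volRate f g) x) atTop (𝓝 0) := by
    have := ((tendsto_pow_atTop_nhds_zero_of_lt_one (r := (1 / 2 : ℝ)) (by norm_num)
      (by norm_num)).const_mul 2).mul_const (tailExp (volRate f g) x)
    simpa using this
  constructor
  · rw [Metric.tendstoUniformlyOn_iff]
    intro ε hε
    filter_upwards [lim.eventually_lt_const hε] with n hn z hz
    rw [dist_eq_norm]
    exact (((h z hz).norm_sub_volIter_le hf hg hz n).1 x).trans_lt hn
  · rw [Metric.tendstoUniformlyOn_iff]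
    intro ε hε
    filter_upwards [lim.eventually_lt_const hε] with n hn z hz
    rw [dist_eq_norm]
    exact (((h z hz).norm_sub_volIter_le hf hg hz n).2 x).trans_lt hn

/-- Regularity in the spectral parameter. -/
structure UpperRegular (f : ℂ → ℂ) (c : ℂ) : Prop where
  cont : ContinuousOn f {z | 0 ≤ z.im}
  diff : DifferentiableOn ℂ f {z | 0 < z.im}
  lim : Tendsto f atInftyUpper (𝓝 c)

theorem UpperRegular.of_tendstoUniformlyOn {F : ℕ → ℂ → ℂ} {f : ℂ → ℂ} {c : ℂ}
    (h : ∀ n, UpperRegular (F n) c) (hu : TendstoUniformlyOn F f atTop {z | 0 ≤ z.im}) :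
    UpperRegular f c := by
  refine ⟨hu.continuousOn (Frequently.of_forall fun n => (h n).cont), ?_, ?_⟩
  · have := (hu.mono (fun z (hz : 0 < z.im) => (le_of_lt hz : (0 : ℝ) ≤ z.im))).tendstoLocallyUniformlyOn
    exact this.differentiableOn (Eventually.of_forall fun n => (h n).diff)
      (isOpen_lt continuous_const continuous_im)
  · rw [Metric.tendsto_nhds]
    intro ε hε
    obtain ⟨n, hn⟩ := ((Metric.tendstoUniformlyOn_iff.1 hu) (ε / 2) (half_pos hε)).exists
    filter_upwards [(Metric.tendsto_nhds.1 (h n).lim) (ε / 2) (half_pos hε),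
      eventually_atInftyUpper] with z hz hzi
    linarith [hn z hzi, dist_triangle (f z) (F n z) c]

theorem UpperRegular.mul {f g : ℂ → ℂ} {c d : ℂ} (hf : UpperRegular f c) (hg : UpperRegular g d) :
    UpperRegular (fun z => f z * g z) (c * d) :=
  ⟨hf.cont.mul hg.cont, hf.diff.mul hg.diff, hf.lim.mul hg.lim⟩

theorem UpperRegular.sub {f g : ℂ → ℂ} {c d : ℂ} (hf : UpperRegular f c) (hg : UpperRegular g d) :
    UpperRegular (fun z => f z - g z) (c - d) :=
  ⟨hf.cont.sub hg.cont, hf.diff.sub hg.diff, hf.lim.sub hg.lim⟩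

theorem UpperRegular.const (c : ℂ) : UpperRegular (fun _ => c) c :=
  ⟨continuousOn_const, differentiableOn_const _, tendsto_const_nhds⟩

theorem IsVol.upperRegular (hf : Integrable f) (hg : Integrable g)
    (h : ∀ z : ℂ, 0 ≤ z.im → IsVol f g z (P z) (Q z)) (x : ℝ) :
    UpperRegular (fun z => P z x) 1 ∧ UpperRegular (fun z => Q z x) 0 := by
  have r := fun n => volIter_regular hf hg n x
  have u := IsVol.tendstoUniformlyOn hf hg h x
  exact ⟨.of_tendstoUniformlyOn (fun n => ⟨(r n).1.1, (r n).2.1.1, (r n).2.2.1⟩) u.1,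
    .of_tendstoUniformlyOn (fun n => ⟨(r n).1.2, (r n).2.1.2, (r n).2.2.2⟩) u.2⟩

end

/-! ### Jost functions -/

theorem UpperRegular.congr {f g : ℂ → ℂ} {c : ℂ} (hf : UpperRegular f c)
    (h : ∀ z : ℂ, 0 ≤ z.im → g z = f z) : UpperRegular g c :=
  ⟨hf.cont.congr fun z hz => h z hz, hf.diff.congr fun z hz => h z (le_of_lt hz),
    hf.lim.congr' (by filter_upwards [eventually_atInftyUpper] with z hz using (h z hz).symm)⟩

/-- The first Volterra potential. -/
noncomputable def volF (u : ℝ → ℝ) (y : ℝ) : ℂ := (u y : ℂ)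

/-- The second Volterra potential. -/
noncomputable def volG (σ : ℝ) (u : ℝ → ℝ) (y : ℝ) : ℂ := (σ : ℂ) * (u (-y) : ℂ)

section

variable {σ : ℝ} {u : ℝ → ℝ} {z : ℂ} {m : ℝ → Fin 2 → ℂ}

theorem integrable_volF (hu : Integrable u) : Integrable (volF u) := hu.ofReal

theorem integrable_volG (hu : Integrable u) : Integrable (volG σ u) := hu.comp_neg.ofReal.const_mul _

theorem phase1_mulVec_zero (w y : ℝ) (v : Fin 2 → ℂ) :
    (phase1 z w *ᵥ (initialQ σ u y *ᵥ v)) 0 = u y * v 1 := by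
  simp [phase1, initialQ, _root_.offDiag, Matrix.mulVec, dotProduct, Fin.sum_univ_two]

theorem phase1_mulVec_one (w y : ℝ) (v : Fin 2 → ℂ) :
    (phase1 z w *ᵥ (initialQ σ u y *ᵥ v)) 1 = exp (2 * I * z * w) * (-(σ * u (-y)) * v 0) := by
  simp [phase1, initialQ, _root_.offDiag, Matrix.mulVec, dotProduct, Fin.sum_univ_two]

theorem phase2_mulVec_zero (w y : ℝ) (v : Fin 2 → ℂ) :
    (phase2 z w *ᵥ (initialQ σ u y *ᵥ v)) 0 = exp (-(2 * I * z * w)) * (u y * v 1) := by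
  simp [phase2, initialQ, _root_.offDiag, Matrix.mulVec, dotProduct, Fin.sum_univ_two]

theorem phase2_mulVec_one (w y : ℝ) (v : Fin 2 → ℂ) :
    (phase2 z w *ᵥ (initialQ σ u y *ᵥ v)) 1 = -(σ * u (-y)) * v 0 := by
  simp [phase2, initialQ, _root_.offDiag, Matrix.mulVec, dotProduct, Fin.sum_univ_two]

theorem volT_eq (z : ℂ) (g p : ℝ → ℂ) (x : ℝ) :
    volT z g p x = ∫ y in Ioi x, exp (2 * I * z * ((y - x : ℝ) : ℂ)) * (g y * p y) := rfl

theorem volT_zero_eq (g p : ℝ → ℂ) (x : ℝ) : volT 0 g p x = ∫ y in Ioi x, g y * p y := by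
  simp [volT]

theorem integrableOn_mul {g p : ℝ → ℂ} (hg : Integrable g) (hp : Continuous p) {C : ℝ}
    (hC : ∀ y, ‖p y‖ ≤ C) (x : ℝ) : IntegrableOn (fun y => g y * p y) (Ioi x) := by
  simpa using integrableOn_volT hg hp hC zero_im_nonneg x

theorem IsJostRight.eval {Q E : ℝ → Mat2} {e : Fin 2 → ℂ} (h : IsJostRight Q E e m) {x : ℝ}
    (hi : ∀ i, IntegrableOn (fun y => (E (y - x) *ᵥ (Q y *ᵥ m y)) i) (Ioi x)) (i : Fin 2) :
    m x i = e i - ∫ y in Ioi x, (E (y - x) *ᵥ (Q y *ᵥ m y)) i := by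
  rw [← eval_integral hi, ← Pi.sub_apply, ← h.volterra]

theorem IsJostLeft.eval {Q E : ℝ → Mat2} {e : Fin 2 → ℂ} (h : IsJostLeft Q E e m) {x : ℝ}
    (hi : ∀ i, IntegrableOn (fun y => (E (-y + x) *ᵥ (Q (-y) *ᵥ m (-y))) i) (Ioi x)) (i : Fin 2) :
    m (-x) i = e i + ∫ y in Ioi x, (E (-y + x) *ᵥ (Q (-y) *ᵥ m (-y))) i := by
  have := congrFun (h.volterra (-x)) i
  rw [← integral_comp_neg_Ioi] at this
  simp only [sub_neg_eq_add] at this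
  rw [this, ← eval_integral hi, Pi.add_apply]

theorem exists_entry_bound {C : ℝ} (h : ∀ x, ‖m x‖ ≤ C) (i : Fin 2) (x : ℝ) : ‖m x i‖ ≤ C :=
  (norm_le_pi_norm (m x) i).trans (h x)

/-- This and the next three lemmas bring all four Jost columns to one normal form in the closed
upper half-plane, so that a single analysis of the Volterra pair covers them. -/
theorem IsJostRight.isVol_fst (hu : Integrable u) (hz : 0 ≤ z.im)
    (h : IsJostRight (initialQ σ u) (phase1 z) ![1, 0] m) :
    IsVol (volF u) (volG σ u) z (fun x => m x 0) (fun x => m x 1) := by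
  obtain ⟨C, hC⟩ := h.bounded
  have c : ∀ i, Continuous fun x => m x i := fun i => (continuous_apply i).comp h.continuous
  have b := exists_entry_bound hC
  have i0 := fun x => integrableOn_mul (integrable_volF hu) (c 1) (b 1) x
  have i1 := fun x => integrableOn_volT (integrable_volG (σ := σ) hu) (c 0) (b 0) hz x
  have e1 : ∀ x y : ℝ, exp (2 * I * z * ((y - x : ℝ) : ℂ)) * (-(σ * u (-y)) * m y 0)
      = -(exp (2 * I * z * ((y - x : ℝ) : ℂ)) * (volG σ u y * m y 0)) := fun x y => by
    rw [volG]; ring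
  have hi : ∀ x i, IntegrableOn (fun y => (phase1 z (y - x) *ᵥ (initialQ σ u y *ᵥ m y)) i) (Ioi x) := by
    intro x i
    fin_cases i
    · simp only [Fin.zero_eta, phase1_mulVec_zero]; exact i0 x
    · simp only [Fin.mk_one, phase1_mulVec_one, e1]; exact (i1 x).neg
  refine ⟨c 0, c 1, ⟨C, b 0⟩, ⟨C, b 1⟩, fun x => ?_, fun x => ?_⟩
  · rw [h.eval (hi x), volT_zero_eq]
    simp only [phase1_mulVec_zero]; rfl
  · rw [h.eval (hi x), volT_eq]
    simp only [phase1_mulVec_one, e1, integral_neg]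
    simp

/-- Under `x ↦ -x` the entries of the potential exchange roles up to `σ`. With its components
exchanged and one of them multiplied by `σ`, this column solves the same pair as the first column
normalized at `+∞`, and by uniqueness coincides with it. -/
theorem IsJostLeft.isVol_snd (hσ : σ ^ 2 = 1) (hu : Integrable u) (hz : 0 ≤ z.im)
    (h : IsJostLeft (initialQ σ u) (phase2 z) ![0, 1] m) :
    IsVol (volF u) (volG σ u) z (fun x => m (-x) 1) (fun x => σ * m (-x) 0) := by
  obtain ⟨C, hC⟩ := h.bounded
  have hσ' : (σ : ℂ) * σ = 1 := by rw [← pow_two]; exact_mod_cast hσ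
  have nσ : ‖(σ : ℂ)‖ = 1 := by
    have : ‖(σ : ℂ)‖ ^ 2 = 1 := by rw [← norm_pow, pow_two, hσ', norm_one]
    exact (pow_eq_one_iff_of_nonneg (norm_nonneg _) (by norm_num)).1 this
  have c : ∀ i, Continuous fun x => m (-x) i := fun i =>
    (continuous_apply i).comp (h.continuous.comp continuous_neg)
  have cσ : Continuous fun x => (σ : ℂ) * m (-x) 0 := (c 0).const_mul _
  have b : ∀ i x, ‖m (-x) i‖ ≤ C := fun i x => exists_entry_bound hC i (-x)
  have bσ : ∀ x, ‖(σ : ℂ) * m (-x) 0‖ ≤ C := fun x => by rw [norm_mul, nσ, one_mul]; exact b 0 x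
  have i0 := fun x => integrableOn_mul (integrable_volF hu) cσ bσ x
  have i1 := fun x => integrableOn_volT (integrable_volG (σ := σ) hu) (c 1) (b 1) hz x
  have e0 : ∀ y : ℝ, -((σ : ℂ) * u (- -y)) * m (-y) 0 = -(volF u y * (σ * m (-y) 0)) := fun y => by
    rw [volF, neg_neg]; ring
  have e1 : ∀ x y : ℝ, exp (-(2 * I * z * ((-y + x : ℝ) : ℂ))) * (u (-y) * m (-y) 1)
      = σ * (exp (2 * I * z * ((y - x : ℝ) : ℂ)) * (volG σ u y * m (-y) 1)) := fun x y => by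
    have : -(2 * I * z * ((-y + x : ℝ) : ℂ)) = 2 * I * z * ((y - x : ℝ) : ℂ) := by push_cast; ring
    rw [volG, this]
    linear_combination -(exp (2 * I * z * ((y - x : ℝ) : ℂ)) * u (-y) * m (-y) 1) * hσ'
  have hi : ∀ x i, IntegrableOn
      (fun y => (phase2 z (-y + x) *ᵥ (initialQ σ u (-y) *ᵥ m (-y))) i) (Ioi x) := by
    intro x i
    fin_cases i
    · simp only [Fin.zero_eta, phase2_mulVec_zero, e1]; exact (i1 x).const_mul _
    · simp only [Fin.mk_one, phase2_mulVec_one, e0]; exact (i0 x).neg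
  refine ⟨c 1, cσ, ⟨C, b 1⟩, ⟨C, bσ⟩, fun x => ?_, fun x => ?_⟩
  · rw [h.eval (hi x), volT_zero_eq]
    simp only [phase2_mulVec_one, e0, integral_neg]
    simp [sub_eq_add_neg]
  · rw [h.eval (hi x), volT_eq]
    simp only [phase2_mulVec_zero, e1]
    rw [integral_const_mul]
    simp only [Matrix.cons_val_zero, zero_add]
    rw [← mul_assoc, hσ', one_mul]

theorem IsJostLeft.isVol_fst (hu : Integrable u) (hz : z.im ≤ 0)
    (h : IsJostLeft (initialQ σ u) (phase1 z) ![1, 0] m) :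
    IsVol (volF fun y => u (-y)) (volG σ fun y => u (-y)) (-z) (fun x => m (-x) 0)
      (fun x => -m (-x) 1) := by
  obtain ⟨C, hC⟩ := h.bounded
  have hz' : 0 ≤ (-z).im := by simpa using hz
  have c : ∀ i, Continuous fun x => m (-x) i := fun i =>
    (continuous_apply i).comp (h.continuous.comp continuous_neg)
  have cn : Continuous fun x => -m (-x) 1 := (c 1).neg
  have b : ∀ i x, ‖m (-x) i‖ ≤ C := fun i x => exists_entry_bound hC i (-x)
  have bn : ∀ x, ‖-m (-x) 1‖ ≤ C := fun x => by rw [norm_neg]; exact b 1 x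
  have i0 := fun x => integrableOn_mul (integrable_volF hu.comp_neg) cn bn x
  have i1 := fun x => integrableOn_volT (integrable_volG (σ := σ) hu.comp_neg) (c 0) (b 0) hz' x
  have e0 : ∀ y : ℝ, (u (-y) : ℂ) * m (-y) 1 = -(volF (fun y => u (-y)) y * -m (-y) 1) := fun y => by
    rw [volF]; ring
  have e1 : ∀ x y : ℝ, exp (2 * I * z * ((-y + x : ℝ) : ℂ)) * (-(σ * u (- -y)) * m (-y) 0)
      = -(exp (2 * I * (-z) * ((y - x : ℝ) : ℂ)) * (volG σ (fun y => u (-y)) y * m (-y) 0)) :=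
    fun x y => by
      have : 2 * I * z * ((-y + x : ℝ) : ℂ) = 2 * I * (-z) * ((y - x : ℝ) : ℂ) := by push_cast; ring
      rw [volG, this]; ring
  have hi : ∀ x i, IntegrableOn
      (fun y => (phase1 z (-y + x) *ᵥ (initialQ σ u (-y) *ᵥ m (-y))) i) (Ioi x) := by
    intro x i
    fin_cases i
    · simp only [Fin.zero_eta, phase1_mulVec_zero, e0]; exact (i0 x).neg
    · simp only [Fin.mk_one, phase1_mulVec_one, e1]; exact (i1 x).neg
  refine ⟨c 0, cn, ⟨C, b 0⟩, ⟨C, bn⟩, fun x => ?_, fun x => ?_⟩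
  · rw [h.eval (hi x), volT_zero_eq]
    simp only [phase1_mulVec_zero, e0, integral_neg]
    simp [sub_eq_add_neg]
  · rw [h.eval (hi x), volT_eq]
    simp only [phase1_mulVec_one, e1, integral_neg]
    simp

theorem IsJostRight.isVol_snd (hσ : σ ^ 2 = 1) (hu : Integrable u) (hz : z.im ≤ 0)
    (h : IsJostRight (initialQ σ u) (phase2 z) ![0, 1] m) :
    IsVol (volF fun y => u (-y)) (volG σ fun y => u (-y)) (-z) (fun x => m x 1)
      (fun x => -(σ * m x 0)) := by
  obtain ⟨C, hC⟩ := h.bounded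
  have hz' : 0 ≤ (-z).im := by simpa using hz
  have hσ' : (σ : ℂ) * σ = 1 := by rw [← pow_two]; exact_mod_cast hσ
  have nσ : ‖(σ : ℂ)‖ = 1 := by
    have : ‖(σ : ℂ)‖ ^ 2 = 1 := by rw [← norm_pow, pow_two, hσ', norm_one]
    exact (pow_eq_one_iff_of_nonneg (norm_nonneg _) (by norm_num)).1 this
  have c : ∀ i, Continuous fun x => m x i := fun i => (continuous_apply i).comp h.continuous
  have cσ : Continuous fun x => -((σ : ℂ) * m x 0) := ((c 0).const_mul _).neg
  have b := exists_entry_bound hC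
  have bσ : ∀ x, ‖-((σ : ℂ) * m x 0)‖ ≤ C := fun x => by
    rw [norm_neg, norm_mul, nσ, one_mul]; exact b 0 x
  have i0 := fun x => integrableOn_mul (integrable_volF hu.comp_neg) cσ bσ x
  have i1 := fun x => integrableOn_volT (integrable_volG (σ := σ) hu.comp_neg) (c 1) (b 1) hz' x
  have e0 : ∀ y : ℝ, -((σ : ℂ) * u (-y)) * m y 0 = volF (fun y => u (-y)) y * -(σ * m y 0) := fun y => by
    rw [volF]; ring
  have e1 : ∀ x y : ℝ, exp (-(2 * I * z * ((y - x : ℝ) : ℂ))) * (u y * m y 1)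
      = σ * (exp (2 * I * (-z) * ((y - x : ℝ) : ℂ)) * (volG σ (fun y => u (-y)) y * m y 1)) :=
    fun x y => by
      have : -(2 * I * z * ((y - x : ℝ) : ℂ)) = 2 * I * (-z) * ((y - x : ℝ) : ℂ) := by ring
      rw [volG, this, neg_neg]
      linear_combination -(exp (2 * I * (-z) * ((y - x : ℝ) : ℂ)) * u y * m y 1) * hσ'
  have hi : ∀ x i, IntegrableOn (fun y => (phase2 z (y - x) *ᵥ (initialQ σ u y *ᵥ m y)) i) (Ioi x) := by
    intro x i
    fin_cases i
    · simp only [Fin.zero_eta, phase2_mulVec_zero, e1]; exact (i1 x).const_mul _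
    · simp only [Fin.mk_one, phase2_mulVec_one, e0]; exact i0 x
  refine ⟨c 1, cσ, ⟨C, b 1⟩, ⟨C, bσ⟩, fun x => ?_, fun x => ?_⟩
  · rw [h.eval (hi x), volT_zero_eq]
    simp only [phase2_mulVec_one, e0]
    simp
  · rw [h.eval (hi x), volT_eq]
    simp only [phase2_mulVec_zero, e1]
    rw [integral_const_mul]
    simp only [Matrix.cons_val_zero, zero_sub]
    rw [mul_neg, neg_neg, ← mul_assoc, hσ', one_mul]

theorem volT_conj (z : ℂ) {g p : ℝ → ℂ} (hg : ∀ y, (starRingEnd ℂ) (g y) = g y) (x : ℝ) :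
    (starRingEnd ℂ) (volT z g p x)
      = volT (-(starRingEnd ℂ) z) g (fun y => (starRingEnd ℂ) (p y)) x := by
  rw [volT, volT, ← integral_conj]
  congr 1
  funext y
  rw [map_mul, map_mul, hg, ← exp_conj]
  congr 2
  simp only [map_mul, conj_I, conj_ofReal, map_ofNat]
  ring

theorem IsVol.conj {f g p q : ℝ → ℂ} (hf : ∀ y, (starRingEnd ℂ) (f y) = f y)
    (hg : ∀ y, (starRingEnd ℂ) (g y) = g y) (h : IsVol f g z p q) :
    IsVol f g (-(starRingEnd ℂ) z) (fun x => (starRingEnd ℂ) (p x))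
      (fun x => (starRingEnd ℂ) (q x)) := by
  obtain ⟨C, hC⟩ := h.bdd_fst
  obtain ⟨D, hD⟩ := h.bdd_snd
  refine ⟨continuous_conj.comp h.cont_fst, continuous_conj.comp h.cont_snd,
    ⟨C, fun x => by rw [RCLike.norm_conj]; exact hC x⟩,
    ⟨D, fun x => by rw [RCLike.norm_conj]; exact hD x⟩, fun x => ?_, fun x => ?_⟩
  · rw [h.eq_fst, map_sub, map_one, volT_conj 0 hf, map_zero, neg_zero]
  · rw [h.eq_snd, volT_conj z hg]

/-- The expression is a Wronskian with value `1` at `+∞`. For opposite real spectral parameters the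
exponentials cancel, and the integrals in the product rules for `p p'` and `σ q q'` are negatives of
each other. -/
theorem IsVol.wronskian {f f' p q p' q' : ℝ → ℂ} (hσ : σ ^ 2 = 1) (hf : Integrable f)
    (hf' : Integrable f') {s : ℝ} (h : IsVol f (fun y => σ * f' y) s p q)
    (h' : IsVol f' (fun y => σ * f y) (-(s : ℂ)) p' q') : p 0 * p' 0 + σ * (q 0 * q' 0) = 1 := by
  have hσ' : (σ : ℂ) * σ = 1 := by rw [← pow_two]; exact_mod_cast hσ
  obtain ⟨C, hC⟩ := h.bdd_fst
  obtain ⟨D, hD⟩ := h.bdd_snd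
  obtain ⟨C', hC'⟩ := h'.bdd_fst
  obtain ⟨D', hD'⟩ := h'.bdd_snd
  -- Multiplication by `exp (2 i w x)` removes `x` from the kernel, which leaves an indefinite
  -- integral to which the product rule applies.
  have kernel : ∀ (w : ℂ) (k r v : ℝ → ℂ), (∀ x, v x = volT w k r x) → ∀ x : ℝ,
      exp (2 * I * w * x) * v x = 0 + ∫ y in Ioi x, exp (2 * I * w * y) * (k y * r y) := by
    intro w k r v hv x
    rw [hv, volT, zero_add, ← integral_const_mul]
    congr 1; funext y
    have : exp (2 * I * w * y) = exp (2 * I * w * x) * exp (2 * I * w * ((y - x : ℝ) : ℂ)) := by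
      rw [← exp_add]; push_cast; ring_nf
    rw [this]; ring
  have ik : ∀ (w : ℂ) (k r : ℝ → ℂ) (A : ℝ), 0 ≤ w.im → Integrable k → Continuous r →
      (∀ y, ‖r y‖ ≤ A) → IntegrableOn (fun y : ℝ => exp (2 * I * w * y) * (k y * r y)) (Ioi 0) := by
    intro w k r A hw hk hr hA
    simpa using integrableOn_volT hk hr hA hw 0
  have w1 := mul_eq_add_integral_Ioi (x := 0) (f := fun y => -(f y * q y))
    (g := fun y => -(f' y * q' y)) (F := p) (G := p') (c := 1) (d := 1)
    (integrableOn_mul hf h.cont_snd hD 0).neg (integrableOn_mul hf' h'.cont_snd hD' 0).neg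
    (fun y _ => by rw [h.eq_fst, volT_zero_eq, integral_neg, sub_eq_add_neg])
    (fun y _ => by rw [h'.eq_fst, volT_zero_eq, integral_neg, sub_eq_add_neg])
  have w2 := mul_eq_add_integral_Ioi (x := 0)
    (f := fun y => exp (2 * I * s * y) * (σ * f' y * p y))
    (g := fun y => exp (2 * I * (-s) * y) * (σ * f y * p' y))
    (F := fun y => exp (2 * I * s * y) * q y) (G := fun y => exp (2 * I * (-s) * y) * q' y)
    (c := 0) (d := 0)
    (ik s _ p C (by simp) (hf'.const_mul _) h.cont_fst hC)
    (ik (-s) _ p' C' (by simp) (hf.const_mul _) h'.cont_fst hC')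
    (fun y _ => kernel _ _ _ _ h.eq_snd y) (fun y _ => kernel _ _ _ _ h'.eq_snd y)
  have cancel : ∀ y : ℝ, exp (2 * I * s * y) * exp (2 * I * (-s) * y) = 1 := fun y => by
    rw [← exp_add]; ring_nf; simp
  have e2 : ∀ y : ℝ, exp (2 * I * s * y) * (σ * f' y * p y) * (exp (2 * I * (-s) * y) * q' y)
      + exp (2 * I * s * y) * q y * (exp (2 * I * (-s) * y) * (σ * f y * p' y))
      = -(σ * (-(f y * q y) * p' y + p y * -(f' y * q' y))) := fun y => by
    linear_combination (σ * f' y * p y * q' y + q y * (σ * f y * p' y)) * cancel y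
  simp only [e2] at w2
  rw [integral_neg, integral_const_mul] at w2
  simp only [ofReal_zero, mul_zero, exp_zero, one_mul, zero_add] at w2
  rw [w1, w2]
  linear_combination (-∫ y in Ioi 0, (-(f y * q y) * p' y + p y * -(f' y * q' y))) * hσ'

end

/-! ### Analyticity and symmetries of the scattering coefficients -/

/-- The properties of the scattering coefficients of a real potential. -/
structure ScatteringRelations (σ : ℝ) (a d : ℂ → ℂ) (b : ℝ → ℂ) : Prop where
  upper : UpperRegular a 1
  lower : UpperRegular (fun z => d (-z)) 1
  det : ∀ s : ℝ, a s * d s + σ * b s ^ 2 = 1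
  conj_a : ∀ s : ℝ, (starRingEnd ℂ) (a ((-s : ℝ) : ℂ)) = a s
  conj_d : ∀ s : ℝ, (starRingEnd ℂ) (d ((-s : ℝ) : ℂ)) = d s
  conj_b : ∀ s : ℝ, (starRingEnd ℂ) (b (-s)) = b s

/-- At `x = 0` the nonlocal symmetry leaves two Volterra solutions `(P, R)` and `(P', R')`, with `a
= P² - σ R²`, `d = P'² - σ R'²` and `b = P' R + P R'`, the primed functions being taken at the
opposite spectral parameter. Then `a d + σ b² = (P P' + σ R R')²`, the square of the Wronskian. -/
theorem IsScatteringCoefficients.relations {σ : ℝ} (hσ : σ ^ 2 = 1) {u : ℝ → ℝ} (hu : Integrable u)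
    {a d : ℂ → ℂ} {b : ℝ → ℂ} (h : IsScatteringCoefficients σ u a d b) :
    ScatteringRelations σ a d b := by
  obtain ⟨m₁p, m₁m, m₂p, m₂m, hup, hlo, ha, hd, hb⟩ := h
  have hσ' : (σ : ℂ) * σ = 1 := by rw [← pow_two]; exact_mod_cast hσ
  have hf := integrable_volF hu
  have hg := integrable_volG (σ := σ) hu
  have hf' := integrable_volF hu.comp_neg
  have hg' := integrable_volG (σ := σ) hu.comp_neg
  obtain ⟨P, hP⟩ : ∃ k : ℂ → ℝ → ℂ, k = fun z x => m₁p z x 0 := ⟨_, rfl⟩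
  obtain ⟨R, hR⟩ : ∃ k : ℂ → ℝ → ℂ, k = fun z x => m₁p z x 1 := ⟨_, rfl⟩
  obtain ⟨P', hP'⟩ : ∃ k : ℂ → ℝ → ℂ, k = fun z x => m₁m (-z) (-x) 0 := ⟨_, rfl⟩
  obtain ⟨R', hR'⟩ : ∃ k : ℂ → ℝ → ℂ, k = fun z x => -m₁m (-z) (-x) 1 := ⟨_, rfl⟩
  have v1 : ∀ z : ℂ, 0 ≤ z.im → IsVol (volF u) (volG σ u) z (P z) (R z) := fun z hz => by
    rw [hP, hR]; exact (hup z hz).1.isVol_fst hu hz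
  have v2 : ∀ z : ℂ, 0 ≤ z.im → IsVol (volF fun y => u (-y)) (volG σ fun y => u (-y)) z (P' z) (R' z) :=
    fun z hz => by
      have hz' : (-z).im ≤ 0 := by simpa using hz
      have := (hlo (-z) hz').1.isVol_fst hu hz'
      rw [neg_neg] at this
      rw [hP', hR']; exact this
  have e1 : ∀ z : ℂ, 0 ≤ z.im → m₂m z 0 1 = P z 0 ∧ σ * m₂m z 0 0 = R z 0 := fun z hz => by
    have := ((hup z hz).2.isVol_snd hσ hu hz).unique hf hg hz (v1 z hz)
    have k1 := congrFun this.1 0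
    have k2 := congrFun this.2 0
    simp only [neg_zero] at k1 k2
    exact ⟨k1, k2⟩
  have e2 : ∀ z : ℂ, 0 ≤ z.im → m₂p (-z) 0 1 = P' z 0 ∧ -(σ * m₂p (-z) 0 0) = R' z 0 := fun z hz => by
    have hz' : (-z).im ≤ 0 := by simpa using hz
    have h1 := (hlo (-z) hz').2.isVol_snd hσ hu hz'
    rw [neg_neg] at h1
    have := h1.unique hf' hg' hz (v2 z hz)
    exact ⟨congrFun this.1 0, congrFun this.2 0⟩
  have fa : ∀ z : ℂ, 0 ≤ z.im → a z = P z 0 * P z 0 - σ * (R z 0 * R z 0) := fun z hz => by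
    obtain ⟨k1, k2⟩ := e1 z hz
    have k3 : m₁p z 0 0 = P z 0 := by rw [hP]
    have k4 : m₁p z 0 1 = R z 0 := by rw [hR]
    rw [ha z hz 0, det2, k1, k3, k4]
    linear_combination m₂m z 0 0 * R z 0 * hσ' - σ * R z 0 * k2
  have fd : ∀ z : ℂ, 0 ≤ z.im → d (-z) = P' z 0 * P' z 0 - σ * (R' z 0 * R' z 0) := fun z hz => by
    have hz' : (-z).im ≤ 0 := by simpa using hz
    obtain ⟨k1, k2⟩ := e2 z hz
    have k3 : P' z 0 = m₁m (-z) 0 0 := by simp [hP']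
    have k4 : m₁m (-z) 0 1 = -R' z 0 := by simp [hR']
    rw [hd (-z) hz' 0, det2, k1, ← k3, k4]
    linear_combination -(m₂p (-z) 0 0 * R' z 0) * hσ' - σ * R' z 0 * k2
  have fd' : ∀ s : ℝ, d s = P' ((-s : ℝ) : ℂ) 0 * P' ((-s : ℝ) : ℂ) 0
      - σ * (R' ((-s : ℝ) : ℂ) 0 * R' ((-s : ℝ) : ℂ) 0) := fun s => by
    rw [← fd _ (by simp)]; simp
  have fb : ∀ s : ℝ, b s = P' ((-s : ℝ) : ℂ) 0 * R s 0 + P s 0 * R' ((-s : ℝ) : ℂ) 0 := fun s => by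
    rw [hb s 0, det2, hP, hR, hP', hR']
    simp
    ring
  have cv : ∀ s : ℝ, -(starRingEnd ℂ) (s : ℂ) = ((-s : ℝ) : ℂ) := fun s => by simp
  have rF : ∀ (v : ℝ → ℝ) y, (starRingEnd ℂ) (volF v y) = volF v y := fun v y => conj_ofReal _
  have rG : ∀ (v : ℝ → ℝ) y, (starRingEnd ℂ) (volG σ v y) = volG σ v y := fun v y => by simp [volG]
  have c1 : ∀ s : ℝ, (starRingEnd ℂ) (P ((-s : ℝ) : ℂ) 0) = P s 0 ∧
      (starRingEnd ℂ) (R ((-s : ℝ) : ℂ) 0) = R s 0 := fun s => by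
    have h1 := (v1 ((-s : ℝ) : ℂ) (by simp)).conj (rF u) (rG u)
    rw [cv, neg_neg] at h1
    have := h1.unique hf hg (by simp) (v1 s (by simp))
    exact ⟨congrFun this.1 0, congrFun this.2 0⟩
  have c2 : ∀ s : ℝ, (starRingEnd ℂ) (P' ((-s : ℝ) : ℂ) 0) = P' s 0 ∧
      (starRingEnd ℂ) (R' ((-s : ℝ) : ℂ) 0) = R' s 0 := fun s => by
    have h1 := (v2 ((-s : ℝ) : ℂ) (by simp)).conj (rF _) (rG _)
    rw [cv, neg_neg] at h1
    have := h1.unique hf' hg' (by simp) (v2 s (by simp))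
    exact ⟨congrFun this.1 0, congrFun this.2 0⟩
  have r1 := IsVol.upperRegular hf hg v1 0
  have r2 := IsVol.upperRegular hf' hg' v2 0
  refine ⟨?_, ?_, fun s => ?_, fun s => ?_, fun s => ?_, fun s => ?_⟩
  · have := (r1.1.mul r1.1).sub ((UpperRegular.const (σ : ℂ)).mul (r1.2.mul r1.2))
    simp only [mul_one, mul_zero, sub_zero] at this
    exact this.congr fa
  · have := (r2.1.mul r2.1).sub ((UpperRegular.const (σ : ℂ)).mul (r2.2.mul r2.2))
    simp only [mul_one, mul_zero, sub_zero] at this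
    exact this.congr fd
  · have w := IsVol.wronskian hσ hf hf' (v1 s (by simp)) (by
      have := v2 ((-s : ℝ) : ℂ) (by simp)
      have e : volG σ (fun y => u (-y)) = fun y => (σ : ℂ) * volF u y := by
        funext y; rw [volG, neg_neg]; rfl
      rw [e] at this
      rwa [ofReal_neg] at this)
    rw [← ofReal_neg] at w
    rw [fa s (by simp), fd' s, fb s]
    linear_combination (P s 0 * P' ((-s : ℝ) : ℂ) 0 + σ * (R s 0 * R' ((-s : ℝ) : ℂ) 0) + 1) * w
  · rw [fa _ (by simp), fa s (by simp), map_sub, map_mul, map_mul, map_mul, conj_ofReal, (c1 s).1,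
      (c1 s).2]
  · have := c2 (-s)
    rw [neg_neg] at this
    rw [fd', fd', map_sub, map_mul, map_mul, map_mul, conj_ofReal, neg_neg, this.1, this.2]
  · have := c2 (-s)
    rw [neg_neg] at this
    rw [fb, fb, map_add, map_mul, map_mul, neg_neg, this.1, this.2, (c1 s).1, (c1 s).2]

/-! ### Symmetries of the Riemann-Hilbert problem -/

theorem vanishes_iff_tendsto {f : ℂ → ℂ} : Vanishes f ↔ Tendsto f atInftyOffReal (𝓝 0) := by
  rw [Metric.tendsto_nhds]
  constructor
  · intro h ε hε
    obtain ⟨R, hR⟩ := h (ε / 2) (half_pos hε)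
    rw [atInftyOffReal, eventually_inf_principal, Filter.hasBasis_cobounded_norm.eventually_iff]
    refine ⟨R, trivial, fun z hz hzi => ?_⟩
    rw [dist_zero_right]
    exact (hR z hzi hz).trans_lt (half_lt_self hε)
  · intro h ε hε
    have := h ε hε
    rw [atInftyOffReal, eventually_inf_principal, Filter.hasBasis_cobounded_norm.eventually_iff] at this
    obtain ⟨R, -, hR⟩ := this
    refine ⟨R, fun z hz hzR => ?_⟩
    have := hR (show z ∈ {z : ℂ | R ≤ ‖z‖} from hzR) hz
    rw [dist_zero_right] at this
    exact this.le

theorem MatDecays.tendsto {M : ℂ → Mat2} {A : Mat2} (h : MatDecays fun z => M z - A) :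
    Tendsto M atInftyOffReal (𝓝 A) := by
  refine tendsto_pi_nhds.2 fun i => tendsto_pi_nhds.2 fun j => ?_
  exact tendsto_sub_nhds_zero_iff.1 (vanishes_iff_tendsto.1 (h i j).vanishes)

/-- Uniqueness for the Riemann-Hilbert problem. -/
theorem RHData.eq_of_tendsto {V Mp Mm Np Nm : ℝ → Mat2} {M N : ℂ → Mat2} (h : RHData V Mp Mm M)
    (hN : MatCut N Np Nm) (hj : ∀ s, Np s = Nm s * V s) (ht : Tendsto N atInftyOffReal (𝓝 1))
    {z : ℂ} (hz : z.im ≠ 0) : N z = M z := by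
  have hc := (hN.mul h.cut.adjugate).sub (MatCut.const 1)
  have e : ∀ s, Np s * (Mp s).adjugate - 1 = Nm s * (Mm s).adjugate - 1 := by
    intro s
    rw [hj, h.jump, Matrix.adjugate_mul_distrib, mul_assoc, ← mul_assoc (V s),
      mul_adj (h.detV s), one_mul]
  have t : Tendsto (fun z => N z * (M z).adjugate) atInftyOffReal (𝓝 (1 * 1)) :=
    ht.mul h.sub_one_adjugate.tendsto
  rw [mul_one] at t
  have hz0 : N z * (M z).adjugate - 1 = 0 := by
    ext i j
    have hc' := hc.congr (fun _ _ => rfl) (fun s => (e s).symm) (fun _ => rfl)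
    refine (hc' i j).eq_zero (vanishes_iff_tendsto.2 ?_) hz
    have := ((continuous_apply_apply i j).tendsto (1 : Mat2)).comp t
    exact tendsto_sub_nhds_zero_iff.2 this
  have : N z * (M z).adjugate = 1 := sub_eq_zero.1 hz0
  calc N z = N z * ((M z).adjugate * M z) := by rw [adj_mul (h.det_eq_one hz), mul_one]
    _ = M z := by rw [← mul_assoc, this, one_mul]

theorem UpperRegular.inv {f : ℂ → ℂ} {c : ℂ} (hf : UpperRegular f c) (h0 : ∀ z : ℂ, 0 ≤ z.im → f z ≠ 0)
    (hc : c ≠ 0) : UpperRegular (fun z => (f z)⁻¹) c⁻¹ :=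
  ⟨hf.cont.inv₀ h0, hf.diff.inv fun z hz => h0 z (le_of_lt hz), hf.lim.inv₀ hc⟩

/-- The function given by `f` above and by `g (-z)` below the real line. -/
noncomputable def glue (f g : ℂ → ℂ) (z : ℂ) : ℂ := if 0 < z.im then f z else g (-z)

section

variable {f g : ℂ → ℂ} {c : ℂ}

theorem glue_up {z : ℂ} (hz : 0 < z.im) : glue f g z = f z := if_pos hz

theorem glue_lo {z : ℂ} (hz : z.im < 0) : glue f g z = g (-z) := if_neg (not_lt.2 hz.le)

theorem hasCut_glue (hf : UpperRegular f c) (hg : UpperRegular g c) :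
    HasCut (glue f g) (fun s => f s) (fun s => g (-s)) := by
  have ou : IsOpen {z : ℂ | 0 < z.im} := isOpen_lt continuous_const continuous_im
  have ol : IsOpen {z : ℂ | z.im < 0} := isOpen_lt continuous_im continuous_const
  refine ⟨fun z hz => DifferentiableAt.differentiableWithinAt ?_, fun s => ?_, fun s => ?_⟩
  · rcases lt_or_gt_of_ne (show z.im ≠ 0 from hz) with h | h
    · have d : DifferentiableAt ℂ (fun z => g (-z)) z := by
        have h' : -z ∈ {z : ℂ | 0 < z.im} := by simpa using h
        exact (hg.diff.differentiableAt (ou.mem_nhds h')).comp z differentiableAt_id.neg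
      refine d.congr_of_eventuallyEq ?_
      filter_upwards [ol.mem_nhds h] with w hw using glue_lo hw
    · refine (hf.diff.differentiableAt (ou.mem_nhds h)).congr_of_eventuallyEq ?_
      filter_upwards [ou.mem_nhds h] with w hw using glue_up hw
  · have := (hf.cont (s : ℂ) (by simp)).mono_left
      (nhdsWithin_mono (s : ℂ) (fun z (hz : 0 < z.im) => (le_of_lt hz : (0 : ℝ) ≤ z.im)))
    refine this.congr' ?_
    filter_upwards [self_mem_nhdsWithin] with z hz using (glue_up hz).symm
  · have h1 : Tendsto (fun z : ℂ => -z) (𝓝[{z : ℂ | z.im < 0}] (s : ℂ)) (𝓝[{z | 0 ≤ z.im}] (-s : ℂ)) := by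
      refine tendsto_nhdsWithin_iff.2 ⟨(continuous_neg.tendsto _).mono_left nhdsWithin_le_nhds, ?_⟩
      filter_upwards [self_mem_nhdsWithin] with z hz
      have hz : z.im < 0 := hz
      simpa using hz.le
    have := (hg.cont (-s : ℂ) (by simp)).tendsto.comp h1
    refine this.congr' ?_
    filter_upwards [self_mem_nhdsWithin] with z hz using (glue_lo hz).symm

theorem tendsto_glue (hf : UpperRegular f c) (hg : UpperRegular g c) :
    Tendsto (glue f g) atInftyOffReal (𝓝 c) := by
  refine Tendsto.if ?_ ?_
  · refine hf.lim.mono_left (le_inf (inf_le_left.trans inf_le_left) (inf_le_right.trans ?_))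
    exact principal_mono.2 fun z (hz : 0 < z.im) => le_of_lt hz
  · refine hg.lim.comp (tendsto_inf.2 ⟨?_, tendsto_principal.2 ?_⟩)
    · exact (tendsto_neg_cobounded).mono_left (inf_le_left.trans inf_le_left)
    · refine mem_inf_of_right (mem_principal.2 fun z hz => ?_)
      have hz : ¬ 0 < z.im := hz
      simpa using hz

end

theorem phase_neg (p : ℝ × ℝ) (s : ℝ) : phase (-p) s = (starRingEnd ℂ) (phase p s) := by
  rw [← exp_neg_phase, phase]
  congr 1
  simp only [theta, Prod.fst_neg, Prod.snd_neg]
  push_cast; ring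

theorem conj_phase_neg (p : ℝ × ℝ) (s : ℝ) : (starRingEnd ℂ) (phase p (-s)) = phase p s := by
  rw [← exp_neg_phase, phase]
  congr 1
  simp only [theta]
  push_cast; ring

namespace RHFlow

variable {σ : ℝ} {r₁ r₂ : ℝ → ℂ} {M : ℝ × ℝ → ℂ → Mat2} {Mp Mm : ℝ × ℝ → ℝ → Mat2}

/-- The map `z ↦ -conj z` preserves each half-plane, and the symmetries of `r₁`, `r₂` and of the
phase make the conjugated problem the original one. Uniqueness concludes. -/
theorem conj_eq (h : RHFlow σ r₁ r₂ M Mp Mm) (h₁ : ∀ s, (starRingEnd ℂ) (r₁ (-s)) = r₁ s)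
    (h₂ : ∀ s, (starRingEnd ℂ) (r₂ (-s)) = r₂ s) (p : ℝ × ℝ) {z : ℂ} (hz : z.im ≠ 0) (i j : Fin 2) :
    (starRingEnd ℂ) (M p (-(starRingEnd ℂ) z) i j) = M p z i j := by
  set N : ℂ → Mat2 := fun z => (M p (-(starRingEnd ℂ) z)).map (starRingEnd ℂ) with hN
  have cut : MatCut N (fun s => (Mp p (-s)).map (starRingEnd ℂ))
      (fun s => (Mm p (-s)).map (starRingEnd ℂ)) := fun i j => by
    simpa [hN] using ((h.data p).cut i j).comp_neg.conj_conj
  have hV : ∀ s, (jumpAt σ r₁ r₂ p (-s)).map (starRingEnd ℂ) = jumpAt σ r₁ r₂ p s := fun s => by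
    rw [jumpAt_eq, jumpAt_eq]
    have c := conj_phase_neg p s
    have c' : phase p (-s) = (starRingEnd ℂ) (phase p s) := by rw [← c, Complex.conj_conj]
    ext i j
    fin_cases i <;> fin_cases j <;> simp [h₁, h₂, c']
  have hj : ∀ s, (Mp p (-s)).map (starRingEnd ℂ)
      = (Mm p (-s)).map (starRingEnd ℂ) * jumpAt σ r₁ r₂ p s := fun s => by
    rw [(h.data p).jump, Matrix.map_mul, hV]
  have ht : Tendsto N atInftyOffReal (𝓝 1) := by
    have hr : Tendsto (fun z : ℂ => -(starRingEnd ℂ) z) atInftyOffReal atInftyOffReal := by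
      refine tendsto_inf.2 ⟨?_, tendsto_principal.2 ?_⟩
      · refine Tendsto.mono_left ?_ inf_le_left
        rw [← tendsto_norm_atTop_iff_cobounded]
        refine tendsto_norm_cobounded_atTop.congr fun z => ?_
        rw [norm_neg, RCLike.norm_conj]
      · refine mem_inf_of_right (mem_principal.2 fun z hz => ?_)
        have hz : z.im ≠ 0 := hz
        simpa using hz
    have t := (h.data p).decays.tendsto.comp hr
    have cm : Continuous fun A : Mat2 => A.map (starRingEnd ℂ) :=
      Continuous.matrix_map continuous_id continuous_conj
    have := (cm.tendsto 1).comp t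
    rwa [Matrix.map_one _ (map_zero _) (map_one _)] at this
  have := (h.data p).eq_of_tendsto cut hj ht hz
  exact congrFun (congrFun this i) j

theorem tendsto_I_mul (h : RHFlow σ r₁ r₂ M Mp Mm) (p : ℝ × ℝ) {i j : Fin 2} (hij : i ≠ j) :
    Tendsto (fun y : ℝ => (I * y) * M p (I * y) i j) atTop (𝓝 (coefM Mp Mm 0 p i j)) := by
  obtain ⟨c, -, hc⟩ := h.rhoBdd_dens p
  have t := (((continuous_apply_apply i j).tendsto _).comp (h.tendsto_matC hc (k := 1)
    (by norm_num))).add_const (coefM Mp Mm 0 p i j)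
  rw [Matrix.zero_apply, zero_add] at t
  refine t.congr' ?_
  filter_upwards [eventually_gt_atTop 0] with y hy
  have hz0 := I_mul_im_ne hy
  have e := congrFun (congrFun (h.smul_matC_dens (k := 0) (by norm_num) p hz0) i) j
  rw [h.eq_one_add_matC p hz0]
  simp only [Matrix.add_apply, Matrix.smul_apply, smul_eq_mul, Matrix.one_apply_ne hij,
    zero_add] at e ⊢
  rw [e]
  rfl

theorem conj_coefM (h : RHFlow σ r₁ r₂ M Mp Mm) (h₁ : ∀ s, (starRingEnd ℂ) (r₁ (-s)) = r₁ s)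
    (h₂ : ∀ s, (starRingEnd ℂ) (r₂ (-s)) = r₂ s) (p : ℝ × ℝ) {i j : Fin 2} (hij : i ≠ j) :
    (starRingEnd ℂ) (coefM Mp Mm 0 p i j) = -coefM Mp Mm 0 p i j := by
  have t := h.tendsto_I_mul p hij
  refine tendsto_nhds_unique ((continuous_conj.tendsto _).comp t) (t.neg.congr' ?_)
  filter_upwards [eventually_gt_atTop 0] with y hy
  have := h.conj_eq h₁ h₂ p (I_mul_im_ne hy) i j
  have e : -(starRingEnd ℂ) (I * (y : ℂ)) = I * y := by simp
  rw [e] at this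
  simp only [Function.comp_apply, map_mul, this, conj_I, conj_ofReal]
  ring

/-- Exchanging rows and columns of `M(-p)`, with factors `σ` off the diagonal, and multiplying on
the right by `diag (α⁻¹, α)`, where `α = a` above and `α = 1/d` below the line, gives the jump at
`p`: indeed `1 + σ r₁ r₂ = 1 / (a d)`. As `a` and `d` have no zeros and tend to `1`, the result is a
normalized solution, and uniqueness identifies it with `M(p)`. -/
theorem reflect_eq (h : RHFlow σ r₁ r₂ M Mp Mm) {a d : ℂ → ℂ} {b : ℝ → ℂ}
    (hs : ScatteringRelations σ a d b) (hn : NoEigenvaluesOrResonances a d)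
    (h₁ : ∀ s, r₁ s = b s / a s) (h₂ : ∀ s, r₂ s = b s / d s) (p : ℝ × ℝ) {z : ℂ} (hz : 0 < z.im) :
    M p z 0 1 = σ * (a z * M (-p) z 1 0) := by
  have hσ' : (σ : ℂ) * σ = 1 := by rw [← pow_two]; exact_mod_cast h.sq
  have hd0 : ∀ z : ℂ, 0 ≤ z.im → d (-z) ≠ 0 := fun z hz => hn.2 _ (by simpa using hz)
  have ra := hs.upper
  have rd := hs.lower
  have ia := ra.inv hn.1 one_ne_zero
  have iid := rd.inv hd0 one_ne_zero
  rw [inv_one] at ia iid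
  set α := glue a fun z => (d (-z))⁻¹ with hα
  set β := glue (fun z => (a z)⁻¹) fun z => d (-z) with hβ
  have cα := hasCut_glue ra iid
  have cβ := hasCut_glue ia rd
  have tα := tendsto_glue ra iid
  have tβ := tendsto_glue ia rd
  set N : ℂ → Mat2 := fun z => !![M (-p) z 1 1 * β z, σ * (α z * M (-p) z 1 0);
    σ * (β z * M (-p) z 0 1), M (-p) z 0 0 * α z] with hN
  have D := h.data (-p)
  have cut : MatCut N
      (fun s => !![Mp (-p) s 1 1 * (a s)⁻¹, σ * (a s * Mp (-p) s 1 0);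
        σ * ((a s)⁻¹ * Mp (-p) s 0 1), Mp (-p) s 0 0 * a s])
      (fun s => !![Mm (-p) s 1 1 * d s, σ * ((d s)⁻¹ * Mm (-p) s 1 0);
        σ * (d s * Mm (-p) s 0 1), Mm (-p) s 0 0 * (d s)⁻¹]) := by
    simp only [neg_neg] at cα cβ
    intro i j
    fin_cases i <;> fin_cases j
    · exact (D.cut 1 1).mul cβ
    · exact (HasCut.const (σ : ℂ)).mul (cα.mul (D.cut 1 0))
    · exact (HasCut.const (σ : ℂ)).mul (cβ.mul (D.cut 0 1))
    · exact (D.cut 0 0).mul cα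
  have ht : Tendsto N atInftyOffReal (𝓝 1) := by
    have t : ∀ i j, Tendsto (fun z => M (-p) z i j) atInftyOffReal (𝓝 ((1 : Mat2) i j)) := fun i j =>
      ((continuous_apply_apply i j).tendsto (1 : Mat2)).comp D.decays.tendsto
    refine tendsto_pi_nhds.2 fun i => tendsto_pi_nhds.2 fun j => ?_
    fin_cases i <;> fin_cases j
    · have := (t 1 1).mul tβ
      simpa [hN] using this
    · have := (tα.mul (t 1 0)).const_mul (σ : ℂ)
      simpa [hN] using this
    · have := (tβ.mul (t 0 1)).const_mul (σ : ℂ)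
      simpa [hN] using this
    · have := (t 0 0).mul tα
      simpa [hN] using this
  have hj : ∀ s : ℝ, !![Mp (-p) s 1 1 * (a s)⁻¹, σ * (a s * Mp (-p) s 1 0);
        σ * ((a s)⁻¹ * Mp (-p) s 0 1), Mp (-p) s 0 0 * a s]
      = !![Mm (-p) s 1 1 * d s, σ * ((d s)⁻¹ * Mm (-p) s 1 0);
        σ * (d s * Mm (-p) s 0 1), Mm (-p) s 0 0 * (d s)⁻¹] * jumpAt σ r₁ r₂ p s := by
    intro s
    have a0 : a s ≠ 0 := hn.1 s (by simp)
    have d0 : d s ≠ 0 := hn.2 s (by simp)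
    have w := hs.det s
    rw [D.jump, jumpAt_eq, jumpAt_eq, phase_neg, Complex.conj_conj, h₁, h₂]
    have e : (1 : ℂ) + σ * (b s / a s) * (b s / d s) = (a s)⁻¹ * (d s)⁻¹ := by
      field_simp
      linear_combination w
    rw [e]
    ext i j
    fin_cases i <;> fin_cases j
    · simp [mul_apply2]
      field_simp
      ring
    · simp [mul_apply2]
      field_simp
      ring
    · simp [mul_apply2]
      field_simp
      linear_combination (Mm (-p) s 0 0 * b s * (starRingEnd ℂ) (phase p s)) * hσ'
    · simp [mul_apply2]
      field_simp
      linear_combination -(d s * Mm (-p) s 0 1 * b s * phase p s) * hσ'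
  have := congrFun (congrFun ((h.data p).eq_of_tendsto cut hj ht hz.ne') 0) 1
  rw [← this]
  simp [hN, hα, glue_up hz]

/-- Along the imaginary axis `a → 1`, so the correction factor disappears at leading order. -/
theorem coefM_reflect (h : RHFlow σ r₁ r₂ M Mp Mm) {a d : ℂ → ℂ} {b : ℝ → ℂ}
    (hs : ScatteringRelations σ a d b) (hn : NoEigenvaluesOrResonances a d)
    (h₁ : ∀ s, r₁ s = b s / a s) (h₂ : ∀ s, r₂ s = b s / d s) (p : ℝ × ℝ) :
    coefM Mp Mm 0 p 0 1 = σ * coefM Mp Mm 0 (-p) 1 0 := by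
  have t1 := h.tendsto_I_mul p (i := 0) (j := 1) (by decide)
  have t2 := h.tendsto_I_mul (-p) (i := 1) (j := 0) (by decide)
  have ta : Tendsto (fun y : ℝ => a (I * y)) atTop (𝓝 1) := by
    refine hs.upper.lim.comp (tendsto_inf.2 ⟨?_, tendsto_principal.2 ?_⟩)
    · rw [← tendsto_norm_atTop_iff_cobounded]
      refine tendsto_abs_atTop_atTop.congr fun y => ?_
      simp
    · filter_upwards [eventually_ge_atTop 0] with y hy
      simpa using hy
  have t3 := (ta.mul t2).const_mul (σ : ℂ)
  rw [one_mul] at t3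
  refine tendsto_nhds_unique t1 (t3.congr' ?_)
  filter_upwards [eventually_gt_atTop 0] with y hy
  rw [h.reflect_eq hs hn h₁ h₂ p (z := I * y) (by simpa using hy)]
  ring

end RHFlow

/-! ### The potential and the conclusion -/

theorem RHFlow.isPotential {σ : ℝ} {r₁ r₂ : ℝ → ℂ} {M : ℝ × ℝ → ℂ → Mat2}
    {Mp Mm : ℝ × ℝ → ℝ → Mat2} (h : RHFlow σ r₁ r₂ M Mp Mm) {u : ℝ → ℝ → ℝ}
    (hu : ∀ x t, ((u x t : ℝ) : ℂ) = -(2 * I) * coefM Mp Mm 0 (x, t) 0 1)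
    (hr : ∀ p, coefM Mp Mm 0 p 0 1 = σ * coefM Mp Mm 0 (-p) 1 0) :
    IsPotential σ Mp Mm u := by
  have hσ' : (σ : ℂ) * σ = 1 := by rw [← pow_two]; exact_mod_cast h.sq
  intro x t
  have e := hr (-(x, t))
  rw [neg_neg] at e
  have e' : coefM Mp Mm 0 (-x, -t) 0 1 = σ * coefM Mp Mm 0 (x, t) 1 0 := e
  rw [(h.coefS_eq (x, t)).1, laxQ, _root_.offDiag]
  have hu' := hu (-x) (-t)
  rw [e'] at hu'
  ext i j
  rw [Matrix.smul_apply]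
  simp only [Matrix.sub_apply, mul_apply2]
  fin_cases i <;> fin_cases j
  · simp [sigma3]
  · simp [sigma3, hu]; ring
  · simp [sigma3, hu']
    linear_combination 2 * I * coefM Mp Mm 0 (x, t) 1 0 * hσ'
  · simp [sigma3]

theorem mainTheorem5 (σ : ℝ) (hσ : σ = 1 ∨ σ = -1)
    (u₀ : ℝ → ℝ) (hu₀ : Integrable u₀ volume)
    (a d : ℂ → ℂ) (b : ℝ → ℂ) (hscat : IsScatteringCoefficients σ u₀ a d b)
    (hspec : NoEigenvaluesOrResonances a d)
    (r₁ r₂ : ℝ → ℂ) (hr₁ : r₁ = reflection1 a b) (hr₂ : r₂ = reflection2 d b)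
    (hr₁mem : MemH11 r₁ ∧ MemL2k 3 r₁) (hr₂mem : MemH11 r₂ ∧ MemL2k 3 r₂)
    (M : ℝ → ℝ → ℂ → Mat2)
    (hM : ∀ x t : ℝ, IsRHSolution (jumpMatrix σ r₁ r₂ x t) (M x t)) :
    ∃ u : ℝ → ℝ → ℝ,
      (∀ x t : ℝ, Tendsto (fun z : ℂ => -(2 * I) * z * M x t z 0 1) atInftyOffReal
        (𝓝 ((u x t : ℝ) : ℂ))) ∧
      ContinuousC2InX u ∧
      SatisfiesLaxX σ u M ∧
      SatisfiesLaxT σ u M ∧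
      SolvesNonlocalMKdV σ u := by
  have hσ2 : σ ^ 2 = 1 := by rcases hσ with rfl | rfl <;> norm_num
  have hs := hscat.relations hσ2 hu₀
  have e₁ : ∀ s, r₁ s = b s / a s := fun s => by rw [hr₁, reflection1]
  -- For a real potential the conjugate of `b (-s)` is `b s`, so both reflection coefficients have
  -- the same numerator.
  have e₂ : ∀ s, r₂ s = b s / d s := fun s => by rw [hr₂, reflection2, hs.conj_b]
  have c₁ : ∀ s, (starRingEnd ℂ) (r₁ (-s)) = r₁ s := fun s => by
    rw [e₁, e₁, map_div₀, hs.conj_b, hs.conj_a]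
  have c₂ : ∀ s, (starRingEnd ℂ) (r₂ (-s)) = r₂ s := fun s => by
    rw [e₂, e₂, map_div₀, hs.conj_b, hs.conj_d]
  have hdata : ∀ p : ℝ × ℝ, ∃ Np Nm : ℝ → Mat2, RHData (jumpAt σ r₁ r₂ p) Np Nm (M p.1 p.2) :=
    fun p => IsRHSolution.exists_data (hM p.1 p.2) (det_jumpAt σ r₁ r₂ p)
  choose Mp Mm hdat using hdata
  have l2 : Integrable fun s => ((1 + |s|) ^ 3 * (‖r₁ s‖ + ‖r₂ s‖)) ^ 2 := by
    have hc : Continuous fun s : ℝ => (1 + |s|) ^ 3 := by fun_prop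
    refine ((hr₁mem.2.integrable_sq.add hr₂mem.2.integrable_sq).const_mul 2).mono'
      ((hc.aestronglyMeasurable.mul (hr₁mem.2.aestronglyMeasurable.norm.add
        hr₂mem.2.aestronglyMeasurable.norm)).pow 2) (ae_of_all _ fun s => ?_)
    rw [Real.norm_of_nonneg (sq_nonneg _)]
    show _ ≤ 2 * (((1 + |s|) ^ 3 * ‖r₁ s‖) ^ 2 + ((1 + |s|) ^ 3 * ‖r₂ s‖) ^ 2)
    nlinarith [sq_nonneg ((1 + |s|) ^ 3 * ‖r₁ s‖ - (1 + |s|) ^ 3 * ‖r₂ s‖)]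
  have h : RHFlow σ r₁ r₂ (fun p => M p.1 p.2) Mp Mm := ⟨hdat, hσ2, l2⟩
  set u : ℝ → ℝ → ℝ := fun x t => (-(2 * I) * RHFlow.coefM Mp Mm 0 (x, t) 0 1).re with hu
  have hu' : ∀ x t, ((u x t : ℝ) : ℂ) = -(2 * I) * RHFlow.coefM Mp Mm 0 (x, t) 0 1 := fun x t => by
    -- The off-diagonal coefficient is purely imaginary by the conjugation symmetry, so taking the
    -- real part in the definition of `u` loses nothing.
    refine Complex.conj_eq_iff_re.1 ?_
    have := h.conj_coefM c₁ c₂ (x, t) (i := 0) (j := 1) (by decide)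
    rw [map_mul, this, map_neg, map_mul, conj_I, map_ofNat]
    ring
  have hpot : RHFlow.IsPotential σ Mp Mm u := h.isPotential hu' (h.coefM_reflect hs hspec e₁ e₂)
  refine ⟨u, fun x t => ?_, h.continuousC2InX hpot, h.satisfiesLaxX hpot, h.satisfiesLaxT hpot,
    h.solvesNonlocalMKdV hpot⟩
  have := (h.tendsto_atInftyOffReal (hr₁mem.1.translationBound h.continuous_r₁)
    (hr₂mem.1.translationBound h.continuous_r₂) (x, t) (i := 0) (j := 1) (by decide)).const_mul
    (-(2 * I))
  rw [hu']
  refine this.congr fun z => ?_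
  ring
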